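/- Let $d\ge 2$, $T>0$, $m\ge 1$, $\lambda>0$, and let $\Omega\subset\mathbb R^d$ be an open set with smooth boundary (possibly unbounded, possibly $\Omega=\mathbb R^d$) and outer unit normal $\nu_\Omega$. Let $(E(t))_{t\in[0,T)}$ be a smoothly evolving family of smooth subsets of $\Omega$: near every point of $[0,T)\times\overline\Omega$, relative to $[0,T)\times\Omega$, one has $x\in E(t)\iff\varphi(t,x)<0$ for a smooth $\varphi$ with $\nabla\varphi\ne0$ where $\varphi=0$, and the interface $\Gamma(t)=\overline{\partial E(t)\cap\Omega}$ meets $\partial\Omega$ transversally (it is a smooth hypersurface with boundary on $\partial\Omega$). Denote by $\nu_\Gamma=\nabla\varphi/|\nabla\varphi|$ its outer unit normal, by $V_\Gamma=-\partial_t\varphi/|\nabla\varphi|$ its normal velocity, and by $H_\Gamma=-\operatorname{div}\nu_\Gamma$ its mean curvature (negative for balls, so that the area of $\Gamma$ changes at the rate $-\int_\Gamma H_\Gamma V_\Gamma$). For a function $g$ let $[\![g]\!]=g_+-g_-$ be the jump across $\Gamma(t)$, with $g_+$ and $g_-$ the one-sided limits from $\Omega\setminus \overline{E(t)}$ and from $E(t)$.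 Let $\chi(\cdot,t)=\chi_{E(t)}$ in $\Omega$ and let $\rho\ge 0$ be smooth in each phase up to the interface, i.e. $\rho=\rho_-$ on $E(t)$ and $\rho=\rho_+$ on $\Omega\setminus E(t)$ with $\rho_\pm\in C^\infty(\overline\Omega\times[0,T))$ (this includes every nonnegative $\rho\in C^\infty(\overline\Omega\times[0,T))$). Let $\rho_0\in L^1_{loc}(\overline\Omega)$ and let $\mathbf u$ be a vector field with $\rho\mathbf u\in L^1_{loc}(\overline\Omega\times[0,T))$. Suppose that $$-\int_0^T\!\!\int_\Omega\rho\,(\partial_t\eta+\mathbf u\cdot\nabla\eta)\,dx\,dt=\int_\Omega\rho_0\,\eta(\cdot,0)\,dx\qquad\text{for all }\eta\in C_c^\infty(\overline\Omega\times[0,T)),$$ and $$-\int_0^T\!\!\int_\Omega\rho\mathbf u\cdot\xi\,dx\,dt=\int_0^T\!\!\int_\Omega(\operatorname{div}\xi-\nu\cdot\nabla\xi\,\nu)\,d|\nabla\chi|\,dt-\int_0^T\!\!\int_\Omega(\rho^m-\lambda\chi)\operatorname{div}\xi\,dx\,dt$$ for all $\xi\in C_c^\infty(\overline\Omega\times[0,T);\mathbb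 R^d)$ with $\xi\cdot\nu_\Omega=0$ on $\partial\Omega\times(0,T)$, where $\nu=-\frac{d\nabla\chi}{d|\nabla\chi|}$. Then, after changing $\mathbf u$ without changing $\rho\mathbf u$ almost everywhere, $(\rho,\chi,\mathbf u)$ is a classical solution of the Verigin problem with phase transition, with pressure $\pi=\rho^m-\lambda\chi$ and surface tension $1$. That is, for every $t\in[0,T)$: 1. $\partial_t\rho+\operatorname{div}(\rho\mathbf u)=0$ and $\rho\mathbf u=-\nabla\pi$ pointwise in $\Omega\setminus\Gamma(t)$ (with the one-sided time derivative at $t=0$); 2. the one-sided limits of $\rho$, $\rho\mathbf u$ and $\pi$ at $\Gamma(t)$ exist, and $[\![\rho]\!]V_\Gamma=[\![\rho\mathbf u\cdot\nu_\Gamma]\!]$ and $[\![\pi]\!]=H_\Gamma$ along $\Gamma(t)$; 3. $\nabla\rho\cdot\nu_\Omega=0$ along $\partial\Omega$, for the limits of $\nabla\rho$ from within either phase, where for $m>1$ the condition is claimed only at boundary points at which the limit of $\rho$ from that phase is positive; 4. $\nu_\Gamma\cdot\nu_\Omega=0$ along $\partial\Omega\cap\Gamma(t)$. Moreover $\rho(\cdot,0)=\rho_0$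 almost everywhere in $\Omega$. -/

import Mathlib

open Set Filter Topology MeasureTheory
open scoped ContDiff RealInnerProductSpace

noncomputable section

namespace Verigin

/-- Physical space `ℝᵈ`. Space-time points are pairs `(t, x) : ℝ × Space d`. -/
abbrev Space (d : ℕ) := EuclideanSpace ℝ (Fin d)

variable {d : ℕ}

/-! ### Differential operators -/

/-- Divergence of a vector field, `∑ᵢ ∂ᵢ Fᵢ`. -/
def divergence (F : Space d → Space d) (x : Space d) : ℝ :=
  ∑ i : Fin d, (fderiv ℝ F x (EuclideanSpace.single i 1)) i

/-- Gradient in space of a function of `(t, x)`. -/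
def spaceGrad (f : ℝ × Space d → ℝ) (p : ℝ × Space d) : Space d :=
  gradient (fun y => f (p.1, y)) p.2

/-- Divergence in space of a vector field depending on `(t, x)`. -/
def spaceDiv (F : ℝ × Space d → Space d) (p : ℝ × Space d) : ℝ :=
  divergence (fun y => F (p.1, y)) p.2

/-- Time derivative of a function of `(t, x)`. -/
def timeDeriv (f : ℝ × Space d → ℝ) (p : ℝ × Space d) : ℝ :=
  deriv (fun s => f (s, p.2)) p.1

/-! ### Smooth domains -/

/-- `b` is a smooth defining function of `Ω` near the boundary point `x`:
near `x` one has `Ω = {b < 0}`, with `b x = 0` and `∇b x ≠ 0`. -/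
structure IsDefiningAt (Ω : Set (Space d)) (x : Space d) (b : Space d → ℝ) : Prop where
  smooth : ∀ᶠ y in 𝓝 x, ContDiffAt ℝ ∞ b y
  zero : b x = 0
  grad_ne : gradient b x ≠ 0
  mem_iff : ∀ᶠ y in 𝓝 x, (y ∈ Ω ↔ b y < 0)

/-- An open set with smooth boundary (possibly unbounded, possibly all of `ℝᵈ`). -/
def IsSmoothDomain (Ω : Set (Space d)) : Prop :=
  IsOpen Ω ∧ ∀ x ∈ frontier Ω, ∃ b, IsDefiningAt Ω x b

/-- `n` is the outer unit normal `ν_Ω(x)` of `Ω` at the boundary point `x`. -/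
def IsOuterNormal (Ω : Set (Space d)) (x n : Space d) : Prop :=
  ∃ b, IsDefiningAt Ω x b ∧ n = ‖gradient b x‖⁻¹ • gradient b x

/-! ### Smoothly evolving sets and the geometry of their interface -/

/-- The interface `Γ = ∂E ∩ Ω`, together with its contact points on `∂Ω`. -/
def interface (Ω E : Set (Space d)) : Set (Space d) := closure (frontier E ∩ Ω)

/-- On a space-time neighbourhood of `p`, relative to `[0,T) × Ω`, the evolving set `E` is
`{φ < 0}` with `φ` smooth. -/
structure IsLevelSetAt (Ω : Set (Space d)) (T : ℝ) (E : ℝ → Set (Space d))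
    (p : ℝ × Space d) (φ : ℝ × Space d → ℝ) : Prop where
  smooth : ∀ᶠ q in 𝓝 p, ContDiffAt ℝ ∞ φ q
  mem_iff : ∀ᶠ q in 𝓝 p, q.1 ∈ Ico 0 T → q.2 ∈ Ω → (q.2 ∈ E q.1 ↔ φ q < 0)

/-- `φ` is a smooth defining function of the evolving set `E` near the interface point `p`. -/
structure IsEvolvingDefiningAt (Ω : Set (Space d)) (T : ℝ) (E : ℝ → Set (Space d))
    (p : ℝ × Space d) (φ : ℝ × Space d → ℝ) : Prop extends IsLevelSetAt Ω T E p φ where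
  zero : φ p = 0
  grad_ne : spaceGrad φ p ≠ 0

/-- `(E(t))`, `t ∈ [0,T)`, is a smoothly evolving family of smooth subsets of `Ω`: near every point
of `[0,T) × closure Ω` the set is `{φ < 0}` with `φ` smooth and `∇φ ≠ 0` on `{φ = 0}`, and
where the interface reaches `∂Ω` it does so transversally (so that the interface is
a hypersurface with boundary on `∂Ω`). -/
structure IsSmoothEvolution (Ω : Set (Space d)) (T : ℝ) (E : ℝ → Set (Space d)) : Prop where
  subset : ∀ t ∈ Ico 0 T, E t ⊆ Ω
  level : ∀ t ∈ Ico 0 T, ∀ x ∈ closure Ω, ∃ φ, IsLevelSetAt Ω T E (t, x) φ ∧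
    (φ (t, x) = 0 → spaceGrad φ (t, x) ≠ 0 ∧
      ∀ n, IsOuterNormal Ω x n → LinearIndependent ℝ ![spaceGrad φ (t, x), n])

/-- Outer unit normal `ν_Γ = ∇φ / |∇φ|` of `{φ(t, ·) < 0}`. -/
def levelNormal (φ : ℝ × Space d → ℝ) (p : ℝ × Space d) : Space d :=
  ‖spaceGrad φ p‖⁻¹ • spaceGrad φ p

/-- Normal velocity `V_Γ` of `{φ(t, ·) = 0}` in the direction of the outer normal. -/
def levelVelocity (φ : ℝ × Space d → ℝ) (p : ℝ × Space d) : ℝ :=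
  -(timeDeriv φ p) / ‖spaceGrad φ p‖

/-- Scalar mean curvature `H_Γ = - div ν_Γ` (sum of the principal curvatures), with the sign
for which the area of `Γ` changes at the rate `- ∫ H_Γ V_Γ`; it is negative for balls. -/
def levelCurvature (φ : ℝ × Space d → ℝ) (p : ℝ × Space d) : ℝ :=
  -spaceDiv (levelNormal φ) p

/-- The jump `[[g]] = g₊ - g₋` at `x` equals `j`, where `g₊` and `g₋` are the one-sided limits of `g`
from the outside `Ω \ closure E` and from the inside `E`. -/
def HasJump {F : Type*} [NormedAddCommGroup F] (Ω E : Set (Space d)) (x : Space d)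
    (g : Space d → F) (j : F) : Prop :=
  ∃ gOut gIn : F, Tendsto g (𝓝[Ω \ closure E] x) (𝓝 gOut) ∧ Tendsto g (𝓝[E] x) (𝓝 gIn) ∧
    j = gOut - gIn

/-! ### Smooth densities -/

/-- `f ∈ C^∞(closure Ω × [0,T))`: `f` is smooth up to `∂Ω` and up to `t = 0`. -/
def IsSmoothUpTo (Ω : Set (Space d)) (T : ℝ) (f : ℝ × Space d → ℝ) : Prop :=
  ∀ t ∈ Ico 0 T, ∀ x ∈ closure Ω, ContDiffAt ℝ ∞ f (t, x)

/-- `ρ` is a nonnegative density which is smooth in each phase, up to the interface, up to `∂Ω`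
and up to `t = 0`. This contains the case `ρ ∈ C^∞(closure Ω × [0,T))` (take `ρin = ρout`). -/
def IsSmoothDensity (Ω : Set (Space d)) (T : ℝ) (E : ℝ → Set (Space d))
    (ρ : ℝ × Space d → ℝ) : Prop :=
  (∀ t ∈ Ico 0 T, ∀ x ∈ Ω, 0 ≤ ρ (t, x)) ∧
  ∃ ρin ρout : ℝ × Space d → ℝ, IsSmoothUpTo Ω T ρin ∧ IsSmoothUpTo Ω T ρout ∧
    ∀ t ∈ Ico 0 T, ∀ x ∈ Ω,
      (x ∈ E t → ρ (t, x) = ρin (t, x)) ∧ (x ∉ E t → ρ (t, x) = ρout (t, x))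

/-! ### Weak formulation -/

/-- Test functions in `C_c^∞(closure Ω × [0,T); F)`, as restrictions of smooth functions
on space-time with compact support in `{t < T}`. -/
structure IsTest {F : Type*} [NormedAddCommGroup F] [NormedSpace ℝ F] (T : ℝ)
    (η : ℝ × Space d → F) : Prop where
  smooth : ContDiff ℝ ∞ η
  compact : HasCompactSupport η
  support : tsupport η ⊆ Iio T ×ˢ univ

/-- The distributional transport equation with initial datum `ρ₀`
(the mass flux `ρ u` and the initial datum are locally integrable up to `∂Ω` and `t = 0`). -/
structure WeakTransport (Ω : Set (Space d)) (T : ℝ) (ρ : ℝ × Space d → ℝ)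
    (u : ℝ × Space d → Space d) (ρ₀ : Space d → ℝ) : Prop where
  flux_integrable : LocallyIntegrableOn (fun p => ρ p • u p) (Iio T ×ˢ univ)
    (volume.restrict (Ioo 0 T ×ˢ Ω))
  initial_integrable : LocallyIntegrable ρ₀ (volume.restrict Ω)
  eq : ∀ η : ℝ × Space d → ℝ, IsTest T η →
    -∫ t in Ioo 0 T, ∫ x in Ω, ρ (t, x) * (timeDeriv η (t, x) + ⟪u (t, x), spaceGrad η (t, x)⟫)
      = ∫ x in Ω, ρ₀ x * η (0, x)

/-- `μ = |∇χ|` and `ν = - d∇χ/d|∇χ|` in `Ω`: the polar decomposition of the distributional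
gradient of `χ`, that is `∇χ = - ν μ` with `|ν| = 1` `μ`-almost everywhere. -/
structure IsGradientPolar (Ω : Set (Space d)) (χ : Space d → ℝ) (μ : Measure (Space d))
    (ν : Space d → Space d) : Prop where
  null_compl : μ Ωᶜ = 0
  locally_finite : ∀ K : Set (Space d), IsCompact K → K ⊆ Ω → μ K < ⊤
  measurable : AEStronglyMeasurable ν μ
  norm_eq : ∀ᵐ x ∂μ, ‖ν x‖ = 1
  eq : ∀ ζ : Space d → Space d, ContDiff ℝ ∞ ζ → HasCompactSupport ζ → tsupport ζ ⊆ Ω →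
    ∫ x in Ω, χ x * divergence ζ x = ∫ x, ⟪ζ x, ν x⟫ ∂μ

/-- The pressure `π = ρ^m - lam χ`. -/
def pressure (m lam : ℝ) (ρ χ : ℝ × Space d → ℝ) (p : ℝ × Space d) : ℝ :=
  ρ p ^ m - lam * χ p

/-- The distributional Young-Laplace law. -/
def WeakYoungLaplace (Ω : Set (Space d)) (T m lam : ℝ) (ρ χ : ℝ × Space d → ℝ)
    (u : ℝ × Space d → Space d) : Prop :=
  ∃ (μ : ℝ → Measure (Space d)) (ν : ℝ → Space d → Space d),
    (∀ᵐ t ∂(volume.restrict (Ioo 0 T)), IsGradientPolar Ω (fun x => χ (t, x)) (μ t) (ν t)) ∧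
    ∀ ξ : ℝ × Space d → Space d, IsTest T ξ →
      (∀ t ∈ Ioo 0 T, ∀ x ∈ frontier Ω, ∀ n, IsOuterNormal Ω x n → ⟪ξ (t, x), n⟫ = 0) →
      -∫ t in Ioo 0 T, ∫ x in Ω, ⟪ρ (t, x) • u (t, x), ξ (t, x)⟫
        = (∫ t in Ioo 0 T, ∫ x, (spaceDiv ξ (t, x)
              - ⟪ν t x, fderiv ℝ (fun y => ξ (t, y)) x (ν t x)⟫) ∂(μ t))
          - ∫ t in Ioo 0 T, ∫ x in Ω, pressure m lam ρ χ (t, x) * spaceDiv ξ (t, x)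

/-! ### Classical solutions -/

/-- Classical solutions of the Verigin problem with phase transition (surface tension `1`). -/
structure IsClassicalSolution (Ω : Set (Space d)) (T m lam : ℝ) (E : ℝ → Set (Space d))
    (ρ χ : ℝ × Space d → ℝ) (u : ℝ × Space d → Space d) : Prop where
  /-- `∂ₜρ + div(ρ u) = 0` in both phases, for all `t ∈ [0,T)` (one-sided derivative at `t = 0`). -/
  mass : ∀ t ∈ Ico 0 T, ∀ x ∈ Ω \ interface Ω (E t),
    DifferentiableWithinAt ℝ (fun s => ρ (s, x)) (Ico 0 T) t ∧
    DifferentiableAt ℝ (fun y => ρ (t, y) • u (t, y)) x ∧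
    derivWithin (fun s => ρ (s, x)) (Ico 0 T) t + spaceDiv (fun p => ρ p • u p) (t, x) = 0
  /-- Darcy's law `ρ u = - ∇π` in both phases. -/
  darcy : ∀ t ∈ Ico 0 T, ∀ x ∈ Ω \ interface Ω (E t),
    DifferentiableAt ℝ (fun y => pressure m lam ρ χ (t, y)) x ∧
    ρ (t, x) • u (t, x) = -spaceGrad (pressure m lam ρ χ) (t, x)
  /-- `[[ρ]] V_Γ = [[ρ u · ν_Γ]]` along `Γ`. -/
  mass_jump : ∀ t ∈ Ico 0 T, ∀ x ∈ interface Ω (E t), ∀ φ, IsEvolvingDefiningAt Ω T E (t, x) φ →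
    ∃ (jρ : ℝ) (jflux : Space d), HasJump Ω (E t) x (fun y => ρ (t, y)) jρ ∧
      HasJump Ω (E t) x (fun y => ρ (t, y) • u (t, y)) jflux ∧
      jρ * levelVelocity φ (t, x) = ⟪jflux, levelNormal φ (t, x)⟫
  /-- `[[π]] = H_Γ` along `Γ`. -/
  young_laplace : ∀ t ∈ Ico 0 T, ∀ x ∈ interface Ω (E t), ∀ φ,
    IsEvolvingDefiningAt Ω T E (t, x) φ →
    HasJump Ω (E t) x (fun y => pressure m lam ρ χ (t, y)) (levelCurvature φ (t, x))
  /-- `∇ρ · ν_Ω = 0` along `∂Ω`, from within either phase `A`. In the degenerate case `m > 1` the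
  condition is void at boundary points where `ρ` vanishes (vacuum). -/
  neumann : ∀ t ∈ Ico 0 T, ∀ A : Set (Space d), (A = E t ∨ A = Ω \ closure (E t)) →
    ∀ x ∈ frontier Ω ∩ closure A, ∀ n, IsOuterNormal Ω x n →
    ∃ (r : ℝ) (g : Space d), Tendsto (fun y => ρ (t, y)) (𝓝[A] x) (𝓝 r) ∧
      Tendsto (fun y => spaceGrad ρ (t, y)) (𝓝[A] x) (𝓝 g) ∧
      ((m = 1 ∨ 0 < r) → ⟪g, n⟫ = 0)
  /-- `ν_Γ · ν_Ω = 0` along `∂Ω ∩ Γ` (contact angle of 90 degrees). -/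
  angle : ∀ t ∈ Ico 0 T, ∀ x ∈ frontier Ω ∩ interface Ω (E t), ∀ n, IsOuterNormal Ω x n →
    ∀ φ, IsEvolvingDefiningAt Ω T E (t, x) φ → ⟪levelNormal φ (t, x), n⟫ = 0

end Verigin

end

namespace Verigin

variable {d : ℕ}

/-! ### Calculus in space-time -/

/-! Domain, evolving set and density are smooth by hypothesis, so the task is to read pointwise
identities off two integral identities. The tool is a test function cut off by a smooth profile of
width `ε` around a level set `{ψ = 0}`, followed by `ε → 0`. Where the profile is not differentiated
the terms vanish by dominated convergence, regular level sets being null (`exists_nhds_level_null`).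
Where it is differentiated there remains the weight `ε⁻¹ hump'(ψ/ε)`, which is nonnegative for `ψ <
0`, nonpositive for `ψ > 0`, and whose two halves balance in the limit; it therefore sees only the
difference of the two one-sided values of the integrand. `trace_eq_of_tendsto_concentrated` turns
the vanishing of such limits into equality of traces. Neither surface measure nor the coarea formula
is needed: their role is played by the volume bound `exists_volume_preimage_ge`.

Darcy's law comes first. Fields supported in one phase do not see `|∇χ|`, and the fundamental lemma
gives `ρ u = -∇ρ^m` almost everywhere (`darcy_bulk`). With this flux in the transport equation, `ψ =
φ` yields the Rankine-Hugoniot condition (`PhaseChart.mass_jump`), `ψ = b` with `b` defining `Ω`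
yields the no-flux condition (`PhaseChart.no_flux`), `ψ = t` yields the initial value
(`PhaseChart.integral_initial`), and uncut test functions yield the continuity equation
(`PhaseChart.continuity_equation`).

For the jump of the pressure, `ν` is first identified with `N = ∇φ/|∇φ|`
(`IsGradientPolar.eq_normal`). For `ξ = g N` the tangential divergence is `g div N`, and the
defining relation of `∇χ` rewrites its integral against `|∇χ|` as the integral of `div (g (div N)
N)` over `{φ < 0}`. Now every term is a volume integral, and concentrating `g` at `{φ = 0}` gives
`[[π]] = -div N` (`PhaseChart.young_laplace`).

For the contact angle the test field must be tangential to `∂Ω`. Transversality provides a field `Y`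
with `Y · ∇b = 0` and `Y · N = 1`. Testing with `f step(b/ε) Y` removes all volume terms in the
limit and leaves the conormal component `∇b · N` on the contact line
(`ContactChart.tendsto_conormal`). Weighting by that component again produces a square, and a lower
bound for integrals concentrated at two transversal level sets (`exists_doubly_concentrated_ge`)
forces it to vanish.

These identities are first obtained at positive times, and those on the interface inside `Ω`. All
quantities are continuous, and points of the good kind accumulate at every interface or boundary
point and at `t = 0` (`frequently_later`), which gives the full statement.

Vacuum needs separate care, since `ρ^m` is in general only `C¹` where `ρ = 0`. The new velocity is
`-∇π/ρ`, read as zero in vacuum. There a nonnegative density has a minimum, so `∇ρ = 0` and Darcy's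
law persists. For `m > 1` both terms of the continuity equation are shown to vanish
(`timeDeriv_eq_zero_of_vacuum`, `hasFDerivAt_spaceGrad_rpow_of_vacuum`). -/

lemma hasFDerivAt_slice {G : Type*} [NormedAddCommGroup G] [NormedSpace ℝ G]
    {f : ℝ × Space d → G} {p : ℝ × Space d} (hf : DifferentiableAt ℝ f p) :
    HasFDerivAt (fun y => f (p.1, y))
      ((fderiv ℝ f p).comp (ContinuousLinearMap.inr ℝ ℝ (Space d))) p.2 :=
  HasFDerivAt.comp (g := f) p.2 hf.hasFDerivAt (hasFDerivAt_prodMk_right p.1 p.2)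

lemma spaceGrad_eq {f : ℝ × Space d → ℝ} {p : ℝ × Space d} (hf : DifferentiableAt ℝ f p) :
    spaceGrad f p = (InnerProductSpace.toDual ℝ (Space d)).symm
      ((fderiv ℝ f p).comp (ContinuousLinearMap.inr ℝ ℝ (Space d))) := by
  rw [spaceGrad, gradient, (hasFDerivAt_slice hf).fderiv]

lemma inner_spaceGrad {f : ℝ × Space d → ℝ} {p : ℝ × Space d} (hf : DifferentiableAt ℝ f p)
    (v : Space d) : ⟪spaceGrad f p, v⟫ = fderiv ℝ f p (0, v) := by
  rw [spaceGrad_eq hf, InnerProductSpace.toDual_symm_apply]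
  simp

lemma timeDeriv_eq {f : ℝ × Space d → ℝ} {p : ℝ × Space d} (hf : DifferentiableAt ℝ f p) :
    timeDeriv f p = fderiv ℝ f p (1, 0) := by
  have h : HasFDerivAt (fun s => f (s, p.2))
      ((fderiv ℝ f p).comp (ContinuousLinearMap.inl ℝ ℝ (Space d))) p.1 :=
    HasFDerivAt.comp (g := f) p.1 hf.hasFDerivAt (hasFDerivAt_prodMk_left p.1 p.2)
  rw [timeDeriv, h.hasDerivAt.deriv]
  simp

lemma spaceDiv_eq {F : ℝ × Space d → Space d} {p : ℝ × Space d} (hF : DifferentiableAt ℝ F p) :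
    spaceDiv F p = ∑ i : Fin d, (fderiv ℝ F p (0, EuclideanSpace.single i 1)) i := by
  rw [spaceDiv, divergence, (hasFDerivAt_slice hF).fderiv]
  simp

lemma fderiv_slice {G : Type*} [NormedAddCommGroup G] [NormedSpace ℝ G]
    {f : ℝ × Space d → G} {p : ℝ × Space d} (hf : DifferentiableAt ℝ f p) (v : Space d) :
    fderiv ℝ (fun y => f (p.1, y)) p.2 v = fderiv ℝ f p (0, v) := by
  rw [(hasFDerivAt_slice hf).fderiv]
  simp

lemma spaceGrad_congr {f g : ℝ × Space d → ℝ} {p : ℝ × Space d} (h : f =ᶠ[𝓝 p] g) :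
    spaceGrad f p = spaceGrad g p := by
  have : (fun y => f (p.1, y)) =ᶠ[𝓝 p.2] fun y => g (p.1, y) :=
    (Continuous.prodMk_right p.1).continuousAt.eventually h
  rw [spaceGrad, spaceGrad, gradient, gradient, this.fderiv_eq]

lemma spaceDiv_congr {f g : ℝ × Space d → Space d} {p : ℝ × Space d} (h : f =ᶠ[𝓝 p] g) :
    spaceDiv f p = spaceDiv g p := by
  have : (fun y => f (p.1, y)) =ᶠ[𝓝 p.2] fun y => g (p.1, y) :=
    (Continuous.prodMk_right p.1).continuousAt.eventually h
  rw [spaceDiv, spaceDiv, divergence, divergence, this.fderiv_eq]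

lemma timeDeriv_congr {f g : ℝ × Space d → ℝ} {p : ℝ × Space d} (h : f =ᶠ[𝓝 p] g) :
    timeDeriv f p = timeDeriv g p := by
  have : (fun s => f (s, p.2)) =ᶠ[𝓝 p.1] fun s => g (s, p.2) :=
    (Continuous.prodMk_left p.2).continuousAt.eventually h
  rw [timeDeriv, timeDeriv, this.deriv_eq]

lemma eventually_differentiableAt {V G : Type*} [NormedAddCommGroup V] [NormedSpace ℝ V]
    [NormedAddCommGroup G] [NormedSpace ℝ G] {f : V → G} {p : V} {n : WithTop ℕ∞}
    (hf : ContDiffAt ℝ n f p) (hn : 1 ≤ n) : ∀ᶠ q in 𝓝 p, DifferentiableAt ℝ f q := by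
  have h1 : ContDiffAt ℝ 1 f p := hf.of_le hn
  filter_upwards [h1.eventually (by simp)] with q hq using hq.differentiableAt (by simp)

lemma contDiffAt_spaceGrad {f : ℝ × Space d → ℝ} {p : ℝ × Space d} {m n : WithTop ℕ∞}
    (hf : ContDiffAt ℝ n f p) (h : m + 1 ≤ n) : ContDiffAt ℝ m (spaceGrad f) p := by
  have h1 : ContDiffAt ℝ m (fun q => (InnerProductSpace.toDual ℝ (Space d)).symm
      ((fderiv ℝ f q).comp (ContinuousLinearMap.inr ℝ ℝ (Space d)))) p := by
    have h2 : ContDiffAt ℝ m (fderiv ℝ f) p := hf.fderiv_right h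
    exact ((InnerProductSpace.toDual ℝ (Space d)).symm.contDiff.contDiffAt).comp p
      (h2.clm_comp contDiffAt_const)
  refine h1.congr_of_eventuallyEq ?_
  filter_upwards [eventually_differentiableAt hf (le_trans (by simp) h)] with q hq
    using spaceGrad_eq hq

lemma contDiffAt_timeDeriv {f : ℝ × Space d → ℝ} {p : ℝ × Space d} {m n : WithTop ℕ∞}
    (hf : ContDiffAt ℝ n f p) (h : m + 1 ≤ n) : ContDiffAt ℝ m (timeDeriv f) p := by
  have h1 : ContDiffAt ℝ m (fun q => fderiv ℝ f q (1, 0)) p :=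
    (hf.fderiv_right h).clm_apply contDiffAt_const
  refine h1.congr_of_eventuallyEq ?_
  filter_upwards [eventually_differentiableAt hf (le_trans (by simp) h)] with q hq
    using timeDeriv_eq hq

lemma contDiffAt_spaceDiv {F : ℝ × Space d → Space d} {p : ℝ × Space d} {m n : WithTop ℕ∞}
    (hF : ContDiffAt ℝ n F p) (h : m + 1 ≤ n) : ContDiffAt ℝ m (spaceDiv F) p := by
  have h1 : ContDiffAt ℝ m
      (fun q => ∑ i : Fin d, (fderiv ℝ F q (0, EuclideanSpace.single i 1)) i) p := by
    refine ContDiffAt.sum fun i _ => ?_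
    have h2 : ContDiffAt ℝ m (fun q => fderiv ℝ F q (0, EuclideanSpace.single i 1)) p :=
      (hF.fderiv_right h).clm_apply contDiffAt_const
    exact (EuclideanSpace.proj (𝕜 := ℝ) i).contDiff.contDiffAt.comp p h2
  refine h1.congr_of_eventuallyEq ?_
  filter_upwards [eventually_differentiableAt hF (le_trans (by simp) h)] with q hq
    using spaceDiv_eq hq

lemma ext_inner_space {x y : Space d} (h : ∀ v, ⟪x, v⟫ = ⟪y, v⟫) : x = y :=
  ext_inner_right ℝ h

lemma spaceGrad_mul {f g : ℝ × Space d → ℝ} {p : ℝ × Space d} (hf : DifferentiableAt ℝ f p)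
    (hg : DifferentiableAt ℝ g p) :
    spaceGrad (fun q => f q * g q) p = f p • spaceGrad g p + g p • spaceGrad f p := by
  refine ext_inner_space fun v => ?_
  rw [inner_spaceGrad (hf.fun_mul hg), inner_add_left, real_inner_smul_left, real_inner_smul_left,
    inner_spaceGrad hf, inner_spaceGrad hg, fderiv_fun_mul hf hg]
  simp

lemma timeDeriv_mul {f g : ℝ × Space d → ℝ} {p : ℝ × Space d} (hf : DifferentiableAt ℝ f p)
    (hg : DifferentiableAt ℝ g p) :
    timeDeriv (fun q => f q * g q) p = f p * timeDeriv g p + g p * timeDeriv f p := by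
  rw [timeDeriv_eq (hf.fun_mul hg), timeDeriv_eq hf, timeDeriv_eq hg, fderiv_fun_mul hf hg]
  simp

lemma spaceDiv_smul {g : ℝ × Space d → ℝ} {F : ℝ × Space d → Space d} {p : ℝ × Space d}
    (hg : DifferentiableAt ℝ g p) (hF : DifferentiableAt ℝ F p) :
    spaceDiv (fun q => g q • F q) p = g p * spaceDiv F p + ⟪spaceGrad g p, F p⟫ := by
  rw [spaceDiv_eq (hg.fun_smul hF), spaceDiv_eq hF, Finset.mul_sum, fderiv_fun_smul hg hF]
  have : ⟪spaceGrad g p, F p⟫ = ∑ i, fderiv ℝ g p (0, EuclideanSpace.single i 1) * F p i := by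
    conv_lhs => rw [← (EuclideanSpace.basisFun (Fin d) ℝ).sum_repr (F p)]
    rw [inner_sum]
    refine Finset.sum_congr rfl fun i _ => ?_
    rw [real_inner_smul_right, inner_spaceGrad hg]
    simp [mul_comm]
  rw [this, ← Finset.sum_add_distrib]
  refine Finset.sum_congr rfl fun i _ => ?_
  simp

lemma spaceGrad_comp {h : ℝ → ℝ} {f : ℝ × Space d → ℝ} {p : ℝ × Space d}
    (hh : DifferentiableAt ℝ h (f p)) (hf : DifferentiableAt ℝ f p) :
    spaceGrad (fun q => h (f q)) p = deriv h (f p) • spaceGrad f p := by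
  refine ext_inner_space fun v => ?_
  have h1 := (hh.hasDerivAt.comp_hasFDerivAt p hf.hasFDerivAt)
  have h2 : DifferentiableAt ℝ (fun q => h (f q)) p := h1.differentiableAt
  rw [inner_spaceGrad h2, real_inner_smul_left, inner_spaceGrad hf]
  have h3 : fderiv ℝ (fun q => h (f q)) p = deriv h (f p) • fderiv ℝ f p := h1.fderiv
  rw [h3]; simp

lemma timeDeriv_comp {h : ℝ → ℝ} {f : ℝ × Space d → ℝ} {p : ℝ × Space d}
    (hh : DifferentiableAt ℝ h (f p)) (hf : DifferentiableAt ℝ f p) :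
    timeDeriv (fun q => h (f q)) p = deriv h (f p) * timeDeriv f p := by
  have h1 := (hh.hasDerivAt.comp_hasFDerivAt p hf.hasFDerivAt)
  have h2 : DifferentiableAt ℝ (fun q => h (f q)) p := h1.differentiableAt
  rw [timeDeriv_eq h2, timeDeriv_eq hf]
  have h3 : fderiv ℝ (fun q => h (f q)) p = deriv h (f p) • fderiv ℝ f p := h1.fderiv
  rw [h3]; simp

/-! ### Localized functions -/

section Localized

variable {V G : Type*} [NormedAddCommGroup V] [NormedSpace ℝ V] [NormedAddCommGroup G]
  [NormedSpace ℝ G] {n : WithTop ℕ∞}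

/-- Local objects such as a level set function or its normal are smooth only on a chart; multiplied
by a cut-off supported there they become globally smooth. -/
lemma contDiff_smul_of_tsupport {f : V → ℝ} {g : V → G} {O : Set V}
    (hf : ContDiff ℝ n f) (hO : tsupport f ⊆ O) (hg : ∀ q ∈ O, ContDiffAt ℝ n g q) :
    ContDiff ℝ n (fun q => f q • g q) := by
  rw [contDiff_iff_contDiffAt]
  intro q
  by_cases hq : q ∈ tsupport f
  · exact hf.contDiffAt.smul (hg q (hO hq))
  · have h0 : (fun q => f q • g q) =ᶠ[𝓝 q] fun _ => 0 := by
      filter_upwards [notMem_tsupport_iff_eventuallyEq.mp hq] with y hy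
      simp [hy]
    exact contDiffAt_const.congr_of_eventuallyEq h0

lemma contDiff_mul_of_tsupport {f g : V → ℝ} {O : Set V}
    (hf : ContDiff ℝ n f) (hO : tsupport f ⊆ O) (hg : ∀ q ∈ O, ContDiffAt ℝ n g q) :
    ContDiff ℝ n (fun q => f q * g q) :=
  contDiff_smul_of_tsupport hf hO hg

omit [NormedSpace ℝ V] in
lemma continuous_smul_of_tsupport {f : V → ℝ} {g : V → G} {O : Set V}
    (hf : Continuous f) (hO : tsupport f ⊆ O) (hg : ∀ q ∈ O, ContinuousAt g q) :
    Continuous (fun q => f q • g q) := by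
  rw [continuous_iff_continuousAt]
  intro q
  by_cases hq : q ∈ tsupport f
  · exact hf.continuousAt.smul (hg q (hO hq))
  · have h0 : (fun q => f q • g q) =ᶠ[𝓝 q] fun _ => 0 := by
      filter_upwards [notMem_tsupport_iff_eventuallyEq.mp hq] with y hy
      simp [hy]
    exact continuousAt_const.congr h0.symm

lemma exists_smooth_bump [FiniteDimensional ℝ V] {p : V} {O : Set V} (hO : O ∈ 𝓝 p) :
    ∃ f : V → ℝ, ContDiff ℝ ∞ f ∧ HasCompactSupport f ∧ tsupport f ⊆ O ∧ (∀ q, 0 ≤ f q) ∧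
      (∀ q, f q ≤ 1) ∧ ∀ᶠ q in 𝓝 p, f q = 1 := by
  obtain ⟨r, hr, hball⟩ := Metric.nhds_basis_closedBall.mem_iff.mp hO
  let f : ContDiffBump p := ⟨r / 2, r, by positivity, by linarith⟩
  exact ⟨f, f.contDiff, f.hasCompactSupport, by rw [f.tsupport_eq]; exact hball,
    fun q => f.nonneg, fun q => f.le_one, f.eventuallyEq_one⟩

end Localized

/-! ### Cutoff profiles -/

/-- A smooth nondecreasing profile, `0` on `(-∞, -1]` and `1` on `[-1/2, ∞)`. -/
noncomputable def step (s : ℝ) : ℝ := Real.smoothTransition (2 * (s + 1))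

lemma contDiff_step : ContDiff ℝ ∞ step :=
  Real.smoothTransition.contDiff.comp (by fun_prop)

lemma step_nonneg (s : ℝ) : 0 ≤ step s := Real.smoothTransition.nonneg _

lemma step_le_one (s : ℝ) : step s ≤ 1 := Real.smoothTransition.le_one _

lemma step_eq_zero {s : ℝ} (hs : s ≤ -1) : step s = 0 :=
  Real.smoothTransition.zero_of_nonpos (by linarith)

lemma step_eq_one {s : ℝ} (hs : -(1 / 2) ≤ s) : step s = 1 :=
  Real.smoothTransition.one_of_one_le (by linarith)

lemma monotone_step : Monotone step := fun _ _ h =>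
  Real.smoothTransition.monotone (by linarith)

lemma differentiable_step : Differentiable ℝ step := contDiff_step.differentiable (by simp)

lemma contDiff_deriv_step : ContDiff ℝ ∞ (deriv step) :=
  (contDiff_infty_iff_deriv.mp contDiff_step).2

lemma deriv_step_nonneg (s : ℝ) : 0 ≤ deriv step s := monotone_step.deriv_nonneg

lemma deriv_step_eq_zero_right {s : ℝ} (hs : -(1 / 2) ≤ s) : deriv step s = 0 := by
  refine le_antisymm ?_ (deriv_step_nonneg s)
  have h : IsLocalMax step s := Filter.Eventually.of_forall fun y => by
    rw [step_eq_one hs]; exact step_le_one y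
  exact h.deriv_eq_zero.le

lemma deriv_step_eq_zero_left {s : ℝ} (hs : s ≤ -1) : deriv step s = 0 := by
  have h : IsLocalMin step s := Filter.Eventually.of_forall fun y => by
    rw [step_eq_zero hs]; exact step_nonneg y
  exact h.deriv_eq_zero

/-- The mean slope of `step` over `[-1, -1/2]` is 2, so its derivative exceeds 1 somewhere inside
and, by continuity, on a small interval. This is the quantitative input of all lower bounds for
concentrated integrals. -/
lemma exists_deriv_step_ge : ∃ a b c : ℝ, -1 < a ∧ a < b ∧ b < -(1 / 2) ∧ 0 < c ∧
    ∀ s ∈ Icc a b, c ≤ deriv step s := by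
  obtain ⟨s, hs, hd⟩ := exists_deriv_eq_slope step (a := -1) (b := -(1 / 2)) (by norm_num)
    differentiable_step.continuous.continuousOn differentiable_step.differentiableOn
  rw [step_eq_one le_rfl, step_eq_zero le_rfl] at hd
  have hpos : (1 : ℝ) < deriv step s := by rw [hd]; norm_num
  have h1 : ∀ᶠ y in 𝓝 s, 1 < deriv step y ∧ y ∈ Ioo (-1 : ℝ) (-(1 / 2)) :=
    (contDiff_deriv_step.continuous.continuousAt.eventually (lt_mem_nhds hpos)).and
      (isOpen_Ioo.mem_nhds hs)
  obtain ⟨r, hr, hball⟩ := Metric.eventually_nhds_iff.mp h1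
  refine ⟨s - r / 2, s + r / 2, 1, ?_, by linarith, ?_, one_pos, fun y hy => ?_⟩
  · exact (hball (y := s - r / 2) (by rw [Real.dist_eq]; rw [abs_lt]; constructor <;> linarith)).2.1
  · exact (hball (y := s + r / 2) (by rw [Real.dist_eq]; rw [abs_lt]; constructor <;> linarith)).2.2
  · refine (hball (y := y) ?_).1.le
    rw [Real.dist_eq, abs_lt]; constructor <;> linarith [hy.1, hy.2]

/-- A smooth even bump profile, `1` on `[-1/2, 1/2]` and `0` off `(-1, 1)`. -/
noncomputable def hump (s : ℝ) : ℝ := step s * step (-s)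

lemma contDiff_hump : ContDiff ℝ ∞ hump := contDiff_step.mul (contDiff_step.comp contDiff_neg)

lemma differentiable_hump : Differentiable ℝ hump := contDiff_hump.differentiable (by simp)

lemma hump_nonneg (s : ℝ) : 0 ≤ hump s := mul_nonneg (step_nonneg _) (step_nonneg _)

lemma hump_le_one (s : ℝ) : hump s ≤ 1 :=
  mul_le_one₀ (step_le_one _) (step_nonneg _) (step_le_one _)

lemma hump_zero : hump 0 = 1 := by
  rw [hump, neg_zero, step_eq_one (by norm_num), mul_one]

lemma hump_eq_zero {s : ℝ} (hs : 1 ≤ |s|) : hump s = 0 := by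
  rcases le_abs.mp hs with h | h
  · rw [hump, step_eq_zero (s := -s) (by linarith), mul_zero]
  · rw [hump, step_eq_zero (s := s) (by linarith), zero_mul]

lemma deriv_hump (s : ℝ) :
    deriv hump s = deriv step s * step (-s) - step s * deriv step (-s) := by
  have h1 : HasDerivAt step (deriv step s) s := (differentiable_step s).hasDerivAt
  have h2 : HasDerivAt (fun s => step (-s)) (deriv step (-s) * (-1)) s :=
    (differentiable_step (-s)).hasDerivAt.comp s (hasDerivAt_neg s)
  have := (h1.mul h2).deriv
  have h3 : hump = step * fun s => step (-s) := rfl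
  rw [h3, this]; ring

lemma deriv_hump_of_neg {s : ℝ} (hs : s < 0) : deriv hump s = deriv step s := by
  rw [deriv_hump, step_eq_one (s := -s) (by linarith),
    deriv_step_eq_zero_right (s := -s) (by linarith)]; ring

lemma deriv_hump_nonpos {s : ℝ} (hs : 0 ≤ s) : deriv hump s ≤ 0 := by
  rw [deriv_hump, deriv_step_eq_zero_right (s := s) (by linarith)]
  have := mul_nonneg (step_nonneg s) (deriv_step_nonneg (-s))
  linarith

lemma continuous_deriv_hump : Continuous (deriv hump) :=
  (contDiff_infty_iff_deriv.mp contDiff_hump).2.continuous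

lemma tendsto_hump_div {a : ℝ} (ha : a ≠ 0) :
    Tendsto (fun ε : ℝ => hump (a / ε)) (𝓝[>] 0) (𝓝 0) := by
  refine tendsto_const_nhds.congr' ?_
  have : ∀ᶠ ε : ℝ in 𝓝[>] 0, ε < |a| := nhdsWithin_le_nhds (gt_mem_nhds (abs_pos.mpr ha))
  filter_upwards [this, self_mem_nhdsWithin] with ε h1 h2
  rw [hump_eq_zero]
  have h2' : (0 : ℝ) < ε := h2
  rw [abs_div, abs_of_pos h2', le_div_iff₀ h2']; linarith

lemma tendsto_step_div {a : ℝ} (ha : a < 0) :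
    Tendsto (fun ε : ℝ => step (a / ε)) (𝓝[>] 0) (𝓝 0) := by
  refine tendsto_const_nhds.congr' ?_
  have : ∀ᶠ ε : ℝ in 𝓝[>] 0, ε < -a := nhdsWithin_le_nhds (gt_mem_nhds (by linarith))
  filter_upwards [this, self_mem_nhdsWithin] with ε h1 h2
  rw [step_eq_zero]
  rw [div_le_iff₀ h2]; linarith

/-! ### Integration by parts -/

lemma integral_fderiv_eq_zero {V : Type*} [NormedAddCommGroup V] [NormedSpace ℝ V]
    [FiniteDimensional ℝ V] [MeasurableSpace V] [BorelSpace V] (μ : Measure V)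
    [μ.IsAddHaarMeasure] {g : V → ℝ} (hg : ContDiff ℝ 1 g) (hc : HasCompactSupport g) (v : V) :
    ∫ x, fderiv ℝ g x v ∂μ = 0 := by
  have hgd := hg.continuous_fderiv (by simp)
  have hgc : HasCompactSupport (fun x => fderiv ℝ g x v) := hc.fderiv_apply (𝕜 := ℝ) v
  have key := integral_mul_fderiv_eq_neg_fderiv_mul_of_integrable (μ := μ) (f := fun _ => (1 : ℝ))
    (g := g) (v := v) (by simp)
    (by simpa using (hgd.clm_apply continuous_const).integrable_of_hasCompactSupport hgc)
    (by simpa using hg.continuous.integrable_of_hasCompactSupport hc)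
    (fun x _ => differentiableAt_const _) (fun x _ => hg.differentiable (by simp) x)
  simpa using key

lemma fderiv_coord {V : Type*} [NormedAddCommGroup V] [NormedSpace ℝ V] {F : V → Space d} {x v : V}
    (hF : DifferentiableAt ℝ F x) (i : Fin d) :
    (fderiv ℝ F x v) i = fderiv ℝ (fun y => F y i) x v := by
  have := ((EuclideanSpace.proj (𝕜 := ℝ) i).hasFDerivAt.comp x hF.hasFDerivAt).fderiv
  have h2 : (⇑(EuclideanSpace.proj (𝕜 := ℝ) i) ∘ F) = fun y => F y i := rfl
  rw [h2] at this
  rw [this]; rfl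

/-- Leaving the directions `e i` free covers at once the divergence on space and the spatial
divergence on space-time. -/
lemma sum_integral_fderiv_eq_zero {V : Type*} [NormedAddCommGroup V] [NormedSpace ℝ V]
    [FiniteDimensional ℝ V] [MeasurableSpace V] [BorelSpace V] (μ : Measure V)
    [μ.IsAddHaarMeasure] {F : V → Space d} (hF : ContDiff ℝ 1 F) (hc : HasCompactSupport F)
    (e : Fin d → V) :
    ∫ x, ∑ i, (fderiv ℝ F x (e i)) i ∂μ = 0 := by
  have hd : ∀ x, DifferentiableAt ℝ F x := hF.differentiable (by simp)
  have hcomp : ∀ i, ContDiff ℝ 1 fun y => F y i := fun i =>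
    (EuclideanSpace.proj (𝕜 := ℝ) i).contDiff.comp hF
  have hsupp : ∀ i, HasCompactSupport fun y => F y i := fun i =>
    hc.comp_left (g := fun v : Space d => v i) rfl
  simp_rw [fun x i => fderiv_coord (v := e i) (hd x) i]
  rw [integral_finsetSum]
  · exact Finset.sum_eq_zero fun i _ => integral_fderiv_eq_zero μ (hcomp i) (hsupp i) (e i)
  · intro i _
    exact (((hcomp i).continuous_fderiv (by simp)).clm_apply
      continuous_const).integrable_of_hasCompactSupport ((hsupp i).fderiv_apply (𝕜 := ℝ) (e i))

lemma integral_divergence_eq_zero {F : Space d → Space d} (hF : ContDiff ℝ 1 F)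
    (hc : HasCompactSupport F) : ∫ x, divergence F x = 0 :=
  sum_integral_fderiv_eq_zero volume hF hc _

lemma integral_spaceDiv_eq_zero {F : ℝ × Space d → Space d} (hF : ContDiff ℝ 1 F)
    (hc : HasCompactSupport F) : ∫ p, spaceDiv F p = 0 := by
  simp_rw [fun p => spaceDiv_eq (hF.differentiable (by simp) p)]
  have : (volume : Measure (ℝ × Space d)).IsAddHaarMeasure := by
    rw [Measure.volume_eq_prod]; infer_instance
  exact sum_integral_fderiv_eq_zero volume hF hc _

lemma integral_timeDeriv_eq_zero {f : ℝ × Space d → ℝ} (hf : ContDiff ℝ 1 f)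
    (hc : HasCompactSupport f) : ∫ p, timeDeriv f p = 0 := by
  simp_rw [fun p => timeDeriv_eq (hf.differentiable (by simp) p)]
  have : (volume : Measure (ℝ × Space d)).IsAddHaarMeasure := by
    rw [Measure.volume_eq_prod]; infer_instance
  exact integral_fderiv_eq_zero volume hf hc _

/-! ### Level sets: null sets and volume bounds -/

section LevelSets

variable {V : Type*} [NormedAddCommGroup V] [NormedSpace ℝ V] [FiniteDimensional ℝ V]
  [MeasurableSpace V] [BorelSpace V] (μ : Measure V) [μ.IsAddHaarMeasure]

/-- Along a direction `e` in which `ψ` has nonzero derivative, `ψ` is injective near `p`. Hence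
infinitely many bounded translates of the level set along `e` are disjoint, and a bounded set with
this property is null. -/
lemma exists_nhds_level_null {ψ : V → ℝ} {p : V} (hψ : ContDiffAt ℝ 1 ψ p)
    (hd : fderiv ℝ ψ p ≠ 0) : ∃ O ∈ 𝓝 p, μ (O ∩ {q | ψ q = 0}) = 0 := by
  obtain ⟨e, he⟩ : ∃ e, fderiv ℝ ψ p e ≠ 0 := by
    by_contra! h
    exact hd (ContinuousLinearMap.ext h)
  have he0 : e ≠ 0 := by rintro rfl; simp at he
  have hen : 0 < ‖e‖ := norm_pos_iff.mpr he0
  have hstrict := hψ.hasStrictFDerivAt (by simp)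
  -- Half the slope of `ψ` per unit length along `e`: a linearization error this small cannot cancel
  -- the change of `ψ` along `e`.
  have hcpos : 0 < |fderiv ℝ ψ p e| / (2 * ‖e‖) := by positivity
  obtain ⟨s, hs, happ⟩ := hstrict.approximates_deriv_on_nhds
    (c := (|fderiv ℝ ψ p e| / (2 * ‖e‖)).toNNReal) (Or.inr (by simpa using hcpos))
  have hcont : ∀ᶠ q in 𝓝 p, ContinuousAt ψ q :=
    (hψ.eventually (by simp)).mono fun q hq => hq.continuousAt
  obtain ⟨r, hr, hball⟩ := Metric.nhds_basis_closedBall.mem_iff.mp (inter_mem hs hcont)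
  refine ⟨Metric.closedBall p r, Metric.closedBall_mem_nhds p hr, ?_⟩
  have hcl : IsClosed (Metric.closedBall p r ∩ {q | ψ q = 0}) :=
    ContinuousOn.preimage_isClosed_of_isClosed (t := {0})
      (fun q hq => ((hball hq).2 : ContinuousAt ψ q).continuousWithinAt)
      Metric.isClosed_closedBall isClosed_singleton
  have hu : ∀ n : ℕ, 0 < (1 : ℝ) / (n + 1) ∧ (1 : ℝ) / (n + 1) ≤ 1 := fun n => by
    constructor
    · positivity
    · rw [div_le_one (by positivity)]; linarith [(Nat.cast_nonneg n : (0 : ℝ) ≤ n)]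
  refine Measure.addHaar_eq_zero_of_disjoint_translates μ (fun n : ℕ => ((1 : ℝ) / (n + 1)) • e)
    ?_ ?_ hcl.measurableSet
  · refine (Metric.isBounded_closedBall (x := (0 : V)) (r := ‖e‖)).subset ?_
    rintro _ ⟨n, rfl⟩
    rw [mem_closedBall_zero_iff, norm_smul, Real.norm_of_nonneg (hu n).1.le]
    exact mul_le_of_le_one_left hen.le (hu n).2
  · intro n m hnm
    rw [Function.onFun, Set.disjoint_left]
    rintro x hx1 hx2
    simp only [singleton_add, image_add_left, mem_preimage] at hx1 hx2
    have h1 := happ _ (hball hx1.1).1 _ (hball hx2.1).1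
    have h2 : ψ (-((1 / ((n : ℝ) + 1)) • e) + x) = 0 := hx1.2
    have h3 : ψ (-((1 / ((m : ℝ) + 1)) • e) + x) = 0 := hx2.2
    have h4 : -((1 / ((n : ℝ) + 1)) • e) + x - (-((1 / ((m : ℝ) + 1)) • e) + x)
        = (1 / ((m : ℝ) + 1) - 1 / ((n : ℝ) + 1)) • e := by module
    rw [h2, h3, h4, map_smul, norm_smul, Real.coe_toNNReal _ hcpos.le, sub_self, zero_sub,
      norm_neg, norm_smul, Real.norm_eq_abs (fderiv ℝ ψ p e)] at h1
    have h5 : (0 : ℝ) < ‖1 / ((m : ℝ) + 1) - 1 / ((n : ℝ) + 1)‖ := by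
      rw [norm_pos_iff, sub_ne_zero]
      intro h
      rw [one_div, one_div, inv_inj] at h
      exact hnm (by exact_mod_cast (add_right_cancel h).symm)
    have h6 : 0 < |fderiv ℝ ψ p e| := abs_pos.mpr he
    have h7 : |fderiv ℝ ψ p e| / (2 * ‖e‖) * (‖1 / ((m : ℝ) + 1) - 1 / ((n : ℝ) + 1)‖ * ‖e‖)
        = ‖1 / ((m : ℝ) + 1) - 1 / ((n : ℝ) + 1)‖ * |fderiv ℝ ψ p e| / 2 := by
      field_simp
    rw [h7] at h1
    nlinarith [mul_pos h5 h6]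

/-- A submersion does not shrink volumes of small sets by more than a constant factor. -/
lemma exists_volume_preimage_ge {F : Type*} [NormedAddCommGroup F] [NormedSpace ℝ F]
    [FiniteDimensional ℝ F] [MeasurableSpace F] [BorelSpace F] (ν : Measure F)
    [ν.IsAddHaarMeasure] {Φ : V → F} {Φ' : V →L[ℝ] F} {p : V} (hΦ : HasStrictFDerivAt Φ Φ' p)
    (hsurj : Function.Surjective Φ') {O : Set V} (hO : O ∈ 𝓝 p) :
    ∃ c : ENNReal, c ≠ 0 ∧ ∃ r : ℝ, 0 < r ∧ ∀ S : Set F, MeasurableSet S →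
      S ⊆ Metric.ball (Φ p) r → c * ν S ≤ μ (O ∩ Φ ⁻¹' S) := by
  obtain ⟨A₀, hA₀⟩ := LinearMap.exists_rightInverse_of_surjective (Φ' : V →ₗ[ℝ] F)
    (LinearMap.range_eq_top.mpr hsurj)
  set A : F →L[ℝ] V := LinearMap.toContinuousLinearMap A₀ with hA
  have hΦA : Function.RightInverse A Φ' := fun y => by
    exact LinearMap.congr_fun hA₀ y
  -- `Θ` straightens `Φ`: it is built so that `Φ' (Θ x - p) = Φ x - Φ p` exactly, while its
  -- derivative at `p` is the identity, so that it nearly preserves volume.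
  set Θ : V → V := fun x => x + A (Φ x - Φ p - Φ' (x - p)) with hΘ
  have hΘ' : HasStrictFDerivAt Θ (ContinuousLinearMap.id ℝ V) p := by
    have h1 := (hasStrictFDerivAt_id p).add (A.hasStrictFDerivAt.comp p
      ((hΦ.sub_const (Φ p)).sub (Φ'.hasStrictFDerivAt.comp p ((hasStrictFDerivAt_id p).sub_const p))))
    have h2 : ContinuousLinearMap.id ℝ V = ContinuousLinearMap.id ℝ V +
        A ∘SL (Φ' - Φ' ∘SL ContinuousLinearMap.id ℝ V) := by ext v; simp
    rw [h2]
    exact h1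
  have hΘp : Θ p = p := by simp [hΘ]
  have hkey : ∀ x, Φ' (Θ x - p) = Φ x - Φ p := by
    intro x
    have : Θ x - p = (x - p) + A (Φ x - Φ p - Φ' (x - p)) := by simp only [hΘ]; abel
    rw [this, map_add, hΦA]; abel
  -- Any factor above `|det id| = 1` would do in place of 2.
  obtain ⟨δ, hδ, hδ0⟩ := ((addHaar_image_le_mul_of_det_lt μ (ContinuousLinearMap.id ℝ V)
    (m := 2) (by simp [ContinuousLinearMap.det])).and self_mem_nhdsWithin).exists
  obtain ⟨s, hs, happ⟩ := hΘ'.approximates_deriv_on_nhds (c := δ) (Or.inr hδ0)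
  have himg : Θ '' (s ∩ O) ∈ 𝓝 p := by
    have := hΘ'.map_nhds_eq_of_surj (LinearMap.range_eq_top.mpr fun v => ⟨v, rfl⟩)
    rw [hΘp] at this
    rw [← this]
    exact image_mem_map (inter_mem hs hO)
  -- Under the splitting of `V` into `F` and the kernel, `μ` becomes a multiple of a product
  -- measure, so the set over `S` has volume proportional to `ν S`.
  let e := ContinuousLinearEquiv.equivOfRightInverse Φ' A hΦA
  have hmap : (μ.map e).IsAddHaarMeasure := e.isAddHaarMeasure_map μ
  obtain ⟨c, hc0, hc⟩ : ∃ c : ENNReal, c ≠ 0 ∧ μ.map e = c •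
      (ν.prod (Measure.addHaar : Measure (LinearMap.ker (Φ' : V →ₗ[ℝ] F)))) := by
    refine ⟨(Measure.addHaarScalarFactor (μ.map e)
      (ν.prod (Measure.addHaar : Measure (LinearMap.ker (Φ' : V →ₗ[ℝ] F)))) : NNReal), ?_,
      Measure.isAddLeftInvariant_eq_smul _ _⟩
    exact_mod_cast (Measure.addHaarScalarFactor_pos_of_isAddHaarMeasure _ _).ne'
  have hsymm : (fun z => e.symm z + p) ⁻¹' (Θ '' (s ∩ O)) ∈ 𝓝
      ((0 : F), (0 : LinearMap.ker (Φ' : V →ₗ[ℝ] F))) := by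
    have hcont : ContinuousAt (fun z => e.symm z + p) (0, 0) := by fun_prop
    refine hcont.preimage_mem_nhds ?_
    have h0 : e.symm ((0 : F), (0 : LinearMap.ker (Φ' : V →ₗ[ℝ] F))) = 0 := map_zero e.symm
    simpa only [h0, zero_add] using himg
  obtain ⟨r, hr, hball⟩ := Metric.nhds_basis_ball.mem_iff.mp hsymm
  set B : Set (LinearMap.ker (Φ' : V →ₗ[ℝ] F)) := Metric.ball 0 r with hB
  refine ⟨2⁻¹ * c * Measure.addHaar B, ?_, r, hr, fun S hS hSr => ?_⟩
  · refine mul_ne_zero (mul_ne_zero (by simp) hc0) ?_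
    exact (Metric.measure_ball_pos _ _ hr).ne'
  set S' : Set F := (fun y => y + Φ p) ⁻¹' S with hS'
  have hS'm : MeasurableSet S' := (measurable_add_const (Φ p)) hS
  have hνS' : ν S' = ν S := measure_preimage_add_right ν (Φ p) S
  have h1 : μ (e ⁻¹' (S' ×ˢ B)) = c * (ν S * Measure.addHaar B) := by
    rw [← Measure.map_apply e.continuous.measurable (hS'm.prod measurableSet_ball), hc,
      Measure.smul_apply, Measure.prod_prod, hνS', smul_eq_mul]
  have h2 : μ ((fun q => q + -p) ⁻¹' (e ⁻¹' (S' ×ˢ B))) = μ (e ⁻¹' (S' ×ˢ B)) :=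
    measure_preimage_add_right μ (-p) _
  -- The straightened box lies in the range of `Θ`, and by `hkey` its preimages under `Θ` are points
  -- where `Φ` takes values in `S`.
  have h3 : (fun q => q + -p) ⁻¹' (e ⁻¹' (S' ×ˢ B)) ⊆ Θ '' (s ∩ (O ∩ Φ ⁻¹' S)) := by
    intro q hq
    have hq1 : (e (q + -p)).1 ∈ S' := hq.1
    have hq2 : (e (q + -p)).2 ∈ B := hq.2
    have hfst : (e (q + -p)).1 = Φ' (q - p) := by
      rw [sub_eq_add_neg]; rfl
    have hmem : e (q + -p) ∈ Metric.ball ((0 : F), (0 : LinearMap.ker (Φ' : V →ₗ[ℝ] F))) r := by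
      rw [← ball_prod_same]
      refine ⟨?_, hq2⟩
      have := hSr hq1
      rw [Metric.mem_ball, dist_eq_norm] at this ⊢
      simpa using this
    have h4 := hball hmem
    simp only [mem_preimage, ContinuousLinearEquiv.symm_apply_apply, neg_add_cancel_right] at h4
    obtain ⟨x, hx, rfl⟩ := h4
    refine ⟨x, ⟨hx.1, hx.2, ?_⟩, rfl⟩
    rw [hfst, hkey] at hq1
    simpa [hS'] using hq1
  have h5 : μ (Θ '' (s ∩ (O ∩ Φ ⁻¹' S))) ≤ 2 * μ (s ∩ (O ∩ Φ ⁻¹' S)) :=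
    hδ _ _ (happ.mono_set inter_subset_left)
  calc 2⁻¹ * c * Measure.addHaar B * ν S = 2⁻¹ * (c * (ν S * Measure.addHaar B)) := by ring
    _ = 2⁻¹ * μ ((fun q => q + -p) ⁻¹' (e ⁻¹' (S' ×ˢ B))) := by rw [h2, h1]
    _ ≤ 2⁻¹ * (2 * μ (s ∩ (O ∩ Φ ⁻¹' S))) := by gcongr; exact (measure_mono h3).trans h5
    _ = μ (s ∩ (O ∩ Φ ⁻¹' S)) := by
      rw [← mul_assoc, ENNReal.inv_mul_cancel (by simp) (by simp), one_mul]
    _ ≤ μ (O ∩ Φ ⁻¹' S) := measure_mono inter_subset_right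

omit [FiniteDimensional ℝ V] [μ.IsAddHaarMeasure] [NormedSpace ℝ V] in
-- The integrand jumps across `{ψ = 0}`, but `O ∩ {ψ < 0}` is open, so it is a sum of two continuous
-- pieces cut by measurable sets.
lemma integrable_mul_ite [IsFiniteMeasureOnCompacts μ] {G ψ q₁ q₂ : V → ℝ} {O : Set V}
    (hO : IsOpen O)
    (hG : Continuous G) (hGc : HasCompactSupport G) (hGO : tsupport G ⊆ O)
    (hψ : ∀ q ∈ O, ContinuousAt ψ q) (hq₁ : ∀ q ∈ O, ContinuousAt q₁ q)
    (hq₂ : ∀ q ∈ O, ContinuousAt q₂ q) :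
    Integrable (fun q => G q * (if ψ q < 0 then q₁ q else q₂ q)) μ := by
  have hA : IsOpen (O ∩ ψ ⁻¹' Iio 0) :=
    ContinuousOn.isOpen_inter_preimage (fun q hq => (hψ q hq).continuousWithinAt) hO isOpen_Iio
  have h1 : Integrable (fun q => G q * q₁ q) μ :=
    (continuous_smul_of_tsupport (f := G) hG hGO hq₁).integrable_of_hasCompactSupport hGc.mul_right
  have h2 : Integrable (fun q => G q * q₂ q) μ :=
    (continuous_smul_of_tsupport (f := G) hG hGO hq₂).integrable_of_hasCompactSupport hGc.mul_right
  refine ((h1.indicator hA.measurableSet).add (h2.indicator hA.measurableSet.compl)).congr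
    (ae_of_all _ fun q => ?_)
  by_cases hq : q ∈ O
  · by_cases h : ψ q < 0
    · simp [indicator, hq, h]
    · simp [indicator, hq, h]
  · have hG0 : G q = 0 := image_eq_zero_of_notMem_tsupport fun h => hq (hGO h)
    simp [indicator, hG0]

omit [FiniteDimensional ℝ V] [NormedSpace ℝ V] in
lemma aestronglyMeasurable_comp_mul (m : Measure V) {O : Set V} (hO : IsOpen O) {h : ℝ → ℝ}
    (hh : Continuous h) {ψ G : V → ℝ} (hψ : ∀ q ∈ O, ContinuousAt ψ q)
    (hG : AEStronglyMeasurable G m) (hG0 : ∀ q ∉ O, G q = 0) :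
    AEStronglyMeasurable (fun q => h (ψ q) * G q) m := by
  have h1 : (fun q => h (ψ q) * G q) = O.indicator fun q => h (ψ q) * G q := by
    funext q
    by_cases hq : q ∈ O
    · rw [indicator_of_mem hq]
    · rw [indicator_of_notMem hq, hG0 q hq, mul_zero]
  rw [h1, aestronglyMeasurable_indicator_iff hO.measurableSet]
  refine AEStronglyMeasurable.mul (ContinuousOn.aestronglyMeasurable ?_ hO.measurableSet) hG.restrict
  exact fun q hq => (hh.continuousAt.comp (hψ q hq)).continuousWithinAt

omit [FiniteDimensional ℝ V] [NormedSpace ℝ V] in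
-- Dominated convergence with majorant `‖G‖`. Since `G` vanishes off `O`, nothing need be known of
-- `ψ` outside `O`.
lemma tendsto_integral_profile (m : Measure V) {O : Set V} (hO : IsOpen O) {h : ℝ → ℝ}
    (hh : Continuous h) (hb : ∀ s, |h s| ≤ 1) {ψ G L : V → ℝ} (hψ : ∀ q ∈ O, ContinuousAt ψ q)
    (hG : Integrable G m) (hG0 : ∀ q ∉ O, G q = 0)
    (hL : ∀ᵐ q ∂m, q ∈ O → Tendsto (fun ε : ℝ => h (ψ q / ε)) (𝓝[>] 0) (𝓝 (L q))) :
    Tendsto (fun ε : ℝ => ∫ q, h (ψ q / ε) * G q ∂m) (𝓝[>] 0) (𝓝 (∫ q, L q * G q ∂m)) := by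
  refine tendsto_integral_filter_of_dominated_convergence (fun q => ‖G q‖) ?_ ?_ hG.norm ?_
  · refine Eventually.of_forall fun ε => ?_
    exact aestronglyMeasurable_comp_mul m hO (h := fun s => h (s / ε))
      (hh.comp (continuous_id.div_const ε)) hψ hG.aestronglyMeasurable hG0
  · refine Eventually.of_forall fun ε => ae_of_all _ fun q => ?_
    rw [norm_mul]
    exact mul_le_of_le_one_left (norm_nonneg _) (hb _)
  · filter_upwards [hL] with q hq
    by_cases hqO : q ∈ O
    · exact (hq hqO).mul_const _
    · simp [hG0 q hqO]

omit [FiniteDimensional ℝ V] [NormedSpace ℝ V] in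
lemma tendsto_integral_hump (m : Measure V) {O : Set V} (hO : IsOpen O) {ψ G : V → ℝ}
    (hψ : ∀ q ∈ O, ContinuousAt ψ q) (hG : Integrable G m) (hG0 : ∀ q ∉ O, G q = 0)
    (hnull : m (O ∩ {q | ψ q = 0}) = 0) :
    Tendsto (fun ε : ℝ => ∫ q, hump (ψ q / ε) * G q ∂m) (𝓝[>] 0) (𝓝 0) := by
  have h1 : ∀ᵐ q ∂m, q ∈ O → Tendsto (fun ε : ℝ => hump (ψ q / ε)) (𝓝[>] 0) (𝓝 0) := by
    filter_upwards [measure_eq_zero_iff_ae_notMem.mp hnull] with q hq hqO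
    exact tendsto_hump_div fun h => hq ⟨hqO, h⟩
  simpa using tendsto_integral_profile m hO contDiff_hump.continuous
    (fun s => by rw [abs_of_nonneg (hump_nonneg s)]; exact hump_le_one s) hψ hG hG0 h1

/-- If a density with one-sided traces `q₁`, `q₂` on a smooth level set annihilates the
concentrated profiles `ε⁻¹ hump'(ψ/ε)` in the limit, the traces are ordered (hence agree). -/
lemma trace_le_of_tendsto_concentrated {ψ q₁ q₂ : V → ℝ} {p : V} {O : Set V} (hO : IsOpen O)
    (hp : p ∈ O) (hψ : ∀ q ∈ O, ContDiffAt ℝ ∞ ψ q) (h0 : ψ p = 0) (hd : fderiv ℝ ψ p ≠ 0)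
    (hq₁ : ∀ q ∈ O, ContinuousAt q₁ q) (hq₂ : ∀ q ∈ O, ContinuousAt q₂ q)
    (H : ∀ f : V → ℝ, ContDiff ℝ ∞ f → HasCompactSupport f → tsupport f ⊆ O → (∀ q, 0 ≤ f q) →
      Tendsto (fun ε : ℝ => ∫ q, ε⁻¹ * deriv hump (ψ q / ε) * f q *
        (if ψ q < 0 then q₁ q else q₂ q) ∂μ) (𝓝[>] 0) (𝓝 0)) : q₁ p ≤ q₂ p := by
  by_contra! hlt
  obtain ⟨N, hN, hNnull⟩ := exists_nhds_level_null μ ((hψ p hp).of_le (by simp)) hd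
  obtain ⟨e, he⟩ : ∃ e, 0 < fderiv ℝ ψ p e := by
    obtain ⟨e, he⟩ : ∃ e, fderiv ℝ ψ p e ≠ 0 := by
      by_contra! h
      exact hd (ContinuousLinearMap.ext h)
    rcases lt_or_gt_of_ne he with h | h
    · exact ⟨-e, by simpa using h⟩
    · exact ⟨e, h⟩
  set a := fderiv ℝ ψ p e with ha
  -- With `c` the midpoint of the two values, each trace differs from `c` by `2 δ` at `p`, hence by
  -- more than `δ` near `p`.
  set δ := (q₁ p - q₂ p) / 4 with hδ
  have hδ0 : 0 < δ := by rw [hδ]; linarith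
  set c := (q₁ p + q₂ p) / 2 with hc
  have hdψ : ∀ q ∈ O, ContDiffAt ℝ ∞ (fun x => fderiv ℝ ψ x e) q := fun q hq =>
    ((hψ q hq).fderiv_right (by simp)).clm_apply contDiffAt_const
  have hev : ∀ᶠ q in 𝓝 p, q ∈ O ∧ q ∈ N ∧ a / 2 < fderiv ℝ ψ q e ∧ c + δ < q₁ q ∧
      q₂ q < c - δ := by
    refine (hO.eventually_mem hp).and ((eventually_mem_set.mpr hN).and (Eventually.and ?_
      (Eventually.and ?_ ?_)))
    · exact (hdψ p hp).continuousAt.eventually (lt_mem_nhds (by linarith))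
    · exact (hq₁ p hp).eventually (lt_mem_nhds (by rw [hc, hδ]; linarith))
    · exact (hq₂ p hp).eventually (gt_mem_nhds (by rw [hc, hδ]; linarith))
  obtain ⟨O', hO's, hO'o, hpO'⟩ := eventually_nhds_iff.mp hev
  obtain ⟨h, hh, hhc, hhO, hh0, -, hh1⟩ := exists_smooth_bump (hO'o.mem_nhds hpO')
  have hO'O : O' ⊆ O := fun q hq => (hO's q hq).1
  -- With this weight `ε⁻¹ hump'(ψ/ε) f` is `h` times the derivative of `hump(ψ/ε)` along `e`. An
  -- integration by parts then shows that its integral tends to zero, so the constant `c` may be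
  -- subtracted from the traces.
  set f : V → ℝ := fun q => h q * fderiv ℝ ψ q e with hf
  have hfs : ContDiff ℝ ∞ f := contDiff_mul_of_tsupport hh (hhO.trans hO'O) hdψ
  have hfc : HasCompactSupport f := hhc.mul_right
  have hfh : tsupport f ⊆ tsupport h := tsupport_mul_subset_left
  have hhz : ∀ q ∉ O', h q = 0 := fun q hq => image_eq_zero_of_notMem_tsupport fun h => hq (hhO h)
  have hf0 : ∀ q, 0 ≤ f q := fun q => by
    by_cases hq : q ∈ O'
    · exact mul_nonneg (hh0 q) (by linarith [(hO's q hq).2.2.1])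
    · simp [hf, hhz q hq]
  have hI := H f hfs hfc (hfh.trans (hhO.trans hO'O)) hf0
  -- the profile integrates to zero in the limit
  have hψε : ∀ ε : ℝ, ∀ q ∈ O, ContDiffAt ℝ ∞ (fun x => hump (ψ x / ε)) q := fun ε q hq =>
    contDiff_hump.contDiffAt.comp q ((hψ q hq).div_const ε)
  have hdh : ContDiff ℝ ∞ (fun q => fderiv ℝ h q e) :=
    (hh.fderiv_right (m := ∞) (by simp)).clm_apply contDiff_const
  have hdhc : HasCompactSupport (fun q => fderiv ℝ h q e) := hhc.fderiv_apply (𝕜 := ℝ) e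
  have hdht : tsupport (fun q => fderiv ℝ h q e) ⊆ O' :=
    (tsupport_fderiv_apply_subset ℝ e).trans hhO
  have hJeq : ∀ ε : ℝ, ∫ q, ε⁻¹ * deriv hump (ψ q / ε) * f q ∂μ
      = -∫ q, hump (ψ q / ε) * fderiv ℝ h q e ∂μ := by
    intro ε
    have hs : ContDiff ℝ ∞ fun q => h q * hump (ψ q / ε) :=
      contDiff_mul_of_tsupport hh (hhO.trans hO'O) (hψε ε)
    have hz := integral_fderiv_eq_zero μ (hs.of_le (by simp)) hhc.mul_right e
    have hpt : ∀ q, fderiv ℝ (fun q => h q * hump (ψ q / ε)) q e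
        = ε⁻¹ * deriv hump (ψ q / ε) * f q + hump (ψ q / ε) * fderiv ℝ h q e := by
      intro q
      by_cases hq : q ∈ O'
      · have h1 : HasFDerivAt (fun x => hump (ψ x / ε))
            (deriv hump (ψ q / ε) • (ε⁻¹ • fderiv ℝ ψ q)) q := by
          have h2 : HasFDerivAt (fun x => ψ x / ε) (ε⁻¹ • fderiv ℝ ψ q) q := by
            have := ((hψ q (hO'O hq)).differentiableAt (by simp)).hasFDerivAt.const_smul ε⁻¹
            refine this.congr_of_eventuallyEq (Eventually.of_forall fun x => ?_)
            simp [div_eq_inv_mul]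
          exact (differentiable_hump _).hasDerivAt.comp_hasFDerivAt q h2
        have h3 := ((hh.differentiable (by simp) q).hasFDerivAt.mul h1).fderiv
        have h4 : (fun q => h q * hump (ψ q / ε)) = h * fun x => hump (ψ x / ε) := rfl
        rw [h4, h3]
        simp [hf]; ring
      · have hq' : q ∉ tsupport h := fun h => hq (hhO h)
        have h2 : h =ᶠ[𝓝 q] 0 := notMem_tsupport_iff_eventuallyEq.mp hq'
        have h3 : (fun q => h q * hump (ψ q / ε)) =ᶠ[𝓝 q] fun _ => 0 := by
          filter_upwards [h2] with x hx; simp [hx]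
        rw [h3.fderiv_eq, h2.fderiv_eq]
        simp [hf, hhz q hq]
    simp_rw [hpt] at hz
    rw [integral_add] at hz
    · linarith
    · refine Continuous.integrable_of_hasCompactSupport ?_ hfc.mul_left
      have : (fun q => ε⁻¹ * deriv hump (ψ q / ε) * f q)
          = fun q => f q • (ε⁻¹ * deriv hump (ψ q / ε)) := by funext q; simp [mul_comm]
      rw [this]
      refine continuous_smul_of_tsupport (O := O) hfs.continuous (hfh.trans (hhO.trans hO'O))
        fun q hq => ?_
      exact continuousAt_const.mul (continuous_deriv_hump.continuousAt.comp
        ((hψ q hq).continuousAt.div_const ε))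
    · refine Continuous.integrable_of_hasCompactSupport ?_ hdhc.mul_left
      have : (fun q => hump (ψ q / ε) * fderiv ℝ h q e)
          = fun q => fderiv ℝ h q e • hump (ψ q / ε) := by funext q; simp [mul_comm]
      rw [this]
      exact continuous_smul_of_tsupport (O := O) hdh.continuous (hdht.trans hO'O)
        fun q hq => (hψε ε q hq).continuousAt
  have hJ : Tendsto (fun ε : ℝ => ∫ q, ε⁻¹ * deriv hump (ψ q / ε) * f q ∂μ) (𝓝[>] 0) (𝓝 0) := by
    simp_rw [hJeq]
    have := (tendsto_integral_hump μ hO'o (ψ := ψ) (G := fun q => fderiv ℝ h q e)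
      (fun q hq => (hψ q (hO'O hq)).continuousAt)
      (hdh.continuous.integrable_of_hasCompactSupport hdhc)
      (fun q hq => image_eq_zero_of_notMem_tsupport (f := fun q => fderiv ℝ h q e)
        fun h => hq (hdht h))
      (measure_mono_null (inter_subset_inter_left _ fun q hq => (hO's q hq).2.1) hNnull)).neg
    simpa using this
  -- After this subtraction the integrand is nonnegative on both sides: `hump'` changes sign at
  -- zero, and so does the trace minus `c`.
  have hIJ := hI.sub (hJ.const_mul c)
  rw [mul_zero, sub_zero] at hIJ
  -- volume lower bound
  have hcontf : ∀ ε : ℝ, Continuous fun q => ε⁻¹ * deriv hump (ψ q / ε) * f q := fun ε => by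
    have : (fun q => ε⁻¹ * deriv hump (ψ q / ε) * f q)
        = fun q => f q • (ε⁻¹ * deriv hump (ψ q / ε)) := by funext q; simp [mul_comm]
    rw [this]
    refine continuous_smul_of_tsupport (O := O) hfs.continuous (hfh.trans (hhO.trans hO'O))
      fun q hq => ?_
    exact continuousAt_const.mul (continuous_deriv_hump.continuousAt.comp
      ((hψ q hq).continuousAt.div_const ε))
  obtain ⟨s₁, s₂, c₀, hs1, hs12, hs2, hc₀, hstep⟩ := exists_deriv_step_ge
  obtain ⟨κ, hκ0, r, hr, hvol⟩ := exists_volume_preimage_ge μ (volume : Measure ℝ)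
    ((hψ p hp).hasStrictFDerivAt (by simp)) (fun y => ⟨(y / a) • e, by
      rw [map_smul, smul_eq_mul, ← ha]; field_simp⟩)
    (O := O' ∩ {q | h q = 1}) (inter_mem (hO'o.mem_nhds hpO') hh1)
  -- The constant of the volume bound lives in `ENNReal` and might be infinite; any finite positive
  -- minorant suffices.
  obtain ⟨κ', hκ'0, hκ'⟩ : ∃ κ' : ℝ, 0 < κ' ∧ ENNReal.ofReal κ' ≤ κ := by
    by_cases htop : κ = ⊤
    · exact ⟨1, one_pos, by simp [htop]⟩
    · exact ⟨κ.toReal, ENNReal.toReal_pos hκ0 htop, ENNReal.ofReal_toReal_le⟩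
  -- The layer `ε s₁ ≤ ψ ≤ ε s₂` has volume at least `κ' ε (s₂ - s₁)`, and there the integrand is at
  -- least `ε⁻¹ c₀ (a/2) δ`; the powers of `ε` cancel.
  set m₀ := c₀ * (a / 2) * δ * κ' * (s₂ - s₁) with hm₀
  have hm₀pos : 0 < m₀ := by
    have : 0 < s₂ - s₁ := by linarith
    positivity
  have hsmall : ∀ᶠ ε : ℝ in 𝓝[>] 0, ε < r := nhdsWithin_le_nhds (gt_mem_nhds hr)
  have hge : ∀ᶠ ε : ℝ in 𝓝[>] 0, m₀ ≤ (∫ q, ε⁻¹ * deriv hump (ψ q / ε) * f q *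
        (if ψ q < 0 then q₁ q else q₂ q) ∂μ) - c * ∫ q, ε⁻¹ * deriv hump (ψ q / ε) * f q ∂μ := by
    filter_upwards [hsmall, self_mem_nhdsWithin] with ε hεr hε
    have hε0 : (0 : ℝ) < ε := hε
    have hint1 := integrable_mul_ite μ (G := fun q => ε⁻¹ * deriv hump (ψ q / ε) * f q) hO
      (hcontf ε) hfc.mul_left ((tsupport_mul_subset_right).trans (hfh.trans (hhO.trans hO'O)))
      (fun q hq => (hψ q hq).continuousAt) hq₁ hq₂
    have hint2 : Integrable (fun q => ε⁻¹ * deriv hump (ψ q / ε) * f q) μ :=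
      (hcontf ε).integrable_of_hasCompactSupport hfc.mul_left
    rw [← integral_const_mul, ← integral_sub hint1 (hint2.const_mul c)]
    set S : Set ℝ := Icc (ε * s₁) (ε * s₂) with hS
    set Aε : Set V := O' ∩ {q | h q = 1} ∩ ψ ⁻¹' S with hAε
    have hSr : S ⊆ Metric.ball (ψ p) r := by
      intro y hy
      rw [h0, mem_ball_zero_iff, Real.norm_eq_abs, abs_lt]
      constructor <;> nlinarith [hy.1, hy.2]
    have hv : ENNReal.ofReal (κ' * (ε * (s₂ - s₁))) ≤ μ Aε := by
      refine le_trans ?_ (hvol S measurableSet_Icc hSr)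
      rw [hS, Real.volume_Icc, ENNReal.ofReal_mul hκ'0.le]
      have : ε * s₂ - ε * s₁ = ε * (s₂ - s₁) := by ring
      rw [this]
      gcongr
    have hptge : ∀ q, Aε.indicator (fun _ => ε⁻¹ * c₀ * (a / 2) * δ) q ≤
        ε⁻¹ * deriv hump (ψ q / ε) * f q * (if ψ q < 0 then q₁ q else q₂ q)
          - c * (ε⁻¹ * deriv hump (ψ q / ε) * f q) := by
      intro q
      have hrew : ε⁻¹ * deriv hump (ψ q / ε) * f q * (if ψ q < 0 then q₁ q else q₂ q)
          - c * (ε⁻¹ * deriv hump (ψ q / ε) * f q) =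
          ε⁻¹ * f q * (deriv hump (ψ q / ε) * ((if ψ q < 0 then q₁ q else q₂ q) - c)) := by ring
      rw [hrew]
      by_cases hq : q ∈ O'
      · obtain ⟨-, -, hqa, hq1, hq2⟩ := hO's q hq
        by_cases hneg : ψ q < 0
        · have hneg' : ψ q / ε < 0 := div_neg_of_neg_of_pos hneg hε0
          rw [if_pos hneg, deriv_hump_of_neg hneg']
          by_cases hA : q ∈ Aε
          · rw [indicator_of_mem hA]
            have hst : c₀ ≤ deriv step (ψ q / ε) := by
              refine hstep _ ⟨?_, ?_⟩
              · rw [le_div_iff₀ hε0]; linarith [hA.2.1]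
              · rw [div_le_iff₀ hε0]; linarith [hA.2.2]
            have hfq : a / 2 ≤ f q := by
              have : h q = 1 := hA.1.2
              simp only [hf, this, one_mul]; linarith
            have e1 : ε⁻¹ * c₀ * (a / 2) * δ = ε⁻¹ * (a / 2) * (c₀ * δ) := by ring
            rw [e1]
            have e2 : 0 ≤ ε⁻¹ * f q := mul_nonneg (by positivity) (hf0 q)
            refine mul_le_mul (by gcongr) (mul_le_mul hst (by linarith) hδ0.le
              (deriv_step_nonneg _)) (by positivity) e2
          · rw [indicator_of_notMem hA]
            exact mul_nonneg (mul_nonneg (by positivity) (hf0 q))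
              (mul_nonneg (deriv_step_nonneg _) (by linarith))
        · have hA : q ∉ Aε := fun hA => by
            have h1 : ψ q ≤ ε * s₂ := hA.2.2
            have h2 : ε * s₂ < 0 := mul_neg_of_pos_of_neg hε0 (by linarith)
            exact hneg (by linarith)
          rw [indicator_of_notMem hA, if_neg hneg]
          refine mul_nonneg (mul_nonneg (by positivity) (hf0 q)) ?_
          exact mul_nonneg_of_nonpos_of_nonpos
            (deriv_hump_nonpos (div_nonneg (not_lt.mp hneg) hε0.le)) (by linarith)
      · have hA : q ∉ Aε := fun hA => hq hA.1.1
        rw [indicator_of_notMem hA]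
        simp [hf, hhz q hq]
    have hAm : MeasurableSet Aε := by
      have h1 : Aε = ({q | h q = 1} ∩ (O' ∩ ψ ⁻¹' S)) := by rw [hAε]; ext; simp; tauto
      rw [h1]
      refine (hh.continuous.measurable (measurableSet_singleton 1)).inter ?_
      have hres : Measurable (O'.domRestrict ψ) :=
        (continuousOn_iff_continuous_domRestrict.mp fun q hq =>
          (hψ q (hO'O hq)).continuousAt.continuousWithinAt).measurable
      have h2 := hO'o.measurableSet.subtype_image (hres (measurableSet_Icc (a := ε * s₁) (b := ε * s₂)))
      convert h2 using 1
      ext q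
      simp [hS, Set.domRestrict]
      tauto
    have hAfin : μ Aε < ⊤ := by
      refine lt_of_le_of_lt (measure_mono ?_) hhc.isCompact.measure_lt_top
      intro q hq
      refine subset_tsupport h ?_
      rw [Function.mem_support, show h q = 1 from hq.1.2]
      exact one_ne_zero
    calc m₀ = (κ' * (ε * (s₂ - s₁))) * (ε⁻¹ * c₀ * (a / 2) * δ) := by
          rw [hm₀]; field_simp
      _ ≤ (μ Aε).toReal * (ε⁻¹ * c₀ * (a / 2) * δ) := by
          gcongr
          exact (ENNReal.ofReal_le_iff_le_toReal hAfin.ne).mp hv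
      _ = ∫ q, Aε.indicator (fun _ => ε⁻¹ * c₀ * (a / 2) * δ) q ∂μ := by
          rw [integral_indicator hAm, setIntegral_const]; rfl
      _ ≤ _ := by
          refine integral_mono ((integrable_indicator_iff hAm).mpr ?_)
            (hint1.sub (hint2.const_mul c)) hptge
          exact integrableOn_const hAfin.ne
  have := ge_of_tendsto hIJ hge
  linarith

lemma trace_eq_of_tendsto_concentrated {ψ q₁ q₂ : V → ℝ} {p : V} {O : Set V} (hO : IsOpen O)
    (hp : p ∈ O) (hψ : ∀ q ∈ O, ContDiffAt ℝ ∞ ψ q) (h0 : ψ p = 0) (hd : fderiv ℝ ψ p ≠ 0)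
    (hq₁ : ∀ q ∈ O, ContinuousAt q₁ q) (hq₂ : ∀ q ∈ O, ContinuousAt q₂ q)
    (H : ∀ f : V → ℝ, ContDiff ℝ ∞ f → HasCompactSupport f → tsupport f ⊆ O → (∀ q, 0 ≤ f q) →
      Tendsto (fun ε : ℝ => ∫ q, ε⁻¹ * deriv hump (ψ q / ε) * f q *
        (if ψ q < 0 then q₁ q else q₂ q) ∂μ) (𝓝[>] 0) (𝓝 0)) : q₁ p = q₂ p := by
  refine le_antisymm (trace_le_of_tendsto_concentrated μ hO hp hψ h0 hd hq₁ hq₂ H) ?_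
  have := trace_le_of_tendsto_concentrated μ (q₁ := fun q => -q₁ q) (q₂ := fun q => -q₂ q)
    hO hp hψ h0 hd (fun q hq => (hq₁ q hq).neg) (fun q hq => (hq₂ q hq).neg) fun f h1 h2 h3 h4 => by
      have h5 := (H f h1 h2 h3 h4).neg
      simp_rw [← integral_neg] at h5
      rw [neg_zero] at h5
      refine h5.congr fun ε => integral_congr_ae (ae_of_all _ fun q => ?_)
      by_cases h : ψ q < 0 <;> simp [h]
  simpa using this

end LevelSets

/-! ### Testing with nonnegative smooth functions -/

section Testing

variable {V : Type*} [NormedAddCommGroup V] [NormedSpace ℝ V] [FiniteDimensional ℝ V]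
  [MeasurableSpace V] [BorelSpace V] {m : Measure V}

/-- The indicator of a compact set is the pointwise limit of nonnegative smooth functions, equal to
1 on it and supported in shrinking thickenings of it. -/
lemma setIntegral_nonneg_of_forall_smooth {W : Set V} (hW : IsOpen W) {h : V → ℝ}
    (hint : LocallyIntegrableOn h W m)
    (H : ∀ g : V → ℝ, ContDiff ℝ ∞ g → HasCompactSupport g → tsupport g ⊆ W → (∀ x, 0 ≤ g x) →
      0 ≤ ∫ x, g x * h x ∂m) {s : Set V} (hs : IsCompact s) (hsW : s ⊆ W) :
    0 ≤ ∫ x in s, h x ∂m := by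
  obtain ⟨δ, δpos, hδ⟩ := hs.exists_cthickening_subset_open hW hsW
  have hδc : IsCompact (Metric.cthickening δ s) := hs.cthickening
  obtain ⟨u, -, u_pos, u_lim⟩ : ∃ u, StrictAnti u ∧ (∀ (n : ℕ), u n ∈ Ioo 0 δ)
    ∧ Tendsto u atTop (𝓝 0) := exists_seq_strictAnti_tendsto' δpos
  let v : ℕ → Set V := fun n ↦ Metric.thickening (u n) s
  have vK : ∀ n, v n ⊆ Metric.cthickening δ s := fun n ↦
    Metric.thickening_subset_cthickening_of_le (u_pos n).2.le _
  have : ∀ n, ∃ (g : V → ℝ), Function.support g = v n ∧ ContDiff ℝ ∞ g ∧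
      Set.range g ⊆ Set.Icc 0 1 ∧ ∀ x ∈ s, g x = 1 := by
    intro n
    rcases exists_contMDiff_support_eq_eq_one_iff (modelWithCornersSelf ℝ V)
      (Metric.isOpen_thickening (δ := u n) (E := s)) hs.isClosed
      (Metric.self_subset_thickening (u_pos n).1 s) with ⟨g, g_smooth, g_range, g_supp, hg⟩
    exact ⟨g, g_supp, g_smooth.contDiff, g_range, fun x hx ↦ (hg x).1 hx⟩
  choose g g_supp g_diff g_range hg using this
  have g_tsupp : ∀ n, tsupport (g n) ⊆ Metric.cthickening δ s := fun n =>
    closure_minimal (by rw [g_supp]; exact vK n) Metric.isClosed_cthickening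
  have hK : IntegrableOn h (Metric.cthickening δ s) m :=
    hint.integrableOn_compact_subset hδ hδc
  have L : Tendsto (fun n ↦ ∫ x, g n x * h x ∂m) atTop (𝓝 (∫ x in s, h x ∂m)) := by
    have hgK : ∀ n, ∫ x, g n x * h x ∂m = ∫ x in Metric.cthickening δ s, g n x * h x ∂m := by
      intro n
      rw [setIntegral_eq_integral_of_forall_compl_eq_zero]
      intro x hx
      rw [image_eq_zero_of_notMem_tsupport fun h' => hx (g_tsupp n h'), zero_mul]
    have hsK : ∫ x in s, h x ∂m = ∫ x in Metric.cthickening δ s, s.indicator h x ∂m := by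
      rw [setIntegral_indicator hs.measurableSet,
        inter_eq_self_of_subset_right (Metric.self_subset_cthickening s)]
    simp_rw [hgK, hsK]
    refine tendsto_integral_of_dominated_convergence (fun x => ‖h x‖)
      (fun n => (g_diff n).continuous.aestronglyMeasurable.mul hK.aestronglyMeasurable) hK.norm
      (fun n => ae_of_all _ fun x => ?_) (ae_of_all _ fun x => ?_)
    · rw [norm_mul]
      have := g_range n (mem_range_self (f := g n) x)
      refine mul_le_of_le_one_left (norm_nonneg _) ?_
      rw [Real.norm_of_nonneg this.1]
      exact this.2
    · by_cases hxs : x ∈ s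
      · have : ∀ n, g n x = 1 := fun n ↦ hg n x hxs
        simp [this, indicator_of_mem hxs]
      · rw [indicator_of_notMem hxs]
        apply tendsto_const_nhds.congr'
        obtain ⟨ε, εpos, hε⟩ : ∃ ε, 0 < ε ∧ x ∉ Metric.thickening ε s := by
          rw [← hs.isClosed.closure_eq, Metric.closure_eq_iInter_thickening s] at hxs
          simpa using hxs
        filter_upwards [(tendsto_order.1 u_lim).2 _ εpos] with n hn
        have : g n x = 0 := by
          rw [← Function.notMem_support, g_supp]
          contrapose hε
          exact Metric.thickening_mono hn.le s hε
        rw [this, zero_mul]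
  refine ge_of_tendsto' L fun n => H (g n) (g_diff n) ?_ ((g_tsupp n).trans hδ)
    fun x => (g_range n (mem_range_self x)).1
  exact HasCompactSupport.of_support_subset_isCompact hδc (by rw [g_supp]; exact vK n)

/-- A function with nonnegative integral against all nonnegative smooth test functions supported
in an open set is nonnegative almost everywhere on it. -/
lemma ae_nonneg_of_forall_smooth {W : Set V} (hW : IsOpen W)
    (hfin : ∀ K, IsCompact K → K ⊆ W → m K < ⊤) {h : V → ℝ}
    (hint : LocallyIntegrableOn h W m)
    (H : ∀ g : V → ℝ, ContDiff ℝ ∞ g → HasCompactSupport g → tsupport g ⊆ W → (∀ x, 0 ≤ g x) →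
      0 ≤ ∫ x, g x * h x ∂m) : ∀ᵐ x ∂m, x ∈ W → 0 ≤ h x := by
  have hloc : ∀ K, IsCompact K → K ⊆ W → ∀ᵐ x ∂(m.restrict K), 0 ≤ h x := by
    intro K hK hKW
    have : IsFiniteMeasure (m.restrict K) := ⟨by simpa using hfin K hK hKW⟩
    have hiK : Integrable h (m.restrict K) := hint.integrableOn_compact_subset hKW hK
    refine ae_nonneg_of_forall_setIntegral_nonneg hiK fun s hs _ => ?_
    -- Inner regularity reduces measurable sets to closed ones, which become compact after
    -- intersection with `K`.
    have hlim : ∀ n : ℕ, ∃ F ⊆ s, IsClosed F ∧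
        (m.restrict K) (s \ F) < ENNReal.ofReal (1 / ((n : ℝ) + 1)) := fun n =>
      hs.exists_isClosed_sdiff_lt (measure_ne_top _ _)
        (by simp only [ne_eq, ENNReal.ofReal_eq_zero, not_le]; positivity)
    choose F hFs hFc hFm using hlim
    have htend : Tendsto (fun n => (m.restrict K) (s \ F n)) atTop (𝓝 0) := by
      refine tendsto_of_tendsto_of_tendsto_of_le_of_le tendsto_const_nhds ?_
        (fun n => zero_le) (fun n => (hFm n).le)
      have := ENNReal.tendsto_ofReal (tendsto_one_div_add_atTop_nhds_zero_nat (𝕜 := ℝ))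
      simpa using this
    have h0 := hiK.tendsto_setIntegral_nhds_zero htend
    have h1 : Tendsto (fun n => ∫ x in F n, h x ∂(m.restrict K)) atTop
        (𝓝 (∫ x in s, h x ∂(m.restrict K))) := by
      have h2 : ∀ n, ∫ x in F n, h x ∂(m.restrict K)
          = (∫ x in s, h x ∂(m.restrict K)) - ∫ x in s \ F n, h x ∂(m.restrict K) := fun n => by
        rw [setIntegral_sdiff (hFc n).measurableSet hiK.integrableOn (hFs n)]; ring
      simp_rw [h2]
      simpa using tendsto_const_nhds.sub h0
    refine ge_of_tendsto' h1 fun n => ?_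
    rw [Measure.restrict_restrict (hFc n).measurableSet]
    exact setIntegral_nonneg_of_forall_smooth hW hint H (hK.inter_left (hFc n))
      (inter_subset_right.trans hKW)
  have hnull : m {x | x ∈ W ∧ ¬0 ≤ h x} = 0 := by
    refine measure_null_of_locally_null _ fun x hx => ?_
    obtain ⟨r, hr, hball⟩ := Metric.nhds_basis_closedBall.mem_iff.mp (hW.mem_nhds hx.1)
    refine ⟨Metric.closedBall x r ∩ {x | x ∈ W ∧ ¬0 ≤ h x}, ?_, ?_⟩
    · exact inter_mem (nhdsWithin_le_nhds (Metric.closedBall_mem_nhds x hr)) self_mem_nhdsWithin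
    · have := hloc _ (isCompact_closedBall x r) hball
      rw [ae_restrict_iff' measurableSet_closedBall, ae_iff] at this
      refine measure_mono_null ?_ this
      rintro y ⟨hy1, hy2⟩
      simp only [mem_ofPred_eq, Classical.not_imp]
      exact ⟨hy1, hy2.2⟩
  rw [ae_iff]
  simpa only [Classical.not_imp] using hnull

end Testing

/-! ### The Gauss-Green formula on sublevel sets -/

section GaussGreen

variable {V : Type*} [NormedAddCommGroup V] [NormedSpace ℝ V] [FiniteDimensional ℝ V]
  [MeasurableSpace V] [BorelSpace V] (μ : Measure V) [μ.IsAddHaarMeasure]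

/-- `1 - step (ψ / δ)` approximates the indicator of `{ψ < 0}` smoothly. The divergence of the
cut-off field integrates to zero, and the term in which the cut-off is differentiated stands for the
surface integral. No regularity of the level set is needed. -/
lemma tendsto_integral_concentrated_step {ψ : V → ℝ} {F : V → Space d} {W : Set V}
    (hW : IsOpen W) (hψ : ∀ x ∈ W, ContDiffAt ℝ ∞ ψ x) (hF : ContDiff ℝ 1 F)
    (hFc : HasCompactSupport F) (hFW : tsupport F ⊆ W) (e : Fin d → V) :
    Tendsto (fun δ : ℝ => ∫ x, δ⁻¹ * deriv step (ψ x / δ) * ∑ i, F x i * fderiv ℝ ψ x (e i) ∂μ)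
      (𝓝[>] 0) (𝓝 (∫ x, (if ψ x < 0 then 1 else 0) * ∑ i, (fderiv ℝ F x (e i)) i ∂μ)) := by
  have hFd : Differentiable ℝ F := hF.differentiable (by simp)
  have hdivc : Continuous fun x => ∑ i, (fderiv ℝ F x (e i)) i := by
    have := hF.continuous_fderiv (by simp)
    refine continuous_finsetSum _ fun i _ => ?_
    exact (EuclideanSpace.proj (𝕜 := ℝ) i).continuous.comp (this.clm_apply continuous_const)
  have hdiv0 : ∀ x ∉ tsupport F, fderiv ℝ F x = 0 := fun x hx => by
    rw [(notMem_tsupport_iff_eventuallyEq.mp hx).fderiv_eq]; simp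
  have hF0 : ∀ x ∉ tsupport F, F x = 0 := fun x hx => image_eq_zero_of_notMem_tsupport hx
  have hdivs : HasCompactSupport fun x => ∑ i, (fderiv ℝ F x (e i)) i := by
    refine HasCompactSupport.intro hFc.isCompact fun x hx => ?_
    simp [hdiv0 x hx]
  have hdivint : Integrable (fun x => ∑ i, (fderiv ℝ F x (e i)) i) μ :=
    hdivc.integrable_of_hasCompactSupport hdivs
  have hprof := tendsto_integral_profile μ hW (h := fun s => 1 - step s)
    (L := fun x => if ψ x < 0 then 1 else 0)
    (continuous_const.sub contDiff_step.continuous)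
    (fun s => by rw [abs_le]; constructor <;> linarith [step_nonneg s, step_le_one s])
    (fun x hx => (hψ x hx).continuousAt) hdivint
    (fun x hx => by simp [hdiv0 x fun h => hx (hFW h)]) (ae_of_all _ fun x _ => by
      by_cases hx : ψ x < 0
      · simpa [hx] using (tendsto_step_div hx).const_sub 1
      · rw [if_neg hx]
        refine tendsto_const_nhds.congr' ?_
        filter_upwards [self_mem_nhdsWithin] with ε hε
        have : 0 ≤ ψ x / ε := div_nonneg (not_lt.mp hx) (le_of_lt hε)
        rw [step_eq_one (by linarith), sub_self])
  refine hprof.congr fun δ => ?_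
  have hKs : ∀ x ∈ W, ContDiffAt ℝ 1 (fun x => 1 - step (ψ x / δ)) x := fun x hx =>
    (contDiffAt_const.sub (contDiff_step.contDiffAt.comp x ((hψ x hx).div_const δ))).of_le (by simp)
  have hG : ContDiff ℝ 1 fun x => (1 - step (ψ x / δ)) • F x := by
    rw [contDiff_iff_contDiffAt]
    intro x
    by_cases hx : x ∈ tsupport F
    · exact (hKs x (hFW hx)).smul hF.contDiffAt
    · refine contDiffAt_const (c := (0 : Space d)).congr_of_eventuallyEq ?_
      filter_upwards [notMem_tsupport_iff_eventuallyEq.mp hx] with y hy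
      simp [hy]
  have hGc : HasCompactSupport fun x => (1 - step (ψ x / δ)) • F x :=
    HasCompactSupport.intro hFc.isCompact fun x hx => by rw [hF0 x hx, smul_zero]
  have hz := sum_integral_fderiv_eq_zero μ hG hGc e
  have hpt : ∀ x, ∑ i, (fderiv ℝ (fun x => (1 - step (ψ x / δ)) • F x) x (e i)) i =
      (1 - step (ψ x / δ)) * ∑ i, (fderiv ℝ F x (e i)) i
        - δ⁻¹ * deriv step (ψ x / δ) * ∑ i, F x i * fderiv ℝ ψ x (e i) := by
    intro x
    by_cases hx : x ∈ tsupport F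
    · have h2 : HasFDerivAt (fun x => ψ x / δ) (δ⁻¹ • fderiv ℝ ψ x) x := by
        have := ((hψ x (hFW hx)).differentiableAt (by simp)).hasFDerivAt.const_smul δ⁻¹
        refine this.congr_of_eventuallyEq (Eventually.of_forall fun x => ?_)
        simp [div_eq_inv_mul]
      have h3 : HasFDerivAt (fun x => 1 - step (ψ x / δ))
          (-(deriv step (ψ x / δ) • (δ⁻¹ • fderiv ℝ ψ x))) x :=
        ((differentiable_step _).hasDerivAt.comp_hasFDerivAt x h2).const_sub 1
      rw [fderiv_fun_smul h3.differentiableAt (hFd x), h3.fderiv, Finset.mul_sum, Finset.mul_sum,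
        ← Finset.sum_sub_distrib]
      refine Finset.sum_congr rfl fun i _ => ?_
      simp
      ring
    · have h2 : (fun x => (1 - step (ψ x / δ)) • F x) =ᶠ[𝓝 x] fun _ => 0 := by
        filter_upwards [notMem_tsupport_iff_eventuallyEq.mp hx] with y hy; simp [hy]
      rw [h2.fderiv_eq]
      simp [hdiv0 x hx, hF0 x hx]
  simp_rw [hpt] at hz
  have hi1 : Integrable (fun x => (1 - step (ψ x / δ)) * ∑ i, (fderiv ℝ F x (e i)) i) μ := by
    refine hdivint.norm.mono' (aestronglyMeasurable_comp_mul μ hW (h := fun s => 1 - step (s / δ))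
      (continuous_const.sub (contDiff_step.continuous.comp (continuous_id.div_const δ)))
      (fun x hx => (hψ x hx).continuousAt) hdivint.aestronglyMeasurable
      (fun x hx => by simp [hdiv0 x fun h => hx (hFW h)])) (ae_of_all _ fun x => ?_)
    rw [norm_mul]
    refine mul_le_of_le_one_left (norm_nonneg _) ?_
    rw [Real.norm_eq_abs, abs_le]
    constructor <;> linarith [step_nonneg (ψ x / δ), step_le_one (ψ x / δ)]
  have hi2 : Integrable (fun x => δ⁻¹ * deriv step (ψ x / δ) * ∑ i, F x i * fderiv ℝ ψ x (e i)) μ := by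
    have hc : Continuous fun x => δ⁻¹ * deriv step (ψ x / δ) * ∑ i, F x i * fderiv ℝ ψ x (e i) := by
      rw [continuous_iff_continuousAt]
      intro x
      by_cases hx : x ∈ tsupport F
      · have hx' := hψ x (hFW hx)
        refine ContinuousAt.mul (continuousAt_const.mul
          (contDiff_deriv_step.continuous.continuousAt.comp (hx'.continuousAt.div_const δ))) ?_
        refine tendsto_finsetSum _ fun i _ => ContinuousAt.mul ?_ ?_
        · exact ((EuclideanSpace.proj (𝕜 := ℝ) i).continuous.comp hF.continuous).continuousAt
        · exact ((hx'.fderiv_right (m := 0) (by simp)).continuousAt).clm_apply continuousAt_const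
      · refine (continuousAt_const (y := (0 : ℝ))).congr ?_
        filter_upwards [notMem_tsupport_iff_eventuallyEq.mp hx] with y hy
        simp [hy]
    refine hc.integrable_of_hasCompactSupport (HasCompactSupport.intro hFc.isCompact fun x hx => ?_)
    simp [hF0 x hx]
  rw [integral_sub hi1 hi2] at hz
  linarith

end GaussGreen

lemma sum_mul_fderiv_eq_inner {ψ : Space d → ℝ} {x : Space d} (v : Space d) :
    ∑ i, v i * fderiv ℝ ψ x (EuclideanSpace.single i 1) = ⟪gradient ψ x, v⟫ := by
  have h1 : ⟪gradient ψ x, v⟫ = fderiv ℝ ψ x v := by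
    rw [gradient, InnerProductSpace.toDual_symm_apply]
  rw [h1]
  conv_rhs => rw [← (EuclideanSpace.basisFun (Fin d) ℝ).sum_repr v]
  simp

lemma tendsto_integral_divergence_sublevel {ψ : Space d → ℝ} {F : Space d → Space d}
    {W : Set (Space d)} (hW : IsOpen W) (hψ : ∀ x ∈ W, ContDiffAt ℝ ∞ ψ x) (hF : ContDiff ℝ 1 F)
    (hFc : HasCompactSupport F) (hFW : tsupport F ⊆ W) :
    Tendsto (fun δ : ℝ => ∫ x, δ⁻¹ * deriv step (ψ x / δ) * ⟪gradient ψ x, F x⟫)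
      (𝓝[>] 0) (𝓝 (∫ x, (if ψ x < 0 then 1 else 0) * divergence F x)) := by
  have := tendsto_integral_concentrated_step volume hW hψ hF hFc hFW
    (fun i => EuclideanSpace.single i 1)
  simp_rw [sum_mul_fderiv_eq_inner] at this
  exact this

lemma sum_mul_fderiv_eq_inner_spaceGrad {φ : ℝ × Space d → ℝ} {p : ℝ × Space d}
    (hφ : DifferentiableAt ℝ φ p) (v : Space d) :
    ∑ i, v i * fderiv ℝ φ p (0, EuclideanSpace.single i 1) = ⟪spaceGrad φ p, v⟫ := by
  have := sum_mul_fderiv_eq_inner (ψ := fun y => φ (p.1, y)) (x := p.2) v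
  simp_rw [fderiv_slice hφ] at this
  exact this

lemma tendsto_integral_spaceDiv_sublevel {φ : ℝ × Space d → ℝ} {F : ℝ × Space d → Space d}
    {O : Set (ℝ × Space d)} (hO : IsOpen O) (hφ : ∀ p ∈ O, ContDiffAt ℝ ∞ φ p)
    (hF : ContDiff ℝ 1 F) (hFc : HasCompactSupport F) (hFO : tsupport F ⊆ O) :
    Tendsto (fun δ : ℝ => ∫ p, δ⁻¹ * deriv step (φ p / δ) * ⟪spaceGrad φ p, F p⟫)
      (𝓝[>] 0) (𝓝 (∫ p, (if φ p < 0 then 1 else 0) * spaceDiv F p)) := by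
  have hHaar : (volume : Measure (ℝ × Space d)).IsAddHaarMeasure := by
    rw [Measure.volume_eq_prod]; infer_instance
  have := tendsto_integral_concentrated_step volume hO hφ hF hFc hFO
    (fun i => ((0 : ℝ), EuclideanSpace.single i (1 : ℝ)))
  simp_rw [← fun p => spaceDiv_eq (hF.differentiable (by simp) p)] at this
  refine this.congr fun δ => integral_congr_ae (ae_of_all _ fun p => ?_)
  by_cases hp : p ∈ tsupport F
  · simp only []
    rw [sum_mul_fderiv_eq_inner_spaceGrad ((hφ p (hFO hp)).differentiableAt (by simp))]
  · simp [image_eq_zero_of_notMem_tsupport hp]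

/-! ### The polar decomposition near a smooth piece of the interface -/

lemma divergence_eq_zero_of_notMem_tsupport {F : Space d → Space d} {x : Space d}
    (hx : x ∉ tsupport F) : divergence F x = 0 := by
  have : fderiv ℝ F x = 0 := by
    rw [(notMem_tsupport_iff_eventuallyEq.mp hx).fderiv_eq]; simp
  simp [divergence, this]

namespace IsGradientPolar

variable {Ω W : Set (Space d)} {χ : Space d → ℝ} {μ : Measure (Space d)} {ν : Space d → Space d}

lemma integrableOn_inner (hpol : IsGradientPolar Ω χ μ ν) {Z : Space d → Space d}
    {K : Set (Space d)} (hK : IsCompact K) (hKΩ : K ⊆ Ω) (hZ : ContinuousOn Z K) :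
    IntegrableOn (fun x => ⟪Z x, ν x⟫) K μ := by
  obtain ⟨C, hC⟩ := hK.exists_bound_of_continuousOn hZ
  have : IsFiniteMeasure (μ.restrict K) := ⟨by simpa using hpol.locally_finite K hK hKΩ⟩
  refine Integrable.of_bound
    ((hZ.aestronglyMeasurable hK.measurableSet).inner hpol.measurable.restrict) C ?_
  rw [ae_restrict_iff' hK.measurableSet]
  filter_upwards [hpol.norm_eq] with x hx hxK
  refine (norm_inner_le_norm _ _).trans ?_
  rw [hx, mul_one]
  exact hC x hxK

lemma integrableOn_polar (hpol : IsGradientPolar Ω χ μ ν)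
    {K : Set (Space d)} (hK : IsCompact K) (hKΩ : K ⊆ Ω) : IntegrableOn ν K μ := by
  refine Measure.integrableOn_of_bounded (M := 1) (hpol.locally_finite K hK hKΩ).ne
    hpol.measurable ?_
  exact ae_restrict_of_ae (hpol.norm_eq.mono fun x hx => hx.le)

/-- The cut-off `g` makes a local field admissible in the defining relation, and only values of `χ`
on `W` enter. -/
lemma integral_mul_inner (hpol : IsGradientPolar Ω χ μ ν) (hΩ : MeasurableSet Ω) (hWΩ : W ⊆ Ω)
    {Z : Space d → Space d} (hZ : ∀ x ∈ W, ContDiffAt ℝ ∞ Z x) {g : Space d → ℝ}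
    (hg : ContDiff ℝ ∞ g) (hgc : HasCompactSupport g) (hgW : tsupport g ⊆ W) :
    ∫ x, g x * ⟪Z x, ν x⟫ ∂μ = ∫ x in W, χ x * divergence (fun y => g y • Z y) x := by
  have hs := contDiff_smul_of_tsupport hg hgW hZ
  have ht : tsupport (fun y => g y • Z y) ⊆ tsupport g := tsupport_smul_subset_left _ _
  have hc : HasCompactSupport fun y => g y • Z y := hgc.mono' ((subset_tsupport _).trans ht)
  have := hpol.eq _ hs hc (ht.trans (hgW.trans hWΩ))
  simp_rw [real_inner_smul_left] at this
  rw [← this]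
  refine setIntegral_eq_of_subset_of_forall_sdiff_eq_zero hΩ hWΩ fun x hx => ?_
  rw [divergence_eq_zero_of_notMem_tsupport fun h => hx.2 (hgW (ht h)), mul_zero]

/-- If `χ` is constant on an open set, the total variation measure vanishes there. -/
lemma measure_eq_zero_of_const (hpol : IsGradientPolar Ω χ μ ν) (hΩ : MeasurableSet Ω) (hW : IsOpen W) (hWΩ : W ⊆ Ω)
    {c : ℝ} (hχ : ∀ x ∈ W, χ x = c) : μ W = 0 := by
  have hloc : LocallyIntegrableOn ν W μ := by
    rw [locallyIntegrableOn_iff hW.isLocallyClosed]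
    exact fun K hKW hK => hpol.integrableOn_polar hK (hKW.trans hWΩ)
  have h0 := hW.ae_eq_zero_of_integral_contDiff_smul_eq_zero hloc fun g hg hgc hgW => by
    have hint : Integrable (fun x => g x • ν x) μ := by
      have h1 : IntegrableOn (fun x => g x • ν x) (tsupport g) μ :=
        (hpol.integrableOn_polar hgc.isCompact (hgW.trans hWΩ)).continuousOn_smul
          hg.continuous.continuousOn hgc.isCompact
      refine (integrableOn_iff_integrable_of_support_subset fun x hx => ?_).mp h1
      by_contra hx'
      exact hx (by simp [image_eq_zero_of_notMem_tsupport hx'])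
    refine ext_inner_space fun e => ?_
    rw [inner_zero_left, real_inner_comm, ← integral_inner hint]
    have h1 := hpol.integral_mul_inner hΩ hWΩ (Z := fun _ => e) (fun _ _ => contDiffAt_const)
      hg hgc hgW
    simp_rw [real_inner_smul_right]
    rw [h1]
    have ht : tsupport (fun y => g y • e) ⊆ tsupport g := tsupport_smul_subset_left _ _
    have h2 : ∫ x in W, χ x * divergence (fun y => g y • e) x
        = ∫ x in W, c * divergence (fun y => g y • e) x :=
      setIntegral_congr_fun hW.measurableSet fun x hx => by simp only [hχ x hx]
    rw [h2, integral_const_mul, setIntegral_eq_integral_of_forall_compl_eq_zero,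
      integral_divergence_eq_zero (F := fun y => g y • e) ((hg.smul contDiff_const).of_le (by simp))
        (hgc.mono' ((subset_tsupport _).trans ht)), mul_zero]
    intro x hx
    exact divergence_eq_zero_of_notMem_tsupport fun h => hx (hgW (ht h))
  have h1 : ∀ᵐ x ∂μ, x ∉ W := by
    filter_upwards [h0, hpol.norm_eq] with x hx hn hxW
    rw [hx hxW, norm_zero] at hn
    exact zero_ne_one hn
  exact measure_eq_zero_iff_ae_notMem.mpr h1

/-- Where `χ` is the characteristic function of a smooth sublevel set, `ν` is its outer normal. -/
lemma eq_normal (hpol : IsGradientPolar Ω χ μ ν) (hΩ : MeasurableSet Ω) (hW : IsOpen W) (hWΩ : W ⊆ Ω)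
    {ψ : Space d → ℝ} (hψ : ∀ x ∈ W, ContDiffAt ℝ ∞ ψ x) (hgrad : ∀ x ∈ W, gradient ψ x ≠ 0)
    {N : Space d → Space d} (hN : ∀ x ∈ W, ContDiffAt ℝ ∞ N x)
    (hN' : ∀ x ∈ W, N x = ‖gradient ψ x‖⁻¹ • gradient ψ x)
    (hχ : ∀ x ∈ W, χ x = if ψ x < 0 then 1 else 0) : ∀ᵐ x ∂μ, x ∈ W → ν x = N x := by
  have hnorm : ∀ x ∈ W, ‖N x‖ = 1 := fun x hx => by
    rw [hN' x hx, norm_smul, norm_inv, norm_norm, inv_mul_cancel₀ (norm_ne_zero_iff.mpr (hgrad x hx))]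
  have hgradN : ∀ x ∈ W, gradient ψ x = ‖gradient ψ x‖ • N x := fun x hx => by
    rw [hN' x hx, smul_smul, mul_inv_cancel₀ (norm_ne_zero_iff.mpr (hgrad x hx)), one_smul]
  -- Integrals against `ν μ` are limits of integrals concentrated near `{ψ = 0}` which involve `Z`
  -- only through `⟪gradient ψ, Z⟫`. This one formula determines both components of `ν`.
  have hlim : ∀ (Z : Space d → Space d) (g : Space d → ℝ), (∀ x ∈ W, ContDiffAt ℝ ∞ Z x) →
      ContDiff ℝ ∞ g → HasCompactSupport g → tsupport g ⊆ W →
      Tendsto (fun δ : ℝ => ∫ x, δ⁻¹ * deriv step (ψ x / δ) * ⟪gradient ψ x, g x • Z x⟫)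
        (𝓝[>] 0) (𝓝 (∫ x, g x * ⟪Z x, ν x⟫ ∂μ)) := by
    intro Z g hZ hg hgc hgW
    have ht : tsupport (fun y => g y • Z y) ⊆ tsupport g := tsupport_smul_subset_left _ _
    have := tendsto_integral_divergence_sublevel hW hψ
      ((contDiff_smul_of_tsupport hg hgW hZ).of_le (by simp))
      (hgc.mono' ((subset_tsupport _).trans ht)) (ht.trans hgW)
    rw [hpol.integral_mul_inner hΩ hWΩ hZ hg hgc hgW]
    rw [← setIntegral_eq_integral_of_forall_compl_eq_zero (s := W)] at this
    · rw [setIntegral_congr_fun (g := fun x => (if ψ x < 0 then 1 else 0) *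
        divergence (fun y => g y • Z y) x) hW.measurableSet fun x hx => by simp only [hχ x hx]]
      exact this
    · intro x hx
      rw [divergence_eq_zero_of_notMem_tsupport fun h => hx (hgW (ht h)), mul_zero]
  have hfin : ∀ K, IsCompact K → K ⊆ W → μ K < ⊤ := fun K hK hKW =>
    hpol.locally_finite K hK (hKW.trans hWΩ)
  -- tangential part
  have hNc : ContinuousOn N W := fun x hx => (hN x hx).continuousAt.continuousWithinAt
  have htan := hW.ae_eq_zero_of_integral_contDiff_smul_eq_zero (μ := μ)
    (f := fun x => ν x - ⟪N x, ν x⟫ • N x) (by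
      rw [locallyIntegrableOn_iff hW.isLocallyClosed]
      intro K hKW hK
      refine (hpol.integrableOn_polar hK (hKW.trans hWΩ)).sub ?_
      exact (hpol.integrableOn_inner hK (hKW.trans hWΩ) (hNc.mono hKW)).smul_continuousOn
        (hNc.mono hKW) hK)
    fun g hg hgc hgW => by
      have hK := hgc.isCompact
      have hint : Integrable (fun x => g x • (ν x - ⟪N x, ν x⟫ • N x)) μ := by
        have h1 : IntegrableOn (fun x => g x • (ν x - ⟪N x, ν x⟫ • N x)) (tsupport g) μ :=
          ((hpol.integrableOn_polar hK (hgW.trans hWΩ)).sub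
            ((hpol.integrableOn_inner hK (hgW.trans hWΩ) (hNc.mono hgW)).smul_continuousOn
            (hNc.mono hgW) hK)).continuousOn_smul hg.continuous.continuousOn hgc.isCompact
        refine (integrableOn_iff_integrable_of_support_subset fun x hx => ?_).mp h1
        by_contra hx'
        exact hx (by simp [image_eq_zero_of_notMem_tsupport hx'])
      refine ext_inner_space fun e => ?_
      rw [inner_zero_left, real_inner_comm, ← integral_inner hint]
      have h2 : ∀ x, ⟪e, g x • (ν x - ⟪N x, ν x⟫ • N x)⟫
          = g x * ⟪e - ⟪N x, e⟫ • N x, ν x⟫ := fun x => by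
        rw [real_inner_smul_right, inner_sub_right, inner_sub_left, real_inner_smul_right,
          real_inner_smul_left, real_inner_comm e (N x)]
        ring
      simp_rw [h2]
      -- This field is orthogonal to `gradient ψ`, so the concentrated integrals are zero for every
      -- `δ`.
      have h3 := hlim (fun x => e - ⟪N x, e⟫ • N x) g (fun x hx => contDiffAt_const.sub
        (((hN x hx).inner ℝ contDiffAt_const).smul (hN x hx))) hg hgc hgW
      refine tendsto_nhds_unique h3 (tendsto_const_nhds.congr fun δ => ?_)
      symm
      refine integral_eq_zero_of_ae (ae_of_all _ fun x => ?_)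
      by_cases hx : x ∈ W
      · simp only [Pi.zero_apply]
        rw [hgradN x hx, real_inner_smul_left, real_inner_smul_right, inner_sub_right,
          real_inner_smul_right, real_inner_self_eq_norm_sq, hnorm x hx]
        ring
      · simp [image_eq_zero_of_notMem_tsupport fun h => hx (hgW h)]
  -- For `Z = N` the concentrated integrals are nonnegative. A unit vector without tangential part
  -- and with nonnegative normal part is `N`.
  have hpos := ae_nonneg_of_forall_smooth (m := μ) hW hfin (h := fun x => ⟪N x, ν x⟫) (by
      rw [locallyIntegrableOn_iff hW.isLocallyClosed]
      exact fun K hKW hK => hpol.integrableOn_inner hK (hKW.trans hWΩ) (hNc.mono hKW))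
    fun g hg hgc hgW hg0 => by
      refine ge_of_tendsto (hlim N g hN hg hgc hgW) ?_
      filter_upwards [self_mem_nhdsWithin] with δ hδ
      have hδ' : (0 : ℝ) < δ := hδ
      refine integral_nonneg fun x => ?_
      by_cases hx : x ∈ W
      · simp only [Pi.zero_apply]
        rw [hgradN x hx, real_inner_smul_left, real_inner_smul_right, real_inner_self_eq_norm_sq]
        have := hg0 x
        have := deriv_step_nonneg (ψ x / δ)
        positivity
      · simp [image_eq_zero_of_notMem_tsupport fun h => hx (hgW h)]
  filter_upwards [htan, hpos, hpol.norm_eq] with x h1 h2 h3 hx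
  have h4 : ν x = ⟪N x, ν x⟫ • N x := sub_eq_zero.mp (h1 hx)
  have h5 : ⟪N x, ν x⟫ = 1 := by
    have := h3
    rw [h4, norm_smul, hnorm x hx, mul_one, Real.norm_of_nonneg (h2 hx)] at this
    exact this
  rw [h4, h5, one_smul]

end IsGradientPolar

instance isAddHaarMeasure_volume_spacetime :
    (volume : Measure (ℝ × Space d)).IsAddHaarMeasure := by
  rw [Measure.volume_eq_prod]; infer_instance

/-! ### Weak formulations over space-time -/

/-- The space-time cylinder `(0,T) × Ω`. -/
def cylinder (Ω : Set (Space d)) (T : ℝ) : Set (ℝ × Space d) := Ioo 0 T ×ˢ Ω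

lemma isOpen_cylinder {Ω : Set (Space d)} (hΩ : IsOpen Ω) (T : ℝ) : IsOpen (cylinder Ω T) :=
  isOpen_Ioo.prod hΩ

lemma integrable_inner_of_locallyIntegrableOn {V : Type*} [NormedAddCommGroup V]
    [MeasurableSpace V] [BorelSpace V] {m : Measure V} {S : Set V} {f G : V → Space d}
    (hf : LocallyIntegrableOn f S m) (hG : Continuous G) (hGc : HasCompactSupport G)
    (hGS : tsupport G ⊆ S) : Integrable (fun p => ⟪f p, G p⟫) m := by
  obtain ⟨C, hC⟩ := hGc.exists_bound_of_continuous hG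
  have hi : IntegrableOn f (tsupport G) m := hf.integrableOn_compact_subset hGS hGc.isCompact
  have h1 : IntegrableOn (fun p => ⟪f p, G p⟫) (tsupport G) m := by
    refine Integrable.mono' (hi.norm.mul_const C)
      (hi.aestronglyMeasurable.inner hG.aestronglyMeasurable) (ae_of_all _ fun p => ?_)
    refine (norm_inner_le_norm _ _).trans ?_
    gcongr
    exact hC p
  refine (integrableOn_iff_integrable_of_support_subset fun x hx => ?_).mp h1
  by_contra hx'
  exact hx (by simp [image_eq_zero_of_notMem_tsupport hx'])

lemma integrable_profile_mul {V : Type*} [NormedAddCommGroup V] [MeasurableSpace V] [BorelSpace V]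
    (m : Measure V) {O : Set V} (hO : IsOpen O) {h : ℝ → ℝ}
    (hh : Continuous h) (hb : ∀ s, |h s| ≤ 1) {ψ G : V → ℝ} (hψ : ∀ q ∈ O, ContinuousAt ψ q)
    (hG : Integrable G m) (hG0 : ∀ q ∉ O, G q = 0) (ε : ℝ) :
    Integrable (fun q => h (ψ q / ε) * G q) m := by
  refine hG.norm.mono' (aestronglyMeasurable_comp_mul m hO (h := fun s => h (s / ε))
    (hh.comp (continuous_id.div_const ε)) hψ hG.aestronglyMeasurable hG0) (ae_of_all _ fun q => ?_)
  rw [norm_mul]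
  exact mul_le_of_le_one_left (norm_nonneg _) (hb _)

lemma abs_hump_le_one (s : ℝ) : |hump s| ≤ 1 := by
  rw [abs_of_nonneg (hump_nonneg s)]; exact hump_le_one s

lemma abs_step_le_one (s : ℝ) : |step s| ≤ 1 := by
  rw [abs_of_nonneg (step_nonneg s)]; exact step_le_one s

lemma setIntegral_cylinder {Ω : Set (Space d)} {T : ℝ} {f : ℝ × Space d → ℝ}
    (hf : IntegrableOn f (cylinder Ω T)) :
    ∫ t in Ioo 0 T, ∫ x in Ω, f (t, x) = ∫ p in cylinder Ω T, f p :=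
  (setIntegral_prod f hf).symm

/-! ### Supports and derivatives of cut-off functions -/

section TestCalculus

lemma fderiv_eq_zero_of_notMem_tsupport {V G : Type*} [NormedAddCommGroup V] [NormedSpace ℝ V]
    [NormedAddCommGroup G] [NormedSpace ℝ G] {f : V → G} {x : V} (hx : x ∉ tsupport f) :
    fderiv ℝ f x = 0 := by
  rw [(notMem_tsupport_iff_eventuallyEq.mp hx).fderiv_eq]; simp

lemma spaceGrad_eq_zero_of_notMem_tsupport {f : ℝ × Space d → ℝ} {p : ℝ × Space d}
    (hp : p ∉ tsupport f) : spaceGrad f p = 0 := by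
  rw [spaceGrad_congr (notMem_tsupport_iff_eventuallyEq.mp hp)]
  simp [spaceGrad, gradient]

lemma timeDeriv_eq_zero_of_notMem_tsupport {f : ℝ × Space d → ℝ} {p : ℝ × Space d}
    (hp : p ∉ tsupport f) : timeDeriv f p = 0 := by
  rw [timeDeriv_congr (notMem_tsupport_iff_eventuallyEq.mp hp)]
  simp [timeDeriv]

lemma spaceDiv_eq_zero_of_notMem_tsupport {F : ℝ × Space d → Space d} {p : ℝ × Space d}
    (hp : p ∉ tsupport F) : spaceDiv F p = 0 := by
  rw [spaceDiv_congr (notMem_tsupport_iff_eventuallyEq.mp hp)]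
  simp [spaceDiv, divergence]

lemma tsupport_subset_of_forall_eq_zero {V G : Type*} [TopologicalSpace V] [Zero G] {f : V → G}
    {K : Set V} (hK : IsClosed K) (h : ∀ p ∉ K, f p = 0) : tsupport f ⊆ K :=
  closure_minimal (fun p hp => by by_contra hp'; exact hp (h p hp')) hK

lemma tsupport_spaceGrad_subset (f : ℝ × Space d → ℝ) : tsupport (spaceGrad f) ⊆ tsupport f :=
  tsupport_subset_of_forall_eq_zero (isClosed_tsupport f)
    fun _ hp => spaceGrad_eq_zero_of_notMem_tsupport hp

lemma tsupport_timeDeriv_subset (f : ℝ × Space d → ℝ) : tsupport (timeDeriv f) ⊆ tsupport f :=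
  tsupport_subset_of_forall_eq_zero (isClosed_tsupport f)
    fun _ hp => timeDeriv_eq_zero_of_notMem_tsupport hp

lemma tsupport_spaceDiv_subset (F : ℝ × Space d → Space d) : tsupport (spaceDiv F) ⊆ tsupport F :=
  tsupport_subset_of_forall_eq_zero (isClosed_tsupport F)
    fun _ hp => spaceDiv_eq_zero_of_notMem_tsupport hp

lemma hasCompactSupport_of_tsupport_subset {V G H : Type*} [TopologicalSpace V] [Zero G] [Zero H]
    {f : V → G} {g : V → H} (hf : HasCompactSupport f) (h : tsupport g ⊆ tsupport f) :
    HasCompactSupport g :=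
  hf.isCompact.of_isClosed_subset (isClosed_tsupport g) h

lemma continuous_spaceGrad {f : ℝ × Space d → ℝ} (hf : ContDiff ℝ 1 f) :
    Continuous (spaceGrad f) :=
  continuous_iff_continuousAt.mpr fun _ =>
    (contDiffAt_spaceGrad (m := 0) hf.contDiffAt (by simp)).continuousAt

lemma continuous_timeDeriv {f : ℝ × Space d → ℝ} (hf : ContDiff ℝ 1 f) :
    Continuous (timeDeriv f) :=
  continuous_iff_continuousAt.mpr fun _ =>
    (contDiffAt_timeDeriv (m := 0) hf.contDiffAt (by simp)).continuousAt

lemma continuous_spaceDiv {F : ℝ × Space d → Space d} (hF : ContDiff ℝ 1 F) :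
    Continuous (spaceDiv F) :=
  continuous_iff_continuousAt.mpr fun _ =>
    (contDiffAt_spaceDiv (m := 0) hF.contDiffAt (by simp)).continuousAt

variable {O : Set (ℝ × Space d)} {f ψ : ℝ × Space d → ℝ}

lemma contDiff_mul_profile (hf : ContDiff ℝ ∞ f) (hfO : tsupport f ⊆ O)
    (hψ : ∀ p ∈ O, ContDiffAt ℝ ∞ ψ p) {h : ℝ → ℝ} (hh : ContDiff ℝ ∞ h) (ε : ℝ) :
    ContDiff ℝ ∞ fun q => f q * h (ψ q / ε) :=
  contDiff_mul_of_tsupport hf hfO fun p hp =>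
    hh.contDiffAt.comp p ((hψ p hp).div_const ε)

lemma spaceGrad_mul_profile (hf : ContDiff ℝ ∞ f) (hfO : tsupport f ⊆ O)
    (hψ : ∀ p ∈ O, ContDiffAt ℝ ∞ ψ p) {h : ℝ → ℝ} (hh : ContDiff ℝ ∞ h) (ε : ℝ)
    (p : ℝ × Space d) :
    spaceGrad (fun q => f q * h (ψ q / ε)) p
      = h (ψ p / ε) • spaceGrad f p + (ε⁻¹ * deriv h (ψ p / ε) * f p) • spaceGrad ψ p := by
  by_cases hp : p ∈ tsupport f
  · have h1 : DifferentiableAt ℝ ψ p := (hψ p (hfO hp)).differentiableAt (by simp)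
    have h2 : DifferentiableAt ℝ (fun s => h (s / ε)) (ψ p) :=
      (hh.differentiable (by simp) _).comp (ψ p) (differentiableAt_id.div_const ε)
    have h3 : DifferentiableAt ℝ (fun q => h (ψ q / ε)) p := h2.comp p h1
    have h4 : deriv (fun s => h (s / ε)) (ψ p) = ε⁻¹ * deriv h (ψ p / ε) := by
      have := deriv_comp_mul_left ε⁻¹ h (ψ p)
      simp only [smul_eq_mul] at this
      simpa only [div_eq_inv_mul] using this
    rw [spaceGrad_mul (hf.differentiable (by simp) p) h3,
      spaceGrad_comp (h := fun s => h (s / ε)) h2 h1, h4, smul_smul, add_comm]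
    congr 2
    ring
  · have h1 : p ∉ tsupport fun q => f q * h (ψ q / ε) := fun h' => hp (tsupport_mul_subset_left h')
    rw [spaceGrad_eq_zero_of_notMem_tsupport h1, spaceGrad_eq_zero_of_notMem_tsupport hp,
      image_eq_zero_of_notMem_tsupport hp]
    simp

lemma timeDeriv_mul_profile (hf : ContDiff ℝ ∞ f) (hfO : tsupport f ⊆ O)
    (hψ : ∀ p ∈ O, ContDiffAt ℝ ∞ ψ p) {h : ℝ → ℝ} (hh : ContDiff ℝ ∞ h) (ε : ℝ)
    (p : ℝ × Space d) :
    timeDeriv (fun q => f q * h (ψ q / ε)) p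
      = h (ψ p / ε) * timeDeriv f p + (ε⁻¹ * deriv h (ψ p / ε) * f p) * timeDeriv ψ p := by
  by_cases hp : p ∈ tsupport f
  · have h1 : DifferentiableAt ℝ ψ p := (hψ p (hfO hp)).differentiableAt (by simp)
    have h2 : DifferentiableAt ℝ (fun s => h (s / ε)) (ψ p) :=
      (hh.differentiable (by simp) _).comp (ψ p) (differentiableAt_id.div_const ε)
    have h3 : DifferentiableAt ℝ (fun q => h (ψ q / ε)) p := h2.comp p h1
    have h4 : deriv (fun s => h (s / ε)) (ψ p) = ε⁻¹ * deriv h (ψ p / ε) := by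
      have := deriv_comp_mul_left ε⁻¹ h (ψ p)
      simp only [smul_eq_mul] at this
      simpa only [div_eq_inv_mul] using this
    rw [timeDeriv_mul (hf.differentiable (by simp) p) h3,
      timeDeriv_comp (h := fun s => h (s / ε)) h2 h1, h4]
    ring
  · have h1 : p ∉ tsupport fun q => f q * h (ψ q / ε) := fun h' => hp (tsupport_mul_subset_left h')
    rw [timeDeriv_eq_zero_of_notMem_tsupport h1, timeDeriv_eq_zero_of_notMem_tsupport hp,
      image_eq_zero_of_notMem_tsupport hp]
    simp

end TestCalculus

/-! ### The weak equations as space-time integrals -/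

section Weak

variable {Ω : Set (Space d)} {T m lam : ℝ} {ρ χ : ℝ × Space d → ℝ}
  {u : ℝ × Space d → Space d} {ρ₀ : Space d → ℝ}

lemma WeakTransport.integrable_flux_inner (h : WeakTransport Ω T ρ u ρ₀)
    {G : ℝ × Space d → Space d} (hG : Continuous G) (hGc : HasCompactSupport G)
    (hGS : tsupport G ⊆ Iio T ×ˢ univ) :
    IntegrableOn (fun p => ⟪ρ p • u p, G p⟫) (cylinder Ω T) :=
  integrable_inner_of_locallyIntegrableOn h.flux_integrable hG hGc hGS

lemma WeakTransport.eq_cylinder (h : WeakTransport Ω T ρ u ρ₀) {η : ℝ × Space d → ℝ}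
    (hη : IsTest T η) (hint : IntegrableOn (fun p => timeDeriv η p * ρ p) (cylinder Ω T)) :
    ∫ p in cylinder Ω T, (timeDeriv η p * ρ p + ⟪ρ p • u p, spaceGrad η p⟫)
      = -∫ x in Ω, ρ₀ x * η (0, x) := by
  have h1 : ContDiff ℝ 1 η := hη.smooth.of_le (by simp)
  have h2 := h.integrable_flux_inner (continuous_spaceGrad h1)
    (hasCompactSupport_of_tsupport_subset hη.compact (tsupport_spaceGrad_subset η))
    ((tsupport_spaceGrad_subset η).trans hη.support)
  have h3 : IntegrableOn (fun p => timeDeriv η p * ρ p + ⟪ρ p • u p, spaceGrad η p⟫)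
      (cylinder Ω T) := hint.add h2
  rw [← h.eq η hη, neg_neg, ← setIntegral_cylinder h3]
  refine integral_congr_ae (ae_of_all _ fun t => integral_congr_ae (ae_of_all _ fun x => ?_))
  simp only []
  rw [real_inner_smul_left]
  ring

/-- The inner surface integral in the weak Young-Laplace law. -/
noncomputable def surfaceTerm (μ : Measure (Space d)) (ν : Space d → Space d) (ξ : ℝ × Space d → Space d)
    (t : ℝ) : ℝ :=
  ∫ x, (spaceDiv ξ (t, x) - ⟪ν x, fderiv ℝ (fun y => ξ (t, y)) x (ν x)⟫) ∂μ

lemma youngLaplace_cylinder (h : WeakTransport Ω T ρ u ρ₀) {μ : ℝ → Measure (Space d)}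
    {ν : ℝ → Space d → Space d}
    {ξ : ℝ × Space d → Space d} (hξ : IsTest T ξ)
    (heq : -∫ t in Ioo 0 T, ∫ x in Ω, ⟪ρ (t, x) • u (t, x), ξ (t, x)⟫
        = (∫ t in Ioo 0 T, ∫ x, (spaceDiv ξ (t, x)
              - ⟪ν t x, fderiv ℝ (fun y => ξ (t, y)) x (ν t x)⟫) ∂(μ t))
          - ∫ t in Ioo 0 T, ∫ x in Ω, pressure m lam ρ χ (t, x) * spaceDiv ξ (t, x))
    (hint : IntegrableOn (fun p => spaceDiv ξ p * pressure m lam ρ χ p) (cylinder Ω T)) :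
    ∫ t in Ioo 0 T, surfaceTerm (μ t) (ν t) ξ t
      = (∫ p in cylinder Ω T, spaceDiv ξ p * pressure m lam ρ χ p)
        - ∫ p in cylinder Ω T, ⟪ρ p • u p, ξ p⟫ := by
  have h2 := h.integrable_flux_inner hξ.smooth.continuous hξ.compact hξ.support
  rw [← setIntegral_cylinder h2, ← setIntegral_cylinder hint]
  simp only [surfaceTerm]
  simp_rw [mul_comm (spaceDiv _ _) (pressure _ _ _ _ _)]
  linarith

/-- The concentrated form of the transport equation. -/
lemma WeakTransport.concentrated_eq (h : WeakTransport Ω T ρ u ρ₀) {O : Set (ℝ × Space d)}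
    (hO : IsOpen O) (hOT : O ⊆ Iio T ×ˢ univ) {ψ f : ℝ × Space d → ℝ}
    (hψ : ∀ p ∈ O, ContDiffAt ℝ ∞ ψ p) (hf : ContDiff ℝ ∞ f) (hfc : HasCompactSupport f)
    (hfO : tsupport f ⊆ O)
    (hρ : ∀ G : ℝ × Space d → ℝ, Continuous G → HasCompactSupport G → tsupport G ⊆ O →
      IntegrableOn (fun p => G p * ρ p) (cylinder Ω T)) (ε : ℝ) :
    IntegrableOn (fun p => timeDeriv f p * ρ p + ⟪ρ p • u p, spaceGrad f p⟫) (cylinder Ω T) ∧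
    ∫ p in cylinder Ω T, ε⁻¹ * deriv hump (ψ p / ε) * f p *
        (timeDeriv ψ p * ρ p + ⟪ρ p • u p, spaceGrad ψ p⟫)
      = -(∫ p in cylinder Ω T, hump (ψ p / ε) *
          (timeDeriv f p * ρ p + ⟪ρ p • u p, spaceGrad f p⟫))
        - ∫ x in Ω, ρ₀ x * (f (0, x) * hump (ψ (0, x) / ε)) := by
  set η : ℝ × Space d → ℝ := fun q => f q * hump (ψ q / ε) with hη
  have hηf : tsupport η ⊆ tsupport f := tsupport_mul_subset_left
  have hηs : ContDiff ℝ ∞ η := contDiff_mul_profile hf hfO hψ contDiff_hump ε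
  have hηc : HasCompactSupport η := hasCompactSupport_of_tsupport_subset hfc hηf
  have hη1 : ContDiff ℝ 1 η := hηs.of_le (by simp)
  have hf1 : ContDiff ℝ 1 f := hf.of_le (by simp)
  have hηt := tsupport_timeDeriv_subset η
  have hηint := hρ _ (continuous_timeDeriv hη1) (hasCompactSupport_of_tsupport_subset hηc hηt)
    (hηt.trans (hηf.trans hfO))
  have hfint := hρ _ (continuous_timeDeriv hf1)
    (hasCompactSupport_of_tsupport_subset hfc (tsupport_timeDeriv_subset f))
    ((tsupport_timeDeriv_subset f).trans hfO)
  have hηfl := h.integrable_flux_inner (continuous_spaceGrad hη1)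
    (hasCompactSupport_of_tsupport_subset hηc (tsupport_spaceGrad_subset η))
    ((tsupport_spaceGrad_subset η).trans (hηf.trans (hfO.trans hOT)))
  have hffl := h.integrable_flux_inner (continuous_spaceGrad hf1)
    (hasCompactSupport_of_tsupport_subset hfc (tsupport_spaceGrad_subset f))
    ((tsupport_spaceGrad_subset f).trans (hfO.trans hOT))
  have key := h.eq_cylinder ⟨hηs, hηc, hηf.trans (hfO.trans hOT)⟩ hηint
  have hi2 : IntegrableOn (fun p => hump (ψ p / ε) *
      (timeDeriv f p * ρ p + ⟪ρ p • u p, spaceGrad f p⟫)) (cylinder Ω T) := by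
    refine integrable_profile_mul _ hO contDiff_hump.continuous abs_hump_le_one
      (fun q hq => (hψ q hq).continuousAt) (hfint.add hffl) (fun q hq => ?_) ε
    have hq' : q ∉ tsupport f := fun h => hq (hfO h)
    simp [timeDeriv_eq_zero_of_notMem_tsupport hq', spaceGrad_eq_zero_of_notMem_tsupport hq']
  refine ⟨hfint.add hffl, ?_⟩
  have hfull : IntegrableOn (fun p => timeDeriv η p * ρ p + ⟪ρ p • u p, spaceGrad η p⟫)
      (cylinder Ω T) := hηint.add hηfl
  have hpt : ∀ p, ε⁻¹ * deriv hump (ψ p / ε) * f p *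
        (timeDeriv ψ p * ρ p + ⟪ρ p • u p, spaceGrad ψ p⟫) =
      (timeDeriv η p * ρ p + ⟪ρ p • u p, spaceGrad η p⟫)
        - hump (ψ p / ε) * (timeDeriv f p * ρ p + ⟪ρ p • u p, spaceGrad f p⟫) := by
    intro p
    rw [hη, timeDeriv_mul_profile hf hfO hψ contDiff_hump, spaceGrad_mul_profile hf hfO hψ
      contDiff_hump, inner_add_right, real_inner_smul_right, real_inner_smul_right]
    ring
  simp_rw [hpt]
  rw [integral_sub hfull hi2, key]
  ring

end Weak

/-! ### Powers of smooth densities -/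

/-- For exponents `m ≥ 1` the power is `C¹` on all of `ℝ`, zero included, and in general no better.
Arguments that must hold across the vacuum therefore use only first derivatives of the pressure. -/
lemma contDiffAt_rpow {V : Type*} [NormedAddCommGroup V] [NormedSpace ℝ V] {r : V → ℝ} {p : V}
    {m : ℝ} (hm : 1 ≤ m) (hr : ContDiffAt ℝ 1 r p) : ContDiffAt ℝ 1 (fun q => r q ^ m) p :=
  (Real.contDiff_rpow_const_of_le (n := 1) (by simpa using hm)).contDiffAt.comp p hr

lemma spaceGrad_rpow {r : ℝ × Space d → ℝ} {p : ℝ × Space d} {m : ℝ} (hm : 1 ≤ m)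
    (hr : DifferentiableAt ℝ r p) :
    spaceGrad (fun q => r q ^ m) p = (m * r p ^ (m - 1)) • spaceGrad r p := by
  have h := Real.hasDerivAt_rpow_const (x := r p) (p := m) (Or.inr hm)
  rw [spaceGrad_comp (h := fun s => s ^ m) h.differentiableAt hr, h.deriv]

/-! ### Darcy's law in the bulk -/

/-- The distributional Young-Laplace law with given polar decompositions. -/
structure YoungLaplaceData (Ω : Set (Space d)) (T m lam : ℝ) (ρ χ : ℝ × Space d → ℝ)
    (u : ℝ × Space d → Space d) (μ : ℝ → Measure (Space d)) (ν : ℝ → Space d → Space d) :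
    Prop where
  polar : ∀ᵐ t ∂(volume.restrict (Ioo 0 T)), IsGradientPolar Ω (fun x => χ (t, x)) (μ t) (ν t)
  eq : ∀ ξ : ℝ × Space d → Space d, IsTest T ξ →
      (∀ t ∈ Ioo 0 T, ∀ x ∈ frontier Ω, ∀ n, IsOuterNormal Ω x n → ⟪ξ (t, x), n⟫ = 0) →
      IntegrableOn (fun p => spaceDiv ξ p * pressure m lam ρ χ p) (cylinder Ω T) →
      ∫ t in Ioo 0 T, surfaceTerm (μ t) (ν t) ξ t
        = (∫ p in cylinder Ω T, spaceDiv ξ p * pressure m lam ρ χ p)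
          - ∫ p in cylinder Ω T, ⟪ρ p • u p, ξ p⟫

lemma WeakYoungLaplace.exists_data {Ω : Set (Space d)} {T m lam : ℝ} {ρ χ : ℝ × Space d → ℝ}
    {u : ℝ × Space d → Space d} {ρ₀ : Space d → ℝ} (hy : WeakYoungLaplace Ω T m lam ρ χ u)
    (h : WeakTransport Ω T ρ u ρ₀) : ∃ μ ν, YoungLaplaceData Ω T m lam ρ χ u μ ν := by
  obtain ⟨μ, ν, h1, h2⟩ := hy
  exact ⟨μ, ν, h1, fun ξ hξ ht hint => youngLaplace_cylinder h hξ (h2 ξ hξ ht) hint⟩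

lemma fderiv_slice_eq_zero_of_notMem_tsupport {ξ : ℝ × Space d → Space d} {t : ℝ} {x : Space d}
    (hξ : Differentiable ℝ ξ) (hx : (t, x) ∉ tsupport ξ) : fderiv ℝ (fun y => ξ (t, y)) x = 0 := by
  have := (hasFDerivAt_slice (hξ (t, x))).fderiv
  rw [fderiv_eq_zero_of_notMem_tsupport hx] at this
  simpa using this

section Darcy

variable {Ω : Set (Space d)} {T m lam : ℝ} {ρ χ : ℝ × Space d → ℝ}
  {u : ℝ × Space d → Space d} {ρ₀ : Space d → ℝ} {μ : ℝ → Measure (Space d)}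
  {ν : ℝ → Space d → Space d}

lemma isOpen_slice {O : Set (ℝ × Space d)} (hO : IsOpen O) (t : ℝ) : IsOpen {x | (t, x) ∈ O} :=
  hO.preimage (Continuous.prodMk_right t)

lemma surfaceTerm_eq_zero_of_const (hΩ : IsOpen Ω) {O : Set (ℝ × Space d)} (hO : IsOpen O)
    (hOQ : O ⊆ cylinder Ω T) {c : ℝ} (hχ : ∀ p ∈ O, χ p = c) {ξ : ℝ × Space d → Space d}
    (hξ : Differentiable ℝ ξ) (hξO : tsupport ξ ⊆ O) {t : ℝ}
    (hpol : IsGradientPolar Ω (fun x => χ (t, x)) (μ t) (ν t)) :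
    surfaceTerm (μ t) (ν t) ξ t = 0 := by
  have h0 : μ t {x | (t, x) ∈ O} = 0 :=
    hpol.measure_eq_zero_of_const hΩ.measurableSet (isOpen_slice hO t)
      (fun x hx => (hOQ hx).2) (fun x hx => hχ _ hx)
  refine integral_eq_zero_of_ae ?_
  filter_upwards [measure_eq_zero_iff_ae_notMem.mp h0] with x hx
  have hx' : (t, x) ∉ tsupport ξ := fun h => hx (hξO h)
  simp [spaceDiv_eq_zero_of_notMem_tsupport hx', fderiv_slice_eq_zero_of_notMem_tsupport hξ hx']

lemma WeakTransport.locallyIntegrableOn_flux (h : WeakTransport Ω T ρ u ρ₀)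
    {O : Set (ℝ × Space d)} (hO : IsOpen O) (hOQ : O ⊆ cylinder Ω T) :
    LocallyIntegrableOn (fun p => ρ p • u p) O volume := by
  rw [locallyIntegrableOn_iff hO.isLocallyClosed]
  intro K hKO hK
  have hKQ := hKO.trans hOQ
  have h1 := h.flux_integrable.integrableOn_compact_subset
    (fun p hp => ⟨(hKQ hp).1.2, trivial⟩ : K ⊆ Iio T ×ˢ univ) hK
  rw [IntegrableOn, Measure.restrict_restrict hK.measurableSet] at h1
  have h2 : K ∩ Ioo 0 T ×ˢ Ω = K := inter_eq_left.mpr hKQ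
  rwa [h2] at h1

lemma notMem_frontier_of_mem (hΩ : IsOpen Ω) {x : Space d} (hx : x ∈ Ω) : x ∉ frontier Ω := by
  rw [hΩ.frontier_eq]
  exact fun h => h.2 hx

/-- Fields `g • e` supported in one phase satisfy the boundary constraint trivially and are not seen
by `|∇χ|`. Integrating the pressure term by parts removes the constant `lam * c` and leaves the
fundamental lemma. -/
lemma darcy_bulk (hΩ : IsOpen Ω) (hm : 1 ≤ m) (h : WeakTransport Ω T ρ u ρ₀)
    (hy : YoungLaplaceData Ω T m lam ρ χ u μ ν) {O : Set (ℝ × Space d)} (hO : IsOpen O)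
    (hOQ : O ⊆ cylinder Ω T) {r : ℝ × Space d → ℝ} (hr : ∀ p ∈ O, ContDiffAt ℝ 1 r p) {c : ℝ}
    (hρ : ∀ p ∈ O, ρ p = r p) (hχ : ∀ p ∈ O, χ p = c) :
    ∀ᵐ p, p ∈ O → ρ p • u p = -spaceGrad (fun q => r q ^ m) p := by
  set P : ℝ × Space d → ℝ := fun q => r q ^ m with hP
  have hPs : ∀ p ∈ O, ContDiffAt ℝ 1 P p := fun p hp => contDiffAt_rpow hm (hr p hp)
  have hgc : ContinuousOn (spaceGrad P) O := fun p hp =>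
    (contDiffAt_spaceGrad (m := 0) (hPs p hp) (by simp)).continuousAt.continuousWithinAt
  have hloc : LocallyIntegrableOn (fun p => ρ p • u p + spaceGrad P p) O volume :=
    (h.locallyIntegrableOn_flux hO hOQ).add (hgc.locallyIntegrableOn hO.measurableSet)
  have h0 := hO.ae_eq_zero_of_integral_contDiff_smul_eq_zero hloc fun g hg hgc' hgO => by
    have hK := hgc'.isCompact
    have hsupp : ∀ F : ℝ × Space d → Space d, IntegrableOn F (tsupport g) →
        Integrable fun p => g p • F p := by
      intro F hF
      have h1 : IntegrableOn (fun p => g p • F p) (tsupport g) :=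
        hF.continuousOn_smul hg.continuous.continuousOn hK
      refine (integrableOn_iff_integrable_of_support_subset fun x hx => ?_).mp h1
      by_contra hx'
      exact hx (by simp [image_eq_zero_of_notMem_tsupport hx'])
    have hint1 := hsupp _ ((h.locallyIntegrableOn_flux hO hOQ).integrableOn_compact_subset hgO hK)
    have hint2 := hsupp _ ((hgc.mono hgO).integrableOn_compact hK)
    have hint : Integrable fun p => g p • (ρ p • u p + spaceGrad P p) := by
      simp_rw [smul_add]; exact hint1.add hint2
    refine ext_inner_space fun e => ?_
    rw [inner_zero_left, real_inner_comm, ← integral_inner hint]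
    set ξ : ℝ × Space d → Space d := fun p => g p • e with hξ
    have hξg : tsupport ξ ⊆ tsupport g := tsupport_smul_subset_left _ _
    have hξs : ContDiff ℝ ∞ ξ := hg.smul contDiff_const
    have hξc : HasCompactSupport ξ := hasCompactSupport_of_tsupport_subset hgc' hξg
    have hξ1 : ContDiff ℝ 1 ξ := hξs.of_le (by simp)
    have hξt : IsTest T ξ := ⟨hξs, hξc, fun p hp => ⟨(hOQ (hgO (hξg hp))).1.2, trivial⟩⟩
    -- the pressure term
    have hF : ContDiff ℝ 1 fun p => g p • ((P p - lam * c) • e) :=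
      contDiff_smul_of_tsupport (hg.of_le (by simp)) hgO fun p hp =>
        ((hPs p hp).sub contDiffAt_const).smul contDiffAt_const
    have hFg : tsupport (fun p => g p • ((P p - lam * c) • e)) ⊆ tsupport g :=
      tsupport_smul_subset_left _ _
    have hz := integral_spaceDiv_eq_zero hF (hasCompactSupport_of_tsupport_subset hgc' hFg)
    have hpt : ∀ p, spaceDiv (fun p => g p • ((P p - lam * c) • e)) p
        = spaceDiv ξ p * (P p - lam * c) + ⟪e, g p • spaceGrad P p⟫ := by
      intro p
      by_cases hp : p ∈ tsupport g
      · have hPd : DifferentiableAt ℝ P p := (hPs p (hgO hp)).differentiableAt (by simp)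
        have e1 : (fun p => g p • ((P p - lam * c) • e)) = fun p => (P p - lam * c) • ξ p := by
          funext q; simp only [hξ]; rw [smul_comm]
        rw [e1, spaceDiv_smul (hPd.sub_const _) (hξ1.differentiable (by simp) p)]
        have e2 : spaceGrad (fun p => P p - lam * c) p = spaceGrad P p := by
          refine ext_inner_space fun v => ?_
          rw [inner_spaceGrad (hPd.sub_const _), inner_spaceGrad hPd, fderiv_sub_const]
        rw [e2, hξ, real_inner_smul_right, real_inner_smul_right, real_inner_comm e]
        ring
      · rw [spaceDiv_eq_zero_of_notMem_tsupport fun h => hp (hFg h),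
          spaceDiv_eq_zero_of_notMem_tsupport fun h => hp (hξg h),
          image_eq_zero_of_notMem_tsupport hp]
        simp
    have hdiv : Continuous (spaceDiv ξ) := continuous_spaceDiv hξ1
    have hdivs := tsupport_spaceDiv_subset ξ
    have hi1 : Integrable fun p => spaceDiv ξ p * (P p - lam * c) :=
      (continuous_smul_of_tsupport (f := spaceDiv ξ) (g := fun p => P p - lam * c) hdiv
        (hdivs.trans (hξg.trans hgO))
        fun p hp => (hPs p hp).continuousAt.sub continuousAt_const).integrable_of_hasCompactSupport
        (hasCompactSupport_of_tsupport_subset hξc hdivs).mul_right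
    have hi2 : Integrable fun p => ⟪e, g p • spaceGrad P p⟫ := hint2.const_inner e
    simp_rw [hpt] at hz
    rw [integral_add hi1 hi2] at hz
    have hpr : ∀ p, spaceDiv ξ p * pressure m lam ρ χ p = spaceDiv ξ p * (P p - lam * c) := by
      intro p
      by_cases hp : p ∈ O
      · rw [pressure, hρ p hp, hχ p hp]
      · rw [spaceDiv_eq_zero_of_notMem_tsupport fun h => hp (hgO (hξg h)), zero_mul, zero_mul]
    have hoff : ∀ p ∉ cylinder Ω T, p ∉ tsupport g := fun p hp h => hp (hOQ (hgO h))
    have hyl := hy.eq ξ hξt (fun t _ x hx n _ => by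
      rw [image_eq_zero_of_notMem_tsupport fun h' =>
        notMem_frontier_of_mem hΩ (hOQ (hgO (hξg h'))).2 hx, inner_zero_left])
      (by simp_rw [hpr]; exact hi1.integrableOn)
    simp_rw [hpr] at hyl
    rw [setIntegral_eq_integral_of_forall_compl_eq_zero (s := cylinder Ω T) (fun p hp => by
        rw [spaceDiv_eq_zero_of_notMem_tsupport fun h => hoff p hp (hξg h), zero_mul]),
      setIntegral_eq_integral_of_forall_compl_eq_zero (s := cylinder Ω T) (fun p hp => by
        rw [image_eq_zero_of_notMem_tsupport fun h => hoff p hp (hξg h), inner_zero_right]),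
      integral_eq_zero_of_ae] at hyl
    · have e3 : ∀ p, ⟪ρ p • u p, ξ p⟫ = ⟪e, g p • (ρ p • u p)⟫ := fun p => by
        rw [hξ, real_inner_comm, real_inner_smul_left]
        exact (real_inner_smul_right e (ρ p • u p) (g p)).symm
      simp_rw [e3] at hyl
      simp_rw [smul_add, inner_add_right]
      rw [integral_add (hint1.const_inner e) hi2]
      linarith
    · filter_upwards [hy.polar] with t ht
      exact surfaceTerm_eq_zero_of_const hΩ hO hOQ hχ (hξ1.differentiable (by simp))
        (hξg.trans hgO) ht
  filter_upwards [h0] with p hp hpO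
  exact eq_neg_of_add_eq_zero_left (hp hpO)

end Darcy

/-! ### Charts adapted to the two phases -/

/-- On `O` the evolving set is `{φ < 0}` and the density is `r₁` inside and `r₂` outside. -/
structure PhaseChart (Ω : Set (Space d)) (T : ℝ) (ρ χ : ℝ × Space d → ℝ)
    (O : Set (ℝ × Space d)) (φ r₁ r₂ : ℝ × Space d → ℝ) : Prop where
  isOpen : IsOpen O
  lt_T : O ⊆ Iio T ×ˢ univ
  level : ∀ p ∈ O, ContDiffAt ℝ ∞ φ p
  smooth_in : ∀ p ∈ O, ContDiffAt ℝ 3 r₁ p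
  smooth_out : ∀ p ∈ O, ContDiffAt ℝ 3 r₂ p
  density : ∀ p ∈ O, 0 ≤ p.1 → p.2 ∈ Ω → ρ p = if φ p < 0 then r₁ p else r₂ p
  charFun : ∀ p ∈ O, 0 ≤ p.1 → p.2 ∈ Ω → χ p = if φ p < 0 then 1 else 0
  null : volume (O ∩ {p | φ p = 0}) = 0

lemma PhaseChart.mono {Ω : Set (Space d)} {T : ℝ} {ρ χ : ℝ × Space d → ℝ}
    {O O' : Set (ℝ × Space d)} {φ r₁ r₂ : ℝ × Space d → ℝ}
    (h : PhaseChart Ω T ρ χ O φ r₁ r₂) (hO' : IsOpen O') (hO : O' ⊆ O) :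
    PhaseChart Ω T ρ χ O' φ r₁ r₂ :=
  ⟨hO', hO.trans h.lt_T, fun p hp => h.level p (hO hp), fun p hp => h.smooth_in p (hO hp),
    fun p hp => h.smooth_out p (hO hp), fun p hp => h.density p (hO hp),
    fun p hp => h.charFun p (hO hp), measure_mono_null (inter_subset_inter_left _ hO) h.null⟩

lemma exists_phaseChart {Ω : Set (Space d)} {T : ℝ} {E : ℝ → Set (Space d)}
    {ρ χ : ℝ × Space d → ℝ} {r₁ r₂ : ℝ × Space d → ℝ}
    (hχ : ∀ t ∈ Ico 0 T, ∀ x ∈ Ω, χ (t, x) = (E t).indicator (fun _ => (1 : ℝ)) x)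
    (hr₁ : IsSmoothUpTo Ω T r₁) (hr₂ : IsSmoothUpTo Ω T r₂)
    (hρ : ∀ t ∈ Ico 0 T, ∀ x ∈ Ω,
      (x ∈ E t → ρ (t, x) = r₁ (t, x)) ∧ (x ∉ E t → ρ (t, x) = r₂ (t, x)))
    {t : ℝ} (ht : t ∈ Ico 0 T) {x : Space d} (hx : x ∈ closure Ω) {φ : ℝ × Space d → ℝ}
    (hφ : IsLevelSetAt Ω T E (t, x) φ) (hgrad : φ (t, x) = 0 → spaceGrad φ (t, x) ≠ 0)
    {U : Set (ℝ × Space d)} (hU : U ∈ 𝓝 (t, x)) :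
    ∃ O ⊆ U, (t, x) ∈ O ∧ PhaseChart Ω T ρ χ O φ r₁ r₂ ∧
      ∀ p ∈ O, 0 ≤ p.1 → p.2 ∈ Ω → (p.2 ∈ E p.1 ↔ φ p < 0) := by
  -- Either the point lies on a regular level, which is locally null, or `φ` has no zeros nearby.
  have hnull : ∃ N ∈ 𝓝 (t, x), volume (N ∩ {p | φ p = 0}) = 0 := by
    have hc : ContDiffAt ℝ ∞ φ (t, x) := hφ.smooth.self_of_nhds
    by_cases h0 : φ (t, x) = 0
    · refine exists_nhds_level_null volume (hc.of_le (by simp)) fun hd => hgrad h0 ?_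
      refine ext_inner_space fun v => ?_
      rw [inner_spaceGrad (hc.differentiableAt (by simp)), hd, inner_zero_left]; rfl
    · refine ⟨{p | φ p ≠ 0}, hc.continuousAt.eventually_ne h0, ?_⟩
      have : {p | φ p ≠ 0} ∩ {p | φ p = 0} = ∅ := by
        ext p; simp
      rw [this, measure_empty]
  obtain ⟨N, hN, hNn⟩ := hnull
  -- Smoothness of the densities is assumed pointwise, and `C^∞` at a point spreads to a
  -- neighbourhood only for each finite order; a fixed order 3 is enough for everything below.
  have h1 : ∀ᶠ p in 𝓝 (t, x), ContDiffAt ℝ 3 r₁ p :=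
    (contDiffAt_infty.mp (hr₁ t ht x hx) 3).eventually (by simp)
  have h2 : ∀ᶠ p in 𝓝 (t, x), ContDiffAt ℝ 3 r₂ p :=
    (contDiffAt_infty.mp (hr₂ t ht x hx) 3).eventually (by simp)
  have h3 : ∀ᶠ p : ℝ × Space d in 𝓝 (t, x), p.1 < T :=
    continuous_fst.continuousAt.eventually (gt_mem_nhds ht.2)
  obtain ⟨O, hO, hOo, hp⟩ := eventually_nhds_iff.mp
    (h1.and (h2.and (h3.and (hφ.smooth.and (hφ.mem_iff.and
      ((eventually_mem_set.mpr hU).and (eventually_mem_set.mpr hN)))))))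
  refine ⟨O, fun p hp => (hO p hp).2.2.2.2.2.1, hp, ⟨hOo, fun p hp => ⟨(hO p hp).2.2.1, trivial⟩,
    fun p hp => (hO p hp).2.2.2.1, fun p hp => (hO p hp).1, fun p hp => (hO p hp).2.1, ?_, ?_,
    measure_mono_null (inter_subset_inter_left _ fun p hp => (hO p hp).2.2.2.2.2.2) hNn⟩, ?_⟩
  · intro p hp hp0 hpΩ
    have hpt : p.1 ∈ Ico 0 T := ⟨hp0, (hO p hp).2.2.1⟩
    have hiff := (hO p hp).2.2.2.2.1 hpt hpΩ
    by_cases hlt : φ p < 0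
    · rw [if_pos hlt]; exact (hρ p.1 hpt p.2 hpΩ).1 (hiff.mpr hlt)
    · rw [if_neg hlt]; exact (hρ p.1 hpt p.2 hpΩ).2 fun h => hlt (hiff.mp h)
  · intro p hp hp0 hpΩ
    have hpt : p.1 ∈ Ico 0 T := ⟨hp0, (hO p hp).2.2.1⟩
    have hiff := (hO p hp).2.2.2.2.1 hpt hpΩ
    have := hχ p.1 hpt p.2 hpΩ
    by_cases hlt : φ p < 0
    · rw [if_pos hlt, ← indicator_of_mem (hiff.mpr hlt) fun _ => (1 : ℝ)]; exact this
    · rw [if_neg hlt, ← indicator_of_notMem (fun h => hlt (hiff.mp h)) fun _ => (1 : ℝ)]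
      exact this
  · intro p hp hp0 hpΩ
    exact (hO p hp).2.2.2.2.1 ⟨hp0, (hO p hp).2.2.1⟩ hpΩ

section ChartDarcy

variable {Ω : Set (Space d)} {T m lam : ℝ} {ρ χ : ℝ × Space d → ℝ}
  {u : ℝ × Space d → Space d} {ρ₀ : Space d → ℝ} {μ : ℝ → Measure (Space d)}
  {ν : ℝ → Space d → Space d} {O : Set (ℝ × Space d)} {φ r₁ r₂ : ℝ × Space d → ℝ}

lemma PhaseChart.isOpen_neg (hc : PhaseChart Ω T ρ χ O φ r₁ r₂) : IsOpen (O ∩ {p | φ p < 0}) :=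
  ContinuousOn.isOpen_inter_preimage
    (fun q hq => (hc.level q hq).continuousAt.continuousWithinAt) hc.isOpen isOpen_Iio

lemma PhaseChart.isOpen_pos (hc : PhaseChart Ω T ρ χ O φ r₁ r₂) : IsOpen (O ∩ {p | 0 < φ p}) :=
  ContinuousOn.isOpen_inter_preimage
    (fun q hq => (hc.level q hq).continuousAt.continuousWithinAt) hc.isOpen isOpen_Ioi

lemma PhaseChart.integrableOn_density (hc : PhaseChart Ω T ρ χ O φ r₁ r₂) (hΩ : IsOpen Ω)
    {G : ℝ × Space d → ℝ}
    (hG : Continuous G) (hGc : HasCompactSupport G) (hGO : tsupport G ⊆ O) :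
    IntegrableOn (fun p => G p * ρ p) (cylinder Ω T) := by
  have h1 := integrable_mul_ite (volume.restrict (cylinder Ω T)) hc.isOpen hG hGc hGO
    (fun q hq => (hc.level q hq).continuousAt) (fun q hq => (hc.smooth_in q hq).continuousAt)
    (fun q hq => (hc.smooth_out q hq).continuousAt)
  refine h1.congr ?_
  filter_upwards [ae_restrict_mem (isOpen_cylinder hΩ T).measurableSet] with p hp
  by_cases hpO : p ∈ O
  · rw [hc.density p hpO hp.1.1.le hp.2]
  · rw [image_eq_zero_of_notMem_tsupport fun h => hpO (hGO h), zero_mul, zero_mul]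

lemma PhaseChart.pressure_eq (hc : PhaseChart Ω T ρ χ O φ r₁ r₂) {p : ℝ × Space d} (hp : p ∈ O)
    (hp0 : 0 ≤ p.1) (hpΩ : p.2 ∈ Ω) :
    pressure m lam ρ χ p = if φ p < 0 then r₁ p ^ m - lam else r₂ p ^ m := by
  rw [pressure, hc.density p hp hp0 hpΩ, hc.charFun p hp hp0 hpΩ]
  split_ifs <;> simp

lemma PhaseChart.contDiffAt_rpow_in (hc : PhaseChart Ω T ρ χ O φ r₁ r₂) (hm : 1 ≤ m)
    {p : ℝ × Space d} (hp : p ∈ O) : ContDiffAt ℝ 1 (fun q => r₁ q ^ m) p :=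
  contDiffAt_rpow hm ((hc.smooth_in p hp).of_le (by norm_num))

lemma PhaseChart.contDiffAt_rpow_out (hc : PhaseChart Ω T ρ χ O φ r₁ r₂) (hm : 1 ≤ m)
    {p : ℝ × Space d} (hp : p ∈ O) : ContDiffAt ℝ 1 (fun q => r₂ q ^ m) p :=
  contDiffAt_rpow hm ((hc.smooth_out p hp).of_le (by norm_num))

lemma PhaseChart.integrableOn_pressure (hc : PhaseChart Ω T ρ χ O φ r₁ r₂) (hΩ : IsOpen Ω)
    (hm : 1 ≤ m) {G : ℝ × Space d → ℝ}
    (hG : Continuous G) (hGc : HasCompactSupport G) (hGO : tsupport G ⊆ O) :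
    IntegrableOn (fun p => G p * pressure m lam ρ χ p) (cylinder Ω T) := by
  have h1 := integrable_mul_ite (volume.restrict (cylinder Ω T)) hc.isOpen hG hGc hGO
    (q₁ := fun p => r₁ p ^ m - lam) (q₂ := fun p => r₂ p ^ m)
    (fun q hq => (hc.level q hq).continuousAt)
    (fun q hq => (hc.contDiffAt_rpow_in hm hq).continuousAt.sub continuousAt_const)
    (fun q hq => (hc.contDiffAt_rpow_out hm hq).continuousAt)
  refine h1.congr ?_
  filter_upwards [ae_restrict_mem (isOpen_cylinder hΩ T).measurableSet] with p hp
  by_cases hpO : p ∈ O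
  · rw [hc.pressure_eq hpO hp.1.1.le hp.2]
  · rw [image_eq_zero_of_notMem_tsupport fun h => hpO (hGO h), zero_mul, zero_mul]

/-- Darcy's law almost everywhere in a chart. -/
lemma PhaseChart.darcy_ae (hc : PhaseChart Ω T ρ χ O φ r₁ r₂) (hΩ : IsOpen Ω) (hm : 1 ≤ m)
    (h : WeakTransport Ω T ρ u ρ₀) (hy : YoungLaplaceData Ω T m lam ρ χ u μ ν) :
    ∀ᵐ p, p ∈ O ∩ cylinder Ω T → φ p ≠ 0 ∧ ρ p • u p =
      -(if φ p < 0 then spaceGrad (fun q => r₁ q ^ m) p else spaceGrad (fun q => r₂ q ^ m) p) := by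
  have h1 := darcy_bulk hΩ hm h hy (r := r₁) (c := 1)
    (hc.isOpen_neg.inter (isOpen_cylinder hΩ T)) inter_subset_right
    (fun p hp => (hc.smooth_in p hp.1.1).of_le (by norm_num))
    (fun p hp => by rw [hc.density p hp.1.1 hp.2.1.1.le hp.2.2, if_pos (show φ p < 0 from hp.1.2)])
    (fun p hp => by rw [hc.charFun p hp.1.1 hp.2.1.1.le hp.2.2, if_pos (show φ p < 0 from hp.1.2)])
  have h2 := darcy_bulk hΩ hm h hy (r := r₂) (c := 0)
    (hc.isOpen_pos.inter (isOpen_cylinder hΩ T)) inter_subset_right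
    (fun p hp => (hc.smooth_out p hp.1.1).of_le (by norm_num))
    (fun p hp => by rw [hc.density p hp.1.1 hp.2.1.1.le hp.2.2, if_neg (not_lt.mpr (le_of_lt hp.1.2))])
    (fun p hp => by rw [hc.charFun p hp.1.1 hp.2.1.1.le hp.2.2, if_neg (not_lt.mpr (le_of_lt hp.1.2))])
  filter_upwards [h1, h2, measure_eq_zero_iff_ae_notMem.mp hc.null] with p h1 h2 h3 hp
  have hne : φ p ≠ 0 := fun h => h3 ⟨hp.1, h⟩
  refine ⟨hne, ?_⟩
  rcases lt_or_gt_of_ne hne with hlt | hgt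
  · rw [if_pos hlt, h1 ⟨⟨hp.1, hlt⟩, hp.2⟩]
  · rw [if_neg (not_lt.mpr hgt.le), h2 ⟨⟨hp.1, hgt⟩, hp.2⟩]

end ChartDarcy

/-! ### Consequences of the transport equation -/

lemma spaceGrad_comp_snd (b : Space d → ℝ) (p : ℝ × Space d) :
    spaceGrad (fun q => b q.2) p = gradient b p.2 := rfl

lemma timeDeriv_comp_snd (b : Space d → ℝ) (p : ℝ × Space d) :
    timeDeriv (fun q => b q.2) p = 0 := by
  simp [timeDeriv]

lemma fderiv_ne_zero_of_spaceGrad_ne_zero {f : ℝ × Space d → ℝ} {p : ℝ × Space d}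
    (hf : DifferentiableAt ℝ f p) (h : spaceGrad f p ≠ 0) : fderiv ℝ f p ≠ 0 := fun hd => h <| by
  refine ext_inner_space fun v => ?_
  rw [inner_spaceGrad hf, hd, inner_zero_left]; rfl

section Transport

variable {Ω : Set (Space d)} {T m lam : ℝ} {ρ χ : ℝ × Space d → ℝ}
  {u : ℝ × Space d → Space d} {ρ₀ : Space d → ℝ} {μ : ℝ → Measure (Space d)}
  {ν : ℝ → Space d → Space d} {O : Set (ℝ × Space d)} {φ r₁ r₂ : ℝ × Space d → ℝ}

/-- In `WeakTransport.concentrated_eq` the undifferentiated profile tends to zero off a null set,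
and the initial datum is invisible because the chart lies in positive time. -/
lemma PhaseChart.tendsto_transport_concentrated (hc : PhaseChart Ω T ρ χ O φ r₁ r₂)
    (hΩ : IsOpen Ω) (h : WeakTransport Ω T ρ u ρ₀) (hO0 : ∀ p ∈ O, 0 < p.1)
    {ψ : ℝ × Space d → ℝ} (hψ : ∀ p ∈ O, ContDiffAt ℝ ∞ ψ p)
    (hnull : volume (O ∩ {p | ψ p = 0}) = 0) {f : ℝ × Space d → ℝ} (hf : ContDiff ℝ ∞ f)
    (hfc : HasCompactSupport f) (hfO : tsupport f ⊆ O) :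
    Tendsto (fun ε : ℝ => ∫ p in cylinder Ω T, ε⁻¹ * deriv hump (ψ p / ε) * f p *
        (timeDeriv ψ p * ρ p + ⟪ρ p • u p, spaceGrad ψ p⟫)) (𝓝[>] 0) (𝓝 0) := by
  have hceq := h.concentrated_eq hc.isOpen hc.lt_T hψ hf hfc hfO
    fun G hG hGc hGO => hc.integrableOn_density hΩ hG hGc hGO
  have hf0 : ∀ x, f (0, x) = 0 := fun x =>
    image_eq_zero_of_notMem_tsupport fun h => lt_irrefl _ (hO0 _ (hfO h))
  have hlim := tendsto_integral_hump (volume.restrict (cylinder Ω T)) hc.isOpen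
    (fun q hq => (hψ q hq).continuousAt) (hceq 1).1
    (fun q hq => by
      have hq' : q ∉ tsupport f := fun h => hq (hfO h)
      rw [timeDeriv_eq_zero_of_notMem_tsupport hq', spaceGrad_eq_zero_of_notMem_tsupport hq']
      simp) (by
      rw [← nonpos_iff_eq_zero, ← hnull]
      exact Measure.restrict_apply_le _ _)
  have hlim' := hlim.neg
  rw [neg_zero] at hlim'
  refine hlim'.congr fun ε => ?_
  rw [(hceq ε).2]
  simp [hf0]

/-- The Rankine-Hugoniot condition at interior interface points. -/
lemma PhaseChart.mass_jump (hc : PhaseChart Ω T ρ χ O φ r₁ r₂) (hΩ : IsOpen Ω) (hm : 1 ≤ m)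
    (h : WeakTransport Ω T ρ u ρ₀) (hy : YoungLaplaceData Ω T m lam ρ χ u μ ν)
    {p : ℝ × Space d} (hp : p ∈ O) (hpQ : p ∈ cylinder Ω T) (h0 : φ p = 0)
    (hgrad : spaceGrad φ p ≠ 0) :
    timeDeriv φ p * r₁ p - ⟪spaceGrad (fun q => r₁ q ^ m) p, spaceGrad φ p⟫
      = timeDeriv φ p * r₂ p - ⟪spaceGrad (fun q => r₂ q ^ m) p, spaceGrad φ p⟫ := by
  set O' := O ∩ cylinder Ω T with hO'
  have hc' : PhaseChart Ω T ρ χ O' φ r₁ r₂ :=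
    hc.mono (hc.isOpen.inter (isOpen_cylinder hΩ T)) inter_subset_left
  have hcont : ∀ r : ℝ × Space d → ℝ, ∀ q ∈ O', ContDiffAt ℝ 3 r q → ContinuousAt (fun q =>
      timeDeriv φ q * r q - ⟪spaceGrad (fun q => r q ^ m) q, spaceGrad φ q⟫) q := by
    intro r q hq hr
    have h1 := (contDiffAt_timeDeriv (m := 0) (hc'.level q hq) (by simp)).continuousAt
    have h2 := (contDiffAt_spaceGrad (m := 0) (hc'.level q hq) (by simp)).continuousAt
    have h3 := (contDiffAt_spaceGrad (m := 0)
      (contDiffAt_rpow hm (hr.of_le (by norm_num))) (by simp)).continuousAt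
    exact (h1.mul hr.continuousAt).sub (h3.inner h2)
  -- The traces are `∂ₜφ ρ + ρ u · ∇φ` from either side, with the flux replaced through Darcy's law,
  -- which holds almost everywhere.
  refine trace_eq_of_tendsto_concentrated volume hc'.isOpen ⟨hp, hpQ⟩ hc'.level h0
    (fderiv_ne_zero_of_spaceGrad_ne_zero ((hc.level p hp).differentiableAt (by simp)) hgrad)
    (fun q hq => hcont r₁ q hq (hc'.smooth_in q hq))
    (fun q hq => hcont r₂ q hq (hc'.smooth_out q hq)) fun f hf hfc hfO _ => ?_
  refine (hc'.tendsto_transport_concentrated hΩ h (fun p hp => hp.2.1.1) hc'.level hc'.null hf hfc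
    hfO).congr fun ε => ?_
  rw [setIntegral_eq_integral_of_forall_compl_eq_zero (fun p hp => by
    rw [image_eq_zero_of_notMem_tsupport fun h => hp (hfO h).2]; simp)]
  refine integral_congr_ae ?_
  filter_upwards [hc.darcy_ae hΩ hm h hy] with q hq
  by_cases hqO : q ∈ O'
  · rw [(hq hqO).2, hc.density q hqO.1 hqO.2.1.1.le hqO.2.2]
    split_ifs <;> rw [inner_neg_left, sub_eq_add_neg]
  · rw [image_eq_zero_of_notMem_tsupport fun h => hqO (hfO h)]; simp

lemma PhaseChart.exists_sign_const (hc : PhaseChart Ω T ρ χ O φ r₁ r₂) {p : ℝ × Space d}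
    (hp : p ∈ O) (hne : φ p ≠ 0) : ∃ O' ⊆ O, p ∈ O' ∧ PhaseChart Ω T ρ χ O' φ r₁ r₂ ∧
      ∀ q ∈ O', (φ q < 0 ↔ φ p < 0) ∧ φ q ≠ 0 := by
  rcases lt_or_gt_of_ne hne with h | h
  · exact ⟨_, inter_subset_left, ⟨hp, h⟩, hc.mono hc.isOpen_neg inter_subset_left,
      fun q hq => ⟨⟨fun _ => h, fun _ => hq.2⟩, ne_of_lt hq.2⟩⟩
  · exact ⟨_, inter_subset_left, ⟨hp, h⟩, hc.mono hc.isOpen_pos inter_subset_left,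
      fun q hq => ⟨⟨fun h' => absurd h' (not_lt.mpr (le_of_lt hq.2)),
        fun h' => absurd h' (not_lt.mpr h.le)⟩, ne_of_gt hq.2⟩⟩

/-- The no-flux condition at boundary points away from the interface. -/
lemma PhaseChart.no_flux (hc : PhaseChart Ω T ρ χ O φ r₁ r₂) (hΩ : IsOpen Ω) (hm : 1 ≤ m)
    (h : WeakTransport Ω T ρ u ρ₀) (hy : YoungLaplaceData Ω T m lam ρ χ u μ ν)
    {p : ℝ × Space d} (hp : p ∈ O) (hp0 : 0 < p.1) (hne : φ p ≠ 0) {b : Space d → ℝ}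
    (hb : ∀ q ∈ O, ContDiffAt ℝ ∞ b q.2) (hbΩ : ∀ q ∈ O, q.2 ∈ Ω ↔ b q.2 < 0) (hb0 : b p.2 = 0)
    (hbg : gradient b p.2 ≠ 0) :
    ⟪spaceGrad (fun q => (if φ p < 0 then r₁ else r₂) q ^ m) p, gradient b p.2⟫ = 0 := by
  obtain ⟨O₁, hO₁, hpO₁, hc₁, hsign⟩ := hc.exists_sign_const hp hne
  set ψ : ℝ × Space d → ℝ := fun q => b q.2 with hψ
  have hψs : ∀ q ∈ O, ContDiffAt ℝ ∞ ψ q := fun q hq =>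
    (hb q hq).comp q contDiffAt_snd
  have hdψ : fderiv ℝ ψ p ≠ 0 :=
    fderiv_ne_zero_of_spaceGrad_ne_zero ((hψs p hp).differentiableAt (by simp)) hbg
  obtain ⟨N, hN, hNn⟩ := exists_nhds_level_null volume ((hψs p hp).of_le (by simp)) hdψ
  obtain ⟨N', hN'N, hN'o, hpN'⟩ := mem_nhds_iff.mp hN
  set O' := O₁ ∩ (N' ∩ Ioi 0 ×ˢ univ) with hO'
  have hO'o : IsOpen (N' ∩ Ioi (0 : ℝ) ×ˢ (univ : Set (Space d))) :=
    hN'o.inter (isOpen_Ioi.prod isOpen_univ)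
  have hc' : PhaseChart Ω T ρ χ O' φ r₁ r₂ :=
    hc₁.mono (hc₁.isOpen.inter hO'o) inter_subset_left
  have hO'O : O' ⊆ O := inter_subset_left.trans hO₁
  have hpO' : p ∈ O' := ⟨hpO₁, hpN', hp0, trivial⟩
  set r := if φ p < 0 then r₁ else r₂ with hr
  have hrs : ∀ q ∈ O', ContDiffAt ℝ 1 (fun q => r q ^ m) q := fun q hq => by
    rw [hr]; split_ifs
    · exact hc'.contDiffAt_rpow_in hm hq
    · exact hc'.contDiffAt_rpow_out hm hq
  have hQ : ∀ q ∈ O', q ∈ cylinder Ω T ↔ ψ q < 0 := fun q hq =>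
    ⟨fun h => (hbΩ q (hO'O hq)).mp h.2, fun h => ⟨⟨hq.2.2.1, (hc'.lt_T hq).1⟩,
      (hbΩ q (hO'O hq)).mpr h⟩⟩
  -- The integrals extend by zero across `∂Ω`, so the trace from outside is 0, and the normal flux
  -- from inside must equal it. The time derivative of `b` vanishes.
  have key := trace_eq_of_tendsto_concentrated volume hc'.isOpen hpO' (ψ := ψ)
    (q₁ := fun q => -⟪spaceGrad (fun q => r q ^ m) q, gradient b q.2⟫) (q₂ := fun _ => 0)
    (fun q hq => hψs q (hO'O hq)) hb0 hdψ (fun q hq => by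
      have h2 := (contDiffAt_spaceGrad (m := 0) (hψs q (hO'O hq)) (by simp)).continuousAt
      have h3 := (contDiffAt_spaceGrad (m := 0) (hrs q hq) (by simp)).continuousAt
      exact (h3.inner h2).neg) (fun q _ => continuousAt_const) fun f hf hfc hfO _ => by
    refine (hc'.tendsto_transport_concentrated hΩ h (fun p hp => hp.2.2.1)
      (fun q hq => hψs q (hO'O hq)) (measure_mono_null (inter_subset_inter_left _
        fun q hq => hN'N hq.2.1) hNn) hf hfc hfO).congr fun ε => ?_
    rw [← integral_indicator (isOpen_cylinder hΩ T).measurableSet]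
    refine integral_congr_ae ?_
    filter_upwards [hc'.darcy_ae hΩ hm h hy] with q hq
    by_cases hqO : q ∈ O'
    · by_cases hqQ : q ∈ cylinder Ω T
      · rw [indicator_of_mem hqQ, (hq ⟨hqO, hqQ⟩).2, if_pos ((hQ q hqO).mp hqQ), hψ,
          timeDeriv_comp_snd, spaceGrad_comp_snd, hr, inner_neg_left, zero_mul, zero_add]
        by_cases hs : φ p < 0
        · rw [if_pos ((hsign q hqO.1).1.mpr hs), if_pos hs]
        · rw [if_neg fun h' => hs ((hsign q hqO.1).1.mp h'), if_neg hs]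
      · rw [indicator_of_notMem hqQ, if_neg fun h' => hqQ ((hQ q hqO).mpr h'), mul_zero]
    · rw [image_eq_zero_of_notMem_tsupport fun h => hqO (hfO h)]
      simp [indicator, image_eq_zero_of_notMem_tsupport fun h => hqO (hfO h)]
  simpa using key

/-- The continuity equation at interior points near which the pressure is `C²`. -/
lemma PhaseChart.continuity_equation (hc : PhaseChart Ω T ρ χ O φ r₁ r₂) (hΩ : IsOpen Ω)
    (h : WeakTransport Ω T ρ u ρ₀)
    {r : ℝ × Space d → ℝ} (hOQ : O ⊆ cylinder Ω T)
    (hr : ∀ q ∈ O, ContDiffAt ℝ 3 r q) (hρ : ∀ q ∈ O, ρ q = r q)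
    (hflux : ∀ᵐ q, q ∈ O → ρ q • u q = -spaceGrad (fun q => r q ^ m) q)
    (hP : ∀ q ∈ O, ContDiffAt ℝ 2 (fun q => r q ^ m) q) {p : ℝ × Space d} (hp : p ∈ O) :
    timeDeriv r p = spaceDiv (spaceGrad (fun q => r q ^ m)) p := by
  set P : ℝ × Space d → ℝ := fun q => r q ^ m with hPdef
  have hO := hc.isOpen
  have hr1 : ∀ q ∈ O, ContDiffAt ℝ 1 r q := fun q hq => (hr q hq).of_le (by norm_num)
  have hPg : ∀ q ∈ O, ContDiffAt ℝ 1 (spaceGrad P) q := fun q hq =>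
    contDiffAt_spaceGrad (hP q hq) (by norm_num)
  have hcr : ∀ q ∈ O, ContinuousAt (timeDeriv r) q := fun q hq =>
    (contDiffAt_timeDeriv (m := 0) (hr1 q hq) (by simp)).continuousAt
  have hcd : ∀ q ∈ O, ContinuousAt (spaceDiv (spaceGrad P)) q := fun q hq =>
    (contDiffAt_spaceDiv (m := 0) (hPg q hq) (by simp)).continuousAt
  have hcont : ContinuousOn (fun q => timeDeriv r q - spaceDiv (spaceGrad P) q) O := fun q hq =>
    ((hcr q hq).sub (hcd q hq)).continuousWithinAt
  have h0 := hO.ae_eq_zero_of_integral_contDiff_smul_eq_zero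
    (hcont.locallyIntegrableOn hO.measurableSet (μ := volume)) fun g hg hgc hgO => by
    have hg1 : ContDiff ℝ 1 g := hg.of_le (by simp)
    have hgd : ∀ q, DifferentiableAt ℝ g q := hg1.differentiable (by simp)
    have ht := h.eq_cylinder ⟨hg, hgc, hgO.trans hc.lt_T⟩
      (hc.integrableOn_density hΩ (continuous_timeDeriv hg1)
        (hasCompactSupport_of_tsupport_subset hgc (tsupport_timeDeriv_subset g))
        ((tsupport_timeDeriv_subset g).trans hgO))
    have hg0 : ∀ x, g (0, x) = 0 := fun x =>
      image_eq_zero_of_notMem_tsupport fun h => lt_irrefl _ (hOQ (hgO h)).1.1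
    simp only [hg0, mul_zero, integral_zero, neg_zero] at ht
    have hoff : ∀ q ∉ cylinder Ω T, q ∉ tsupport g := fun q hq h => hq (hOQ (hgO h))
    rw [setIntegral_eq_integral_of_forall_compl_eq_zero (fun q hq => by
      rw [timeDeriv_eq_zero_of_notMem_tsupport (hoff q hq),
        spaceGrad_eq_zero_of_notMem_tsupport (hoff q hq), zero_mul, inner_zero_right, add_zero])] at ht
    have ht' : ∫ q, (timeDeriv g q * r q - ⟪spaceGrad P q, spaceGrad g q⟫) = 0 := by
      rw [← ht]
      refine integral_congr_ae ?_
      filter_upwards [hflux] with q hq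
      by_cases hqO : q ∈ O
      · rw [hq hqO, hρ q hqO, inner_neg_left, sub_eq_add_neg]
      · have hq' : q ∉ tsupport g := fun h => hqO (hgO h)
        rw [timeDeriv_eq_zero_of_notMem_tsupport hq', spaceGrad_eq_zero_of_notMem_tsupport hq']
        simp
    -- integrate by parts
    have hF1 : ContDiff ℝ 1 fun q => g q * r q := contDiff_mul_of_tsupport hg1 hgO hr1
    have hF2 : ContDiff ℝ 1 fun q => g q • spaceGrad P q := contDiff_smul_of_tsupport hg1 hgO hPg
    have hs1 : tsupport (fun q => g q * r q) ⊆ tsupport g := tsupport_mul_subset_left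
    have hs2 : tsupport (fun q => g q • spaceGrad P q) ⊆ tsupport g := tsupport_smul_subset_left _ _
    have hc1 := hasCompactSupport_of_tsupport_subset hgc hs1
    have hc2 := hasCompactSupport_of_tsupport_subset hgc hs2
    have hz1 := integral_timeDeriv_eq_zero hF1 hc1
    have hz2 := integral_spaceDiv_eq_zero hF2 hc2
    have hi1 : Integrable (timeDeriv fun q => g q * r q) :=
      (continuous_timeDeriv hF1).integrable_of_hasCompactSupport
        (hasCompactSupport_of_tsupport_subset hc1 (tsupport_timeDeriv_subset _))
    have hi2 : Integrable (spaceDiv fun q => g q • spaceGrad P q) :=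
      (continuous_spaceDiv hF2).integrable_of_hasCompactSupport
        (hasCompactSupport_of_tsupport_subset hc2 (tsupport_spaceDiv_subset _))
    have hi3 : Integrable fun q => g q • (timeDeriv r q - spaceDiv (spaceGrad P) q) := by
      refine Continuous.integrable_of_hasCompactSupport
        (continuous_smul_of_tsupport (O := O) hg.continuous hgO fun q hq =>
          (hcr q hq).sub (hcd q hq)) ?_
      exact hasCompactSupport_of_tsupport_subset hgc (tsupport_smul_subset_left _ _)
    have hpt : ∀ q, timeDeriv g q * r q - ⟪spaceGrad P q, spaceGrad g q⟫ =
        timeDeriv (fun q => g q * r q) q - spaceDiv (fun q => g q • spaceGrad P q) q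
          - g q • (timeDeriv r q - spaceDiv (spaceGrad P) q) := by
      intro q
      by_cases hq : q ∈ tsupport g
      · rw [timeDeriv_mul (hgd q) ((hr1 q (hgO hq)).differentiableAt (by simp)),
          spaceDiv_smul (hgd q) ((hPg q (hgO hq)).differentiableAt (by simp)), real_inner_comm]
        simp only [smul_eq_mul]
        ring
      · rw [timeDeriv_eq_zero_of_notMem_tsupport hq, spaceGrad_eq_zero_of_notMem_tsupport hq,
          timeDeriv_eq_zero_of_notMem_tsupport fun h => hq (hs1 h),
          spaceDiv_eq_zero_of_notMem_tsupport fun h => hq (hs2 h),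
          image_eq_zero_of_notMem_tsupport hq]
        simp
    simp_rw [hpt] at ht'
    have hi12 : Integrable fun q => timeDeriv (fun q => g q * r q) q
        - spaceDiv (fun q => g q • spaceGrad P q) q := hi1.sub hi2
    rw [integral_sub hi12 hi3, integral_sub hi1 hi2, hz1, hz2] at ht'
    linarith
  -- Both sides are continuous on the open set, so the almost everywhere identity holds at every
  -- point.
  have h1 : (fun q => timeDeriv r q - spaceDiv (spaceGrad P) q) =ᵐ[volume.restrict O] fun _ => 0 := by
    rw [Filter.EventuallyEq, ae_restrict_iff' hO.measurableSet]
    exact h0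
  have h2 := Measure.eqOn_open_of_ae_eq h1 hO hcont continuousOn_const hp
  simpa [sub_eq_zero] using h2

end Transport

/-! ### The initial condition -/

lemma hasCompactSupport_slice {f : ℝ × Space d → ℝ} (hfc : HasCompactSupport f) (t : ℝ) :
    HasCompactSupport fun x => f (t, x) := by
  refine HasCompactSupport.of_support_subset_isCompact (hfc.isCompact.image continuous_snd)
    fun x hx => ⟨(t, x), subset_tsupport _ hx, rfl⟩

lemma tsupport_slice_subset (f : ℝ × Space d → ℝ) (t : ℝ) :
    tsupport (fun x => f (t, x)) ⊆ {x | (t, x) ∈ tsupport f} :=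
  closure_minimal (fun _ hx => subset_tsupport f hx)
    ((isClosed_tsupport f).preimage (Continuous.prodMk_right t))

/-- For almost every `x` in the slice at `t₀` the sign of `φ (t, x)` does not change for `t` near
`t₀`, because `{φ (t₀, ·) = 0}` is null there. Hence the moving jump does not spoil dominated
convergence. -/
lemma tendsto_integral_slice {O : Set (ℝ × Space d)} (hO : IsOpen O) {f φ r₁ r₂ : ℝ × Space d → ℝ}
    (hf : Continuous f) (hfc : HasCompactSupport f) (hfO : tsupport f ⊆ O)
    (hφ : ∀ p ∈ O, ContinuousAt φ p) (hr₁ : ∀ p ∈ O, ContinuousAt r₁ p)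
    (hr₂ : ∀ p ∈ O, ContinuousAt r₂ p) {t₀ : ℝ}
    (hnull : volume {x | (t₀, x) ∈ O ∧ φ (t₀, x) = 0} = 0) :
    Tendsto (fun t => ∫ x, f (t, x) * (if φ (t, x) < 0 then r₁ (t, x) else r₂ (t, x))) (𝓝 t₀)
      (𝓝 (∫ x, f (t₀, x) * (if φ (t₀, x) < 0 then r₁ (t₀, x) else r₂ (t₀, x)))) := by
  have hs : ∀ {g : ℝ × Space d → ℝ} {t : ℝ} {x : Space d}, ContinuousAt g (t, x) →
      ContinuousAt (fun y => g (t, y)) x := fun hg =>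
    ContinuousAt.comp (f := fun y => (_, y)) hg (Continuous.prodMk_right _).continuousAt
  have hs' : ∀ {g : ℝ × Space d → ℝ} {t : ℝ} {x : Space d}, ContinuousAt g (t, x) →
      Tendsto (fun s => g (s, x)) (𝓝 t) (𝓝 (g (t, x))) := fun hg =>
    ContinuousAt.comp (f := fun s => (s, _)) hg (Continuous.prodMk_left _).continuousAt
  have hb : ∀ r : ℝ × Space d → ℝ, (∀ p ∈ O, ContinuousAt r p) → ∃ C, ∀ p, ‖f p * r p‖ ≤ C :=
    fun r hr => (HasCompactSupport.mul_right (f' := r) hfc).exists_bound_of_continuous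
      (continuous_smul_of_tsupport hf hfO hr)
  obtain ⟨C₁, hC₁⟩ := hb r₁ hr₁
  obtain ⟨C₂, hC₂⟩ := hb r₂ hr₂
  set K := Prod.snd '' tsupport f with hK
  have hKc : IsCompact K := hfc.isCompact.image continuous_snd
  have hoff : ∀ t x, x ∉ K → f (t, x) = 0 := fun t x hx =>
    image_eq_zero_of_notMem_tsupport fun h => hx ⟨_, h, rfl⟩
  refine tendsto_integral_filter_of_dominated_convergence (K.indicator fun _ => max C₁ C₂)
    (Eventually.of_forall fun t => ?_) (Eventually.of_forall fun t => Eventually.of_forall fun x => ?_)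
    ?_ ?_
  · exact (integrable_mul_ite volume (O := {x | (t, x) ∈ O}) (isOpen_slice hO t)
      (hf.comp (Continuous.prodMk_right t)) (hasCompactSupport_slice hfc t)
      ((tsupport_slice_subset f t).trans fun x hx => hfO hx)
      (fun x hx => hs (hφ _ hx)) (fun x hx => hs (hr₁ _ hx))
      (fun x hx => hs (hr₂ _ hx))).aestronglyMeasurable
  · by_cases hx : x ∈ K
    · rw [indicator_of_mem hx]
      split_ifs
      · exact (hC₁ _).trans (le_max_left _ _)
      · exact (hC₂ _).trans (le_max_right _ _)
    · rw [indicator_of_notMem hx, hoff t x hx, zero_mul, norm_zero]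
  · exact (integrable_indicator_iff hKc.measurableSet).mpr
      (integrableOn_const hKc.measure_lt_top.ne)
  · filter_upwards [measure_eq_zero_iff_ae_notMem.mp hnull] with x hx
    by_cases hxO : (t₀, x) ∈ O
    · have hne : φ (t₀, x) ≠ 0 := fun h => hx ⟨hxO, h⟩
      rcases lt_or_gt_of_ne hne with h | h
      · rw [if_pos h]
        refine ((hs' hf.continuousAt).mul (hs' (hr₁ _ hxO))).congr' ?_
        filter_upwards [(hs' (hφ _ hxO)).eventually_lt_const h] with t ht
        rw [if_pos ht]
      · rw [if_neg h.not_gt]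
        refine ((hs' hf.continuousAt).mul (hs' (hr₂ _ hxO))).congr' ?_
        filter_upwards [(hs' (hφ _ hxO)).eventually_const_lt h] with t ht
        rw [if_neg ht.not_gt]
    · have h0 : ∀ᶠ t in 𝓝 t₀, f (t, x) = 0 := by
        have hcl : (tsupport f)ᶜ ∈ 𝓝 (t₀, x) :=
          (isClosed_tsupport f).isOpen_compl.mem_nhds fun h => hxO (hfO h)
        have hc : ContinuousAt (fun t : ℝ => (t, x)) t₀ := (Continuous.prodMk_left x).continuousAt
        filter_upwards [hc hcl] with t ht
        exact image_eq_zero_of_notMem_tsupport ht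
      refine Tendsto.congr' (f₁ := fun _ => f (t₀, x) *
        (if φ (t₀, x) < 0 then r₁ (t₀, x) else r₂ (t₀, x))) ?_ tendsto_const_nhds
      filter_upwards [h0] with t ht
      rw [ht, h0.self_of_nhds, zero_mul, zero_mul]

lemma integral_deriv_hump_div {T ε : ℝ} (hε : 0 < ε) (hεT : ε ≤ T) :
    ∫ t in Ioo 0 T, ε⁻¹ * deriv hump (t / ε) = -1 := by
  rw [← integral_Ioc_eq_integral_Ioo, ← intervalIntegral.integral_of_le (hε.le.trans hεT)]
  have hd : ∀ t ∈ uIcc 0 T, HasDerivAt (fun t => hump (t / ε)) (ε⁻¹ * deriv hump (t / ε)) t := by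
    intro t _
    have := (differentiable_hump (t / ε)).hasDerivAt.comp t ((hasDerivAt_id t).div_const ε)
    exact this.congr_deriv (by rw [one_div, mul_comm])
  rw [intervalIntegral.integral_eq_sub_of_hasDerivAt hd
    (((continuous_deriv_hump.comp (continuous_id.div_const ε)).const_mul _).intervalIntegrable _ _)]
  rw [zero_div, hump_zero, hump_eq_zero, zero_sub]
  rw [abs_of_nonneg (div_nonneg (hε.le.trans hεT) hε.le)]
  exact (one_le_div hε).mpr hεT

/-- For small `ε`, `-ε⁻¹ hump'(t/ε)` is a nonnegative kernel of mass one on `(0, T)` that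
concentrates at zero: a one-sided approximate identity. -/
lemma tendsto_integral_hump_initial {T : ℝ} (hT : 0 < T) {A : ℝ → ℝ} {a : ℝ}
    (hA : Tendsto A (𝓝[>] 0) (𝓝 a))
    (hint : ∀ ε : ℝ, IntegrableOn (fun t => ε⁻¹ * deriv hump (t / ε) * A t) (Ioo 0 T)) :
    Tendsto (fun ε : ℝ => ∫ t in Ioo 0 T, ε⁻¹ * deriv hump (t / ε) * A t) (𝓝[>] 0) (𝓝 (-a)) := by
  rw [Metric.tendsto_nhds]
  intro e he
  have h1 := (Metric.tendsto_nhds.mp hA) (e / 2) (by linarith)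
  obtain ⟨δ, hδ, hδA⟩ := mem_nhdsGT_iff_exists_Ioo_subset.mp h1
  have hδ : 0 < δ := hδ
  filter_upwards [Ioo_mem_nhdsGT (lt_min hδ hT)] with ε hε
  have hε0 : 0 < ε := hε.1
  have hεδ : ε < δ := hε.2.trans_le (min_le_left _ _)
  have hεT : ε ≤ T := (hε.2.trans_le (min_le_right _ _)).le
  have hI := integral_deriv_hump_div hε0 hεT
  have hi : IntegrableOn (fun t => ε⁻¹ * deriv hump (t / ε)) (Ioo 0 T) := by
    by_contra h
    rw [integral_undef h] at hI
    norm_num at hI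
  have e1 : (∫ t in Ioo 0 T, ε⁻¹ * deriv hump (t / ε) * A t) - -a
      = ∫ t in Ioo 0 T, ε⁻¹ * deriv hump (t / ε) * (A t - a) := by
    simp_rw [mul_sub]
    rw [integral_sub (hint ε) (hi.mul_const a), integral_mul_const, hI]
    ring
  rw [Real.dist_eq, e1, ← Real.norm_eq_abs]
  refine lt_of_le_of_lt (norm_integral_le_of_norm_le (hi.neg.mul_const (e / 2)) ?_) ?_
  · filter_upwards [ae_restrict_mem measurableSet_Ioo] with t ht
    have hsg : ε⁻¹ * deriv hump (t / ε) ≤ 0 :=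
      mul_nonpos_of_nonneg_of_nonpos (inv_nonneg.mpr hε0.le)
        (deriv_hump_nonpos (div_nonneg ht.1.le hε0.le))
    rw [norm_mul, Real.norm_eq_abs, abs_of_nonpos hsg]
    by_cases htδ : t < δ
    · exact mul_le_mul_of_nonneg_left (le_of_lt (hδA ⟨ht.1, htδ⟩)) (neg_nonneg.mpr hsg)
    · have : deriv hump (t / ε) = 0 := by
        rw [deriv_hump]
        have h1 : 1 ≤ t / ε := (one_le_div hε0).mpr (hεδ.le.trans (not_lt.mp htδ))
        rw [step_eq_zero (by linarith : -(t / ε) ≤ -1),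
          deriv_step_eq_zero_left (by linarith : -(t / ε) ≤ -1)]
        ring
      simp [this]
  · rw [integral_mul_const]
    simp only [Pi.neg_apply]
    rw [integral_neg, hI]
    linarith

section Initial

variable {Ω : Set (Space d)} {T : ℝ} {ρ χ : ℝ × Space d → ℝ}
  {u : ℝ × Space d → Space d} {ρ₀ : Space d → ℝ} {O : Set (ℝ × Space d)}
  {φ r₁ r₂ : ℝ × Space d → ℝ}

/-- Testing with `f hump(t/ε)`, the volume terms disappear, the derivative of the profile reproduces
`ρ` at time zero, and the datum term stays fixed because `hump 0 = 1`. -/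
lemma PhaseChart.integral_initial (hc : PhaseChart Ω T ρ χ O φ r₁ r₂) (hΩ : IsOpen Ω) (hT : 0 < T)
    (h : WeakTransport Ω T ρ u ρ₀) (hnull : volume {x | ((0 : ℝ), x) ∈ O ∧ φ (0, x) = 0} = 0)
    (hOΩ : ∀ p ∈ O, p.2 ∈ Ω) {f : ℝ × Space d → ℝ}
    (hf : ContDiff ℝ ∞ f) (hfc : HasCompactSupport f) (hfO : tsupport f ⊆ O) :
    ∫ x in Ω, ρ₀ x * f (0, x) = ∫ x in Ω, f (0, x) * ρ (0, x) := by
  have hceq := h.concentrated_eq hc.isOpen hc.lt_T (ψ := Prod.fst) (fun p _ => contDiffAt_fst) hf hfc hfO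
    fun G hG hGc hGO => hc.integrableOn_density hΩ hG hGc hGO
  have hlim := tendsto_integral_hump (volume.restrict (cylinder Ω T)) hc.isOpen (ψ := Prod.fst)
    (fun q _ => continuousAt_fst) (hceq 1).1
    (fun q hq => by
      have hq' : q ∉ tsupport f := fun h => hq (hfO h)
      rw [timeDeriv_eq_zero_of_notMem_tsupport hq', spaceGrad_eq_zero_of_notMem_tsupport hq']
      simp) (by
      rw [Measure.restrict_apply' (isOpen_cylinder hΩ T).measurableSet]
      have : (O ∩ {q : ℝ × Space d | q.1 = 0}) ∩ cylinder Ω T = ∅ := by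
        ext q
        simp only [mem_inter_iff, mem_ofPred_eq, mem_empty_iff_false, iff_false]
        rintro ⟨⟨_, h0⟩, h1⟩
        exact h1.1.1.ne' h0
      rw [this, measure_empty])
  have ht1 : ∀ p : ℝ × Space d, timeDeriv Prod.fst p = 1 := fun p => by
    show deriv (fun s => s) p.1 = 1
    simp
  have hg1 : ∀ p : ℝ × Space d, spaceGrad Prod.fst p = 0 := fun p => by
    show gradient (fun _ => p.1) p.2 = 0
    exact gradient_fun_const _ _
  have hlim2 := hlim.neg.sub_const (∫ x in Ω, ρ₀ x * (f (0, x) * hump ((0 : ℝ) / 1)))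
  simp only [zero_div, hump_zero, mul_one, neg_zero, zero_sub] at hlim2
  set F : ℝ × Space d → ℝ := fun p => f p * (if φ p < 0 then r₁ p else r₂ p) with hF
  have hFρ : ∀ p : ℝ × Space d, 0 ≤ p.1 → p.2 ∈ Ω → f p * ρ p = F p := fun p hp0 hpΩ => by
    by_cases hpO : p ∈ O
    · rw [hF, hc.density p hpO hp0 hpΩ]
    · simp only [hF]
      rw [image_eq_zero_of_notMem_tsupport fun h => hpO (hfO h), zero_mul, zero_mul]
  have hFΩ : ∀ t, ∫ x in Ω, F (t, x) = ∫ x, F (t, x) := fun t =>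
    setIntegral_eq_integral_of_forall_compl_eq_zero fun x hx => by
      simp only [hF]
      rw [image_eq_zero_of_notMem_tsupport fun h => hx (hOΩ _ (hfO h)), zero_mul]
  have hA := tendsto_integral_slice hc.isOpen hf.continuous hfc hfO
    (fun p hp => (hc.level p hp).continuousAt) (fun p hp => (hc.smooth_in p hp).continuousAt)
    (fun p hp => (hc.smooth_out p hp).continuousAt) hnull
  have hFi : ∀ ε : ℝ, IntegrableOn (fun p => ε⁻¹ * deriv hump (p.1 / ε) * F p) (cylinder Ω T) := by
    intro ε
    have hG : Continuous fun p : ℝ × Space d => ε⁻¹ * deriv hump (p.1 / ε) * f p :=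
      (continuous_const.mul (continuous_deriv_hump.comp (continuous_fst.div_const ε))).mul
        hf.continuous
    have hGs : tsupport (fun p : ℝ × Space d => ε⁻¹ * deriv hump (p.1 / ε) * f p) ⊆ tsupport f :=
      tsupport_mul_subset_right
    have := integrable_mul_ite (volume.restrict (cylinder Ω T)) hc.isOpen hG
      (hasCompactSupport_of_tsupport_subset hfc hGs) (hGs.trans hfO)
      (fun p hp => (hc.level p hp).continuousAt) (fun p hp => (hc.smooth_in p hp).continuousAt)
      (fun p hp => (hc.smooth_out p hp).continuousAt)
    simp only [hF]
    simpa only [IntegrableOn, mul_assoc] using this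
  have hslice : ∀ ε : ℝ, (fun t => ε⁻¹ * deriv hump (t / ε) * ∫ x, F (t, x))
      = fun t => ∫ x in Ω, ε⁻¹ * deriv hump (t / ε) * F (t, x) := fun ε => by
    funext t; rw [integral_const_mul, hFΩ]
  have hlim3 := tendsto_integral_hump_initial hT (hA.mono_left nhdsWithin_le_nhds)
    (fun ε => by
      rw [hslice ε]
      have := hFi ε
      rw [IntegrableOn, cylinder, Measure.volume_eq_prod, ← Measure.prod_restrict] at this
      exact this.integral_prod_left)
  have heq : ∀ ε : ℝ, ∫ t in Ioo 0 T, ε⁻¹ * deriv hump (t / ε) * ∫ x, F (t, x)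
      = -(∫ p in cylinder Ω T, hump (p.1 / ε) *
          (timeDeriv f p * ρ p + ⟪ρ p • u p, spaceGrad f p⟫)) - ∫ x in Ω, ρ₀ x * f (0, x) := by
    intro ε
    have h2 := (hceq ε).2
    simp only [zero_div, hump_zero, mul_one] at h2
    rw [← h2, hslice ε, setIntegral_cylinder (hFi ε)]
    refine setIntegral_congr_fun (isOpen_cylinder hΩ T).measurableSet fun p hp => ?_
    simp only [ht1, hg1, inner_zero_right, add_zero, one_mul]
    rw [mul_assoc _ (f p), hFρ p hp.1.1.le hp.2]
  have := tendsto_nhds_unique (hlim3.congr heq) hlim2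
  rw [← hFΩ] at this
  have h3 : ∫ x in Ω, F (0, x) = ∫ x in Ω, f (0, x) * ρ (0, x) :=
    setIntegral_congr_fun hΩ.measurableSet fun x hx => (hFρ (0, x) le_rfl hx).symm
  linarith

lemma PhaseChart.initial_ae (hc : PhaseChart Ω T ρ χ O φ r₁ r₂) (hΩ : IsOpen Ω) (hT : 0 < T)
    (h : WeakTransport Ω T ρ u ρ₀) {x : Space d} (hx : x ∈ Ω) (hxO : ((0 : ℝ), x) ∈ O)
    (hgrad : φ (0, x) = 0 → spaceGrad φ (0, x) ≠ 0) :
    ∃ W ∈ 𝓝 x, ∀ᵐ y, y ∈ W → ρ (0, y) = ρ₀ y := by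
  have hsl : ContDiffAt ℝ 1 (fun y => φ (0, y)) x :=
    ContDiffAt.comp (f := fun y => ((0 : ℝ), y)) x ((hc.level _ hxO).of_le (by simp))
      (contDiff_prodMk_right 0).contDiffAt
  have hnull : ∃ N ∈ 𝓝 x, volume (N ∩ {y | φ (0, y) = 0}) = 0 := by
    by_cases h0 : φ (0, x) = 0
    · refine exists_nhds_level_null volume hsl fun hd => hgrad h0 ?_
      rw [spaceGrad, gradient, hd, map_zero]
    · refine ⟨{y | φ (0, y) ≠ 0}, hsl.continuousAt.eventually_ne h0, ?_⟩
      have : {y | φ (0, y) ≠ 0} ∩ {y | φ (0, y) = 0} = ∅ := by ext; simp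
      rw [this, measure_empty]
  obtain ⟨N, hN, hNn⟩ := hnull
  obtain ⟨I, hI, W₀, hW₀, hIW⟩ := mem_nhds_prod_iff.mp (hc.isOpen.mem_nhds hxO)
  obtain ⟨I', hI'I, hI'o, h0I'⟩ := mem_nhds_iff.mp hI
  obtain ⟨W, hWs, hWo, hxW⟩ := mem_nhds_iff.mp
    (inter_mem hW₀ (inter_mem hN (hΩ.mem_nhds hx)))
  refine ⟨W, hWo.mem_nhds hxW, ?_⟩
  have hO'O : I' ×ˢ W ⊆ O := fun p hp => hIW ⟨hI'I hp.1, (hWs hp.2).1⟩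
  have hc' := hc.mono (hI'o.prod hWo) hO'O
  obtain ⟨θ, hθ, hθc, hθI, -, -, hθ1⟩ := exists_smooth_bump (hI'o.mem_nhds h0I')
  have hWΩ : W ⊆ Ω := fun y hy => (hWs hy).2.2
  have hnull' : volume {y | ((0 : ℝ), y) ∈ I' ×ˢ W ∧ φ (0, y) = 0} = 0 :=
    measure_mono_null (t := N ∩ {y | φ (0, y) = 0})
      (fun y (hy : _ ∧ _) => ⟨(hWs hy.1.2).2.1, hy.2⟩) hNn
  have hslc : ∀ {r : ℝ × Space d → ℝ}, (∀ p ∈ I' ×ˢ W, ContinuousAt r p) → ∀ y ∈ W,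
      ContinuousAt (fun z => r (0, z)) y := fun hr y hy =>
    ContinuousAt.comp (f := fun z => ((0 : ℝ), z)) (hr _ ⟨h0I', hy⟩)
      (Continuous.prodMk_right _).continuousAt
  have hρi : ∀ g : Space d → ℝ, Continuous g → HasCompactSupport g → tsupport g ⊆ W →
      Integrable fun y => g y * ρ (0, y) := by
    intro g hg hgc hgW
    refine (integrable_mul_ite volume hWo hg hgc hgW
      (hslc fun p hp => (hc'.level p hp).continuousAt)
      (hslc fun p hp => (hc'.smooth_in p hp).continuousAt)
      (hslc fun p hp => (hc'.smooth_out p hp).continuousAt)).congr (Eventually.of_forall fun y => ?_)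
    by_cases hy : y ∈ W
    · simp only; rw [hc'.density (0, y) ⟨h0I', hy⟩ le_rfl (hWΩ hy)]
    · simp only; rw [image_eq_zero_of_notMem_tsupport fun h => hy (hgW h), zero_mul, zero_mul]
  have hρ₀l : LocallyIntegrableOn ρ₀ W := by
    rw [locallyIntegrableOn_iff hWo.isLocallyClosed]
    intro K hKW hK
    have := h.initial_integrable.integrableOn_isCompact hK
    rwa [IntegrableOn, Measure.restrict_restrict hK.measurableSet,
      inter_eq_left.mpr (hKW.trans hWΩ)] at this
  have hρl : LocallyIntegrableOn (fun y => ρ (0, y)) W := by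
    intro y hy
    obtain ⟨g, hg, hgc, hgW, -, -, hg1⟩ := exists_smooth_bump (hWo.mem_nhds hy)
    obtain ⟨V, hV, hVo, hyV⟩ := mem_nhds_iff.mp hg1
    refine ⟨V, mem_nhdsWithin_of_mem_nhds (hVo.mem_nhds hyV), ?_⟩
    exact (hρi g hg.continuous hgc hgW).integrableOn.congr_fun
      (fun z hz => by simp only; rw [show g z = 1 from hV hz, one_mul]) hVo.measurableSet
  have key := hWo.ae_eq_zero_of_integral_contDiff_smul_eq_zero (hρl.sub hρ₀l)
    fun g hg hgc hgW => by
    have hρ₀i : Integrable fun y => g y * ρ₀ y := by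
      have h1 : IntegrableOn (fun y => g y • ρ₀ y) (tsupport g) :=
        ((hρ₀l.integrableOn_compact_subset hgW hgc)).continuousOn_smul hg.continuous.continuousOn
          hgc.isCompact
      refine (integrableOn_iff_integrable_of_support_subset fun z hz => ?_).mp h1
      by_contra hz'
      exact hz (by simp [image_eq_zero_of_notMem_tsupport hz'])
    -- `θ` equals 1 near time zero, so the slice of `f` at time zero is the given spatial test
    -- function.
    set f : ℝ × Space d → ℝ := fun p => θ p.1 * g p.2 with hf
    have hfs : ContDiff ℝ ∞ f := (hθ.comp contDiff_fst).mul (hg.comp contDiff_snd)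
    have hsub : tsupport f ⊆ tsupport θ ×ˢ tsupport g :=
      closure_minimal (fun p hp => by
        have := mul_ne_zero_iff.mp (show θ p.1 * g p.2 ≠ 0 from hp)
        exact mem_prod.mpr ⟨subset_tsupport _ this.1, subset_tsupport _ this.2⟩)
        ((isClosed_tsupport θ).prod (isClosed_tsupport g))
    have hfc : HasCompactSupport f :=
      (hθc.isCompact.prod hgc.isCompact).of_isClosed_subset (isClosed_tsupport f) hsub
    have := hc'.integral_initial hΩ hT h hnull' (fun p hp => hWΩ hp.2) hfs hfc
      (hsub.trans (prod_mono hθI hgW))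
    simp only [hf, hθ1.self_of_nhds, one_mul] at this
    have hz : ∀ y ∉ Ω, g y = 0 := fun y hy =>
      image_eq_zero_of_notMem_tsupport fun h => hy (hWΩ (hgW h))
    rw [setIntegral_eq_integral_of_forall_compl_eq_zero (fun y hy => by rw [hz y hy, mul_zero]),
      setIntegral_eq_integral_of_forall_compl_eq_zero (fun y hy => by rw [hz y hy, zero_mul])] at this
    simp only [Pi.sub_apply, smul_eq_mul, mul_sub]
    rw [integral_sub (hρi g hg.continuous hgc hgW) hρ₀i, ← this, sub_eq_zero]
    simp_rw [mul_comm]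
  filter_upwards [key] with y hy hyW
  exact sub_eq_zero.mp (hy hyW)

end Initial

/-! ### The Young-Laplace law -/

lemma contDiffAt_levelNormal {φ : ℝ × Space d → ℝ} {p : ℝ × Space d} (hφ : ContDiffAt ℝ ∞ φ p)
    (hg : spaceGrad φ p ≠ 0) : ContDiffAt ℝ ∞ (levelNormal φ) p := by
  have h := contDiffAt_spaceGrad (m := ∞) hφ (by simp)
  exact ((h.norm ℝ hg).inv (norm_ne_zero_iff.mpr hg)).smul h

lemma norm_levelNormal {φ : ℝ × Space d → ℝ} {p : ℝ × Space d} (hg : spaceGrad φ p ≠ 0) :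
    ‖levelNormal φ p‖ = 1 := by
  rw [levelNormal, norm_smul, norm_inv, norm_norm, inv_mul_cancel₀ (norm_ne_zero_iff.mpr hg)]

lemma inner_levelNormal {φ : ℝ × Space d → ℝ} {p : ℝ × Space d} (hg : spaceGrad φ p ≠ 0) :
    ⟪spaceGrad φ p, levelNormal φ p⟫ = ‖spaceGrad φ p‖ := by
  rw [levelNormal, real_inner_smul_right, real_inner_self_eq_norm_sq]
  field_simp [norm_ne_zero_iff.mpr hg]

lemma fderiv_slice_smul {g : ℝ × Space d → ℝ} {F : ℝ × Space d → Space d} {p : ℝ × Space d}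
    (hg : DifferentiableAt ℝ g p) (hF : DifferentiableAt ℝ F p) (v : Space d) :
    fderiv ℝ (fun y => g (p.1, y) • F (p.1, y)) p.2 v
      = g p • fderiv ℝ (fun y => F (p.1, y)) p.2 v + ⟪spaceGrad g p, v⟫ • F p := by
  have h1 : HasFDerivAt (fun y => g (p.1, y) • F (p.1, y)) _ p.2 :=
    (hasFDerivAt_slice hg).smul (hasFDerivAt_slice hF)
  rw [h1.fderiv, inner_spaceGrad hg, fderiv_slice hF]
  simp

/-- A unit field is orthogonal to its derivatives. -/
lemma inner_fderiv_slice_of_norm_one {N : ℝ × Space d → Space d} {p : ℝ × Space d}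
    (hN : DifferentiableAt ℝ N p) (h1 : ∀ᶠ q in 𝓝 p, ‖N q‖ = 1) (v : Space d) :
    ⟪N p, fderiv ℝ (fun y => N (p.1, y)) p.2 v⟫ = 0 := by
  have hs := hasFDerivAt_slice hN
  have hc : ContinuousAt (fun y => (p.1, y)) p.2 := (Continuous.prodMk_right p.1).continuousAt
  have h2 : (fun y => ⟪N (p.1, y), N (p.1, y)⟫) =ᶠ[𝓝 p.2] fun _ => (1 : ℝ) := by
    filter_upwards [hc.eventually (show ∀ᶠ q in 𝓝 (p.1, p.2), ‖N q‖ = 1 from h1)] with y hy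
    rw [real_inner_self_eq_norm_sq, hy, one_pow]
  have h3 := (hs.inner ℝ hs).fderiv
  have h4 : fderiv ℝ (fun y => ⟪N (p.1, y), N (p.1, y)⟫) p.2 = 0 := by
    rw [h2.fderiv_eq]; simp
  rw [h4] at h3
  have h5 := congrArg (fun L : Space d →L[ℝ] ℝ => L v) h3
  rw [hs.fderiv]
  simp only [zero_apply, ContinuousLinearMap.comp_apply,
    ContinuousLinearMap.prod_apply, fderivInnerCLM_apply, Prod.mk.eta] at h5
  rw [real_inner_comm (N p)] at h5
  rw [ContinuousLinearMap.comp_apply]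
  linarith

section YoungLaplace

variable {Ω : Set (Space d)} {T m lam : ℝ} {ρ χ : ℝ × Space d → ℝ}
  {u : ℝ × Space d → Space d} {ρ₀ : Space d → ℝ} {μ : ℝ → Measure (Space d)}
  {ν : ℝ → Space d → Space d} {O : Set (ℝ × Space d)} {φ r₁ r₂ : ℝ × Space d → ℝ}

lemma contDiffAt_slice {G : Type*} [NormedAddCommGroup G] [NormedSpace ℝ G]
    {n : WithTop ℕ∞} {f : ℝ × Space d → G} {t : ℝ} {x : Space d} (hf : ContDiffAt ℝ n f (t, x)) :
    ContDiffAt ℝ n (fun y => f (t, y)) x :=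
  ContDiffAt.comp (f := fun y => (t, y)) x hf (contDiff_prodMk_right t).contDiffAt

lemma PhaseChart.ae_eq_levelNormal (hc : PhaseChart Ω T ρ χ O φ r₁ r₂) (hΩ : IsOpen Ω)
    (hgrad : ∀ p ∈ O, spaceGrad φ p ≠ 0) {t : ℝ} (ht : 0 ≤ t)
    (hpol : IsGradientPolar Ω (fun x => χ (t, x)) (μ t) (ν t)) :
    ∀ᵐ x ∂(μ t), (t, x) ∈ O → x ∈ Ω → ν t x = levelNormal φ (t, x) := by
  have := hpol.eq_normal hΩ.measurableSet (W := {x | (t, x) ∈ O} ∩ Ω)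
    ((isOpen_slice hc.isOpen t).inter hΩ) inter_subset_right (ψ := fun x => φ (t, x))
    (N := fun x => levelNormal φ (t, x)) (fun x hx => contDiffAt_slice (hc.level _ hx.1))
    (fun x hx => hgrad _ hx.1)
    (fun x hx => contDiffAt_slice (contDiffAt_levelNormal (hc.level _ hx.1) (hgrad _ hx.1)))
    (fun x hx => rfl) (fun x hx => hc.charFun _ hx.1 ht hx.2)
  filter_upwards [this] with x hx h1 h2 using hx ⟨h1, h2⟩

/-- Integrals against `|∇χ|` as bulk integrals over the evolving set. -/
lemma PhaseChart.integral_inner_polar (hc : PhaseChart Ω T ρ χ O φ r₁ r₂) (hΩ : IsOpen Ω)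
    (hgrad : ∀ p ∈ O, spaceGrad φ p ≠ 0) {t : ℝ} (ht : 0 ≤ t)
    (hpol : IsGradientPolar Ω (fun x => χ (t, x)) (μ t) (ν t)) {g : ℝ × Space d → ℝ}
    (hg : ContDiff ℝ ∞ g) (hgc : HasCompactSupport g) (hgO : tsupport g ⊆ O)
    (hgΩ : ∀ p ∈ tsupport g, p.2 ∈ Ω) {Y : ℝ × Space d → Space d}
    (hY : ∀ p ∈ O, ContDiffAt ℝ ∞ Y p) :
    ∫ x, g (t, x) * ⟪Y (t, x), levelNormal φ (t, x)⟫ ∂(μ t)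
      = ∫ x, (if φ (t, x) < 0 then 1 else 0) * spaceDiv (fun q => g q • Y q) (t, x) := by
  set W := {x | (t, x) ∈ O} ∩ Ω with hW
  have hgW : tsupport (fun x => g (t, x)) ⊆ W := (tsupport_slice_subset g t).trans
    fun x hx => ⟨hgO hx, hgΩ _ hx⟩
  have h1 := hpol.integral_mul_inner hΩ.measurableSet (W := W) inter_subset_right
    (Z := fun x => Y (t, x)) (fun x hx => contDiffAt_slice (hY _ hx.1))
    (g := fun x => g (t, x)) (hg.comp (contDiff_prodMk_right t)) (hasCompactSupport_slice hgc t) hgW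
  have h2 : ∫ x, g (t, x) * ⟪Y (t, x), levelNormal φ (t, x)⟫ ∂(μ t)
      = ∫ x, g (t, x) * ⟪Y (t, x), ν t x⟫ ∂(μ t) := by
    refine integral_congr_ae ?_
    filter_upwards [hc.ae_eq_levelNormal hΩ hgrad ht hpol] with x hx
    by_cases hxs : (t, x) ∈ tsupport g
    · rw [hx (hgO hxs) (hgΩ _ hxs)]
    · simp only [image_eq_zero_of_notMem_tsupport hxs, zero_mul]
  have hWo : IsOpen W := (isOpen_slice hc.isOpen t).inter hΩ
  have hz : ∀ x ∉ W, (if φ (t, x) < 0 then (1 : ℝ) else 0)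
      * spaceDiv (fun q => g q • Y q) (t, x) = 0 := fun x hx => by
    have hsub : tsupport (fun q => g q • Y q) ⊆ tsupport g :=
      tsupport_smul_subset_left _ _
    rw [spaceDiv_eq_zero_of_notMem_tsupport fun h => hx ⟨hgO (hsub h), hgΩ _ (hsub h)⟩, mul_zero]
  rw [h2, h1, ← setIntegral_eq_integral_of_forall_compl_eq_zero hz]
  refine setIntegral_congr_fun hWo.measurableSet fun x hx => ?_
  rw [hc.charFun (t, x) hx.1 ht hx.2]
  rfl

/-- The field `Y` is free apart from its normal component. Inside `Ω` the unit normal itself serves;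
at the boundary a field tangential to `∂Ω` is required. -/
lemma PhaseChart.integral_polar (hc : PhaseChart Ω T ρ χ O φ r₁ r₂) (hΩ : IsOpen Ω)
    (hgrad : ∀ p ∈ O, spaceGrad φ p ≠ 0) {t : ℝ} (ht : 0 ≤ t)
    (hpol : IsGradientPolar Ω (fun x => χ (t, x)) (μ t) (ν t)) {g : ℝ × Space d → ℝ}
    (hg : ContDiff ℝ ∞ g) (hgc : HasCompactSupport g) (hgO : tsupport g ⊆ O)
    (hgΩ : ∀ p ∈ tsupport g, p.2 ∈ Ω) {Y : ℝ × Space d → Space d}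
    (hY : ∀ p ∈ O, ContDiffAt ℝ ∞ Y p) (hYN : ∀ p ∈ O, ⟪Y p, levelNormal φ p⟫ = 1) :
    ∫ x, g (t, x) ∂(μ t)
      = ∫ x, (if φ (t, x) < 0 then 1 else 0) * spaceDiv (fun q => g q • Y q) (t, x) := by
  rw [← hc.integral_inner_polar hΩ hgrad ht hpol hg hgc hgO hgΩ hY]
  refine integral_congr_ae (Eventually.of_forall fun x => ?_)
  by_cases hxs : (t, x) ∈ tsupport g
  · simp only [hYN _ (hgO hxs), mul_one]
  · simp only [image_eq_zero_of_notMem_tsupport hxs, zero_mul]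

/-- For normal test fields, the surface term is the weighted mean curvature. -/
lemma spaceDiv_sub_normal {g : ℝ × Space d → ℝ} {N : ℝ × Space d → Space d} {p : ℝ × Space d}
    (hg : DifferentiableAt ℝ g p) (hN : DifferentiableAt ℝ N p)
    (h1 : ∀ᶠ q in 𝓝 p, ‖N q‖ = 1) :
    spaceDiv (fun q => g q • N q) p
        - ⟪N p, fderiv ℝ (fun y => g (p.1, y) • N (p.1, y)) p.2 (N p)⟫
      = g p * spaceDiv N p := by
  rw [fderiv_slice_smul hg hN, inner_add_right, real_inner_smul_right,
    inner_fderiv_slice_of_norm_one hN h1, real_inner_smul_right, real_inner_self_eq_norm_sq,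
    h1.self_of_nhds, spaceDiv_smul hg hN]
  ring

/-- With `ξ = g N` and `g = f hump(φ/ε)`, the differentiated profile multiplies `κ - (r₁^m - lam)`
inside and `-r₂^m` outside, each times `|∇φ|`, where `κ = div N`. Equality of these traces is the
law, as the curvature is `-κ`. -/
lemma PhaseChart.young_laplace (hc : PhaseChart Ω T ρ χ O φ r₁ r₂) (hΩ : IsOpen Ω) (hm : 1 ≤ m)
    (h : WeakTransport Ω T ρ u ρ₀) (hy : YoungLaplaceData Ω T m lam ρ χ u μ ν)
    (hOQ : O ⊆ cylinder Ω T) (hgrad : ∀ p ∈ O, spaceGrad φ p ≠ 0)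
    {p : ℝ × Space d} (hp : p ∈ O) (h0 : φ p = 0) :
    r₂ p ^ m - (r₁ p ^ m - lam) = levelCurvature φ p := by
  set N := levelNormal φ with hNdef
  set κ := spaceDiv N with hκ
  -- Since `⟪Z, N⟫ = κ`, the divergence of `g • Z` over `{φ < 0}` represents the integral of `g κ`
  -- against `|∇χ|`.
  set Z : ℝ × Space d → Space d := fun q => κ q • N q with hZ
  have hN : ∀ q ∈ O, ContDiffAt ℝ ∞ N q := fun q hq =>
    contDiffAt_levelNormal (hc.level q hq) (hgrad q hq)
  have hκs : ∀ q ∈ O, ContDiffAt ℝ ∞ κ q := fun q hq => contDiffAt_spaceDiv (hN q hq) (by simp)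
  have hZs : ∀ q ∈ O, ContDiffAt ℝ ∞ Z q := fun q hq => (hκs q hq).smul (hN q hq)
  have hgs : ∀ q ∈ O, ContinuousAt (fun q => ‖spaceGrad φ q‖) q := fun q hq =>
    (contDiffAt_spaceGrad (m := 0) (hc.level q hq) (by simp)).continuousAt.norm
  have hNn : ∀ q ∈ O, ∀ᶠ q' in 𝓝 q, ‖N q'‖ = 1 := fun q hq => by
    filter_upwards [hc.isOpen.mem_nhds hq] with q' hq' using norm_levelNormal (hgrad q' hq')
  have key : κ p * ‖spaceGrad φ p‖ - (r₁ p ^ m - lam) * ‖spaceGrad φ p‖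
      = - (r₂ p ^ m * ‖spaceGrad φ p‖) := by
    refine trace_eq_of_tendsto_concentrated volume hc.isOpen hp hc.level h0
      (q₁ := fun q => κ q * ‖spaceGrad φ q‖ - (r₁ q ^ m - lam) * ‖spaceGrad φ q‖)
      (q₂ := fun q => - (r₂ q ^ m * ‖spaceGrad φ q‖))
      (fderiv_ne_zero_of_spaceGrad_ne_zero ((hc.level p hp).differentiableAt (by simp)) (hgrad p hp))
      (fun q hq => ((hκs q hq).continuousAt.mul (hgs q hq)).sub
        (((hc.contDiffAt_rpow_in hm hq).continuousAt.sub continuousAt_const).mul (hgs q hq)))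
      (fun q hq => ((hc.contDiffAt_rpow_out hm hq).continuousAt.mul (hgs q hq)).neg)
      fun f hf hfc hfO _ => ?_
    have hpr : ∀ q ∈ O, pressure m lam ρ χ q = if φ q < 0 then r₁ q ^ m - lam else r₂ q ^ m :=
      fun q hq => hc.pressure_eq hq (hOQ hq).1.1.le (hOQ hq).2
    have hf1 : ContDiff ℝ 1 f := hf.of_le (by simp)
    have hsp : ∀ F : ℝ × Space d → Space d, (∀ q ∈ O, ContDiffAt ℝ ∞ F q) → ∀ g : ℝ × Space d → ℝ,
        ContDiff ℝ ∞ g → tsupport g ⊆ tsupport f → ContDiff ℝ ∞ (fun q => g q • F q) ∧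
        HasCompactSupport (fun q => g q • F q) ∧ tsupport (fun q => g q • F q) ⊆ tsupport f ∧
        Continuous (spaceDiv fun q => g q • F q) ∧
        HasCompactSupport (spaceDiv fun q => g q • F q) ∧
        tsupport (spaceDiv fun q => g q • F q) ⊆ tsupport f := by
      intro F hF g hg hgf
      have h1 : ContDiff ℝ ∞ (fun q => g q • F q) := contDiff_smul_of_tsupport hg (hgf.trans hfO) hF
      have h2 : tsupport (fun q => g q • F q) ⊆ tsupport f :=
        (tsupport_smul_subset_left _ _).trans hgf
      have h3 := (tsupport_spaceDiv_subset fun q => g q • F q).trans h2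
      exact ⟨h1, hasCompactSupport_of_tsupport_subset hfc h2, h2,
        continuous_spaceDiv (h1.of_le (by simp)), hasCompactSupport_of_tsupport_subset hfc h3, h3⟩
    have hin : ∀ G : ℝ × Space d → ℝ, Continuous G → HasCompactSupport G → tsupport G ⊆ tsupport f →
        Integrable (fun q => (if φ q < 0 then 1 else 0) * G q) ∧
        Integrable (fun q => G q * pressure m lam ρ χ q) := by
      intro G hG hGc hGf
      constructor
      · simpa only [mul_comm] using integrable_mul_ite volume hc.isOpen hG hGc (hGf.trans hfO)
          (q₁ := fun _ => 1) (q₂ := fun _ => 0)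
          (fun q hq => (hc.level q hq).continuousAt) (fun _ _ => continuousAt_const)
          (fun _ _ => continuousAt_const)
      · refine (integrableOn_iff_integrable_of_support_subset (s := cylinder Ω T)
          fun q hq => ?_).mp (hc.integrableOn_pressure hΩ hm hG hGc (hGf.trans hfO))
        by_contra hq'
        exact hq (by simp only; rw [image_eq_zero_of_notMem_tsupport fun h => hq' (hOQ (hfO (hGf h))),
          zero_mul])
    have hfl : ∀ F : ℝ × Space d → Space d, ContDiff ℝ ∞ F → HasCompactSupport F →
        tsupport F ⊆ tsupport f → Integrable fun q => ⟪ρ q • u q, F q⟫ := by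
      intro F hF hFc hFf
      refine (integrableOn_iff_integrable_of_support_subset (s := cylinder Ω T)
          fun q hq => ?_).mp (h.integrable_flux_inner hF.continuous hFc
            ((hFf.trans hfO).trans hc.lt_T))
      by_contra hq'
      exact hq (by simp only; rw [image_eq_zero_of_notMem_tsupport fun h => hq' (hOQ (hfO (hFf h))),
          inner_zero_right])
    have hoff : ∀ q ∉ cylinder Ω T, q ∉ tsupport f := fun q hq hh => hq (hOQ (hfO hh))
    -- the weak law for the field `g • N`
    have hweak : ∀ g : ℝ × Space d → ℝ, ContDiff ℝ ∞ g → tsupport g ⊆ tsupport f →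
        ∫ q, (if φ q < 0 then 1 else 0) * spaceDiv (fun q => g q • Z q) q
          = (∫ q, spaceDiv (fun q => g q • N q) q * pressure m lam ρ χ q)
            - ∫ q, ⟪ρ q • u q, g q • N q⟫ := by
      intro g hg hgf
      have hgO := hgf.trans hfO
      obtain ⟨hN1, hN2, hN3, hN4, hN5, hN6⟩ := hsp N hN g hg hgf
      obtain ⟨hZ1, hZ2, hZ3, hZ4, hZ5, hZ6⟩ := hsp Z hZs g hg hgf
      have hyl := hy.eq _ ⟨hN1, hN2, (hN3.trans hfO).trans hc.lt_T⟩ (fun t _ x hx n _ => by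
        rw [image_eq_zero_of_notMem_tsupport fun h' =>
          notMem_frontier_of_mem hΩ (hOQ (hfO (hN3 h'))).2 hx, inner_zero_left])
        (hin _ hN4 hN5 hN6).2.integrableOn
      have hz1 : ∫ q in cylinder Ω T, spaceDiv (fun q => g q • N q) q * pressure m lam ρ χ q
          = ∫ q, spaceDiv (fun q => g q • N q) q * pressure m lam ρ χ q :=
        setIntegral_eq_integral_of_forall_compl_eq_zero fun q hq => by
          rw [spaceDiv_eq_zero_of_notMem_tsupport fun h => hoff q hq (hN3 h), zero_mul]
      have hz2 : ∫ q in cylinder Ω T, ⟪ρ q • u q, g q • N q⟫ = ∫ q, ⟪ρ q • u q, g q • N q⟫ :=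
        setIntegral_eq_integral_of_forall_compl_eq_zero fun q hq => by
          rw [image_eq_zero_of_notMem_tsupport (f := fun q => g q • N q) fun h => hoff q hq (hN3 h),
            inner_zero_right]
      have hz3 : ∫ q in cylinder Ω T, (if φ q < 0 then 1 else 0) * spaceDiv (fun q => g q • Z q) q
          = ∫ q, (if φ q < 0 then 1 else 0) * spaceDiv (fun q => g q • Z q) q :=
        setIntegral_eq_integral_of_forall_compl_eq_zero fun q hq => by
          rw [spaceDiv_eq_zero_of_notMem_tsupport fun h => hoff q hq (hZ3 h), mul_zero]
      rw [hz1, hz2] at hyl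
      rw [← hyl, ← hz3, ← setIntegral_cylinder (hin _ hZ4 hZ5 hZ6).1.integrableOn]
      refine (integral_congr_ae ?_).symm
      filter_upwards [hy.polar, ae_restrict_mem measurableSet_Ioo] with t ht htT
      have hgκ : ContDiff ℝ ∞ (fun q => g q * κ q) := contDiff_mul_of_tsupport hg hgO hκs
      have hgκs : tsupport (fun q => g q * κ q) ⊆ tsupport g := tsupport_mul_subset_left
      have h3 := hc.integral_polar hΩ hgrad htT.1.le ht hgκ
        (hasCompactSupport_of_tsupport_subset hfc (hgκs.trans hgf)) (hgκs.trans hgO)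
        (fun q hq => (hOQ (hgO (hgκs hq))).2) hN fun q hq => by
          rw [real_inner_self_eq_norm_sq, norm_levelNormal (hgrad q hq), one_pow]
      have h4 : (fun q => (g q * κ q) • N q) = fun q => g q • Z q := by
        funext q; rw [mul_smul]
      rw [h4] at h3
      rw [setIntegral_eq_integral_of_forall_compl_eq_zero, ← h3]
      · refine integral_congr_ae ?_
        filter_upwards [hc.ae_eq_levelNormal hΩ hgrad htT.1.le ht] with x hx
        by_cases hxs : (t, x) ∈ tsupport g
        · have hxO := hgO hxs
          rw [hx hxO (hOQ hxO).2]
          exact spaceDiv_sub_normal (p := (t, x)) (hg.contDiffAt.differentiableAt (by simp))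
            ((hN _ hxO).differentiableAt (by simp)) (hNn _ hxO)
        · have hx' : (t, x) ∉ tsupport fun q => g q • N q := fun h =>
            hxs (tsupport_smul_subset_left _ _ h)
          rw [spaceDiv_eq_zero_of_notMem_tsupport hx', fderiv_slice_eq_zero_of_notMem_tsupport
            (hN1.differentiable (by simp)) hx', image_eq_zero_of_notMem_tsupport hxs]
          simp
      · intro x hx
        rw [spaceDiv_eq_zero_of_notMem_tsupport fun h => hx (hOQ (hfO (hZ3 h))).2, mul_zero]
    -- the smooth remainder
    set R : ℝ × Space d → ℝ := fun q => (if φ q < 0 then 1 else 0) * spaceDiv (fun q => f q • Z q) q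
      - spaceDiv (fun q => f q • N q) q * pressure m lam ρ χ q + ⟪ρ q • u q, f q • N q⟫ with hR
    obtain ⟨hN1, hN2, hN3, hN4, hN5, hN6⟩ := hsp N hN f hf le_rfl
    obtain ⟨hZ1, hZ2, hZ3, hZ4, hZ5, hZ6⟩ := hsp Z hZs f hf le_rfl
    have hRi : Integrable R := ((hin _ hZ4 hZ5 hZ6).1.sub (hin _ hN4 hN5 hN6).2).add
      (hfl _ hN1 hN2 hN3)
    have hR0 : ∀ q ∉ O, R q = 0 := fun q hq => by
      simp only [hR]
      rw [spaceDiv_eq_zero_of_notMem_tsupport fun h => hq (hfO (hZ3 h)),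
        spaceDiv_eq_zero_of_notMem_tsupport fun h => hq (hfO (hN3 h)),
        image_eq_zero_of_notMem_tsupport fun h => hq (hfO h)]
      simp
    have hlim := (tendsto_integral_hump volume hc.isOpen
      (fun q hq => (hc.level q hq).continuousAt) hRi hR0 hc.null).neg
    rw [neg_zero] at hlim
    refine hlim.congr fun ε => ?_
    set g : ℝ × Space d → ℝ := fun q => f q * hump (φ q / ε) with hg
    have hgs' : ContDiff ℝ ∞ g := contDiff_mul_profile hf hfO hc.level contDiff_hump ε
    have hgf : tsupport g ⊆ tsupport f := tsupport_mul_subset_left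
    have hw := hweak g hgs' hgf
    obtain ⟨hN1', hN2', hN3', hN4', hN5', hN6'⟩ := hsp N hN g hgs' hgf
    obtain ⟨hZ1', hZ2', hZ3', hZ4', hZ5', hZ6'⟩ := hsp Z hZs g hgs' hgf
    have hiZ := (hin _ hZ4' hZ5' hZ6').1
    have hiN := (hin _ hN4' hN5' hN6').2
    have hiF := hfl _ hN1' hN2' hN3'
    have hhR : Integrable fun q => hump (φ q / ε) * R q :=
      integrable_profile_mul volume hc.isOpen contDiff_hump.continuous abs_hump_le_one
        (fun q hq => (hc.level q hq).continuousAt) hRi hR0 ε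
    -- Replacing `f` by `g` changes the three terms in `R` by the factor `hump(φ/ε)`, apart from the
    -- derivative of the profile, which meets `⟪∇φ, N⟫ = |∇φ|`.
    have hpt : ∀ q, ε⁻¹ * deriv hump (φ q / ε) * f q *
        (if φ q < 0 then κ q * ‖spaceGrad φ q‖ - (r₁ q ^ m - lam) * ‖spaceGrad φ q‖
          else -(r₂ q ^ m * ‖spaceGrad φ q‖))
        = (if φ q < 0 then 1 else 0) * spaceDiv (fun q => g q • Z q) q
          - spaceDiv (fun q => g q • N q) q * pressure m lam ρ χ q + ⟪ρ q • u q, g q • N q⟫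
          - hump (φ q / ε) * R q := by
      intro q
      by_cases hq : q ∈ O
      · have hgd : DifferentiableAt ℝ g q := hgs'.contDiffAt.differentiableAt (by simp)
        have hfd : DifferentiableAt ℝ f q := hf.contDiffAt.differentiableAt (by simp)
        have hNd : DifferentiableAt ℝ N q := (hN q hq).differentiableAt (by simp)
        have hZd : DifferentiableAt ℝ Z q := (hZs q hq).differentiableAt (by simp)
        have hNφ : ⟪spaceGrad φ q, N q⟫ = ‖spaceGrad φ q‖ := inner_levelNormal (hgrad q hq)
        have hZφ : ⟪spaceGrad φ q, Z q⟫ = κ q * ‖spaceGrad φ q‖ := by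
          rw [hZ, real_inner_smul_right, hNφ]
        simp only [hR]
        rw [spaceDiv_smul hgd hZd, spaceDiv_smul hgd hNd, spaceDiv_smul hfd hZd,
          spaceDiv_smul hfd hNd, hg, spaceGrad_mul_profile hf hfO hc.level contDiff_hump ε q,
          inner_add_left, inner_add_left, real_inner_smul_left, real_inner_smul_left,
          real_inner_smul_left, real_inner_smul_left, hNφ, hZφ,
          real_inner_smul_right (ρ q • u q) (N q), real_inner_smul_right (ρ q • u q) (N q) (f q),
          hpr q hq]
        split_ifs <;> ring
      · have hqf : q ∉ tsupport f := fun h => hq (hfO h)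
        rw [hR0 q hq, image_eq_zero_of_notMem_tsupport hqf,
          spaceDiv_eq_zero_of_notMem_tsupport fun h => hqf (hZ3' h),
          spaceDiv_eq_zero_of_notMem_tsupport fun h => hqf (hN3' h),
          image_eq_zero_of_notMem_tsupport (f := g) fun h => hqf (hgf h)]
        simp
    simp_rw [hpt]
    have hi12 : Integrable fun q => (if φ q < 0 then 1 else 0) * spaceDiv (fun q => g q • Z q) q
          - spaceDiv (fun q => g q • N q) q * pressure m lam ρ χ q := hiZ.sub hiN
    have hi123 : Integrable fun q => (if φ q < 0 then 1 else 0) * spaceDiv (fun q => g q • Z q) q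
          - spaceDiv (fun q => g q • N q) q * pressure m lam ρ χ q + ⟪ρ q • u q, g q • N q⟫ :=
      hi12.add hiF
    rw [integral_sub hi123 hhR, integral_add hi12 hiF, integral_sub hiZ hiN, hw]
    ring
  have hne : ‖spaceGrad φ p‖ ≠ 0 := norm_ne_zero_iff.mpr (hgrad p hp)
  have : κ p - (r₁ p ^ m - lam) = -(r₂ p ^ m) := by
    apply mul_right_cancel₀ hne
    linarith
  rw [levelCurvature]
  show _ = -κ p
  linarith

end YoungLaplace

/-! ### Functions with the same sublevel set, and transversal level sets -/

/-- Moving from `x` in a direction that decreases `a` to first order cannot increase `b` to first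
order. An open half-space contained in a closed one has a positively proportional normal. -/
lemma exists_gradient_eq_smul {a b : Space d → ℝ} {x : Space d} (ha : DifferentiableAt ℝ a x)
    (hb : DifferentiableAt ℝ b x) (ha0 : a x = 0) (hb0 : b x = 0) (hbg : gradient b x ≠ 0)
    (hag : gradient a x ≠ 0) (h : ∀ᶠ y in 𝓝 x, a y < 0 → b y ≤ 0) :
    ∃ c : ℝ, 0 < c ∧ gradient b x = c • gradient a x := by
  set A := gradient a x with hA
  set B := gradient b x with hB
  have key : ∀ v : Space d, ⟪A, v⟫ < 0 → ⟪B, v⟫ ≤ 0 := by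
    intro v hv
    by_contra! hBv
    have hline : HasDerivAt (fun s : ℝ => x + s • v) v 0 := by
      simpa using ((hasDerivAt_id (0 : ℝ)).smul_const v).const_add x
    have hder : ∀ {f : Space d → ℝ}, DifferentiableAt ℝ f x →
        HasDerivAt (fun s : ℝ => f (x + s • v)) ⟪gradient f x, v⟫ 0 := by
      intro f hf
      have h1 : HasFDerivAt f (fderiv ℝ f x) (x + (0 : ℝ) • v) := by simpa using hf.hasFDerivAt
      have h2 := h1.comp_hasDerivAt 0 hline
      have h3 : fderiv ℝ f x v = ⟪gradient f x, v⟫ := by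
        rw [gradient, InnerProductSpace.toDual_symm_apply]
      rw [← h3]; exact h2
    have hs : ∀ {f : ℝ → ℝ} {c : ℝ}, HasDerivAt f c 0 → f 0 = 0 → 0 < c →
        ∀ᶠ s in 𝓝[>] (0 : ℝ), 0 < f s := by
      intro f c hf hf0 hc
      have h1 := hasDerivAt_iff_tendsto_slope.mp hf
      have h2 := (h1.mono_left (nhdsWithin_mono 0 fun s (hs : 0 < s) => hs.ne')).eventually
        (lt_mem_nhds hc)
      filter_upwards [h2, self_mem_nhdsWithin] with s h3 h4
      have h4 : 0 < s := h4
      rw [slope_def_field, hf0, sub_zero, sub_zero] at h3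
      exact (div_pos_iff_of_pos_right h4).mp h3
    have e1 := hs (hder ha).neg (by simp [ha0]) (neg_pos.mpr hv)
    have e2 := hs (hder hb) (by simp [hb0]) hBv
    have e3 : ∀ᶠ s in 𝓝[>] (0 : ℝ), a (x + s • v) < 0 → b (x + s • v) ≤ 0 := by
      have : Tendsto (fun s : ℝ => x + s • v) (𝓝[>] 0) (𝓝 x) := by
        have := hline.continuousAt.tendsto.mono_left (nhdsWithin_le_nhds (s := Ioi (0 : ℝ)))
        simpa using this
      exact this.eventually h
    obtain ⟨s, h1, h2, h3⟩ := (e1.and (e2.and e3)).exists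
    have h1' : a (x + s • v) < 0 := by simpa using h1
    exact absurd h2 (not_lt.mpr (h3 h1'))
  have hA0 : 0 < ‖A‖ ^ 2 := by positivity
  set c := ⟪A, B⟫ / ‖A‖ ^ 2 with hc
  -- The part of `B` orthogonal to `A`, to be shown zero.
  set w := B - c • A with hw
  have hAw : ⟪A, w⟫ = 0 := by
    rw [hw, inner_sub_right, real_inner_smul_right, real_inner_self_eq_norm_sq, hc]
    field_simp; ring
  have hBw : ⟪B, w⟫ = ‖w‖ ^ 2 := by
    have : B = w + c • A := by rw [hw]; abel
    conv_lhs => rw [this]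
    rw [inner_add_left, real_inner_smul_left, hAw, real_inner_self_eq_norm_sq]; ring
  have hw0 : w = 0 := by
    by_contra hne
    have hpos : 0 < ‖w‖ ^ 2 := by positivity
    -- The multiple of `w` costs nothing in `⟪A, ·⟫`, which stays negative, but is chosen to
    -- contribute `|⟪B, A⟫| + 1` to `⟪B, ·⟫`, outweighing the contribution of `-A`.
    have := key (((|⟪B, A⟫| + 1) / ‖w‖ ^ 2) • w - A) (by
      rw [inner_sub_right, real_inner_smul_right, hAw, real_inner_self_eq_norm_sq]; linarith)
    rw [inner_sub_right, real_inner_smul_right, hBw, div_mul_cancel₀ _ hpos.ne',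
      real_inner_comm] at this
    linarith [le_abs_self ⟪A, B⟫]
  have hBc : B = c • A := by rw [← sub_eq_zero]; exact hw0
  refine ⟨c, ?_, hBc⟩
  have h1 := key (-A) (by rw [inner_neg_right, real_inner_self_eq_norm_sq]; linarith)
  rw [hBc, inner_neg_right, real_inner_smul_left, real_inner_self_eq_norm_sq] at h1
  have h2 : c ≠ 0 := fun h => hbg (by rw [hBc, h, zero_smul])
  have h3 : 0 ≤ c := by
    by_contra! h; nlinarith
  exact lt_of_le_of_ne h3 (Ne.symm h2)

lemma inv_norm_smul_smul {c : ℝ} (hc : 0 < c) (v : Space d) :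
    ‖c • v‖⁻¹ • (c • v) = ‖v‖⁻¹ • v := by
  rw [norm_smul, Real.norm_eq_abs, abs_of_pos hc, mul_inv, smul_smul]
  congr 1
  field_simp

/-! ### Integrals concentrated at two transversal level sets -/

section LowerBound

variable {V : Type*} [NormedAddCommGroup V] [NormedSpace ℝ V] [FiniteDimensional ℝ V]
  [MeasurableSpace V] [BorelSpace V] (μ : Measure V) [μ.IsAddHaarMeasure]

/-- Since `(ψ₁, ψ₂)` is a submersion, the set where `ψ₁/δ` and `ψ₂/ε` lie in a fixed interval has
volume of order at least `δ ε`, which compensates the factor `δ⁻¹ ε⁻¹`. The bound is thus uniform in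
both widths, so the limits may be taken one after the other. -/
lemma exists_doubly_concentrated_ge {ψ₁ ψ₂ G : V → ℝ} {p : V} {L₁ L₂ : V →L[ℝ] ℝ}
    (h₁ : HasStrictFDerivAt ψ₁ L₁ p) (h₂ : HasStrictFDerivAt ψ₂ L₂ p)
    (hsurj : Function.Surjective (L₁.prod L₂)) (h01 : ψ₁ p = 0) (h02 : ψ₂ p = 0) {g₀ : ℝ}
    (hg₀ : 0 < g₀) (hG : ∀ᶠ q in 𝓝 p, g₀ ≤ G q) (hG0 : ∀ q, 0 ≤ G q) :
    ∃ c > 0, ∃ r > 0, ∀ δ ε : ℝ, 0 < δ → δ < r → 0 < ε → ε < r →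
      Integrable (fun q => δ⁻¹ * deriv step (ψ₁ q / δ) * (ε⁻¹ * deriv step (ψ₂ q / ε) * G q)) μ →
      c ≤ ∫ q, δ⁻¹ * deriv step (ψ₁ q / δ) * (ε⁻¹ * deriv step (ψ₂ q / ε) * G q) ∂μ := by
  obtain ⟨a, b, c, ha, hab, hb, hc, hstep⟩ := exists_deriv_step_ge
  obtain ⟨C, hC, r, hr, hvol⟩ := exists_volume_preimage_ge μ (volume : Measure (ℝ × ℝ))
    (h₁.prodMk h₂) hsurj hG
  -- The minimum with 1 guards against an infinite constant.
  have hC1 : (min C 1).toReal > 0 := ENNReal.toReal_pos (by simp [hC]) (by simp)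
  refine ⟨c ^ 2 * g₀ * ((min C 1).toReal * (b - a) ^ 2), by
    have := sub_pos.mpr hab
    positivity, r, hr, fun δ ε hδ hδr hε hεr hint => ?_⟩
  set F := fun q => δ⁻¹ * deriv step (ψ₁ q / δ) * (ε⁻¹ * deriv step (ψ₂ q / ε) * G q) with hF
  set κ := δ⁻¹ * c * (ε⁻¹ * c * g₀) with hκ
  have hκ0 : 0 < κ := by positivity
  have hF0 : ∀ q, 0 ≤ F q := fun q => mul_nonneg
    (mul_nonneg (inv_nonneg.mpr hδ.le) (deriv_step_nonneg _))
    (mul_nonneg (mul_nonneg (inv_nonneg.mpr hε.le) (deriv_step_nonneg _)) (hG0 q))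
  have h1 := mul_meas_ge_le_integral_of_nonneg (Eventually.of_forall hF0) hint κ
  set S : Set (ℝ × ℝ) := Icc (δ * a) (δ * b) ×ˢ Icc (ε * a) (ε * b) with hS
  have hball : ∀ {s η : ℝ}, 0 < η → η < r → s ∈ Icc (η * a) (η * b) → |s| < r := by
    intro s η hη hηr hs
    rw [abs_lt]
    constructor <;> nlinarith [hs.1, hs.2]
  have hSb : S ⊆ Metric.ball (ψ₁ p, ψ₂ p) r := by
    rintro ⟨s, t⟩ ⟨hs, ht⟩
    rw [h01, h02, Metric.mem_ball, Prod.dist_eq, max_lt_iff]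
    simp only [Real.dist_eq, sub_zero]
    exact ⟨hball hδ hδr hs, hball hε hεr ht⟩
  have h2 := hvol S (measurableSet_Icc.prod measurableSet_Icc) hSb
  have hscale : ∀ {s η : ℝ}, 0 < η → s ∈ Icc (η * a) (η * b) → s / η ∈ Icc a b := by
    intro s η hη hs
    exact ⟨(le_div_iff₀ hη).mpr (by linarith [hs.1]), (div_le_iff₀ hη).mpr (by linarith [hs.2])⟩
  have h3 : {q | g₀ ≤ G q} ∩ (fun q => (ψ₁ q, ψ₂ q)) ⁻¹' S ⊆ {q | κ ≤ F q} := by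
    rintro q ⟨hq, hq1, hq2⟩
    have e1 := hstep _ (hscale hδ hq1)
    have e2 := hstep _ (hscale hε hq2)
    have hq' : g₀ ≤ G q := hq
    show δ⁻¹ * c * (ε⁻¹ * c * g₀) ≤ F q
    exact mul_le_mul (mul_le_mul_of_nonneg_left e1 (inv_nonneg.mpr hδ.le))
      (mul_le_mul (mul_le_mul_of_nonneg_left e2 (inv_nonneg.mpr hε.le)) hq' hg₀.le
        (mul_nonneg (inv_nonneg.mpr hε.le) (deriv_step_nonneg _))) (by positivity)
      (mul_nonneg (inv_nonneg.mpr hδ.le) (deriv_step_nonneg _))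
  have hfin : μ {q | κ ≤ F q} < ⊤ := hint.measure_ge_lt_top hκ0
  have hvS : volume S = ENNReal.ofReal (δ * (b - a)) * ENNReal.ofReal (ε * (b - a)) := by
    rw [hS, Measure.volume_eq_prod, Measure.prod_prod, Real.volume_Icc, Real.volume_Icc, ← mul_sub,
      ← mul_sub]
  have h4 : (min C 1).toReal * (δ * (b - a) * (ε * (b - a))) ≤ μ.real {q | κ ≤ F q} := by
    have h5 : min C 1 * volume S ≤ μ {q | κ ≤ F q} :=
      (mul_le_mul_left (min_le_left _ _) _).trans (h2.trans (measure_mono h3))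
    have h6 := ENNReal.toReal_mono hfin.ne h5
    rw [hvS, ENNReal.toReal_mul, ENNReal.toReal_mul, ENNReal.toReal_ofReal,
      ENNReal.toReal_ofReal] at h6
    · exact h6
    · nlinarith
    · nlinarith
  refine le_trans (le_of_eq ?_) ((mul_le_mul_of_nonneg_left h4 hκ0.le).trans h1)
  rw [hκ]
  field_simp

end LowerBound

/-- A smooth field tangential to the level sets of `b` and with unit component along the normal
of the level sets of `φ`. -/
lemma exists_tangential_field {O : Set (ℝ × Space d)} {φ b : ℝ × Space d → ℝ}
    (hφ : ∀ p ∈ O, ContDiffAt ℝ ∞ φ p) (hb : ∀ p ∈ O, ContDiffAt ℝ ∞ b p)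
    (hgrad : ∀ p ∈ O, spaceGrad φ p ≠ 0)
    (hD : ∀ p ∈ O, ‖spaceGrad φ p‖ ^ 2 * ‖spaceGrad b p‖ ^ 2 - ⟪spaceGrad φ p, spaceGrad b p⟫ ^ 2
      ≠ 0) :
    ∃ Y : ℝ × Space d → Space d, (∀ p ∈ O, ContDiffAt ℝ ∞ Y p) ∧
      (∀ p ∈ O, ⟪spaceGrad b p, Y p⟫ = 0) ∧ (∀ p ∈ O, ⟪Y p, levelNormal φ p⟫ = 1) ∧
      ∀ p ∈ O, ⟪spaceGrad φ p, Y p⟫ = ‖spaceGrad φ p‖ := by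
  set D := fun p => ‖spaceGrad φ p‖ ^ 2 * ‖spaceGrad b p‖ ^ 2
    - ⟪spaceGrad φ p, spaceGrad b p⟫ ^ 2 with hDdef
  have h3 : ∀ p ∈ O, ⟪spaceGrad φ p, (‖spaceGrad φ p‖ * (D p)⁻¹) • (‖spaceGrad b p‖ ^ 2 •
      spaceGrad φ p - ⟪spaceGrad φ p, spaceGrad b p⟫ • spaceGrad b p)⟫ = ‖spaceGrad φ p‖ := by
    intro p hp
    rw [real_inner_smul_right, inner_sub_right, real_inner_smul_right, real_inner_smul_right,
      real_inner_self_eq_norm_sq]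
    have := hD p hp
    have e : ‖spaceGrad b p‖ ^ 2 * ‖spaceGrad φ p‖ ^ 2 - ⟪spaceGrad φ p, spaceGrad b p⟫
      * ⟪spaceGrad φ p, spaceGrad b p⟫ = D p := by simp only [hDdef]; ring
    rw [e, mul_assoc, inv_mul_cancel₀ this, mul_one]
  -- Gram-Schmidt: `∇φ` without its component along `∇b`, rescaled. The scaling divides by the Gram
  -- determinant `D`, nonzero by transversality.
  refine ⟨fun p => (‖spaceGrad φ p‖ * (D p)⁻¹) • (‖spaceGrad b p‖ ^ 2 • spaceGrad φ p
    - ⟪spaceGrad φ p, spaceGrad b p⟫ • spaceGrad b p), fun p hp => ?_, fun p hp => ?_,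
    fun p hp => ?_, h3⟩
  · have e1 := contDiffAt_spaceGrad (m := ∞) (hφ p hp) (by simp)
    have e2 := contDiffAt_spaceGrad (m := ∞) (hb p hp) (by simp)
    have e3 := e1.inner ℝ e2
    have e4 : ContDiffAt ℝ ∞ D p := ((e1.norm_sq ℝ).mul (e2.norm_sq ℝ)).sub (e3.pow 2)
    exact ((e1.norm ℝ (hgrad p hp)).mul (e4.inv (hD p hp))).smul
      (((e2.norm_sq ℝ).smul e1).sub (e3.smul e2))
  · rw [real_inner_smul_right, inner_sub_right, real_inner_smul_right, real_inner_smul_right,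
      real_inner_self_eq_norm_sq, real_inner_comm (spaceGrad φ p)]
    ring
  · have hn := norm_ne_zero_iff.mpr (hgrad p hp)
    rw [levelNormal, real_inner_smul_right, real_inner_comm, h3 p hp, inv_mul_cancel₀ hn]

/-! ### The contact angle -/

lemma contDiff_inner_of_tsupport {F Z : ℝ × Space d → Space d} {O : Set (ℝ × Space d)}
    {n : WithTop ℕ∞} (hF : ContDiff ℝ n F) (hFO : tsupport F ⊆ O)
    (hZ : ∀ q ∈ O, ContDiffAt ℝ n Z q) : ContDiff ℝ n fun q => ⟪F q, Z q⟫ := by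
  rw [contDiff_iff_contDiffAt]
  intro q
  by_cases hq : q ∈ tsupport F
  · exact hF.contDiffAt.inner ℝ (hZ q (hFO hq))
  · refine (contDiffAt_const (c := (0 : ℝ))).congr_of_eventuallyEq ?_
    filter_upwards [(isClosed_tsupport F).isOpen_compl.mem_nhds hq] with q' hq'
    rw [image_eq_zero_of_notMem_tsupport hq', inner_zero_left]

/-- Cutting off along the level sets of `ψ` commutes with the divergence along fields tangential
to these level sets. -/
lemma spaceDiv_mul_profile_smul {f ψ : ℝ × Space d → ℝ} {Y : ℝ × Space d → Space d}
    {O : Set (ℝ × Space d)} (hf : ContDiff ℝ ∞ f) (hfO : tsupport f ⊆ O)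
    (hψ : ∀ p ∈ O, ContDiffAt ℝ ∞ ψ p) (hY : ∀ p ∈ O, ContDiffAt ℝ ∞ Y p)
    (hYψ : ∀ p ∈ O, ⟪spaceGrad ψ p, Y p⟫ = 0) {h : ℝ → ℝ} (hh : ContDiff ℝ ∞ h) (ε : ℝ)
    (p : ℝ × Space d) :
    spaceDiv (fun q => (f q * h (ψ q / ε)) • Y q) p
      = h (ψ p / ε) * spaceDiv (fun q => f q • Y q) p := by
  by_cases hp : p ∈ tsupport f
  · have hpO := hfO hp
    have hd : DifferentiableAt ℝ Y p := (hY p hpO).differentiableAt (by simp)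
    rw [spaceDiv_smul ((contDiff_mul_profile hf hfO hψ hh ε).contDiffAt.differentiableAt (by simp))
      hd, spaceDiv_smul (hf.contDiffAt.differentiableAt (by simp)) hd,
      spaceGrad_mul_profile hf hfO hψ hh ε, inner_add_left, real_inner_smul_left,
      real_inner_smul_left, hYψ p hpO]
    ring
  · rw [spaceDiv_eq_zero_of_notMem_tsupport, spaceDiv_eq_zero_of_notMem_tsupport, mul_zero]
    · exact fun h => hp (tsupport_smul_subset_left _ _ h)
    · exact fun h => hp (tsupport_mul_subset_left (tsupport_smul_subset_left _ _ h))

lemma contDiff_one_sub_step : ContDiff ℝ ∞ fun s => 1 - step s := contDiff_const.sub contDiff_step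

lemma abs_one_sub_step_le_one (s : ℝ) : |1 - step s| ≤ 1 := by
  rw [abs_le]; constructor <;> linarith [step_nonneg s, step_le_one s]

lemma tendsto_one_sub_step_div (a : ℝ) :
    Tendsto (fun ε : ℝ => 1 - step (a / ε)) (𝓝[>] 0) (𝓝 (if a < 0 then 1 else 0)) := by
  split_ifs with h
  · simpa using (tendsto_step_div h).const_sub 1
  · refine Tendsto.congr' (f₁ := fun _ => (0 : ℝ)) ?_ tendsto_const_nhds
    filter_upwards [self_mem_nhdsWithin] with ε hε
    have hε : 0 < ε := hε
    rw [step_eq_one, sub_self]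
    have := div_nonneg (not_lt.mp h) hε.le
    linarith

/-- A phase chart at a boundary point of `Ω` at which the interface is transversal to `∂Ω`. -/
structure ContactChart (Ω : Set (Space d)) (T : ℝ) (ρ χ : ℝ × Space d → ℝ)
    (O : Set (ℝ × Space d)) (φ r₁ r₂ : ℝ × Space d → ℝ) (b : Space d → ℝ)
    (Y : ℝ × Space d → Space d) : Prop extends PhaseChart Ω T ρ χ O φ r₁ r₂ where
  pos : ∀ p ∈ O, 0 < p.1
  grad_ne : ∀ p ∈ O, spaceGrad φ p ≠ 0
  smooth_boundary : ∀ p ∈ O, ContDiffAt ℝ ∞ (fun q : ℝ × Space d => b q.2) p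
  boundary : ∀ p ∈ O, p.2 ∈ Ω ↔ b p.2 < 0
  boundary_grad_ne : ∀ p ∈ O, gradient b p.2 ≠ 0
  field : ∀ p ∈ O, ContDiffAt ℝ ∞ Y p
  field_boundary : ∀ p ∈ O, ⟪gradient b p.2, Y p⟫ = 0
  field_normal : ∀ p ∈ O, ⟪Y p, levelNormal φ p⟫ = 1

/-! ### Surface integrals up to the boundary of the domain -/

namespace ContactChart

variable {Ω : Set (Space d)} {T m lam : ℝ} {ρ χ : ℝ × Space d → ℝ}
  {u : ℝ × Space d → Space d} {ρ₀ : Space d → ℝ} {μ : ℝ → Measure (Space d)}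
  {ν : ℝ → Space d → Space d} {O : Set (ℝ × Space d)} {φ r₁ r₂ : ℝ × Space d → ℝ}
  {b : Space d → ℝ} {Y : ℝ × Space d → Space d}

/-- `step` equals 1 from `-1/2` on, so the cut-off already vanishes for `b ≥ -δ/2` and its closed
support keeps away from `∂Ω`. -/
lemma mem_of_mem_tsupport_cutoff (hc : ContactChart Ω T ρ χ O φ r₁ r₂ b Y)
    {s : ℝ × Space d → ℝ} (hsO : tsupport s ⊆ O) {δ : ℝ} (hδ : 0 < δ) {p : ℝ × Space d}
    (hp : p ∈ tsupport fun q => s q * (1 - step (b q.2 / δ))) : p.2 ∈ Ω := by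
  have hpO : p ∈ O := hsO (tsupport_mul_subset_left hp)
  rw [hc.boundary p hpO]
  by_contra! hb
  have hcont : ContinuousAt (fun q : ℝ × Space d => b q.2) p :=
    (hc.smooth_boundary p hpO).continuousAt
  have hev : ∀ᶠ q in 𝓝 p, -(δ / 2) < b q.2 :=
    hcont.eventually (lt_mem_nhds (show -(δ / 2) < b p.2 by linarith))
  refine notMem_tsupport_iff_eventuallyEq.mpr ?_ hp
  filter_upwards [hev] with q hq
  rw [step_eq_one, sub_self, mul_zero]; · rfl
  rw [le_div_iff₀ hδ]; linarith

/-- The defining relation of `∇χ` admits only fields compactly supported in `Ω`. The cut-off `1 -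
step (b / δ)` ensures this, and because `Y` is tangential to the level sets of `b` its derivative
never enters: the limit `δ → 0` leaves no boundary term. -/
lemma tendsto_bulk (hc : ContactChart Ω T ρ χ O φ r₁ r₂ b Y) (hΩ : IsOpen Ω)
    {s : ℝ × Space d → ℝ} (hs : ContDiff ℝ ∞ s) (hsc : HasCompactSupport s)
    (hsO : tsupport s ⊆ O) {t : ℝ} (ht : 0 ≤ t)
    (hpol : IsGradientPolar Ω (fun x => χ (t, x)) (μ t) (ν t)) :
    Tendsto (fun δ : ℝ => ∫ x, s (t, x) * (1 - step (b x / δ)) ∂(μ t)) (𝓝[>] 0)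
      (𝓝 (∫ x in Ω, (if φ (t, x) < 0 then 1 else 0) * spaceDiv (fun q => s q • Y q) (t, x))) := by
  set D := spaceDiv fun q => s q • Y q with hD
  have hsY : ContDiff ℝ ∞ fun q => s q • Y q := contDiff_smul_of_tsupport hs hsO hc.field
  have hDs : tsupport D ⊆ tsupport s :=
    (tsupport_spaceDiv_subset _).trans (tsupport_smul_subset_left _ _)
  have hDc : Continuous D := continuous_spaceDiv (hsY.of_le (by simp))
  have hsl : ∀ {g : ℝ × Space d → ℝ} {x : Space d}, ContinuousAt g (t, x) →
      ContinuousAt (fun y => g (t, y)) x := fun hg =>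
    ContinuousAt.comp (f := fun y => (_, y)) hg (Continuous.prodMk_right _).continuousAt
  have hG : Integrable fun x => D (t, x) * (if φ (t, x) < 0 then 1 else 0) :=
    integrable_mul_ite volume (O := {x | (t, x) ∈ O}) (isOpen_slice hc.isOpen t)
      (q₁ := fun _ => 1) (q₂ := fun _ => 0)
      (hDc.comp (Continuous.prodMk_right t))
      (hasCompactSupport_slice (hasCompactSupport_of_tsupport_subset hsc hDs) t)
      ((tsupport_slice_subset D t).trans fun x hx => hsO (hDs hx))
      (fun x hx => hsl (hc.level _ hx).continuousAt) (fun _ _ => continuousAt_const)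
      (fun _ _ => continuousAt_const)
  have hG0 : ∀ x ∉ {x | (t, x) ∈ O}, D (t, x) * (if φ (t, x) < 0 then 1 else 0) = 0 := fun x hx => by
    rw [image_eq_zero_of_notMem_tsupport fun h => hx (hsO (hDs h)), zero_mul]
  have hlim := tendsto_integral_profile volume (isOpen_slice hc.isOpen t)
    contDiff_one_sub_step.continuous abs_one_sub_step_le_one (ψ := b)
    (L := fun x => if b x < 0 then 1 else 0)
    (fun x hx => hsl (g := fun q => b q.2) (hc.smooth_boundary _ hx).continuousAt) hG hG0
    (Eventually.of_forall fun x _ => tendsto_one_sub_step_div (b x))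
  have hval : ∫ x, (if b x < 0 then 1 else 0) * (D (t, x) * (if φ (t, x) < 0 then 1 else 0))
      = ∫ x in Ω, (if φ (t, x) < 0 then 1 else 0) * D (t, x) := by
    rw [← integral_indicator hΩ.measurableSet]
    refine integral_congr_ae (Eventually.of_forall fun x => ?_)
    by_cases hx : (t, x) ∈ O
    · by_cases hxΩ : x ∈ Ω
      · simp only [indicator_of_mem hxΩ, if_pos ((hc.boundary _ hx).mp hxΩ), one_mul]
        rw [mul_comm]
      · simp only [indicator_of_notMem hxΩ]
        rw [if_neg fun h => hxΩ ((hc.boundary _ hx).mpr h), zero_mul]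
    · simp only [indicator]
      rw [hG0 x hx, mul_zero, mul_comm, hG0 x hx, ite_self]
  rw [hval] at hlim
  refine hlim.congr' ?_
  filter_upwards [self_mem_nhdsWithin] with δ hδ
  have hδ : 0 < δ := hδ
  have hg := contDiff_mul_profile hs hsO hc.smooth_boundary contDiff_one_sub_step δ
  have hgs : tsupport (fun q => s q * (1 - step (b q.2 / δ))) ⊆ tsupport s :=
    tsupport_mul_subset_left
  have := hc.toPhaseChart.integral_polar hΩ hc.grad_ne ht hpol hg
    (hasCompactSupport_of_tsupport_subset hsc hgs) (hgs.trans hsO)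
    (fun p hp => hc.mem_of_mem_tsupport_cutoff hsO hδ hp) hc.field hc.field_normal
  simp only at this
  rw [this]
  refine integral_congr_ae (Eventually.of_forall fun x => ?_)
  simp only
  rw [spaceDiv_mul_profile_smul hs hsO hc.smooth_boundary hc.field hc.field_boundary
    contDiff_one_sub_step δ (t, x)]
  ring

lemma tendsto_cutoff (hc : ContactChart Ω T ρ χ O φ r₁ r₂ b Y)
    {s : ℝ × Space d → ℝ} (hsO : tsupport s ⊆ O) {t : ℝ} {x : Space d} (hx : x ∈ Ω) :
    Tendsto (fun δ : ℝ => s (t, x) * (1 - step (b x / δ))) (𝓝[>] 0) (𝓝 (s (t, x))) := by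
  by_cases hxO : (t, x) ∈ O
  · have := tendsto_one_sub_step_div (b x)
    rw [if_pos ((hc.boundary _ hxO).mp hx)] at this
    simpa using this.const_mul (s (t, x))
  · rw [image_eq_zero_of_notMem_tsupport fun h => hxO (hsO h)]
    simp

/-- The measure `|∇χ|` is assumed finite only on compact subsets of `Ω`. Finiteness up to `∂Ω`
follows by Fatou's lemma from the convergence of the cut-off integrals in `tendsto_bulk`. -/
lemma integrable_polar (hc : ContactChart Ω T ρ χ O φ r₁ r₂ b Y) (hΩ : IsOpen Ω)
    {s : ℝ × Space d → ℝ} (hs : ContDiff ℝ ∞ s) (hsc : HasCompactSupport s)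
    (hsO : tsupport s ⊆ O) (hs0 : ∀ p, 0 ≤ s p) {t : ℝ} (ht : 0 ≤ t)
    (hpol : IsGradientPolar Ω (fun x => χ (t, x)) (μ t) (ν t)) :
    Integrable (fun x => s (t, x)) (μ t) := by
  have hmeas : AEStronglyMeasurable (fun x => s (t, x)) (μ t) :=
    (hs.continuous.comp (Continuous.prodMk_right t)).aestronglyMeasurable
  refine ⟨hmeas, ?_⟩
  have hgc : ∀ δ : ℝ, Continuous fun x => s (t, x) * (1 - step (b x / δ)) := fun δ =>
    (contDiff_mul_profile hs hsO hc.smooth_boundary contDiff_one_sub_step δ).continuous.comp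
      (Continuous.prodMk_right t)
  have hF := lintegral_liminf_le' (μ := μ t) (u := 𝓝[>] (0 : ℝ))
    (f := fun δ x => ‖s (t, x) * (1 - step (b x / δ))‖ₑ)
    fun δ => (hgc δ).aestronglyMeasurable.enorm
  have hΩae : ∀ᵐ x ∂(μ t), x ∈ Ω := by
    have := measure_eq_zero_iff_ae_notMem.mp hpol.null_compl
    filter_upwards [this] with x hx using not_not.mp hx
  have h1 : ∫⁻ x, ‖s (t, x)‖ₑ ∂(μ t)
      = ∫⁻ x, liminf (fun δ : ℝ => ‖s (t, x) * (1 - step (b x / δ))‖ₑ) (𝓝[>] 0) ∂(μ t) := by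
    refine lintegral_congr_ae ?_
    filter_upwards [hΩae] with x hx
    exact ((hc.tendsto_cutoff hsO hx).enorm.liminf_eq).symm
  rw [HasFiniteIntegral, h1]
  refine lt_of_le_of_lt hF ?_
  have hlim := (ENNReal.continuous_ofReal.tendsto _).comp (hc.tendsto_bulk hΩ hs hsc hsO ht hpol)
  have h2 : Tendsto (fun δ : ℝ => ∫⁻ x, ‖s (t, x) * (1 - step (b x / δ))‖ₑ ∂(μ t)) (𝓝[>] 0)
      (𝓝 (ENNReal.ofReal (∫ x in Ω, (if φ (t, x) < 0 then 1 else 0)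
        * spaceDiv (fun q => s q • Y q) (t, x)))) := by
    refine hlim.congr' ?_
    filter_upwards [self_mem_nhdsWithin] with δ hδ
    have hδ : 0 < δ := hδ
    set g : ℝ × Space d → ℝ := fun q => s q * (1 - step (b q.2 / δ)) with hg
    have hgs : tsupport g ⊆ tsupport s := tsupport_mul_subset_left
    have hg0 : ∀ x, 0 ≤ g (t, x) := fun x =>
      mul_nonneg (hs0 _) (sub_nonneg.mpr (step_le_one _))
    have hgc' := hasCompactSupport_slice (hasCompactSupport_of_tsupport_subset hsc hgs) t
    have hKΩ : tsupport (fun x => g (t, x)) ⊆ Ω := (tsupport_slice_subset g t).trans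
      fun x hx => hc.mem_of_mem_tsupport_cutoff hsO hδ hx
    obtain ⟨C, hC⟩ := hgc'.exists_bound_of_continuous (hgc δ)
    have hint : Integrable (fun x => g (t, x)) (μ t) := by
      refine (integrableOn_iff_integrable_of_support_subset (subset_tsupport _)).mp
        (Measure.integrableOn_of_bounded (M := C) (hpol.locally_finite _ hgc' hKΩ).ne
          (hgc δ).aestronglyMeasurable (Eventually.of_forall hC))
    rw [Function.comp_apply, ofReal_integral_eq_lintegral_ofReal hint (Eventually.of_forall hg0)]
    refine lintegral_congr fun x => ?_
    rw [← ofReal_norm, Real.norm_of_nonneg (hg0 x)]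
  rw [h2.liminf_eq]
  exact ENNReal.ofReal_lt_top

/-- Integrals against `|∇χ|` up to the boundary as bulk integrals over the evolving set. -/
lemma integral_polar (hc : ContactChart Ω T ρ χ O φ r₁ r₂ b Y) (hΩ : IsOpen Ω)
    {s : ℝ × Space d → ℝ} (hs : ContDiff ℝ ∞ s) (hsc : HasCompactSupport s)
    (hsO : tsupport s ⊆ O) {t : ℝ} (ht : 0 ≤ t)
    (hpol : IsGradientPolar Ω (fun x => χ (t, x)) (μ t) (ν t))
    (hint : Integrable (fun x => s (t, x)) (μ t)) :
    ∫ x, s (t, x) ∂(μ t)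
      = ∫ x in Ω, (if φ (t, x) < 0 then 1 else 0) * spaceDiv (fun q => s q • Y q) (t, x) := by
  refine tendsto_nhds_unique ?_ (hc.tendsto_bulk hΩ hs hsc hsO ht hpol)
  have hΩae : ∀ᵐ x ∂(μ t), x ∈ Ω := by
    have := measure_eq_zero_iff_ae_notMem.mp hpol.null_compl
    filter_upwards [this] with x hx using not_not.mp hx
  refine tendsto_integral_filter_of_dominated_convergence (fun x => ‖s (t, x)‖)
    (Eventually.of_forall fun δ =>
      ((contDiff_mul_profile hs hsO hc.smooth_boundary contDiff_one_sub_step δ).continuous.comp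
        (Continuous.prodMk_right t)).aestronglyMeasurable)
    (Eventually.of_forall fun δ => Eventually.of_forall fun x => ?_) hint.norm ?_
  · rw [norm_mul]
    exact mul_le_of_le_one_right (norm_nonneg _) (abs_one_sub_step_le_one _)
  · filter_upwards [hΩae] with x hx using hc.tendsto_cutoff hsO hx

lemma inner_outerNormal (hc : ContactChart Ω T ρ χ O φ r₁ r₂ b Y) {p : ℝ × Space d} (hp : p ∈ O)
    (hpΩ : p.2 ∈ frontier Ω) (hΩ : IsOpen Ω) {n : Space d} (hn : IsOuterNormal Ω p.2 n) :
    ⟪Y p, n⟫ = 0 := by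
  obtain ⟨b', hb', rfl⟩ := hn
  have hcont : ContinuousAt b p.2 := by
    have := contDiffAt_slice (f := fun q : ℝ × Space d => b q.2) (t := p.1) (x := p.2)
      (hc.smooth_boundary p hp)
    exact this.continuousAt
  have hdb : DifferentiableAt ℝ b p.2 :=
    (contDiffAt_slice (f := fun q : ℝ × Space d => b q.2) (t := p.1) (x := p.2)
      (hc.smooth_boundary p hp)).differentiableAt (by simp)
  have hnear : ∀ᶠ y in 𝓝 p.2, (p.1, y) ∈ O :=
    (isOpen_slice hc.isOpen p.1).mem_nhds (show (p.1, p.2) ∈ O from hp)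
  have h0 : b p.2 = 0 := by
    refine le_antisymm ?_ (not_lt.mp fun h => notMem_frontier_of_mem hΩ
      ((hc.boundary p hp).mpr h) hpΩ)
    by_contra! hpos
    have h1 : ∀ᶠ y in 𝓝 p.2, y ∉ Ω := by
      filter_upwards [hnear, hcont.eventually (lt_mem_nhds hpos)] with y hy hby
      exact fun h => absurd ((hc.boundary _ hy).mp h) (not_lt.mpr (le_of_lt hby))
    have := (mem_closure_iff_frequently.mp (frontier_subset_closure hpΩ))
    exact this h1
  -- The outer normal may come from another defining function; its gradient is parallel to that of
  -- `b`.
  obtain ⟨c, hc0, hcb⟩ := exists_gradient_eq_smul hdb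
    (hb'.smooth.self_of_nhds.differentiableAt (by simp)) h0 hb'.zero hb'.grad_ne
    (hc.boundary_grad_ne p hp) (by
      filter_upwards [hnear, hb'.mem_iff] with y hy hy' hby
      exact (hy'.mp ((hc.boundary _ hy).mpr hby)).le)
  rw [hcb, real_inner_smul_right, real_inner_smul_right, real_inner_comm, hc.field_boundary p hp]
  simp

end ContactChart

/-- Cramer's rule with the Gram matrix, solved within the span of `v` and `w`. -/
lemma exists_inner_eq_of_gram_ne_zero {v w : Space d} (hD : ‖v‖ ^ 2 * ‖w‖ ^ 2 - ⟪v, w⟫ ^ 2 ≠ 0)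
    (α β : ℝ) : ∃ z : Space d, ⟪v, z⟫ = α ∧ ⟪w, z⟫ = β := by
  refine ⟨((α * ‖w‖ ^ 2 - β * ⟪v, w⟫) / (‖v‖ ^ 2 * ‖w‖ ^ 2 - ⟪v, w⟫ ^ 2)) • v
    + ((β * ‖v‖ ^ 2 - α * ⟪v, w⟫) / (‖v‖ ^ 2 * ‖w‖ ^ 2 - ⟪v, w⟫ ^ 2)) • w, ?_, ?_⟩
  · rw [inner_add_right, real_inner_smul_right, real_inner_smul_right, real_inner_self_eq_norm_sq,
      div_mul_eq_mul_div, div_mul_eq_mul_div, ← add_div, div_eq_iff hD]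
    ring
  · rw [inner_add_right, real_inner_smul_right, real_inner_smul_right, real_inner_self_eq_norm_sq,
      real_inner_comm v w, div_mul_eq_mul_div, div_mul_eq_mul_div, ← add_div, div_eq_iff hD]
    ring

namespace ContactChart

variable {Ω : Set (Space d)} {T m lam : ℝ} {ρ χ : ℝ × Space d → ℝ}
  {u : ℝ × Space d → Space d} {ρ₀ : Space d → ℝ} {μ : ℝ → Measure (Space d)}
  {ν : ℝ → Space d → Space d} {O : Set (ℝ × Space d)} {φ r₁ r₂ : ℝ × Space d → ℝ}
  {b : Space d → ℝ} {Y : ℝ × Space d → Space d}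

/-- The surface term of a tangential field `g • Y` as an integral of smooth functions. -/
lemma surfaceTerm_eq (hc : ContactChart Ω T ρ χ O φ r₁ r₂ b Y) (hΩ : IsOpen Ω)
    {g : ℝ × Space d → ℝ} (hg : ContDiff ℝ ∞ g) (hgO : tsupport g ⊆ O) {t : ℝ} (ht : 0 ≤ t)
    (hpol : IsGradientPolar Ω (fun x => χ (t, x)) (μ t) (ν t)) :
    surfaceTerm (μ t) (ν t) (fun q => g q • Y q) t
      = ∫ x, (g (t, x) * (spaceDiv Y (t, x) - ⟪levelNormal φ (t, x),
          fderiv ℝ Y (t, x) (0, levelNormal φ (t, x))⟫)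
        + ⟪spaceGrad g (t, x), Y (t, x) - levelNormal φ (t, x)⟫) ∂(μ t) := by
  refine integral_congr_ae ?_
  filter_upwards [hc.toPhaseChart.ae_eq_levelNormal hΩ hc.grad_ne ht hpol,
    measure_eq_zero_iff_ae_notMem.mp hpol.null_compl] with x hx hxΩ
  by_cases hxs : (t, x) ∈ tsupport g
  · have hxO := hgO hxs
    have hgd : DifferentiableAt ℝ g (t, x) := hg.contDiffAt.differentiableAt (by simp)
    have hYd : DifferentiableAt ℝ Y (t, x) := (hc.field _ hxO).differentiableAt (by simp)
    have h1 := fderiv_slice_smul hgd hYd (levelNormal φ (t, x))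
    have h2 := fderiv_slice hYd (levelNormal φ (t, x))
    simp only at h1 h2
    rw [hx hxO (not_not.mp hxΩ)]
    rw [h1, h2, spaceDiv_smul hgd hYd, inner_add_right, real_inner_smul_right,
      real_inner_smul_right, real_inner_comm (Y (t, x)) (levelNormal φ (t, x)), hc.field_normal _ hxO, inner_sub_right]
    ring
  · have hx' : (t, x) ∉ tsupport fun q => g q • Y q := fun h =>
      hxs (tsupport_smul_subset_left _ _ h)
    rw [spaceDiv_eq_zero_of_notMem_tsupport hx', fderiv_slice_eq_zero_of_notMem_tsupport
      ((contDiff_smul_of_tsupport hg hgO hc.field).differentiable (by simp)) hx',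
      image_eq_zero_of_notMem_tsupport hxs, spaceGrad_eq_zero_of_notMem_tsupport hxs]
    simp

lemma contDiffAt_surface (hc : ContactChart Ω T ρ χ O φ r₁ r₂ b Y) {p : ℝ × Space d} (hp : p ∈ O) :
    ContDiffAt ℝ ∞ (fun p => spaceDiv Y p - ⟪levelNormal φ p,
      fderiv ℝ Y p (0, levelNormal φ p)⟫) p := by
  have hN := contDiffAt_levelNormal (hc.level p hp) (hc.grad_ne p hp)
  have h1 : ContDiffAt ℝ ∞ (fderiv ℝ Y) p := (hc.field p hp).fderiv_right (by simp)
  exact (contDiffAt_spaceDiv (hc.field p hp) (by simp)).sub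
    (hN.inner ℝ (h1.clm_apply (contDiffAt_const.prodMk hN)))

lemma contDiffAt_conormal (hc : ContactChart Ω T ρ χ O φ r₁ r₂ b Y) {p : ℝ × Space d}
    (hp : p ∈ O) : ContDiffAt ℝ ∞ (fun p => ⟪gradient b p.2, levelNormal φ p⟫) p :=
  (contDiffAt_spaceGrad (hc.smooth_boundary p hp) (by simp)).inner ℝ
    (contDiffAt_levelNormal (hc.level p hp) (hc.grad_ne p hp))

/-- In the law tested with `f step(b/ε) Y`, all terms containing the undifferentiated profile
vanish, because `step(b/ε) → 0` inside `Ω`. No derivative of the profile enters the divergence, `Y`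
being tangential. In the surface term the gradient of the profile meets `Y - N`, leaving `-ε⁻¹
step'(b/ε) f ∇b · N`, which is then rewritten as a volume integral. -/
lemma tendsto_conormal (hc : ContactChart Ω T ρ χ O φ r₁ r₂ b Y) (hΩ : IsOpen Ω) (hm : 1 ≤ m)
    (h : WeakTransport Ω T ρ u ρ₀) (hy : YoungLaplaceData Ω T m lam ρ χ u μ ν)
    {s₁ : ℝ × Space d → ℝ} (hs₁ : ContDiff ℝ ∞ s₁) (hs₁c : HasCompactSupport s₁)
    (hs₁O : tsupport s₁ ⊆ O) (hs₁0 : ∀ p, 0 ≤ s₁ p) {f : ℝ × Space d → ℝ} (hf : ContDiff ℝ ∞ f)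
    (hfc : HasCompactSupport f) (hf1 : ∀ p ∈ tsupport f, s₁ p = 1) (hfO : tsupport f ⊆ O) :
    Tendsto (fun ε : ℝ => ∫ p in cylinder Ω T, (if φ p < 0 then 1 else 0) *
        (ε⁻¹ * deriv step (b p.2 / ε) *
          spaceDiv (fun q => (f q * ⟪gradient b q.2, levelNormal φ q⟫) • Y q) p))
      (𝓝[>] 0) (𝓝 0) := by
  set B : ℝ × Space d → ℝ := fun q => b q.2 with hB
  set k : ℝ × Space d → ℝ := fun q => ⟪gradient b q.2, levelNormal φ q⟫ with hk
  set A : ℝ × Space d → ℝ := fun p => spaceDiv Y p - ⟪levelNormal φ p,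
      fderiv ℝ Y p (0, levelNormal φ p)⟫ with hA
  set fR : ℝ × Space d → ℝ := fun q => f q * A q + ⟪spaceGrad f q, Y q - levelNormal φ q⟫ with hfR
  have hN : ∀ q ∈ O, ContDiffAt ℝ ∞ (levelNormal φ) q := fun q hq =>
    contDiffAt_levelNormal (hc.level q hq) (hc.grad_ne q hq)
  have hgf : ContDiff ℝ ∞ (spaceGrad f) := contDiff_iff_contDiffAt.mpr fun q =>
    contDiffAt_spaceGrad hf.contDiffAt (by simp)
  have hfRs : ContDiff ℝ ∞ fR := (contDiff_mul_of_tsupport hf hfO fun q hq =>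
    hc.contDiffAt_surface hq).add (contDiff_inner_of_tsupport hgf
      ((tsupport_spaceGrad_subset f).trans hfO) fun q hq => (hc.field q hq).sub (hN q hq))
  have hfRf : tsupport fR ⊆ tsupport f := by
    refine tsupport_subset_of_forall_eq_zero (isClosed_tsupport f) fun q hq => ?_
    simp only [hfR]
    rw [image_eq_zero_of_notMem_tsupport hq, spaceGrad_eq_zero_of_notMem_tsupport hq]
    simp
  have hfk : ContDiff ℝ ∞ fun q => f q * k q :=
    contDiff_mul_of_tsupport hf hfO fun q hq => hc.contDiffAt_conormal hq
  have hfkf : tsupport (fun q => f q * k q) ⊆ tsupport f := tsupport_mul_subset_left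
  -- smooth fields cut off by functions supported in the support of `f`
  have hsp : ∀ g : ℝ × Space d → ℝ, ContDiff ℝ ∞ g → tsupport g ⊆ tsupport f →
      ContDiff ℝ ∞ (fun q => g q • Y q) ∧ HasCompactSupport (fun q => g q • Y q) ∧
      tsupport (fun q => g q • Y q) ⊆ tsupport f ∧ Continuous (spaceDiv fun q => g q • Y q) ∧
      HasCompactSupport (spaceDiv fun q => g q • Y q) ∧
      tsupport (spaceDiv fun q => g q • Y q) ⊆ tsupport f := by
    intro g hg hgf
    have h1 : ContDiff ℝ ∞ (fun q => g q • Y q) :=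
      contDiff_smul_of_tsupport hg (hgf.trans hfO) hc.field
    have h2 : tsupport (fun q => g q • Y q) ⊆ tsupport f :=
      (tsupport_smul_subset_left _ _).trans hgf
    have h3 := (tsupport_spaceDiv_subset fun q => g q • Y q).trans h2
    exact ⟨h1, hasCompactSupport_of_tsupport_subset hfc h2, h2,
      continuous_spaceDiv (h1.of_le (by simp)), hasCompactSupport_of_tsupport_subset hfc h3, h3⟩
  have hin : ∀ G : ℝ × Space d → ℝ, Continuous G → HasCompactSupport G → tsupport G ⊆ tsupport f →
      IntegrableOn (fun q => (if φ q < 0 then 1 else 0) * G q) (cylinder Ω T) := by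
    intro G hG hGc hGf
    rw [IntegrableOn]
    simpa only [mul_comm] using integrable_mul_ite (volume.restrict (cylinder Ω T)) hc.isOpen hG hGc
      (hGf.trans hfO) (q₁ := fun _ => 1) (q₂ := fun _ => 0)
      (fun q hq => (hc.level q hq).continuousAt) (fun _ _ => continuousAt_const)
      (fun _ _ => continuousAt_const)
  -- the weak law
  have hpolar : ∀ g : ℝ × Space d → ℝ, ContDiff ℝ ∞ g → tsupport g ⊆ tsupport f →
      ∀ t, 0 ≤ t → IsGradientPolar Ω (fun x => χ (t, x)) (μ t) (ν t) →
      ∫ x, g (t, x) ∂(μ t)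
        = ∫ x in Ω, (if φ (t, x) < 0 then 1 else 0) * spaceDiv (fun q => g q • Y q) (t, x) := by
    intro g hg hgf t ht hpol
    have hgc := hasCompactSupport_of_tsupport_subset hfc hgf
    obtain ⟨C, hC⟩ := hgc.exists_bound_of_continuous hg.continuous
    refine hc.integral_polar hΩ hg hgc (hgf.trans hfO) ht hpol ?_
    refine ((hc.integrable_polar hΩ hs₁ hs₁c hs₁O hs₁0 ht hpol).const_mul C).mono'
      (hg.continuous.comp (Continuous.prodMk_right t)).aestronglyMeasurable
      (Eventually.of_forall fun x => ?_)
    by_cases hx : (t, x) ∈ tsupport g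
    · rw [hf1 _ (hgf hx), mul_one]; exact hC _
    · rw [image_eq_zero_of_notMem_tsupport hx, norm_zero]
      exact mul_nonneg ((norm_nonneg _).trans (hC (0, 0))) (hs₁0 _)
  have hweak : ∀ ε : ℝ, 0 < ε →
      ∫ p in cylinder Ω T, (if φ p < 0 then 1 else 0) * (step (B p / ε) *
          spaceDiv (fun q => fR q • Y q) p - ε⁻¹ * deriv step (B p / ε) *
          spaceDiv (fun q => (f q * k q) • Y q) p)
        = (∫ p in cylinder Ω T, step (B p / ε) * spaceDiv (fun q => f q • Y q) p *
            pressure m lam ρ χ p) - ∫ p in cylinder Ω T, ⟪ρ p • u p, (f p * step (B p / ε)) • Y p⟫ := by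
    intro ε hε
    set g : ℝ × Space d → ℝ := fun q => f q * step (B q / ε) with hg
    have hgs : ContDiff ℝ ∞ g := contDiff_mul_profile hf hfO hc.smooth_boundary contDiff_step ε
    have hgf' : tsupport g ⊆ tsupport f := tsupport_mul_subset_left
    obtain ⟨h1, h2, h3, h4, h5, h6⟩ := hsp g hgs hgf'
    have hdiv : ∀ p, spaceDiv (fun q => g q • Y q) p
        = step (B p / ε) * spaceDiv (fun q => f q • Y q) p := fun p =>
      spaceDiv_mul_profile_smul hf hfO hc.smooth_boundary hc.field hc.field_boundary contDiff_step ε p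
    have hyl := hy.eq _ ⟨h1, h2, (h3.trans hfO).trans hc.lt_T⟩ (fun t _ x hx n hn => by
        by_cases hx' : (t, x) ∈ tsupport g
        · rw [real_inner_smul_left, hc.inner_outerNormal (hfO (hgf' hx')) hx hΩ hn, mul_zero]
        · rw [image_eq_zero_of_notMem_tsupport hx', zero_smul, inner_zero_left])
      (hc.integrableOn_pressure hΩ hm h4 h5 (h6.trans hfO))
    simp_rw [hdiv] at hyl
    rw [← hyl]
    -- The scalar whose integral against `|∇χ|` is the surface term: `fR` collects what does not
    -- differentiate the profile.
    set S : ℝ × Space d → ℝ := fun q => fR q * step (B q / ε) - ε⁻¹ * (f q * k q * deriv step (B q / ε))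
      with hS
    have hS1 : ContDiff ℝ ∞ fun q => fR q * step (B q / ε) :=
      contDiff_mul_profile hfRs (hfRf.trans hfO) hc.smooth_boundary contDiff_step ε
    have hS2 : ContDiff ℝ ∞ fun q => f q * k q * deriv step (B q / ε) :=
      contDiff_mul_profile hfk (hfkf.trans hfO) hc.smooth_boundary contDiff_deriv_step ε
    have hSs : ContDiff ℝ ∞ S := hS1.sub (contDiff_const.mul hS2)
    have hSf : tsupport S ⊆ tsupport f := by
      refine tsupport_subset_of_forall_eq_zero (isClosed_tsupport f) fun q hq => ?_
      simp only [hS]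
      rw [image_eq_zero_of_notMem_tsupport fun h => hq (hfRf h), image_eq_zero_of_notMem_tsupport hq]
      simp
    obtain ⟨s1, s2, s3, s4, s5, s6⟩ := hsp S hSs hSf
    have hSdiv : ∀ p, spaceDiv (fun q => S q • Y q) p = step (B p / ε) *
          spaceDiv (fun q => fR q • Y q) p - ε⁻¹ * deriv step (B p / ε) *
          spaceDiv (fun q => (f q * k q) • Y q) p := by
      intro p
      by_cases hp : p ∈ O
      · have hYd : DifferentiableAt ℝ Y p := (hc.field p hp).differentiableAt (by simp)
        have e1 := spaceDiv_mul_profile_smul hfRs (hfRf.trans hfO) hc.smooth_boundary hc.field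
          hc.field_boundary contDiff_step ε p
        have e2 := spaceDiv_mul_profile_smul hfk (hfkf.trans hfO) hc.smooth_boundary hc.field
          hc.field_boundary contDiff_deriv_step ε p
        have d1 : DifferentiableAt ℝ (fun q => fR q * step (B q / ε)) p :=
          hS1.contDiffAt.differentiableAt (by simp)
        have d2 : DifferentiableAt ℝ (fun q => f q * k q * deriv step (B q / ε)) p :=
          hS2.contDiffAt.differentiableAt (by simp)
        rw [spaceDiv_smul d1 hYd] at e1
        rw [spaceDiv_smul d2 hYd] at e2
        have e3 : spaceGrad S p = spaceGrad (fun q => fR q * step (B q / ε)) p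
            - ε⁻¹ • spaceGrad (fun q => f q * k q * deriv step (B q / ε)) p := by
          refine ext_inner_space fun v => ?_
          have hSd : DifferentiableAt ℝ S p := d1.sub (d2.const_mul _)
          have hfd : fderiv ℝ S p = fderiv ℝ (fun q => fR q * step (B q / ε)) p
              - ε⁻¹ • fderiv ℝ (fun q => f q * k q * deriv step (B q / ε)) p := by
            rw [← fderiv_const_mul d2, ← fderiv_fun_sub d1 (d2.const_mul _)]
          rw [inner_sub_left, real_inner_smul_left, inner_spaceGrad hSd, inner_spaceGrad d1,
            inner_spaceGrad d2, hfd]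
          rfl
        rw [spaceDiv_smul (hSs.contDiffAt.differentiableAt (by simp)) hYd, e3, inner_sub_left,
          real_inner_smul_left]
        simp only [hS] at e1 e2 ⊢
        linear_combination e1 - ε⁻¹ * e2
      · rw [spaceDiv_eq_zero_of_notMem_tsupport fun h => hp (hfO (s3 h)),
          spaceDiv_eq_zero_of_notMem_tsupport fun h =>
            hp (hfO (hfRf (tsupport_smul_subset_left _ _ h))),
          spaceDiv_eq_zero_of_notMem_tsupport fun h =>
            hp (hfO (hfkf (tsupport_smul_subset_left _ _ h)))]
        simp
    simp_rw [← hSdiv]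
    rw [← setIntegral_cylinder (hin _ s4 s5 s6)]
    refine (integral_congr_ae ?_).symm
    filter_upwards [hy.polar, ae_restrict_mem measurableSet_Ioo] with t ht htT
    rw [hc.surfaceTerm_eq hΩ hgs (hgf'.trans hfO) htT.1.le ht, ← hpolar S hSs hSf t htT.1.le ht]
    refine integral_congr_ae (Eventually.of_forall fun x => ?_)
    simp only [hS, hfR, hA]
    by_cases hx : (t, x) ∈ O
    · rw [hg, spaceGrad_mul_profile hf hfO hc.smooth_boundary contDiff_step ε, inner_add_left,
        real_inner_smul_left, real_inner_smul_left]
      -- Only the normal part of the difference survives, since `Y` is orthogonal to `∇b`.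
      have e1 : ⟪spaceGrad B (t, x), Y (t, x) - levelNormal φ (t, x)⟫ = - k (t, x) := by
        rw [inner_sub_right]
        have := hc.field_boundary _ hx
        rw [show ⟪spaceGrad B (t, x), Y (t, x)⟫ = 0 from this, zero_sub]
        rfl
      rw [e1]
      ring
    · have hxf : (t, x) ∉ tsupport f := fun h => hx (hfO h)
      rw [image_eq_zero_of_notMem_tsupport fun h => hxf (hgf' h),
        spaceGrad_eq_zero_of_notMem_tsupport fun h => hxf (hgf' h),
        image_eq_zero_of_notMem_tsupport hxf, spaceGrad_eq_zero_of_notMem_tsupport hxf]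
      simp
  -- the remainder
  obtain ⟨R1, R2, R3, R4, R5, R6⟩ := hsp fR hfRs hfRf
  obtain ⟨F1, F2, F3, F4, F5, F6⟩ := hsp f hf le_rfl
  obtain ⟨K1, K2, K3, K4, K5, K6⟩ := hsp (fun q => f q * k q) hfk hfkf
  set R : ℝ × Space d → ℝ := fun q => (if φ q < 0 then 1 else 0) * spaceDiv (fun q => fR q • Y q) q
    - spaceDiv (fun q => f q • Y q) q * pressure m lam ρ χ q + ⟪ρ q • u q, f q • Y q⟫ with hR
  have iR := hin _ R4 R5 R6
  have iF := hc.integrableOn_pressure hΩ hm (lam := lam) F4 F5 (F6.trans hfO)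
  have iU := h.integrable_flux_inner F1.continuous F2 ((F3.trans hfO).trans hc.lt_T)
  have hoff : ∀ q ∉ O, spaceDiv (fun q => fR q • Y q) q = 0 ∧ spaceDiv (fun q => f q • Y q) q = 0
      ∧ f q = 0 := fun q hq =>
    ⟨spaceDiv_eq_zero_of_notMem_tsupport fun h => hq (hfO (R3 h)),
      spaceDiv_eq_zero_of_notMem_tsupport fun h => hq (hfO (F3 h)),
      image_eq_zero_of_notMem_tsupport fun h => hq (hfO h)⟩
  have hRi : Integrable R (volume.restrict (cylinder Ω T)) := (iR.sub iF).add iU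
  have hBc : ∀ q ∈ O, ContinuousAt B q := fun q hq => (hc.smooth_boundary q hq).continuousAt
  have hlim := tendsto_integral_profile (volume.restrict (cylinder Ω T)) hc.isOpen
    contDiff_step.continuous abs_step_le_one (L := fun _ => 0) hBc hRi
    (fun q hq => by
      simp only [hR]
      rw [(hoff q hq).1, (hoff q hq).2.1, (hoff q hq).2.2]; simp) (by
      filter_upwards [ae_restrict_mem (isOpen_cylinder hΩ T).measurableSet] with q hq hqO
      exact tendsto_step_div ((hc.boundary q hqO).mp hq.2))
  simp only [zero_mul, integral_zero] at hlim
  refine hlim.congr' ?_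
  filter_upwards [self_mem_nhdsWithin] with ε hε
  have hw := hweak ε hε
  have hpi : ∀ G : ℝ × Space d → ℝ, Integrable G (volume.restrict (cylinder Ω T)) →
      (∀ q ∉ O, G q = 0) → Integrable (fun q => step (B q / ε) * G q)
        (volume.restrict (cylinder Ω T)) := fun G hG hG0 =>
    integrable_profile_mul _ hc.isOpen contDiff_step.continuous abs_step_le_one hBc hG hG0 ε
  have j1 := hpi _ iR fun q hq => by rw [(hoff q hq).1, mul_zero]
  have j2 := hpi _ iF fun q hq => by rw [(hoff q hq).2.1, zero_mul]
  have j3 := hpi _ iU fun q hq => by rw [(hoff q hq).2.2]; simp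
  have j4 : Integrable (fun p => (if φ p < 0 then 1 else 0) * (ε⁻¹ * deriv step (B p / ε) *
      spaceDiv (fun q => (f q * k q) • Y q) p)) (volume.restrict (cylinder Ω T)) := by
    have hG : Continuous fun p => spaceDiv (fun q => (f q * k q) • Y q) p *
        (ε⁻¹ * deriv step (B p / ε)) :=
      continuous_smul_of_tsupport K4 (K6.trans hfO) fun q hq => continuousAt_const.mul
        (ContinuousAt.comp (g := deriv step) contDiff_deriv_step.continuous.continuousAt
          ((hBc q hq).div_const ε))
    have hs : tsupport (fun p => spaceDiv (fun q => (f q * k q) • Y q) p *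
        (ε⁻¹ * deriv step (B p / ε))) ⊆ tsupport f := (tsupport_mul_subset_left).trans K6
    have := hin _ hG (hasCompactSupport_of_tsupport_subset hfc hs) hs
    simp only [mul_comm (spaceDiv _ _)] at this
    exact this
  have e1 : ∀ p, (if φ p < 0 then 1 else 0) * (step (B p / ε) *
          spaceDiv (fun q => fR q • Y q) p - ε⁻¹ * deriv step (B p / ε) *
          spaceDiv (fun q => (f q * k q) • Y q) p)
      = step (B p / ε) * ((if φ p < 0 then 1 else 0) * spaceDiv (fun q => fR q • Y q) p)
        - (if φ p < 0 then 1 else 0) * (ε⁻¹ * deriv step (B p / ε) *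
          spaceDiv (fun q => (f q * k q) • Y q) p) := fun p => by ring
  have e2 : ∀ p, ⟪ρ p • u p, (f p * step (B p / ε)) • Y p⟫
      = step (B p / ε) * ⟪ρ p • u p, f p • Y p⟫ := fun p => by
    rw [mul_comm, mul_smul, real_inner_smul_right]
  simp_rw [e1, e2, mul_assoc (step _)] at hw
  rw [integral_sub j1 j4] at hw
  have e3 : ∀ q, step (B q / ε) * R q
      = step (B q / ε) * ((if φ q < 0 then 1 else 0) * spaceDiv (fun q => fR q • Y q) q)
        - step (B q / ε) * (spaceDiv (fun q => f q • Y q) q * pressure m lam ρ χ q)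
        + step (B q / ε) * ⟪ρ q • u q, f q • Y q⟫ := fun q => by simp only [hR]; ring
  simp_rw [e3]
  have j12 : Integrable (fun q => step (B q / ε) * ((if φ q < 0 then 1 else 0) *
      spaceDiv (fun q => fR q • Y q) q) - step (B q / ε) * (spaceDiv (fun q => f q • Y q) q *
      pressure m lam ρ χ q)) (volume.restrict (cylinder Ω T)) := j1.sub j2
  rw [integral_add j12 j3, integral_sub j1 j2]
  linarith

/-- The contact angle is 90 degrees. -/
lemma angle (hc : ContactChart Ω T ρ χ O φ r₁ r₂ b Y) (hΩ : IsOpen Ω) (hm : 1 ≤ m)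
    (h : WeakTransport Ω T ρ u ρ₀) (hy : YoungLaplaceData Ω T m lam ρ χ u μ ν)
    {p : ℝ × Space d} (hp : p ∈ O) (h0 : φ p = 0) (hb0 : b p.2 = 0)
    (hD : ‖spaceGrad φ p‖ ^ 2 * ‖gradient b p.2‖ ^ 2 - ⟪spaceGrad φ p, gradient b p.2⟫ ^ 2 ≠ 0) :
    ⟪gradient b p.2, levelNormal φ p⟫ = 0 := by
  set B : ℝ × Space d → ℝ := fun q => b q.2 with hB
  set k : ℝ × Space d → ℝ := fun q => ⟪gradient b q.2, levelNormal φ q⟫ with hk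
  by_contra hk0
  have hk0 : k p ≠ 0 := hk0
  obtain ⟨s₁, hs₁, hs₁c, hs₁O, hs₁0, -, hs₁1⟩ := exists_smooth_bump (hc.isOpen.mem_nhds hp)
  obtain ⟨O', hO'1, hO'o, hpO'⟩ := mem_nhds_iff.mp hs₁1
  obtain ⟨f₀, hf₀, hf₀c, hf₀O, hf₀0, -, hf₀1⟩ :=
    exists_smooth_bump ((hO'o.inter hc.isOpen).mem_nhds ⟨hpO', hp⟩)
  have hf₀O' : tsupport f₀ ⊆ O := hf₀O.trans inter_subset_right
  have hks : ∀ q ∈ O, ContDiffAt ℝ ∞ k q := fun q hq => hc.contDiffAt_conormal hq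
  have hf : ContDiff ℝ ∞ fun q => f₀ q * k q := contDiff_mul_of_tsupport hf₀ hf₀O' hks
  have hff : tsupport (fun q => f₀ q * k q) ⊆ tsupport f₀ := tsupport_mul_subset_left
  -- The weight `f₀ k` makes the concentrated quantity proportional to `k²`, hence of one sign.
  have hlim := hc.tendsto_conormal hΩ hm h hy hs₁ hs₁c hs₁O hs₁0 hf
    (hasCompactSupport_of_tsupport_subset hf₀c hff) (fun q hq => hO'1 (hf₀O (hff hq)).1)
    (hff.trans hf₀O')
  have hYφ : ∀ q ∈ O, ⟪spaceGrad φ q, Y q⟫ = ‖spaceGrad φ q‖ := fun q hq => by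
    have h1 := hc.field_normal q hq
    have hn := norm_ne_zero_iff.mpr (hc.grad_ne q hq)
    rw [levelNormal, real_inner_smul_right, real_inner_comm] at h1
    field_simp at h1
    exact h1
  have hns : ∀ q ∈ O, ContDiffAt ℝ ∞ (fun q => ‖spaceGrad φ q‖) q := fun q hq =>
    (contDiffAt_spaceGrad (hc.level q hq) (by simp)).norm ℝ (hc.grad_ne q hq)
  set G : ℝ × Space d → ℝ := fun q => f₀ q * (k q ^ 2 * ‖spaceGrad φ q‖) with hG
  have hGs : ContDiff ℝ ∞ G := contDiff_mul_of_tsupport hf₀ hf₀O' fun q hq =>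
    ((hks q hq).pow 2).mul (hns q hq)
  have hGf : tsupport G ⊆ tsupport f₀ := tsupport_mul_subset_left
  have hG0 : ∀ q, 0 ≤ G q := fun q => mul_nonneg (hf₀0 q) (by positivity)
  have hGp : 0 < G p := by
    simp only [hG]
    rw [hf₀1.self_of_nhds, one_mul]
    have := norm_pos_iff.mpr (hc.grad_ne p hp)
    positivity
  have hφd : DifferentiableAt ℝ φ p := (hc.level p hp).differentiableAt (by simp)
  have hBd : DifferentiableAt ℝ B p := (hc.smooth_boundary p hp).differentiableAt (by simp)
  -- If `k p ≠ 0`, then `G p > 0` and the doubly concentrated integrals are bounded below,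
  -- contradicting `hlim`. The Gram determinant gives surjectivity already in the spatial
  -- directions.
  obtain ⟨c, hc0, r, hr, hlow⟩ := exists_doubly_concentrated_ge volume
    ((hc.level p hp).hasStrictFDerivAt (by simp)) ((hc.smooth_boundary p hp).hasStrictFDerivAt (by simp))
    (fun ⟨α, β⟩ => by
      obtain ⟨z, hz1, hz2⟩ := exists_inner_eq_of_gram_ne_zero hD α β
      refine ⟨(0, z), ?_⟩
      rw [ContinuousLinearMap.prod_apply, ← inner_spaceGrad hφd, ← inner_spaceGrad hBd, hz1]
      exact congrArg _ hz2) h0 hb0 (half_pos hGp)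
    (hGs.continuous.continuousAt.eventually (le_mem_nhds (half_lt_self hGp))) hG0
  have hge : ∀ᶠ ε in 𝓝[>] (0 : ℝ), c ≤ ∫ p in cylinder Ω T, (if φ p < 0 then 1 else 0) *
        (ε⁻¹ * deriv step (b p.2 / ε) * spaceDiv (fun q => (f₀ q * k q * k q) • Y q) p) := by
    filter_upwards [Ioo_mem_nhdsGT hr] with ε hε
    have hε0 : 0 < ε := hε.1
    have hfk : ContDiff ℝ ∞ fun q => f₀ q * k q * k q :=
      contDiff_mul_of_tsupport hf (hff.trans hf₀O') hks
    have hfks : tsupport (fun q => f₀ q * k q * k q) ⊆ tsupport f₀ :=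
      tsupport_mul_subset_left.trans hff
    set s : ℝ × Space d → ℝ := fun q => f₀ q * k q * k q * deriv step (B q / ε) with hs
    have hss : ContDiff ℝ ∞ s :=
      contDiff_mul_profile hfk (hfks.trans hf₀O') hc.smooth_boundary contDiff_deriv_step ε
    have hsf : tsupport s ⊆ tsupport f₀ := tsupport_mul_subset_left.trans hfks
    have hF : ContDiff ℝ 1 fun q => s q • Y q :=
      (contDiff_smul_of_tsupport hss (hsf.trans hf₀O') hc.field).of_le (by simp)
    have hFs : tsupport (fun q => s q • Y q) ⊆ tsupport f₀ :=
      (tsupport_smul_subset_left _ _).trans hsf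
    -- At fixed `ε`, the divergence over `{φ < 0}` is itself a limit `δ → 0` of integrals
    -- concentrated at `{φ = 0}`; the lower bound passes to it.
    have hconv := (tendsto_integral_spaceDiv_sublevel hc.isOpen hc.level hF
      (hasCompactSupport_of_tsupport_subset hf₀c hFs) (hFs.trans hf₀O')).const_mul ε⁻¹
    have hval : ∫ p in cylinder Ω T, (if φ p < 0 then 1 else 0) *
        (ε⁻¹ * deriv step (b p.2 / ε) * spaceDiv (fun q => (f₀ q * k q * k q) • Y q) p)
        = ε⁻¹ * ∫ p, (if φ p < 0 then 1 else 0) * spaceDiv (fun q => s q • Y q) p := by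
      rw [← integral_const_mul]
      have hpt : ∀ p, (if φ p < 0 then 1 else 0) *
          (ε⁻¹ * deriv step (b p.2 / ε) * spaceDiv (fun q => (f₀ q * k q * k q) • Y q) p)
          = ε⁻¹ * ((if φ p < 0 then 1 else 0) * spaceDiv (fun q => s q • Y q) p) := fun p => by
        rw [hs, spaceDiv_mul_profile_smul hfk (hfks.trans hf₀O') hc.smooth_boundary hc.field
          hc.field_boundary contDiff_deriv_step ε p]
        ring
      have hoff : ∀ q ∉ cylinder Ω T,
          ε⁻¹ * ((if φ q < 0 then 1 else 0) * spaceDiv (fun q => s q • Y q) q) = 0 := by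
        intro q hq
        rw [← hpt]
        by_cases hqO : q ∈ O
        -- Outside `Ω` one has `b ≥ 0`, where `step` is constant, so restricting to the cylinder
        -- changes nothing.
        · have : deriv step (b q.2 / ε) = 0 := by
            refine deriv_step_eq_zero_right ?_
            have hbq : 0 ≤ b q.2 := by
              by_contra! hb
              exact hq ⟨⟨hc.pos q hqO, (hc.lt_T hqO).1⟩, (hc.boundary q hqO).mpr hb⟩
            have := div_nonneg hbq hε0.le
            linarith
          rw [this]; ring
        · rw [spaceDiv_eq_zero_of_notMem_tsupport fun h =>
            hqO (hf₀O' (hfks (tsupport_smul_subset_left _ _ h)))]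
          ring
      rw [← setIntegral_eq_integral_of_forall_compl_eq_zero hoff]
      exact integral_congr_ae (Eventually.of_forall hpt)
    rw [hval]
    refine ge_of_tendsto hconv ?_
    filter_upwards [Ioo_mem_nhdsGT hr] with δ hδ
    have hint : Integrable fun q => δ⁻¹ * deriv step (φ q / δ) *
        (ε⁻¹ * deriv step (B q / ε) * G q) := by
      have w1 : ContDiff ℝ ∞ fun q => G q * deriv step (B q / ε) :=
        contDiff_mul_profile hGs (hGf.trans hf₀O') hc.smooth_boundary contDiff_deriv_step ε
      have w1s : tsupport (fun q => G q * deriv step (B q / ε)) ⊆ tsupport f₀ :=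
        tsupport_mul_subset_left.trans hGf
      have w2 : ContDiff ℝ ∞ fun q => G q * deriv step (B q / ε) * deriv step (φ q / δ) :=
        contDiff_mul_profile w1 (w1s.trans hf₀O') hc.level contDiff_deriv_step δ
      have w2s : tsupport (fun q => G q * deriv step (B q / ε) * deriv step (φ q / δ))
          ⊆ tsupport f₀ := tsupport_mul_subset_left.trans w1s
      refine ((w2.continuous.integrable_of_hasCompactSupport
        (hasCompactSupport_of_tsupport_subset hf₀c w2s)).const_mul (δ⁻¹ * ε⁻¹)).congr
          (Eventually.of_forall fun q => ?_)
      simp only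
      ring
    refine (hlow δ ε hδ.1 hδ.2 hε.1 hε.2 hint).trans (le_of_eq ?_)
    rw [← integral_const_mul]
    refine integral_congr_ae (Eventually.of_forall fun q => ?_)
    simp only
    by_cases hq : q ∈ O
    · rw [real_inner_smul_right, hYφ q hq]
      simp only [hG, hs]
      ring
    · have hq0 : f₀ q = 0 := image_eq_zero_of_notMem_tsupport fun h => hq (hf₀O' h)
      simp [hG, hs, hq0]
  exact absurd (ge_of_tendsto hlim hge) (not_le.mpr hc0)

end ContactChart

/-! ### Geometry of the evolving set -/

section Geometry

variable {Ω : Set (Space d)} {T : ℝ} {E : ℝ → Set (Space d)} {φ : ℝ × Space d → ℝ} {t : ℝ}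
  {x : Space d}

lemma tendsto_slice_nhds (t : ℝ) (x : Space d) : Tendsto (fun y => (t, y)) (𝓝 x) (𝓝 (t, x)) :=
  (Continuous.prodMk_right t).tendsto x

lemma IsLevelSetAt.eventually {p : ℝ × Space d} (h : IsLevelSetAt Ω T E p φ) :
    ∀ᶠ q in 𝓝 p, IsLevelSetAt Ω T E q φ := by
  filter_upwards [eventually_eventually_nhds.mpr h.smooth,
    eventually_eventually_nhds.mpr h.mem_iff] with q h1 h2 using ⟨h1, h2⟩

lemma IsLevelSetAt.eventually_slice (h : IsLevelSetAt Ω T E (t, x) φ) (ht : t ∈ Ico 0 T) :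
    ∀ᶠ y in 𝓝 x, y ∈ Ω → (y ∈ E t ↔ φ (t, y) < 0) := by
  filter_upwards [(tendsto_slice_nhds t x).eventually h.mem_iff] with y hy using hy ht

lemma IsLevelSetAt.continuousAt_slice (h : IsLevelSetAt Ω T E (t, x) φ) :
    ContinuousAt (fun y => φ (t, y)) x :=
  (contDiffAt_slice h.smooth.self_of_nhds).continuousAt

lemma IsLevelSetAt.eq_zero_of_mem_frontier (h : IsLevelSetAt Ω T E (t, x) φ) (hΩ : IsOpen Ω)
    (ht : t ∈ Ico 0 T) (hx : x ∈ Ω) (hxE : x ∈ frontier (E t)) : φ (t, x) = 0 := by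
  by_contra hne
  have h1 := h.eventually_slice ht
  rcases lt_or_gt_of_ne hne with hlt | hgt
  · have : x ∈ interior (E t) := by
      rw [mem_interior_iff_mem_nhds]
      filter_upwards [h1, hΩ.mem_nhds hx, h.continuousAt_slice.eventually (gt_mem_nhds hlt)]
        with y hy hyΩ hyφ using (hy hyΩ).mpr hyφ
    exact hxE.2 this
  · refine mem_closure_iff_frequently.mp hxE.1 ?_
    filter_upwards [h1, hΩ.mem_nhds hx, h.continuousAt_slice.eventually (lt_mem_nhds hgt)]
      with y hy hyΩ hyφ hyE
    exact absurd ((hy hyΩ).mp hyE) (not_lt.mpr (le_of_lt hyφ))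

lemma IsLevelSetAt.eq_zero_of_mem_interface (h : IsLevelSetAt Ω T E (t, x) φ) (hΩ : IsOpen Ω)
    (ht : t ∈ Ico 0 T) (hx : x ∈ interface Ω (E t)) : φ (t, x) = 0 := by
  have h1 : ∃ᶠ y in 𝓝 x, φ (t, y) = 0 := by
    refine ((mem_closure_iff_frequently.mp hx).and_eventually
      ((tendsto_slice_nhds t x).eventually h.eventually)).mono ?_
    rintro y ⟨⟨hyE, hyΩ⟩, hy⟩
    exact hy.eq_zero_of_mem_frontier hΩ ht hyΩ hyE
  exact tendsto_nhds_unique_of_frequently_eq h.continuousAt_slice.tendsto tendsto_const_nhds h1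

lemma frequently_neg_of_gradient_ne_zero {a : Space d → ℝ} (h0 : a x = 0)
    (hg : gradient a x ≠ 0) : ∃ᶠ y in 𝓝 x, a y < 0 := by
  intro hev
  have hmin : IsLocalMin a x := by
    filter_upwards [hev] with y hy
    rw [h0]; exact not_lt.mp hy
  refine hg ?_
  rw [gradient, hmin.fderiv_eq_zero, map_zero]

/-- A zero with nonzero gradient is not a local minimum, so negative values, that is points of `E`,
accumulate there, while the point itself is outside `E`. -/
lemma IsLevelSetAt.mem_frontier (h : IsLevelSetAt Ω T E (t, x) φ) (hΩ : IsOpen Ω)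
    (ht : t ∈ Ico 0 T) (hx : x ∈ Ω) (h0 : φ (t, x) = 0) (hg : spaceGrad φ (t, x) ≠ 0) :
    x ∈ frontier (E t) := by
  have h1 := h.eventually_slice ht
  refine ⟨mem_closure_iff_frequently.mpr ?_, fun hi => ?_⟩
  · refine ((frequently_neg_of_gradient_ne_zero h0 hg).and_eventually
      (h1.and (hΩ.mem_nhds hx))).mono ?_
    rintro y ⟨hy, hy', hyΩ⟩
    exact (hy' hyΩ).mpr hy
  · exact absurd ((h1.self_of_nhds hx).mp (interior_subset hi)) (by rw [h0]; exact lt_irrefl 0)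

lemma interface_subset_closure (A B : Set (Space d)) : interface A B ⊆ closure A :=
  closure_mono inter_subset_right

/-- Any two level set functions of the evolving set define the same normal at the interface. -/
lemma levelNormal_eq {φ' : ℝ × Space d → ℝ} (hΩ : IsOpen Ω) (ht : t ∈ Ico 0 T)
    (hx : x ∈ interface Ω (E t)) (h : IsLevelSetAt Ω T E (t, x) φ)
    (hg : spaceGrad φ (t, x) ≠ 0) (h' : IsLevelSetAt Ω T E (t, x) φ')
    (hg' : spaceGrad φ' (t, x) ≠ 0) : levelNormal φ (t, x) = levelNormal φ' (t, x) := by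
  have hne : ∀ {ψ : ℝ × Space d → ℝ}, IsLevelSetAt Ω T E (t, x) ψ → spaceGrad ψ (t, x) ≠ 0 →
      (∀ᶠ y in 𝓝 x, spaceGrad ψ (t, y) ≠ 0) ∧
      Tendsto (fun y => levelNormal ψ (t, y)) (𝓝 x) (𝓝 (levelNormal ψ (t, x))) := by
    intro ψ hψ hgψ
    have hs := hψ.smooth.self_of_nhds
    exact ⟨(tendsto_slice_nhds t x).eventually
        ((contDiffAt_spaceGrad (m := 0) hs (by simp)).continuousAt.eventually_ne hgψ),
      (contDiffAt_levelNormal hs hgψ).continuousAt.tendsto.comp (tendsto_slice_nhds t x)⟩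
  refine tendsto_nhds_unique_of_frequently_eq (hne h hg).2 (hne h' hg').2 ?_
  -- Level functions are tied to `E` only within `Ω`, so the normals are compared at interior
  -- interface points and the equality carried to contact points by continuity.
  refine ((mem_closure_iff_frequently.mp hx).and_eventually
    (((tendsto_slice_nhds t x).eventually h.eventually).and
      (((tendsto_slice_nhds t x).eventually h'.eventually).and
      ((hne h hg).1.and (hne h' hg').1)))).mono ?_
  rintro y ⟨⟨hyE, hyΩ⟩, hy, hy', hgy, hgy'⟩
  obtain ⟨c, hc, hcg⟩ := exists_gradient_eq_smul
    ((contDiffAt_slice hy'.smooth.self_of_nhds).differentiableAt (by simp))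
    ((contDiffAt_slice hy.smooth.self_of_nhds).differentiableAt (by simp))
    (hy'.eq_zero_of_mem_frontier hΩ ht hyΩ hyE) (hy.eq_zero_of_mem_frontier hΩ ht hyΩ hyE) hgy hgy'
    (by
      filter_upwards [hy.eventually_slice ht, hy'.eventually_slice ht, hΩ.mem_nhds hyΩ]
        with z hz hz' hzΩ hlt
      exact ((hz hzΩ).mp ((hz' hzΩ).mpr hlt)).le)
  show ‖gradient (fun z => φ (t, z)) y‖⁻¹ • gradient (fun z => φ (t, z)) y
    = ‖gradient (fun z => φ' (t, z)) y‖⁻¹ • gradient (fun z => φ' (t, z)) y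
  rw [hcg, inv_norm_smul_smul hc]

/-- Points at later times with prescribed values of a submersion. -/
lemma frequently_later {F : Type*} [NormedAddCommGroup F] [NormedSpace ℝ F] [CompleteSpace F]
    {Φ : ℝ × Space d → F} {Φ' : ℝ × Space d →L[ℝ] F} {p : ℝ × Space d}
    (hΦ : HasStrictFDerivAt Φ Φ' p) (hsurj : ∀ w, ∃ v, Φ' (0, v) = w) {S : Set F}
    (hS : Φ p ∈ closure S) : ∃ᶠ q in 𝓝 p, p.1 < q.1 ∧ Φ q ∈ S := by
  have hfst : HasStrictFDerivAt (fun q : ℝ × Space d => q.1)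
    (ContinuousLinearMap.fst ℝ ℝ (Space d)) p := hasStrictFDerivAt_fst
  -- `Φ` is a submersion in the spatial variables alone, so time and the value of `Φ` can be
  -- prescribed independently.
  have hmap := (hfst.prodMk hΦ).map_nhds_eq_of_surj (LinearMap.range_eq_top.mpr fun ⟨s, w⟩ => by
    obtain ⟨v, hv⟩ := hsurj (w - Φ' (s, 0))
    refine ⟨(s, v), ?_⟩
    have e : ((s, v) : ℝ × Space d) = (s, 0) + (0, v) := by simp
    have e2 : Φ' (s, v) = w := by rw [e, map_add, hv]; abel
    show ((ContinuousLinearMap.fst ℝ ℝ (Space d)) (s, v), Φ' (s, v)) = (s, w)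
    rw [e2]; rfl)
  have h1 : ∃ᶠ z : ℝ × F in 𝓝 (p.1, Φ p), p.1 < z.1 ∧ z.2 ∈ S := by
    have : (p.1, Φ p) ∈ closure (Ioi p.1 ×ˢ S) := by
      rw [closure_prod_eq, closure_Ioi]
      exact ⟨self_mem_Ici, hS⟩
    exact mem_closure_iff_frequently.mp this
  rw [← hmap, frequently_map] at h1
  exact h1

/-- Interface points are limits of interior interface points at positive times. -/
lemma IsEvolvingDefiningAt.frequently_zero (h : IsEvolvingDefiningAt Ω T E (t, x) φ)
    (hΩ : IsOpen Ω) (ht : t ∈ Ico 0 T) (hx : x ∈ interface Ω (E t)) :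
    ∃ᶠ q in 𝓝 (t, x), q ∈ cylinder Ω T ∧ φ q = 0 := by
  have hgev : ∀ᶠ q in 𝓝 (t, x), spaceGrad φ q ≠ 0 := (contDiffAt_spaceGrad (m := 0)
    h.smooth.self_of_nhds (by simp)).continuousAt.eventually_ne h.grad_ne
  intro hev
  have h1 := (mem_closure_iff_frequently.mp hx).and_eventually
    (((tendsto_slice_nhds t x).eventually h.toIsLevelSetAt.eventually).and
      (((tendsto_slice_nhds t x).eventually hgev).and
      ((tendsto_slice_nhds t x).eventually (eventually_eventually_nhds.mpr hev))))
  obtain ⟨y, ⟨hyE, hyΩ⟩, hy, hgy, hyn⟩ := h1.exists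
  have h0 := hy.eq_zero_of_mem_frontier hΩ ht hyΩ hyE
  have hs := hy.smooth.self_of_nhds
  have hlater := frequently_later (hs.hasStrictFDerivAt (by simp)) (fun w => by
    refine ⟨(w / ‖spaceGrad φ (t, y)‖ ^ 2) • spaceGrad φ (t, y), ?_⟩
    rw [← inner_spaceGrad (hs.differentiableAt (by simp)), real_inner_smul_right,
      real_inner_self_eq_norm_sq]
    exact div_mul_cancel₀ _ (pow_ne_zero 2 (norm_ne_zero_iff.mpr hgy))) (S := {0})
    (subset_closure h0)
  have hT : ∀ᶠ q : ℝ × Space d in 𝓝 (t, y), q.1 < T ∧ q.2 ∈ Ω :=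
    (continuous_fst.continuousAt.eventually (gt_mem_nhds ht.2)).and
      (continuous_snd.continuousAt.eventually (hΩ.mem_nhds hyΩ))
  obtain ⟨q, ⟨hq1, hq2⟩, ⟨hqT, hqΩ⟩, hqn⟩ := (hlater.and_eventually (hT.and hyn)).exists
  exact hqn ⟨⟨⟨ht.1.trans_lt hq1, hqT⟩, hqΩ⟩, hq2⟩

end Geometry

/-! ### Charts for the evolving set -/

/-- A phase chart in which the evolving set is `{φ < 0}` with regular level `{φ = 0}`. -/
structure EvolutionChart (Ω : Set (Space d)) (T : ℝ) (E : ℝ → Set (Space d))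
    (ρ χ : ℝ × Space d → ℝ) (O : Set (ℝ × Space d)) (φ r₁ r₂ : ℝ × Space d → ℝ) : Prop
    extends PhaseChart Ω T ρ χ O φ r₁ r₂ where
  mem_iff : ∀ p ∈ O, 0 ≤ p.1 → p.2 ∈ Ω → (p.2 ∈ E p.1 ↔ φ p < 0)
  regular : ∀ p ∈ O, φ p = 0 → spaceGrad φ p ≠ 0

lemma exists_evolutionChart {Ω : Set (Space d)} {T : ℝ} {E : ℝ → Set (Space d)}
    {ρ χ : ℝ × Space d → ℝ} {r₁ r₂ : ℝ × Space d → ℝ}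
    (hχ : ∀ t ∈ Ico 0 T, ∀ x ∈ Ω, χ (t, x) = (E t).indicator (fun _ => (1 : ℝ)) x)
    (hr₁ : IsSmoothUpTo Ω T r₁) (hr₂ : IsSmoothUpTo Ω T r₂)
    (hρ : ∀ t ∈ Ico 0 T, ∀ x ∈ Ω,
      (x ∈ E t → ρ (t, x) = r₁ (t, x)) ∧ (x ∉ E t → ρ (t, x) = r₂ (t, x)))
    {t : ℝ} (ht : t ∈ Ico 0 T) {x : Space d} (hx : x ∈ closure Ω) {φ : ℝ × Space d → ℝ}
    (hφ : IsLevelSetAt Ω T E (t, x) φ) (hgrad : φ (t, x) = 0 → spaceGrad φ (t, x) ≠ 0)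
    {U : Set (ℝ × Space d)} (hU : U ∈ 𝓝 (t, x)) :
    ∃ O ⊆ U, (t, x) ∈ O ∧ EvolutionChart Ω T E ρ χ O φ r₁ r₂ := by
  have hs := hφ.smooth.self_of_nhds
  have hreg : ∀ᶠ q in 𝓝 (t, x), φ q = 0 → spaceGrad φ q ≠ 0 := by
    by_cases h0 : φ (t, x) = 0
    · filter_upwards [(contDiffAt_spaceGrad (m := 0) hs (by simp)).continuousAt.eventually_ne
        (hgrad h0)] with q hq _ using hq
    · filter_upwards [hs.continuousAt.eventually_ne h0] with q hq hq' using absurd hq' hq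
  obtain ⟨O, hOU, hp, hc, hiff⟩ := exists_phaseChart hχ hr₁ hr₂ hρ ht hx hφ hgrad
    (inter_mem hU hreg)
  exact ⟨O, fun q hq => (hOU hq).1, hp, ⟨hc, hiff, fun q hq => (hOU hq).2⟩⟩

/-- The velocity `-∇π/ρ` (zero where `ρ` vanishes). -/
noncomputable def velocity (m lam : ℝ) (ρ χ : ℝ × Space d → ℝ) (p : ℝ × Space d) : Space d :=
  -((ρ p)⁻¹ • spaceGrad (pressure m lam ρ χ) p)

section Bulk

variable {Ω : Set (Space d)} {T m lam : ℝ} {E : ℝ → Set (Space d)} {ρ χ : ℝ × Space d → ℝ}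
  {O : Set (ℝ × Space d)} {φ r₁ r₂ : ℝ × Space d → ℝ}

lemma gradient_congr {f g : Space d → ℝ} {x : Space d} (h : f =ᶠ[𝓝 x] g) :
    gradient f x = gradient g x := by
  rw [gradient, gradient, h.fderiv_eq]

lemma gradient_sub_const (f : Space d → ℝ) (c : ℝ) (x : Space d) :
    gradient (fun y => f y - c) x = gradient f x := by
  rw [gradient, gradient, fderiv_sub_const]

/-- Near a point off the interface, the density and the pressure are given by one phase. -/
lemma PhaseChart.exists_bulk (hc : PhaseChart Ω T ρ χ O φ r₁ r₂) (m lam : ℝ)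
    {p : ℝ × Space d} (hp : p ∈ O) (hne : φ p ≠ 0) {r : ℝ × Space d → ℝ}
    (hr : r = if φ p < 0 then r₁ else r₂) :
    ∃ O' ⊆ O, IsOpen O' ∧ p ∈ O' ∧ (∀ q ∈ O', ContDiffAt ℝ 3 r q) ∧ ∃ c, ∀ q ∈ O',
      φ q ≠ 0 ∧ (φ q < 0 ↔ φ p < 0) ∧
      (0 ≤ q.1 → q.2 ∈ Ω → ρ q = r q ∧ pressure m lam ρ χ q = r q ^ m - c) := by
  obtain ⟨O', hO'O, hpO', hc', hsign⟩ := hc.exists_sign_const hp hne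
  refine ⟨O', hO'O, hc'.isOpen, hpO', fun q hq => ?_, if φ p < 0 then lam else 0, fun q hq =>
    ⟨(hsign q hq).2, (hsign q hq).1, fun h0 hΩ => ⟨?_, ?_⟩⟩⟩
  · rw [hr]; split_ifs
    · exact hc'.smooth_in q hq
    · exact hc'.smooth_out q hq
  · rw [hc'.density q hq h0 hΩ, hr]
    simp only [(hsign q hq).1]
    split_ifs <;> rfl
  · rw [hc'.pressure_eq hq h0 hΩ, hr]
    simp only [(hsign q hq).1]
    split_ifs <;> simp

/-- The only delicate point is Darcy's law in vacuum: there the nonnegative density has a spatial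
minimum, so `∇ρ = 0` and `∇ρ^m = m ρ^(m-1) ∇ρ` vanishes, in agreement with the zero flux. -/
lemma PhaseChart.slice_bulk (hc : PhaseChart Ω T ρ χ O φ r₁ r₂) (hΩ : IsOpen Ω) (hm : 1 ≤ m)
    {p : ℝ × Space d} (hp : p ∈ O) (hp0 : 0 ≤ p.1) (hpΩ : p.2 ∈ Ω) (hne : φ p ≠ 0)
    (hpos : ∀ y ∈ Ω, 0 ≤ ρ (p.1, y)) {r : ℝ × Space d → ℝ} (hr : r = if φ p < 0 then r₁ else r₂) :
    ρ p = r p ∧ spaceGrad ρ p = spaceGrad r p ∧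
    DifferentiableAt ℝ (fun y => pressure m lam ρ χ (p.1, y)) p.2 ∧
    spaceGrad (pressure m lam ρ χ) p = spaceGrad (fun q => r q ^ m) p ∧
    ρ p • velocity m lam ρ χ p = -spaceGrad (pressure m lam ρ χ) p := by
  obtain ⟨O', hO'O, hO'o, hpO', hrs, c, hbulk⟩ := hc.exists_bulk m lam hp hne hr
  have hev : ∀ᶠ y in 𝓝 p.2, ρ (p.1, y) = r (p.1, y) ∧
      pressure m lam ρ χ (p.1, y) = r (p.1, y) ^ m - c := by
    filter_upwards [(isOpen_slice hO'o p.1).mem_nhds (show (p.1, p.2) ∈ O' from hpO'),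
      hΩ.mem_nhds hpΩ] with y hy hyΩ using (hbulk _ hy).2.2 hp0 hyΩ
  have h1 : ρ p = r p := hev.self_of_nhds.1
  have hrd : DifferentiableAt ℝ r p := (hrs p hpO').differentiableAt (by simp)
  have hPd : DifferentiableAt ℝ (fun q => r q ^ m) p :=
    (contDiffAt_rpow hm ((hrs p hpO').of_le (by norm_num))).differentiableAt (by simp)
  have hgπ : spaceGrad (pressure m lam ρ χ) p = spaceGrad (fun q => r q ^ m) p := by
    rw [spaceGrad, gradient_congr (hev.mono fun y hy => hy.2)]
    exact gradient_sub_const _ _ _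
  refine ⟨h1, gradient_congr (hev.mono fun y hy => hy.1), ?_, hgπ, ?_⟩
  · have : DifferentiableAt ℝ (fun y => r (p.1, y) ^ m - c) p.2 :=
      (hasFDerivAt_slice hPd).differentiableAt.sub_const c
    exact this.congr_of_eventuallyEq (hev.mono fun y hy => hy.2)
  · rw [velocity, smul_neg, smul_smul]
    by_cases h0 : ρ p = 0
    · have hmin : IsLocalMin (fun y => r (p.1, y)) p.2 := by
        filter_upwards [hev, hΩ.mem_nhds hpΩ] with y hy hyΩ
        have : r (p.1, p.2) = 0 := by rw [← h0, h1]
        rw [this, ← hy.1]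
        exact hpos y hyΩ
      have hz : spaceGrad r p = 0 := by
        rw [spaceGrad, gradient, hmin.fderiv_eq_zero, map_zero]
      rw [hgπ, spaceGrad_rpow hm hrd, hz, smul_zero, smul_zero]
    · rw [mul_inv_cancel₀ h0, one_smul]

end Bulk

/-! ### Traces and interface conditions -/

section Traces

variable {Ω : Set (Space d)} {T m lam : ℝ} {E : ℝ → Set (Space d)} {ρ χ : ℝ × Space d → ℝ}
  {O : Set (ℝ × Space d)} {φ r₁ r₂ : ℝ × Space d → ℝ} {t : ℝ} {x : Space d}

lemma EvolutionChart.isLevelSetAt (hc : EvolutionChart Ω T E ρ χ O φ r₁ r₂) {p : ℝ × Space d}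
    (hp : p ∈ O) : IsLevelSetAt Ω T E p φ := by
  constructor
  · filter_upwards [hc.isOpen.mem_nhds hp] with q hq using hc.level q hq
  · filter_upwards [hc.isOpen.mem_nhds hp] with q hq h0 hΩ using hc.mem_iff q hq h0.1 hΩ

lemma EvolutionChart.eventually_in (hc : EvolutionChart Ω T E ρ χ O φ r₁ r₂)
    (hE : IsSmoothEvolution Ω T E) (ht : t ∈ Ico 0 T) (hx : (t, x) ∈ O) :
    ∀ᶠ y in 𝓝[E t] x, (t, y) ∈ O ∧ y ∈ Ω ∧ φ (t, y) < 0 := by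
  filter_upwards [self_mem_nhdsWithin, mem_nhdsWithin_of_mem_nhds
    ((isOpen_slice hc.isOpen t).mem_nhds hx)] with y hy hyO
  have hyΩ := hE.subset t ht hy
  exact ⟨hyO, hyΩ, (hc.mem_iff (t, y) hyO ht.1 hyΩ).mp hy⟩

/-- Strict positivity uses regularity of the level set: a zero of `φ` in `Ω` would belong to the
closure of `E t`. -/
lemma EvolutionChart.eventually_out (hc : EvolutionChart Ω T E ρ χ O φ r₁ r₂)
    (hΩ : IsOpen Ω) (ht : t ∈ Ico 0 T) (hx : (t, x) ∈ O) :
    ∀ᶠ y in 𝓝[Ω \ closure (E t)] x, (t, y) ∈ O ∧ y ∈ Ω ∧ 0 < φ (t, y) := by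
  filter_upwards [self_mem_nhdsWithin, mem_nhdsWithin_of_mem_nhds
    ((isOpen_slice hc.isOpen t).mem_nhds hx)] with y hy hyO
  refine ⟨hyO, hy.1, ?_⟩
  have h1 : ¬ φ (t, y) < 0 := fun h =>
    hy.2 (subset_closure ((hc.mem_iff (t, y) hyO ht.1 hy.1).mpr h))
  refine lt_of_le_of_ne (not_lt.mp h1) fun h0 => hy.2 ?_
  exact ((hc.isLevelSetAt hyO).mem_frontier hΩ ht hy.1 h0.symm (hc.regular _ hyO h0.symm)).1

/-- The traces of a phase. -/
lemma PhaseChart.tendsto_traces (hc : PhaseChart Ω T ρ χ O φ r₁ r₂) (hΩ : IsOpen Ω) (hm : 1 ≤ m)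
    (ht : 0 ≤ t) (hpos : ∀ y ∈ Ω, 0 ≤ ρ (t, y)) {A : Set (Space d)}
    {r : ℝ × Space d → ℝ} (hr : ContDiffAt ℝ 3 r (t, x))
    (hA : ∀ᶠ y in 𝓝[A] x, (t, y) ∈ O ∧ y ∈ Ω ∧ φ (t, y) ≠ 0 ∧ r = if φ (t, y) < 0 then r₁ else r₂) :
    Tendsto (fun y => ρ (t, y)) (𝓝[A] x) (𝓝 (r (t, x))) ∧
    Tendsto (fun y => spaceGrad ρ (t, y)) (𝓝[A] x) (𝓝 (spaceGrad r (t, x))) ∧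
    Tendsto (fun y => ρ (t, y) • velocity m lam ρ χ (t, y)) (𝓝[A] x)
      (𝓝 (-spaceGrad (fun q => r q ^ m) (t, x))) := by
  have hb : ∀ᶠ y in 𝓝[A] x, ρ (t, y) = r (t, y) ∧ spaceGrad ρ (t, y) = spaceGrad r (t, y) ∧
      ρ (t, y) • velocity m lam ρ χ (t, y) = -spaceGrad (fun q => r q ^ m) (t, y) := by
    filter_upwards [hA] with y ⟨hyO, hyΩ, hne, hry⟩
    obtain ⟨h1, h2, -, h4, h5⟩ := hc.slice_bulk (m := m) (lam := lam) hΩ hm hyO ht hyΩ hne hpos hry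
    exact ⟨h1, h2, h5.trans (by rw [h4])⟩
  have hsl : Tendsto (fun y => (t, y)) (𝓝[A] x) (𝓝 (t, x)) :=
    (tendsto_slice_nhds t x).mono_left nhdsWithin_le_nhds
  have h1 := hr.continuousAt.tendsto.comp hsl
  have h2 := (contDiffAt_spaceGrad (m := 0) hr (by norm_num)).continuousAt.tendsto.comp hsl
  have h3 := ((contDiffAt_spaceGrad (m := 0) (contDiffAt_rpow hm (hr.of_le (by norm_num)))
    (by simp)).continuousAt.tendsto.comp hsl).neg
  exact ⟨h1.congr' (hb.mono fun y hy => hy.1.symm), h2.congr' (hb.mono fun y hy => hy.2.1.symm),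
    h3.congr' (hb.mono fun y hy => hy.2.2.symm)⟩

end Traces

/-- Equality in the Cauchy-Schwarz inequality would make the vectors dependent. The factor `c`
accommodates the normalized outer normal. -/
lemma gram_ne_zero {v w : Space d} {c : ℝ} (h : LinearIndependent ℝ ![v, c • w]) :
    ‖v‖ ^ 2 * ‖w‖ ^ 2 - ⟪v, w⟫ ^ 2 ≠ 0 := by
  intro hD
  rw [LinearIndependent.pair_iff] at h
  have hn : ‖‖w‖ ^ 2 • v - ⟪v, w⟫ • w‖ ^ 2 = ‖w‖ ^ 2 * (‖v‖ ^ 2 * ‖w‖ ^ 2 - ⟪v, w⟫ ^ 2) := by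
    rw [← real_inner_self_eq_norm_sq]
    simp only [inner_sub_left, inner_sub_right, real_inner_smul_left, real_inner_smul_right]
    rw [real_inner_self_eq_norm_sq, real_inner_self_eq_norm_sq, real_inner_comm v w]
    ring
  have hz : ‖w‖ ^ 2 • v - ⟪v, w⟫ • w = 0 := by
    rw [hD, mul_zero] at hn
    exact norm_eq_zero.mp (pow_eq_zero_iff (two_ne_zero)|>.mp hn)
  have h1 := h (c * ‖w‖ ^ 2) (-⟪v, w⟫) (by
    have : (c * ‖w‖ ^ 2) • v + -⟪v, w⟫ • c • w = c • (‖w‖ ^ 2 • v - ⟪v, w⟫ • w) := by module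
    rw [this, hz, smul_zero])
  have hcw : c = 0 ∨ w = 0 := by
    rcases mul_eq_zero.mp h1.1 with h | h
    · exact Or.inl h
    · exact Or.inr (norm_eq_zero.mp (pow_eq_zero_iff (two_ne_zero)|>.mp h))
  have h2 := h 0 1 (by rcases hcw with h | h <;> simp [h])
  exact one_ne_zero h2.2

/-- The hypotheses on weak solutions. -/
structure WeakSolution (Ω : Set (Space d)) (T m lam : ℝ) (E : ℝ → Set (Space d))
    (ρ χ r₁ r₂ : ℝ × Space d → ℝ) (u : ℝ × Space d → Space d) (ρ₀ : Space d → ℝ)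
    (μ : ℝ → Measure (Space d)) (ν : ℝ → Space d → Space d) : Prop where
  one_le : 1 ≤ m
  domain : IsSmoothDomain Ω
  evolution : IsSmoothEvolution Ω T E
  charFun : ∀ t ∈ Ico 0 T, ∀ x ∈ Ω, χ (t, x) = (E t).indicator (fun _ => (1 : ℝ)) x
  nonneg : ∀ t ∈ Ico 0 T, ∀ x ∈ Ω, 0 ≤ ρ (t, x)
  smooth_in : IsSmoothUpTo Ω T r₁
  smooth_out : IsSmoothUpTo Ω T r₂
  density : ∀ t ∈ Ico 0 T, ∀ x ∈ Ω,
    (x ∈ E t → ρ (t, x) = r₁ (t, x)) ∧ (x ∉ E t → ρ (t, x) = r₂ (t, x))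
  transport : WeakTransport Ω T ρ u ρ₀
  youngLaplace : YoungLaplaceData Ω T m lam ρ χ u μ ν

namespace WeakSolution

variable {Ω : Set (Space d)} {T m lam : ℝ} {E : ℝ → Set (Space d)} {ρ χ r₁ r₂ : ℝ × Space d → ℝ}
  {u : ℝ × Space d → Space d} {ρ₀ : Space d → ℝ} {μ : ℝ → Measure (Space d)}
  {ν : ℝ → Space d → Space d} {φ : ℝ × Space d → ℝ} {t : ℝ} {x : Space d}

lemma exists_chart (h : WeakSolution Ω T m lam E ρ χ r₁ r₂ u ρ₀ μ ν) (ht : t ∈ Ico 0 T)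
    (hx : x ∈ closure Ω) (hφ : IsLevelSetAt Ω T E (t, x) φ)
    (hgrad : φ (t, x) = 0 → spaceGrad φ (t, x) ≠ 0) {U : Set (ℝ × Space d)}
    (hU : U ∈ 𝓝 (t, x)) : ∃ O ⊆ U, (t, x) ∈ O ∧ EvolutionChart Ω T E ρ χ O φ r₁ r₂ :=
  exists_evolutionChart h.charFun h.smooth_in h.smooth_out h.density ht hx hφ hgrad hU

/-- The interface conditions for the traces. -/
lemma interface_conditions (h : WeakSolution Ω T m lam E ρ χ r₁ r₂ u ρ₀ μ ν) (ht : t ∈ Ico 0 T)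
    (hx : x ∈ interface Ω (E t)) (hφ : IsEvolvingDefiningAt Ω T E (t, x) φ) :
    timeDeriv φ (t, x) * r₁ (t, x) - ⟪spaceGrad (fun q => r₁ q ^ m) (t, x), spaceGrad φ (t, x)⟫
      = timeDeriv φ (t, x) * r₂ (t, x)
        - ⟪spaceGrad (fun q => r₂ q ^ m) (t, x), spaceGrad φ (t, x)⟫ ∧
    r₂ (t, x) ^ m - (r₁ (t, x) ^ m - lam) = levelCurvature φ (t, x) := by
  have hΩ := h.domain.1
  have hm := h.one_le
  have hs := hφ.smooth.self_of_nhds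
  have hgev : {q | spaceGrad φ q ≠ 0} ∈ 𝓝 (t, x) := (contDiffAt_spaceGrad (m := 0)
    hs (by simp)).continuousAt.eventually_ne hφ.grad_ne
  obtain ⟨O, hOg, hpO, hc⟩ := h.exists_chart ht (interface_subset_closure _ _ hx)
    hφ.toIsLevelSetAt (fun _ => hφ.grad_ne) hgev
  -- Both conditions are known at interior interface points at positive times. These accumulate at
  -- the given point, which may have `t = 0` or lie on `∂Ω`, and both sides are continuous.
  have hfreq := (hφ.frequently_zero hΩ ht hx).and_eventually (hc.isOpen.mem_nhds hpO)
  have h1 : ContDiffAt ℝ 3 r₁ (t, x) := hc.smooth_in _ hpO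
  have h2 : ContDiffAt ℝ 3 r₂ (t, x) := hc.smooth_out _ hpO
  have hcont : ∀ {r : ℝ × Space d → ℝ}, ContDiffAt ℝ 3 r (t, x) →
      ContinuousAt (fun q => timeDeriv φ q * r q
        - ⟪spaceGrad (fun q => r q ^ m) q, spaceGrad φ q⟫) (t, x) ∧
      ContinuousAt (fun q => r q ^ m) (t, x) := by
    intro r hr
    have hP := contDiffAt_rpow hm (hr.of_le (by norm_num))
    exact ⟨((contDiffAt_timeDeriv (m := 0) hs (by simp)).continuousAt.mul hr.continuousAt).sub
      ((contDiffAt_spaceGrad (m := 0) hP (by simp)).continuousAt.inner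
        (contDiffAt_spaceGrad (m := 0) hs (by simp)).continuousAt), hP.continuousAt⟩
  constructor
  · refine tendsto_nhds_unique_of_frequently_eq (hcont h1).1.tendsto (hcont h2).1.tendsto
      (hfreq.mono ?_)
    rintro q ⟨⟨hqQ, hq0⟩, hqO⟩
    exact hc.toPhaseChart.mass_jump hΩ hm h.transport h.youngLaplace hqO hqQ hq0 (hOg hqO)
  · have hκ : ContinuousAt (levelCurvature φ) (t, x) :=
      (contDiffAt_spaceDiv (m := 0) (contDiffAt_levelNormal hs hφ.grad_ne)
        (by simp)).continuousAt.neg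
    refine tendsto_nhds_unique_of_frequently_eq
      ((hcont h2).2.sub ((hcont h1).2.sub continuousAt_const)).tendsto hκ.tendsto (hfreq.mono ?_)
    rintro q ⟨⟨hqQ, hq0⟩, hqO⟩
    exact (hc.toPhaseChart.mono (hc.isOpen.inter (isOpen_cylinder hΩ T))
      inter_subset_left).young_laplace hΩ hm h.transport h.youngLaplace inter_subset_right
      (fun q hq => hOg hq.1) ⟨hqO, hqQ⟩ hq0

lemma mass_jump (h : WeakSolution Ω T m lam E ρ χ r₁ r₂ u ρ₀ μ ν) (ht : t ∈ Ico 0 T)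
    (hx : x ∈ interface Ω (E t)) (hφ : IsEvolvingDefiningAt Ω T E (t, x) φ) :
    ∃ (jρ : ℝ) (jflux : Space d), HasJump Ω (E t) x (fun y => ρ (t, y)) jρ ∧
      HasJump Ω (E t) x (fun y => ρ (t, y) • velocity m lam ρ χ (t, y)) jflux ∧
      jρ * levelVelocity φ (t, x) = ⟪jflux, levelNormal φ (t, x)⟫ := by
  have hΩ := h.domain.1
  obtain ⟨O, -, hpO, hc⟩ := h.exists_chart ht (interface_subset_closure _ _ hx)
    hφ.toIsLevelSetAt (fun _ => hφ.grad_ne) univ_mem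
  obtain ⟨i1, -, i3⟩ := hc.toPhaseChart.tendsto_traces (m := m) (lam := lam) hΩ h.one_le ht.1
    (h.nonneg t ht) (hc.smooth_in _ hpO)
    ((hc.eventually_in h.evolution ht hpO).mono fun y hy =>
      ⟨hy.1, hy.2.1, hy.2.2.ne, by rw [if_pos hy.2.2]⟩)
  obtain ⟨o1, -, o3⟩ := hc.toPhaseChart.tendsto_traces (m := m) (lam := lam) hΩ h.one_le ht.1
    (h.nonneg t ht) (hc.smooth_out _ hpO)
    ((hc.eventually_out hΩ ht hpO).mono fun y hy =>
      ⟨hy.1, hy.2.1, hy.2.2.ne', by rw [if_neg hy.2.2.not_gt]⟩)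
  refine ⟨_, _, ⟨_, _, o1, i1, rfl⟩, ⟨_, _, o3, i3, rfl⟩, ?_⟩
  have key := (h.interface_conditions ht hx hφ).1
  have hn := norm_ne_zero_iff.mpr hφ.grad_ne
  rw [levelVelocity, levelNormal, real_inner_smul_right, inner_sub_left, inner_neg_left,
    inner_neg_left]
  field_simp
  linarith

lemma young_laplace (h : WeakSolution Ω T m lam E ρ χ r₁ r₂ u ρ₀ μ ν) (ht : t ∈ Ico 0 T)
    (hx : x ∈ interface Ω (E t)) (hφ : IsEvolvingDefiningAt Ω T E (t, x) φ) :
    HasJump Ω (E t) x (fun y => pressure m lam ρ χ (t, y)) (levelCurvature φ (t, x)) := by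
  have hΩ := h.domain.1
  obtain ⟨O, -, hpO, hc⟩ := h.exists_chart ht (interface_subset_closure _ _ hx)
    hφ.toIsLevelSetAt (fun _ => hφ.grad_ne) univ_mem
  have hsl : ∀ A : Set (Space d), Tendsto (fun y => (t, y)) (𝓝[A] x) (𝓝 (t, x)) := fun A =>
    (tendsto_slice_nhds t x).mono_left nhdsWithin_le_nhds
  have c1 := (hc.contDiffAt_rpow_in h.one_le hpO).continuousAt.tendsto.comp (hsl (E t))
  have c2 := (hc.contDiffAt_rpow_out h.one_le hpO).continuousAt.tendsto.comp
    (hsl (Ω \ closure (E t)))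
  refine ⟨r₂ (t, x) ^ m, r₁ (t, x) ^ m - lam, c2.congr' ?_, (c1.sub_const lam).congr' ?_,
    (h.interface_conditions ht hx hφ).2.symm⟩
  · filter_upwards [hc.eventually_out hΩ ht hpO] with y hy
    rw [hc.pressure_eq hy.1 ht.1 hy.2.1, if_neg hy.2.2.not_gt]; rfl
  · filter_upwards [hc.eventually_in h.evolution ht hpO] with y hy
    rw [hc.pressure_eq hy.1 ht.1 hy.2.1, if_pos hy.2.2]; rfl

/-! ### Conditions on the boundary of the domain -/

/-- Where `φ` vanishes, transversality lets `b` and `φ` be prescribed independently, so boundary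
points at later times inside a chosen phase accumulate. Where `φ ≠ 0`, its sign persists and only
`b` must be solved for. -/
lemma frequently_boundary {b : Space d → ℝ}
    (hb : IsDefiningAt Ω x b) (hφ : IsLevelSetAt Ω T E (t, x) φ)
    (htr : φ (t, x) = 0 → spaceGrad φ (t, x) ≠ 0 ∧
      ∀ n, IsOuterNormal Ω x n → LinearIndependent ℝ ![spaceGrad φ (t, x), n])
    {S : Set ℝ} (hS : φ (t, x) ∈ closure S) (hS' : φ (t, x) ≠ 0 → S ∈ 𝓝 (φ (t, x))) :
    ∃ᶠ q in 𝓝 (t, x), t < q.1 ∧ b q.2 = 0 ∧ φ q ∈ S := by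
  have hs := hφ.smooth.self_of_nhds
  have hbs : ContDiffAt ℝ ∞ (fun q : ℝ × Space d => b q.2) (t, x) :=
    ContDiffAt.comp (t, x) (g := b) hb.smooth.self_of_nhds contDiffAt_snd
  have hφd : DifferentiableAt ℝ φ (t, x) := hs.differentiableAt (by simp)
  have hbd : DifferentiableAt ℝ (fun q : ℝ × Space d => b q.2) (t, x) :=
    hbs.differentiableAt (by simp)
  have hbg : spaceGrad (fun q : ℝ × Space d => b q.2) (t, x) ≠ 0 := hb.grad_ne
  by_cases h0 : φ (t, x) = 0
  · have hD := gram_ne_zero ((htr h0).2 _ ⟨b, hb, rfl⟩)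
    have := frequently_later ((hbs.hasStrictFDerivAt (by simp)).prodMk
      (hs.hasStrictFDerivAt (by simp))) (fun ⟨α, β⟩ => by
        obtain ⟨z, hz1, hz2⟩ := exists_inner_eq_of_gram_ne_zero hD β α
        refine ⟨z, ?_⟩
        rw [ContinuousLinearMap.prod_apply, ← inner_spaceGrad hφd, ← inner_spaceGrad hbd, hz1]
        exact congrArg (fun s => (s, β)) hz2) (S := {0} ×ˢ S) (by
          rw [closure_prod_eq]
          exact ⟨subset_closure hb.zero, hS⟩)
    exact this.mono fun q hq => ⟨hq.1, hq.2.1, hq.2.2⟩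
  · have := frequently_later (hbs.hasStrictFDerivAt (by simp)) (fun w => by
      refine ⟨(w / ‖gradient b x‖ ^ 2) • gradient b x, ?_⟩
      rw [← inner_spaceGrad hbd, real_inner_smul_right, spaceGrad_comp_snd,
        real_inner_self_eq_norm_sq]
      exact div_mul_cancel₀ _ (pow_ne_zero 2 (norm_ne_zero_iff.mpr hb.grad_ne))) (S := {0})
      (subset_closure hb.zero)
    refine (this.and_eventually (hφd.continuousAt (hS' h0))).mono ?_
    rintro q ⟨⟨h1, h2⟩, h3⟩
    exact ⟨h1, h2, h3⟩

lemma boundary_nhds {b : Space d → ℝ} (hb : IsDefiningAt Ω x b) (t : ℝ) :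
    {q : ℝ × Space d | ContDiffAt ℝ ∞ b q.2 ∧ (q.2 ∈ Ω ↔ b q.2 < 0) ∧ gradient b q.2 ≠ 0}
      ∈ 𝓝 (t, x) := by
  have hsnd : Tendsto (Prod.snd : ℝ × Space d → Space d) (𝓝 (t, x)) (𝓝 x) :=
    continuous_snd.tendsto (t, x)
  have hbs : ContDiffAt ℝ ∞ (fun q : ℝ × Space d => b q.2) (t, x) :=
    ContDiffAt.comp (t, x) (g := b) hb.smooth.self_of_nhds contDiffAt_snd
  have hg : ∀ᶠ q in 𝓝 (t, x), spaceGrad (fun q : ℝ × Space d => b q.2) q ≠ 0 :=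
    (contDiffAt_spaceGrad (m := 0) hbs (by simp)).continuousAt.eventually_ne hb.grad_ne
  filter_upwards [hsnd.eventually hb.smooth, hsnd.eventually hb.mem_iff, hg] with q h1 h2 h3
  exact ⟨h1, h2, h3⟩

/-- `S` holds the values of `φ` in one phase. The no-flux condition at later boundary points of this
phase passes to the limit; the factor `m r^(m-1)` can then be divided out, which is why vacuum is
excluded for `m > 1`. -/
lemma neumann_phase (h : WeakSolution Ω T m lam E ρ χ r₁ r₂ u ρ₀ μ ν) (ht : t ∈ Ico 0 T)
    (hx : x ∈ frontier Ω) {b : Space d → ℝ} (hb : IsDefiningAt Ω x b)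
    (hφ : IsLevelSetAt Ω T E (t, x) φ)
    (htr : φ (t, x) = 0 → spaceGrad φ (t, x) ≠ 0 ∧
      ∀ n, IsOuterNormal Ω x n → LinearIndependent ℝ ![spaceGrad φ (t, x), n])
    {S : Set ℝ} (hS : φ (t, x) ∈ closure S) (hS' : φ (t, x) ≠ 0 → S ∈ 𝓝 (φ (t, x)))
    {r : ℝ × Space d → ℝ} (hr : ContDiffAt ℝ 3 r (t, x))
    (hSr : ∀ s ∈ S, s ≠ 0 ∧ r = if s < 0 then r₁ else r₂) :
    (m = 1 ∨ 0 < r (t, x)) → ⟪spaceGrad r (t, x), gradient b x⟫ = 0 := by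
  intro hmr
  obtain ⟨O, hOU, hpO, hc⟩ := h.exists_chart ht (frontier_subset_closure hx) hφ
    (fun h0 => (htr h0).1) (boundary_nhds hb t)
  have hfreq := (frequently_boundary hb hφ htr hS hS').and_eventually (hc.isOpen.mem_nhds hpO)
  have hP := contDiffAt_rpow h.one_le (hr.of_le (by norm_num))
  have hbs : ContDiffAt ℝ ∞ (fun q : ℝ × Space d => b q.2) (t, x) :=
    ContDiffAt.comp (t, x) (g := b) hb.smooth.self_of_nhds contDiffAt_snd
  have hcont : ContinuousAt (fun q : ℝ × Space d =>
      ⟪spaceGrad (fun q => r q ^ m) q, gradient b q.2⟫) (t, x) :=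
    (contDiffAt_spaceGrad (m := 0) hP (by simp)).continuousAt.inner
      (contDiffAt_spaceGrad (m := 0) hbs (by simp)).continuousAt
  have key : ⟪spaceGrad (fun q => r q ^ m) (t, x), gradient b x⟫ = 0 := by
    refine tendsto_nhds_unique_of_frequently_eq hcont.tendsto tendsto_const_nhds (hfreq.mono ?_)
    rintro q ⟨⟨hqt, hqb, hqS⟩, hqO⟩
    have h1 := hc.toPhaseChart.no_flux h.domain.1 h.one_le h.transport h.youngLaplace hqO
      (ht.1.trans_lt hqt) (hSr _ hqS).1 (fun q hq => (hOU hq).1) (fun q hq => (hOU hq).2.1) hqb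
      (hOU hqO).2.2
    rwa [← (hSr _ hqS).2] at h1
  rw [spaceGrad_rpow h.one_le (hr.differentiableAt (by norm_num)), real_inner_smul_left] at key
  refine (mul_eq_zero.mp key).resolve_left (mul_ne_zero ?_ ?_)
  · linarith [h.one_le]
  · rcases hmr with h1 | h1
    · rw [h1, sub_self, Real.rpow_zero]; exact one_ne_zero
    · exact (Real.rpow_pos_of_pos h1 _).ne'

lemma neumann (h : WeakSolution Ω T m lam E ρ χ r₁ r₂ u ρ₀ μ ν) (ht : t ∈ Ico 0 T)
    {A : Set (Space d)} (hA : A = E t ∨ A = Ω \ closure (E t)) (hx : x ∈ frontier Ω ∩ closure A)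
    {n : Space d} (hn : IsOuterNormal Ω x n) :
    ∃ (r : ℝ) (g : Space d), Tendsto (fun y => ρ (t, y)) (𝓝[A] x) (𝓝 r) ∧
      Tendsto (fun y => spaceGrad ρ (t, y)) (𝓝[A] x) (𝓝 g) ∧
      ((m = 1 ∨ 0 < r) → ⟪g, n⟫ = 0) := by
  have hΩ := h.domain.1
  obtain ⟨φ, hφ, htr⟩ := h.evolution.level t ht x (frontier_subset_closure hx.1)
  obtain ⟨O, -, hpO, hc⟩ := h.exists_chart ht (frontier_subset_closure hx.1) hφ
    (fun h0 => (htr h0).1) univ_mem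
  obtain ⟨b, hb, rfl⟩ := hn
  have hNB : (𝓝[A] x).NeBot := mem_closure_iff_nhdsWithin_neBot.mp hx.2
  have hφt : Tendsto (fun y => φ (t, y)) (𝓝[A] x) (𝓝 (φ (t, x))) :=
    hφ.continuousAt_slice.tendsto.mono_left nhdsWithin_le_nhds
  rcases hA with rfl | rfl
  · have hev := hc.eventually_in h.evolution ht hpO
    obtain ⟨i1, i2, -⟩ := hc.toPhaseChart.tendsto_traces (m := m) (lam := lam) hΩ h.one_le ht.1
      (h.nonneg t ht) (hc.smooth_in _ hpO)
      (hev.mono fun y hy => ⟨hy.1, hy.2.1, hy.2.2.ne, by rw [if_pos hy.2.2]⟩)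
    refine ⟨_, _, i1, i2, fun hmr => ?_⟩
    have hle : φ (t, x) ≤ 0 := le_of_tendsto hφt (hev.mono fun y hy => hy.2.2.le)
    rw [real_inner_smul_right, h.neumann_phase ht hx.1 hb hφ htr (S := Iio 0)
      (by rwa [closure_Iio]) (fun hne => Iio_mem_nhds (lt_of_le_of_ne hle hne))
      (hc.smooth_in _ hpO) (fun s (hs : s < 0) => ⟨hs.ne, by rw [if_pos hs]⟩) hmr, mul_zero]
  · have hev := hc.eventually_out hΩ ht hpO
    obtain ⟨o1, o2, -⟩ := hc.toPhaseChart.tendsto_traces (m := m) (lam := lam) hΩ h.one_le ht.1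
      (h.nonneg t ht) (hc.smooth_out _ hpO)
      (hev.mono fun y hy => ⟨hy.1, hy.2.1, hy.2.2.ne', by rw [if_neg hy.2.2.not_gt]⟩)
    refine ⟨_, _, o1, o2, fun hmr => ?_⟩
    have hle : 0 ≤ φ (t, x) := ge_of_tendsto hφt (hev.mono fun y hy => hy.2.2.le)
    rw [real_inner_smul_right, h.neumann_phase ht hx.1 hb hφ htr (S := Ioi 0)
      (by rwa [closure_Ioi]) (fun hne => Ioi_mem_nhds (lt_of_le_of_ne hle hne.symm))
      (hc.smooth_out _ hpO) (fun s (hs : 0 < s) => ⟨hs.ne', by rw [if_neg hs.not_gt]⟩) hmr, mul_zero]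

lemma angle (h : WeakSolution Ω T m lam E ρ χ r₁ r₂ u ρ₀ μ ν) (ht : t ∈ Ico 0 T)
    (hx : x ∈ frontier Ω ∩ interface Ω (E t)) {n : Space d} (hn : IsOuterNormal Ω x n)
    (hφ : IsEvolvingDefiningAt Ω T E (t, x) φ) : ⟪levelNormal φ (t, x), n⟫ = 0 := by
  have hΩ := h.domain.1
  -- Transversality is postulated for the level function supplied by the evolution, so the argument
  -- runs with `ψ`; its normal agrees with that of `φ`.
  obtain ⟨ψ, hψ, htr⟩ := h.evolution.level t ht x (frontier_subset_closure hx.1)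
  have h0 := hψ.eq_zero_of_mem_interface hΩ ht hx.2
  have hg := (htr h0).1
  rw [levelNormal_eq hΩ ht hx.2 hφ.toIsLevelSetAt hφ.grad_ne hψ hg]
  obtain ⟨b, hb, rfl⟩ := hn
  have hD := gram_ne_zero ((htr h0).2 _ ⟨b, hb, rfl⟩)
  have hs := hψ.smooth.self_of_nhds
  have hbs : ContDiffAt ℝ ∞ (fun q : ℝ × Space d => b q.2) (t, x) :=
    ContDiffAt.comp (t, x) (g := b) hb.smooth.self_of_nhds contDiffAt_snd
  have hgc := (contDiffAt_spaceGrad (m := 0) hs (by simp)).continuousAt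
  have hbc := (contDiffAt_spaceGrad (m := 0) hbs (by simp)).continuousAt
  have hDev : ∀ᶠ q : ℝ × Space d in 𝓝 (t, x), ‖spaceGrad ψ q‖ ^ 2 * ‖gradient b q.2‖ ^ 2
      - ⟪spaceGrad ψ q, gradient b q.2⟫ ^ 2 ≠ 0 :=
    ContinuousAt.eventually_ne (g := fun q : ℝ × Space d => ‖spaceGrad ψ q‖ ^ 2 *
      ‖gradient b q.2‖ ^ 2 - ⟪spaceGrad ψ q, gradient b q.2⟫ ^ 2)
      (((hgc.norm.pow 2).mul (hbc.norm.pow 2)).sub ((hgc.inner hbc).pow 2)) hD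
  obtain ⟨O, hOU, hpO, hc⟩ := h.exists_chart ht (frontier_subset_closure hx.1) hψ (fun _ => hg)
    (inter_mem (boundary_nhds hb t) (inter_mem hDev (hgc.eventually_ne hg)))
  set O' := O ∩ Ioi 0 ×ˢ univ with hO'
  have hO'o : IsOpen O' := hc.isOpen.inter (isOpen_Ioi.prod isOpen_univ)
  have hbO : ∀ q ∈ O', ContDiffAt ℝ ∞ (fun q : ℝ × Space d => b q.2) q := fun q hq =>
    ContDiffAt.comp q (g := b) (hOU hq.1).1.1 contDiffAt_snd
  have hgO : ∀ q ∈ O', spaceGrad ψ q ≠ 0 := fun q hq => (hOU hq.1).2.2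
  obtain ⟨Y, hY, hYb, hYN, -⟩ := exists_tangential_field (O := O') (φ := ψ)
    (b := fun q => b q.2) (fun q hq => hc.level q hq.1) hbO hgO (fun q hq => (hOU hq.1).2.1)
  have hcc : ContactChart Ω T ρ χ O' ψ r₁ r₂ b Y :=
    ⟨hc.toPhaseChart.mono hO'o inter_subset_left, fun q hq => hq.2.1, hgO, hbO,
      fun q hq => (hOU hq.1).1.2.1, fun q hq => (hOU hq.1).1.2.2, hY, hYb, hYN⟩
  have hfreq := (frequently_boundary hb hψ htr (S := {0}) (subset_closure h0)
    (fun hne => absurd h0 hne)).and_eventually (hc.isOpen.mem_nhds hpO)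
  have hcont : ContinuousAt (fun q : ℝ × Space d => ⟪gradient b q.2, levelNormal ψ q⟫) (t, x) :=
    hbc.inner (contDiffAt_levelNormal hs hg).continuousAt
  have key : ⟪gradient b x, levelNormal ψ (t, x)⟫ = 0 := by
    refine tendsto_nhds_unique_of_frequently_eq hcont.tendsto tendsto_const_nhds (hfreq.mono ?_)
    rintro q ⟨⟨hqt, hqb, hq0⟩, hqO⟩
    exact hcc.angle hΩ h.one_le h.transport h.youngLaplace ⟨hqO, ht.1.trans_lt hqt, trivial⟩ hq0 hqb
      (hOU hqO).2.1
  rw [real_inner_smul_right, real_inner_comm, key, mul_zero]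

end WeakSolution

/-! ### The vacuum -/

section Vacuum

variable {r : ℝ × Space d → ℝ} {m t : ℝ} {x : Space d}

lemma contDiffAt_rpow_of_pos {p : ℝ × Space d} (hr : ContDiffAt ℝ 3 r p) (h : m = 1 ∨ 0 < r p) :
    ContDiffAt ℝ 3 (fun q => r q ^ m) p := by
  rcases h with rfl | h
  · simpa using hr
  · exact hr.rpow_const_of_ne h.ne'

lemma tendsto_time_nhds (t : ℝ) (x : Space d) :
    Tendsto (fun s => (s, x)) (𝓝[>] t) (𝓝 (t, x)) :=
  ((Continuous.prodMk_left x).tendsto t).mono_left nhdsWithin_le_nhds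

/-- The gradient term is arranged so that `‖∇r‖² / r²` stands alone: near a vacuum point it stays
bounded along the time line when `∂ₜr > 0`. -/
lemma spaceDiv_spaceGrad_rpow (hm : 1 ≤ m) {p : ℝ × Space d} (hr : ContDiffAt ℝ 3 r p)
    (hp : 0 < r p) : spaceDiv (spaceGrad (fun q => r q ^ m)) p
      = m * r p ^ (m - 1) * spaceDiv (spaceGrad r) p
        + m * (m - 1) * (r p ^ m * (‖spaceGrad r p‖ ^ 2 / r p ^ 2)) := by
  have hev : spaceGrad (fun q => r q ^ m) =ᶠ[𝓝 p]
      fun q => (m * r q ^ (m - 1)) • spaceGrad r q := by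
    filter_upwards [eventually_differentiableAt hr (by norm_num)] with q hq
      using spaceGrad_rpow hm hq
  have h1 := (Real.hasDerivAt_rpow_const (x := r p) (p := m - 1) (Or.inl hp.ne')).const_mul m
  have hrd := hr.differentiableAt (by norm_num)
  have hd : DifferentiableAt ℝ (fun q => m * r q ^ (m - 1)) p :=
    (h1.comp_hasFDerivAt p hrd.hasFDerivAt).differentiableAt
  rw [spaceDiv_congr hev, spaceDiv_smul hd
    ((contDiffAt_spaceGrad (m := 1) hr (by norm_num)).differentiableAt (by simp)),
    spaceGrad_comp (h := fun s => m * s ^ (m - 1)) h1.differentiableAt hrd, h1.deriv,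
    real_inner_smul_left, real_inner_self_eq_norm_sq]
  have e : r p ^ (m - 1 - 1) = r p ^ m / r p ^ 2 := by
    rw [show m - 1 - 1 = m - (2 : ℕ) by push_cast; ring, Real.rpow_sub hp, Real.rpow_natCast]
  rw [e]
  ring

/-- At vacuum points the density of a solution of the porous medium equation is stationary. -/
lemma timeDeriv_eq_zero_of_vacuum (hm : 1 < m) (hr : ContDiffAt ℝ 3 r (t, x)) (h0 : r (t, x) = 0)
    (hg : spaceGrad r (t, x) = 0) (hnn : ∀ᶠ s in 𝓝[>] t, 0 ≤ r (s, x))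
    (heq : ∀ᶠ s in 𝓝[>] t, 0 < r (s, x) →
      timeDeriv r (s, x) = spaceDiv (spaceGrad (fun q => r q ^ m)) (s, x)) :
    timeDeriv r (t, x) = 0 := by
  have htime := tendsto_time_nhds t x
  have hline : ContDiffAt ℝ 1 (fun s : ℝ => (s, x)) t := contDiffAt_id.prodMk contDiffAt_const
  have hfd : HasDerivAt (fun s => r (s, x)) (timeDeriv r (t, x)) t :=
    (ContDiffAt.comp (f := fun s : ℝ => (s, x)) t (hr.of_le (by norm_num))
      hline).differentiableAt (by simp) |>.hasDerivAt
  have hGd := (ContDiffAt.comp (f := fun s : ℝ => (s, x)) t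
    (contDiffAt_spaceGrad (m := 1) hr (by norm_num)) hline).differentiableAt (by simp) |>.hasDerivAt
  have hf := (hasDerivAt_iff_tendsto_slope.mp hfd).mono_left
    (nhdsWithin_mono t (show Ioi t ⊆ {t}ᶜ from fun s (hs : t < s) => hs.ne'))
  have hG := (hasDerivAt_iff_tendsto_slope.mp hGd).mono_left
    (nhdsWithin_mono t (show Ioi t ⊆ {t}ᶜ from fun s (hs : t < s) => hs.ne'))
  -- The density is zero now and nonnegative later.
  have hnonneg : 0 ≤ timeDeriv r (t, x) := by
    refine ge_of_tendsto hf ?_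
    filter_upwards [hnn, self_mem_nhdsWithin] with s hs (hts : t < s)
    rw [slope_def_field, h0, sub_zero]
    exact div_nonneg hs (sub_pos.mpr hts).le
  by_contra hne
  have hpos : 0 < timeDeriv r (t, x) := lt_of_le_of_ne hnonneg (Ne.symm hne)
  have hrc : Tendsto (fun s => r (s, x)) (𝓝[>] t) (𝓝 0) := h0 ▸ hr.continuousAt.tendsto.comp htime
  have hpow : ∀ {a : ℝ}, 0 < a → Tendsto (fun s => r (s, x) ^ a) (𝓝[>] t) (𝓝 0) := by
    intro a ha
    have := hrc.rpow_const (p := a) (Or.inr ha.le)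
    rwa [Real.zero_rpow ha.ne'] at this
  have hlap : Tendsto (fun s => spaceDiv (spaceGrad r) (s, x)) (𝓝[>] t)
      (𝓝 (spaceDiv (spaceGrad r) (t, x))) :=
    (contDiffAt_spaceDiv (m := 0) (contDiffAt_spaceGrad (m := 1) hr (by norm_num))
      (by simp)).continuousAt.tendsto.comp htime
  -- Both `∇r` and `r` vanish at `(t, x)`, so their quotient at `(s, x)` is that of difference
  -- quotients and converges if the time derivative is nonzero. The powers of `r` then drive the
  -- right side of the equation to zero.
  have hquot := ((hG.norm.pow 2).div (hf.pow 2) (pow_ne_zero 2 hne))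
  have hlim := (((hpow (sub_pos.mpr hm)).const_mul m).mul hlap).add
    (((hpow (zero_lt_one.trans hm)).mul hquot).const_mul (m * (m - 1)))
  have hder : Tendsto (fun s => timeDeriv r (s, x)) (𝓝[>] t) (𝓝 (timeDeriv r (t, x))) :=
    (contDiffAt_timeDeriv (m := 0) hr (by norm_num)).continuousAt.tendsto.comp htime
  refine hne (tendsto_nhds_unique hder ?_)
  have hl := hlim.congr' (f₂ := fun s => timeDeriv r (s, x)) (by
    filter_upwards [heq, hf.eventually (lt_mem_nhds hpos), self_mem_nhdsWithin,
      htime.eventually (hr.eventually (by simp))] with s hs hsl (hts : t < s) hrs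
    have hts' := sub_pos.mpr hts
    rw [slope_def_field, h0, sub_zero] at hsl
    have hrpos : 0 < r (s, x) := by
      have := mul_pos hsl hts'
      rwa [div_mul_cancel₀ _ hts'.ne'] at this
    rw [hs hrpos, spaceDiv_spaceGrad_rpow hm.le hrs hrpos]
    simp only [Pi.div_apply]
    rw [slope_def_module, slope_def_field]
    simp only [Function.comp_apply, hg, h0, sub_zero]
    rw [norm_smul, norm_inv, Real.norm_of_nonneg hts'.le]
    field_simp)
  simpa using hl

/-- At vacuum points the flux of a solution of the porous medium equation is stationary. -/
lemma hasFDerivAt_spaceGrad_rpow_of_vacuum (hm : 1 < m) (hr : ContDiffAt ℝ 3 r (t, x))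
    (h0 : r (t, x) = 0) (hg : spaceGrad r (t, x) = 0) :
    HasFDerivAt (fun y => spaceGrad (fun q => r q ^ m) (t, y))
      (0 : Space d →L[ℝ] Space d) x := by
  have hG := ((contDiffAt_slice (contDiffAt_spaceGrad (m := 1) hr
    (by norm_num))).differentiableAt (by simp)).hasFDerivAt.isBigO_sub
  have hc : Tendsto (fun y => m * r (t, y) ^ (m - 1)) (𝓝 x) (𝓝 0) := by
    have h1 : Tendsto (fun y => r (t, y)) (𝓝 x) (𝓝 0) :=
      h0 ▸ hr.continuousAt.tendsto.comp (tendsto_slice_nhds t x)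
    have h2 := (h1.rpow_const (p := m - 1) (Or.inr (sub_pos.mpr hm).le)).const_mul m
    rwa [Real.zero_rpow (sub_pos.mpr hm).ne', mul_zero] at h2
  rw [hasFDerivAt_iff_isLittleO]
  -- `∇r^m = m r^(m-1) ∇r` is `o(1)` times `O(|y - x|)`.
  have ho := (((Asymptotics.isLittleO_one_iff ℝ).mpr hc).smul_isBigO hG)
  simp only [one_smul] at ho
  refine ho.congr' ?_ EventuallyEq.rfl
  filter_upwards [(tendsto_slice_nhds t x).eventually
    (eventually_differentiableAt hr (by norm_num))] with y hy
  rw [spaceGrad_rpow hm.le hy, spaceGrad_rpow hm.le (hr.differentiableAt (by norm_num)), hg]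
  simp

end Vacuum

namespace WeakSolution

variable {Ω : Set (Space d)} {T m lam : ℝ} {E : ℝ → Set (Space d)} {ρ χ r₁ r₂ : ℝ × Space d → ℝ}
  {u : ℝ × Space d → Space d} {ρ₀ : Space d → ℝ} {μ : ℝ → Measure (Space d)}
  {ν : ℝ → Space d → Space d} {t : ℝ} {x : Space d}

/-! ### The equations in the bulk -/

lemma exists_bulk_phase (h : WeakSolution Ω T m lam E ρ χ r₁ r₂ u ρ₀ μ ν) (ht : t ∈ Ico 0 T)
    (hx : x ∈ Ω \ interface Ω (E t)) :
    ∃ (O : Set (ℝ × Space d)) (φ r : ℝ × Space d → ℝ), PhaseChart Ω T ρ χ O φ r₁ r₂ ∧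
      (t, x) ∈ O ∧ O ⊆ Iio T ×ˢ Ω ∧ (∀ q ∈ O, ContDiffAt ℝ 3 r q) ∧
      (∀ q ∈ O, 0 ≤ q.1 → ρ q = r q ∧
        DifferentiableAt ℝ (fun y => pressure m lam ρ χ (q.1, y)) q.2 ∧
        spaceGrad (pressure m lam ρ χ) q = spaceGrad (fun q => r q ^ m) q ∧
        ρ q • velocity m lam ρ χ q = -spaceGrad (pressure m lam ρ χ) q) ∧
      ∀ᵐ q, q ∈ O ∩ cylinder Ω T → ρ q • u q = -spaceGrad (fun q => r q ^ m) q := by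
  have hΩ := h.domain.1
  have hxc := subset_closure hx.1
  obtain ⟨φ, hφ, htr⟩ := h.evolution.level t ht x hxc
  have hne : φ (t, x) ≠ 0 := fun h0 => hx.2 (subset_closure
    ⟨hφ.mem_frontier hΩ ht hx.1 h0 (htr h0).1, hx.1⟩)
  obtain ⟨O, hOU, hpO, hc⟩ := h.exists_chart ht hxc hφ (fun h0 => absurd h0 hne)
    ((isOpen_Iio.prod hΩ).mem_nhds (show (t, x) ∈ Iio T ×ˢ Ω from ⟨ht.2, hx.1⟩))
  obtain ⟨O', hO'O, hO'o, hpO', hrs, c, hbulk⟩ := hc.exists_bulk m lam hpO hne rfl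
  set r := if φ (t, x) < 0 then r₁ else r₂ with hr
  have hrq : ∀ q ∈ O', r = if φ q < 0 then r₁ else r₂ := fun q hq => by
    rw [hr]; simp only [(hbulk q hq).2.1]
  refine ⟨O', φ, r, hc.toPhaseChart.mono hO'o hO'O, hpO', hO'O.trans hOU, hrs, ?_, ?_⟩
  · intro q hq hq0
    have hqU := hOU (hO'O hq)
    obtain ⟨h1, -, h3, h4, h5⟩ := hc.toPhaseChart.slice_bulk (m := m) (lam := lam) hΩ h.one_le
      (hO'O hq) hq0 hqU.2 (hbulk q hq).1 (h.nonneg q.1 ⟨hq0, hqU.1⟩) (hrq q hq)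
    exact ⟨h1, h3, h4, h5⟩
  · filter_upwards [hc.toPhaseChart.darcy_ae hΩ h.one_le h.transport h.youngLaplace] with q hq hqO
    rw [(hq ⟨hO'O hqO.1, hqO.2⟩).2, hrq q hqO.1]
    split_ifs <;> rfl

lemma darcy (h : WeakSolution Ω T m lam E ρ χ r₁ r₂ u ρ₀ μ ν) (ht : t ∈ Ico 0 T)
    (hx : x ∈ Ω \ interface Ω (E t)) :
    DifferentiableAt ℝ (fun y => pressure m lam ρ χ (t, y)) x ∧
    ρ (t, x) • velocity m lam ρ χ (t, x) = -spaceGrad (pressure m lam ρ χ) (t, x) := by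
  obtain ⟨O, φ, r, -, hpO, -, -, hb, -⟩ := h.exists_bulk_phase ht hx
  exact ⟨(hb _ hpO ht.1).2.1, (hb _ hpO ht.1).2.2.2⟩

/-- Where `m = 1` or the density is positive, the continuity equation extends by continuity from
later times. In vacuum with `m > 1`, the time derivative and the divergence of the flux are each
zero. -/
lemma mass (h : WeakSolution Ω T m lam E ρ χ r₁ r₂ u ρ₀ μ ν) (ht : t ∈ Ico 0 T)
    (hx : x ∈ Ω \ interface Ω (E t)) :
    DifferentiableWithinAt ℝ (fun s => ρ (s, x)) (Ico 0 T) t ∧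
    DifferentiableAt ℝ (fun y => ρ (t, y) • velocity m lam ρ χ (t, y)) x ∧
    derivWithin (fun s => ρ (s, x)) (Ico 0 T) t
      + spaceDiv (fun p => ρ p • velocity m lam ρ χ p) (t, x) = 0 := by
  have hΩ := h.domain.1
  obtain ⟨O, φ, r, hc, hpO, hOΩ, hrs, hb, hflux⟩ := h.exists_bulk_phase ht hx
  have hrp := hrs _ hpO
  -- the continuity equation where the pressure is smooth
  have hpos : ∀ q ∈ O, 0 < q.1 → (m = 1 ∨ 0 < r q) →
      timeDeriv r q = spaceDiv (spaceGrad (fun q => r q ^ m)) q := by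
    intro q hq hq0 hqr
    -- On this open set `r^m` is as smooth as `r`.
    have hS : IsOpen (O ∩ {q | m = 1 ∨ 0 < r q}) := by
      by_cases hm1 : m = 1
      · simpa [hm1] using hc.isOpen
      · have hcont : ContinuousOn r O := fun q hq => (hrs q hq).continuousAt.continuousWithinAt
        have heq : O ∩ {q | m = 1 ∨ 0 < r q} = O ∩ r ⁻¹' Ioi 0 := by
          ext q; simp [hm1]
        rw [heq]
        exact hcont.isOpen_inter_preimage hc.isOpen isOpen_Ioi
    have hO' : IsOpen (O ∩ {q | m = 1 ∨ 0 < r q} ∩ Ioi 0 ×ˢ univ) :=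
      hS.inter (isOpen_Ioi.prod isOpen_univ)
    have hcyl : ∀ q ∈ O ∩ {q | m = 1 ∨ 0 < r q} ∩ Ioi 0 ×ˢ univ, q ∈ cylinder Ω T :=
      fun q hq => ⟨⟨hq.2.1, (hOΩ hq.1.1).1⟩, (hOΩ hq.1.1).2⟩
    exact (hc.mono hO' fun q hq => hq.1.1).continuity_equation hΩ h.transport hcyl
      (fun q hq => hrs q hq.1.1) (fun q hq => (hb q hq.1.1 (le_of_lt hq.2.1)).1)
      (hflux.mono fun q hq hqO => hq ⟨hqO.1.1, hcyl q hqO⟩)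
      (fun q hq => (contDiffAt_rpow_of_pos (hrs q hq.1.1) hq.1.2).of_le (by norm_num))
      ⟨⟨hq, hqr⟩, hq0, mem_univ _⟩
  have htime := tendsto_time_nhds t x
  have hOtime : ∀ᶠ s in 𝓝[>] t, (s, x) ∈ O ∧ t < s :=
    (htime.eventually (hc.isOpen.mem_nhds hpO)).and self_mem_nhdsWithin
  have key : DifferentiableAt ℝ (fun y => spaceGrad (fun q => r q ^ m) (t, y)) x ∧
      timeDeriv r (t, x) = spaceDiv (spaceGrad (fun q => r q ^ m)) (t, x) := by
    by_cases hmr : m = 1 ∨ 0 < r (t, x)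
    · have hP := contDiffAt_rpow_of_pos hrp hmr
      have hG := contDiffAt_spaceGrad (m := 1) hP (by norm_num)
      refine ⟨(contDiffAt_slice hG).differentiableAt (by simp), ?_⟩
      -- Approaching from later times includes `t = 0`, where the weak equation gives no direct
      -- pointwise information.
      refine tendsto_nhds_unique_of_eventuallyEq
        ((contDiffAt_timeDeriv (m := 0) hrp (by norm_num)).continuousAt.tendsto.comp htime)
        ((contDiffAt_spaceDiv (m := 0) hG (by simp)).continuousAt.tendsto.comp htime) ?_
      have hmr' : ∀ᶠ q in 𝓝 (t, x), m = 1 ∨ 0 < r q := by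
        rcases hmr with h1 | h1
        · exact Eventually.of_forall fun q => Or.inl h1
        · exact (hrp.continuousAt.eventually (lt_mem_nhds h1)).mono fun q hq => Or.inr hq
      filter_upwards [hOtime, htime.eventually hmr'] with s hs hsr
        using hpos _ hs.1 (ht.1.trans_lt hs.2) hsr
    · push Not at hmr
      have hm1 : 1 < m := lt_of_le_of_ne h.one_le (Ne.symm hmr.1)
      have hnn : ∀ y, (t, y) ∈ O → 0 ≤ r (t, y) := fun y hy => by
        rw [← (hb _ hy ht.1).1]
        exact h.nonneg t ht y (hOΩ hy).2
      have h0 : r (t, x) = 0 := le_antisymm hmr.2 (hnn x hpO)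
      have hmin : IsLocalMin (fun y => r (t, y)) x := by
        filter_upwards [(isOpen_slice hc.isOpen t).mem_nhds hpO] with y hy
        rw [h0]; exact hnn y hy
      have hg : spaceGrad r (t, x) = 0 := by
        rw [spaceGrad, gradient, hmin.fderiv_eq_zero, map_zero]
      have hd := hasFDerivAt_spaceGrad_rpow_of_vacuum hm1 hrp h0 hg
      refine ⟨hd.differentiableAt, ?_⟩
      rw [spaceDiv, divergence, hd.fderiv, timeDeriv_eq_zero_of_vacuum hm1 hrp h0 hg]
      · simp
      · filter_upwards [hOtime] with s hs
        have hs0 := ht.1.trans hs.2.le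
        rw [← (hb _ hs.1 hs0).1]
        exact h.nonneg s ⟨hs0, (hOΩ hs.1).1⟩ x hx.1
      · filter_upwards [hOtime] with s hs hsr using hpos _ hs.1 (ht.1.trans_lt hs.2) (Or.inr hsr)
  have hslice : (fun y => ρ (t, y) • velocity m lam ρ χ (t, y))
      =ᶠ[𝓝 x] fun y => -spaceGrad (fun q => r q ^ m) (t, y) := by
    filter_upwards [(isOpen_slice hc.isOpen t).mem_nhds hpO] with y hy
    rw [(hb _ hy ht.1).2.2.2, (hb _ hy ht.1).2.2.1]
  have hρt : (fun s => ρ (s, x)) =ᶠ[𝓝[Ico 0 T] t] fun s => r (s, x) := by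
    filter_upwards [self_mem_nhdsWithin, mem_nhdsWithin_of_mem_nhds
      ((Continuous.prodMk_left x).continuousAt.eventually (hc.isOpen.mem_nhds hpO))] with s hs hsO
      using (hb _ hsO hs.1).1
  have hρx : ρ (t, x) = r (t, x) := (hb _ hpO ht.1).1
  have hrt : HasDerivAt (fun s => r (s, x)) (timeDeriv r (t, x)) t :=
    (ContDiffAt.comp (f := fun s : ℝ => (s, x)) t (hrp.of_le (m := 1) (by norm_num))
      (contDiffAt_id.prodMk contDiffAt_const)).differentiableAt (by simp) |>.hasDerivAt
  have hρd := hrt.hasDerivWithinAt (s := Ico 0 T) |>.congr_of_eventuallyEq hρt hρx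
  refine ⟨hρd.differentiableWithinAt, key.1.neg.congr_of_eventuallyEq hslice, ?_⟩
  rw [hρd.derivWithin (uniqueDiffOn_Ico 0 T t ht), key.2, spaceDiv, spaceDiv, divergence,
    divergence, hslice.fderiv_eq, fderiv_fun_neg]
  simp

/-! ### Almost everywhere statements -/

/-- The exceptional set is null in each chart, hence null. On the interface, which is itself null,
nothing is claimed. -/
lemma flux_ae (h : WeakSolution Ω T m lam E ρ χ r₁ r₂ u ρ₀ μ ν) :
    ∀ᵐ p ∂(volume.restrict (cylinder Ω T)), ρ p • u p = ρ p • velocity m lam ρ χ p := by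
  have hΩ := h.domain.1
  rw [ae_restrict_iff' (isOpen_cylinder hΩ T).measurableSet, ae_iff]
  refine measure_null_of_locally_null _ ?_
  rintro ⟨t, x⟩ hp
  simp only [mem_ofPred_eq, Classical.not_imp] at hp
  have ht : t ∈ Ico 0 T := ⟨hp.1.1.1.le, hp.1.1.2⟩
  have hxc : x ∈ closure Ω := subset_closure hp.1.2
  obtain ⟨φ, hφ, htr⟩ := h.evolution.level t ht x hxc
  obtain ⟨O, -, hpO, hc⟩ := h.exists_chart ht hxc hφ (fun h0 => (htr h0).1) univ_mem
  refine ⟨{q | ¬(q ∈ cylinder Ω T → ρ q • u q = ρ q • velocity m lam ρ χ q)} ∩ O,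
    inter_mem self_mem_nhdsWithin (mem_nhdsWithin_of_mem_nhds (hc.isOpen.mem_nhds hpO)), ?_⟩
  rw [measure_eq_zero_iff_ae_notMem]
  filter_upwards [hc.toPhaseChart.darcy_ae hΩ h.one_le h.transport h.youngLaplace] with q hq hqn
  refine hqn.1 fun hqc => ?_
  obtain ⟨hne, hfl⟩ := hq ⟨hqn.2, hqc⟩
  obtain ⟨-, -, -, h4, h5⟩ := hc.toPhaseChart.slice_bulk (m := m) (lam := lam) hΩ h.one_le
    hqn.2 hqc.1.1.le hqc.2 hne (h.nonneg q.1 ⟨hqc.1.1.le, hqc.1.2⟩) rfl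
  rw [hfl, h5, h4]
  split_ifs <;> rfl

lemma initial (h : WeakSolution Ω T m lam E ρ χ r₁ r₂ u ρ₀ μ ν) (hT : 0 < T) :
    ∀ᵐ x ∂(volume.restrict Ω), ρ (0, x) = ρ₀ x := by
  have hΩ := h.domain.1
  rw [ae_restrict_iff' hΩ.measurableSet, ae_iff]
  refine measure_null_of_locally_null _ ?_
  intro x hp
  simp only [mem_ofPred_eq, Classical.not_imp] at hp
  have ht : (0 : ℝ) ∈ Ico 0 T := ⟨le_rfl, hT⟩
  have hxc : x ∈ closure Ω := subset_closure hp.1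
  obtain ⟨φ, hφ, htr⟩ := h.evolution.level 0 ht x hxc
  obtain ⟨O, -, hpO, hc⟩ := h.exists_chart ht hxc hφ (fun h0 => (htr h0).1) univ_mem
  obtain ⟨W, hW, hae⟩ := hc.toPhaseChart.initial_ae hΩ hT h.transport hp.1 hpO
    fun h0 => (htr h0).1
  refine ⟨{y | ¬(y ∈ Ω → ρ (0, y) = ρ₀ y)} ∩ W,
    inter_mem self_mem_nhdsWithin (mem_nhdsWithin_of_mem_nhds hW), ?_⟩
  rw [measure_eq_zero_iff_ae_notMem]
  filter_upwards [hae] with y hy hyn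
  exact hyn.1 fun _ => hy hyn.2

theorem isClassicalSolution (h : WeakSolution Ω T m lam E ρ χ r₁ r₂ u ρ₀ μ ν) :
    IsClassicalSolution Ω T m lam E ρ χ (velocity m lam ρ χ) where
  mass _ ht _ hx := h.mass ht hx
  darcy _ ht _ hx := h.darcy ht hx
  mass_jump _ ht _ hx _ hφ := h.mass_jump ht hx hφ
  young_laplace _ ht _ hx _ hφ := h.young_laplace ht hx hφ
  neumann _ ht _ hA _ hx _ hn := h.neumann ht hA hx hn
  angle _ ht _ hx _ hn _ hφ := h.angle ht hx hn hφ

end WeakSolution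

end Verigin

/-! ### Conclusion -/

theorem mainTheorem5 (d : ℕ) (hd : 2 ≤ d) (Ω : Set (Verigin.Space d))
    (hΩ : Verigin.IsSmoothDomain Ω) (T : ℝ) (hT : 0 < T) (m : ℝ) (hm : 1 ≤ m)
    (lam : ℝ) (hlam : 0 < lam)
    (ρ χ : ℝ × Verigin.Space d → ℝ) (u : ℝ × Verigin.Space d → Verigin.Space d)
    (ρ₀ : Verigin.Space d → ℝ) (E : ℝ → Set (Verigin.Space d))
    (hE : Verigin.IsSmoothEvolution Ω T E)
    (hχ : ∀ t ∈ Set.Ico 0 T, ∀ x ∈ Ω, χ (t, x) = (E t).indicator (fun _ => (1 : ℝ)) x)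
    (hρ : Verigin.IsSmoothDensity Ω T E ρ)
    (htransport : Verigin.WeakTransport Ω T ρ u ρ₀)
    (hyoung : Verigin.WeakYoungLaplace Ω T m lam ρ χ u) :
    (∃ v : ℝ × Verigin.Space d → Verigin.Space d,
      (∀ᵐ p ∂(MeasureTheory.volume.restrict (Set.Ioo 0 T ×ˢ Ω)), ρ p • u p = ρ p • v p) ∧
      Verigin.IsClassicalSolution Ω T m lam E ρ χ v) ∧
    (∀ᵐ x ∂(MeasureTheory.volume.restrict Ω), ρ (0, x) = ρ₀ x) := by
  obtain ⟨hnn, r₁, r₂, hr₁, hr₂, hρ⟩ := hρ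
  obtain ⟨μ, ν, hy⟩ := hyoung.exists_data htransport
  have h : Verigin.WeakSolution Ω T m lam E ρ χ r₁ r₂ u ρ₀ μ ν :=
    ⟨hm, hΩ, hE, hχ, hnn, hr₁, hr₂, hρ, htransport, hy⟩
  exact ⟨⟨Verigin.velocity m lam ρ χ, h.flux_ae, h.isClassicalSolution⟩, h.initial hT⟩
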